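/- **Setting.** Let $\Gamma\subset\mathbb R^2$ be a smooth tropical $(3,3)$-curve: the corner locus of $\max_{0\le i,j\le 3}(a_{ij}+ix+jy)$, where $a\in\mathbb R^{16}$ induces a unimodular triangulation of the square $[0,3]^2$ (the Newton subdivision). For $p\in\mathbb R^2$ let $p^\vee$ be the cell of this triangulation dual to $p$ (spanned by the $(i,j)$ attaining the maximum at $p$), and let $(i,j)^\vee$ be the open chamber $\{p: p^\vee=\{(i,j)\}\}$ of $\mathbb R^2\smallsetminus\Gamma$. Tropical $(1,1)$-curves $\Lambda$ are parameterized by $(v_0,l)\in\mathbb R^2\times\mathbb R$, where $v_0$ is the lower vertex, $l$ is the signed length of the bounded edge, and the other vertex is $v_1=v_0+l(1,1)$ if $l\ge 0$ (slope $1$) and $v_1=v_0-l(-1,1)$ if $l<0$ (slope $-1$); $\Lambda$ is $4$-valent if $l=0$. The curve $\Lambda$ is *tritangent* to $\Gamma$ if $\Lambda\cap\Gamma$ has three connected components, each of stable intersection multiplicity $2$; or two components, of multiplicities $2$ and $4$; or is connected of multiplicity $6$. A *tritangent class* $\Omega$ is a connected component of the set of $(v_0,l)\in\mathbb R^3$ whose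 curves are tritangent to $\Gamma$. **The complexes.** Endow $\Omega$ with any finite polyhedral complex structure that is compatible with $\Gamma$: on the relative interior of each cell, each of $v_0,v_1$ stays in one relatively open cell of the polyhedral structure on $\mathbb R^2$ induced by $\Gamma$. The *bounded complex* $\Omega^b$ is the collection of cells left after removing every cell with a point $(v_0,l)$ in its relative interior for which one of the following holds: * $l>0$, and $v_0\in(0,0)^\vee$ or $v_1\in(3,3)^\vee$; * $l<0$, and $v_0\in(3,0)^\vee$ or $v_1\in(0,3)^\vee$; * $l>0$, $v_0^\vee\supseteq\{(1,0),(0,1)\}$ and $(i,2-i)\notin v_0^\vee$ for $i=0,1,2$; * $l>0$, $v_1^\vee\supseteq\{(2,3),(3,2)\}$ and $(1+i,3-i)\notin v_1^\vee$ for $i=0,1,2$; * $l<0$, $v_0^\vee\supseteq\{(2,0),(3,1)\}$ and $(1+i,i)\notin v_0^\vee$ for $i=0,1,2$; * $l<0$, $v_1^\vee\supseteq\{(0,2),(1,3)\}$ and $(i,1+i)\notin v_1^\vee$ for $i=0,1,2$. A tritangent $\Lambda$ is *special* if two of its tangency points lie in the interior of the same leg of $\Lambda$, i.e. if there are two different components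 of $\Lambda\cap\Gamma$ of multiplicity $2$ whose tangency points do; the tangency point of a component with stable intersection divisor $A+B$ is the midpoint of $A$ and $B$. The *non-special bounded complex* $\Omega^b_{ns}$ consists of the cells of $\Omega^b$ with no special tritangent in their relative interior. The dimension of either collection is the maximum of the dimensions of its cells. **Theorem.** (1) If $\Gamma$ has generic edge lengths, then $\dim\Omega^b_{ns}=\dim\Omega^b$ for every tritangent class $\Omega$ of $\Gamma$. Here generic means: there is a finite set $H$ of nonzero integral linear forms on $\mathbb R^{16}$ that vanish on all affine functions of $(i,j)$ (equivalently, on each combinatorial type, nontrivial integral linear forms in the edge lengths of $\Gamma$), such that the equality holds for every smooth $\Gamma$ whose coefficient vector $a$ is not a zero of any form in $H$. (2) For every smooth $\Gamma$, with no genericity assumption, and every tritangent class $\Omega$ of $\Gamma$: if $\dim\Omega^b_{ns}\in\{2,3\}$, then $\dim\Omega^b_{ns}=\dim\Omega^b$. -/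

import Mathlib

open Set MeasureTheory
open scoped Pointwise

namespace Tritangent

noncomputable section

/-! ## Tropical plane curves of bidegree (n,n) and their dual subdivisions -/

/-- Exponents of bidegree at most `(n,n)`. -/
abbrev Exps (n : ℕ) : Type := Fin (n + 1) × Fin (n + 1)

/-- The exponent `(i,j)` as a point of the Newton square. -/
def toPlane {n : ℕ} (u : Exps n) : ℝ × ℝ := (((u.1 : ℕ) : ℝ), ((u.2 : ℕ) : ℝ))

/-- The value at `p = (x,y)` of the tropical monomial `a_ij + i x + j y` (max convention). -/
def term {n : ℕ} (a : Exps n → ℝ) (u : Exps n) (p : ℝ × ℝ) : ℝ :=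
  a u + ((u.1 : ℕ) : ℝ) * p.1 + ((u.2 : ℕ) : ℝ) * p.2

/-- The exponents at which the tropical polynomial with coefficients `a` attains its
maximum at `p`: the vertices of the cell dual to `p`. The relatively open cells of the
polyhedral structure on the plane induced by the curve are the level sets of `active a`. -/
def active {n : ℕ} (a : Exps n → ℝ) (p : ℝ × ℝ) : Set (Exps n) :=
  {u | ∀ w, term a w p ≤ term a u p}

/-- The tropical plane curve: the points where the maximum is attained at least twice. -/
def curve {n : ℕ} (a : Exps n → ℝ) : Set (ℝ × ℝ) := {p | (active a p).Nontrivial}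

/-- The cell of the Newton subdivision dual to the point `p`. -/
def dualCell {n : ℕ} (a : Exps n → ℝ) (p : ℝ × ℝ) : Set (ℝ × ℝ) :=
  convexHull ℝ (toPlane '' active a p)

/-- Twice the signed area of the lattice triangle `u v w`. -/
def latticeDet {n : ℕ} (u v w : Exps n) : ℤ :=
  (((v.1 : ℕ) : ℤ) - ((u.1 : ℕ) : ℤ)) * (((w.2 : ℕ) : ℤ) - ((u.2 : ℕ) : ℤ)) -
    (((v.2 : ℕ) : ℤ) - ((u.2 : ℕ) : ℤ)) * (((w.1 : ℕ) : ℤ) - ((u.1 : ℕ) : ℤ))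

/-- The curve is smooth: its Newton subdivision is a unimodular triangulation of the square. -/
def IsSmooth {n : ℕ} (a : Exps n → ℝ) : Prop :=
  ∀ p, (active a p).ncard ≤ 3 ∧
    ∀ u ∈ active a p, ∀ v ∈ active a p, ∀ w ∈ active a p,
      u ≠ v → v ≠ w → u ≠ w → |latticeDet u v w| = 1

/-! ## Stable intersections -/

/-- Mixed area of two planar convex bodies. -/
def mixedArea (P Q : Set (ℝ × ℝ)) : ℝ :=
  volume.real (P + Q) - volume.real P - volume.real Q

/-- Multiplicity of `p` in the stable intersection of two tropical curves: the mixed area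
of the two cells dual to `p`. -/
def stableMult {m n : ℕ} (a : Exps m → ℝ) (b : Exps n → ℝ) (p : ℝ × ℝ) : ℝ :=
  mixedArea (dualCell a p) (dualCell b p)

/-- The connected components of the set-theoretic intersection of two tropical curves. -/
def interComponents {m n : ℕ} (a : Exps m → ℝ) (b : Exps n → ℝ) : Set (Set (ℝ × ℝ)) :=
  {C | ∃ p ∈ curve a ∩ curve b, C = connectedComponentIn (curve a ∩ curve b) p}

/-- Total stable intersection multiplicity of a component. -/
def componentMult {m n : ℕ} (a : Exps m → ℝ) (b : Exps n → ℝ) (C : Set (ℝ × ℝ)) : ℝ :=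
  ∑ᶠ p ∈ C, stableMult a b p

/-! ## (1,1)-curves -/

/-- The parameter space of (1,1)-curves: pairs `(v₀, l)`, where `v₀` is the lower vertex and
`l` is the signed length of the bounded edge. The edge has slope `1` if `l > 0` and slope
`-1` if `l < 0`; the curve is 4-valent if `l = 0`. -/
abbrev Params : Type := (ℝ × ℝ) × ℝ

/-- The lower vertex. -/
def vert0 (t : Params) : ℝ × ℝ := t.1

/-- The upper vertex: `v₀ + l (1,1)` if `l ≥ 0` and `v₀ - l (-1,1)` if `l < 0`. -/
def vert1 (t : Params) : ℝ × ℝ := (t.1.1 + t.2, t.1.2 + |t.2|)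

/-- Coefficients of a tropical polynomial `max {A, B + x, C + y, D + x + y}` that defines the
curve with parameters `(v₀, l)`. If `l ≥ 0` then `v₀ = (A - B, A - C)` and
`l = B + C - A - D`; if `l < 0` then `v₀ = (A - B, B - D)` and `l = B + C - A - D`. -/
def lineCoeff (t : Params) : Exps 1 → ℝ := fun u =>
  if u = (0, 0) then 0
  else if u = (1, 0) then -t.1.1
  else if u = (0, 1) then -t.1.2 + min t.2 0
  else -t.1.1 - t.1.2 - max t.2 0

/-- Origin of the negative horizontal leg. -/
def leftVert (t : Params) : ℝ × ℝ := if 0 ≤ t.2 then vert0 t else vert1 t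

/-- Origin of the positive horizontal leg. -/
def rightVert (t : Params) : ℝ × ℝ := if 0 ≤ t.2 then vert1 t else vert0 t

/-- The relative interiors of the four legs (negative and positive horizontal, negative and
positive vertical) of the curve with parameters `t`. -/
def legInteriors (t : Params) : Set (Set (ℝ × ℝ)) :=
  { {p | p.2 = (leftVert t).2 ∧ p.1 < (leftVert t).1},
    {p | p.2 = (rightVert t).2 ∧ (rightVert t).1 < p.1},
    {p | p.1 = (vert0 t).1 ∧ p.2 < (vert0 t).2},
    {p | p.1 = (vert1 t).1 ∧ (vert1 t).2 < p.2} }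

/-! ## Tritangents -/

/-- The (1,1)-curve with parameters `t` is tritangent to the (3,3)-curve of `a`: the
intersection has three components of multiplicity 2, or two components of multiplicities
2 and 4, or it is connected, of multiplicity 6. -/
def IsTritangent (a : Exps 3 → ℝ) (t : Params) : Prop :=
  ((interComponents a (lineCoeff t)).ncard = 3 ∧
      ∀ C ∈ interComponents a (lineCoeff t), componentMult a (lineCoeff t) C = 2) ∨
  (∃ C C', C ≠ C' ∧ interComponents a (lineCoeff t) = {C, C'} ∧
      componentMult a (lineCoeff t) C = 2 ∧ componentMult a (lineCoeff t) C' = 4) ∨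
  (∃ C, interComponents a (lineCoeff t) = {C} ∧ componentMult a (lineCoeff t) C = 6)

/-- The set of all parameters of tritangent (1,1)-curves. -/
def tritangentSet (a : Exps 3 → ℝ) : Set Params := {t | IsTritangent a t}

/-- A tritangent class is a connected component of the set of tritangents. -/
def IsTritangentClass (a : Exps 3 → ℝ) (Ω : Set Params) : Prop :=
  ∃ t ∈ tritangentSet a, Ω = connectedComponentIn (tritangentSet a) t

/-- `P` is the tangency point on the component `C` of multiplicity two: the stable
intersection divisor on `C` is `A + B` (with `A = B` allowed), and `P` is the midpoint
of `A` and `B`. -/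
def IsTangencyPoint (a : Exps 3 → ℝ) (t : Params) (C : Set (ℝ × ℝ)) (P : ℝ × ℝ) : Prop :=
  ∃ A ∈ C, ∃ B ∈ C,
    (∀ p ∈ C, stableMult a (lineCoeff t) p =
      ({A} : Set (ℝ × ℝ)).indicator 1 p + ({B} : Set (ℝ × ℝ)).indicator 1 p) ∧
    P = midpoint ℝ A B

/-- A tritangent is special if two of its tangencies lie in the interior of the same leg.
The tangencies in question lie on two different components of multiplicity two: a component
of higher multiplicity that meets a leg contains its origin and meets it in at most one
segment, which carries at most one tangency in its interior, and if there is one, then no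
other component meets that leg with even multiplicity. -/
def IsSpecial (a : Exps 3 → ℝ) (t : Params) : Prop :=
  IsTritangent a t ∧ ∃ L ∈ legInteriors t,
    ∃ C ∈ interComponents a (lineCoeff t), ∃ C' ∈ interComponents a (lineCoeff t), C ≠ C' ∧
      ∃ P ∈ L, ∃ P' ∈ L, IsTangencyPoint a t C P ∧ IsTangencyPoint a t C' P'

/-! ## Polyhedral complexes -/

/-- A polyhedron: a finite intersection of closed half-spaces. -/
def IsPolyhedron (P : Set Params) : Prop :=
  ∃ s : Finset ((Params →L[ℝ] ℝ) × ℝ), P = {x | ∀ h ∈ s, h.1 x ≤ h.2}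

/-- A finite polyhedral complex in `ℝ³`. `IsExposed ℝ P F`, for nonempty `F`, says that `F` is
a face of the polyhedron `P` (possibly `P` itself). -/
structure PolyComplex where
  /-- the closed cells -/
  cells : Set (Set Params)
  finite : cells.Finite
  nonempty : ∀ P ∈ cells, P.Nonempty
  polyhedron : ∀ P ∈ cells, IsPolyhedron P
  face_mem : ∀ P ∈ cells, ∀ F : Set Params, F.Nonempty → IsExposed ℝ P F → F ∈ cells
  inter_face : ∀ P ∈ cells, ∀ Q ∈ cells, (P ∩ Q).Nonempty →
    IsExposed ℝ P (P ∩ Q) ∧ IsExposed ℝ Q (P ∩ Q)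

/-- The support of a polyhedral complex. -/
def PolyComplex.support (K : PolyComplex) : Set Params := ⋃₀ K.cells

/-- `K` is a polyhedral structure on `Ω` that is compatible with the structure on the plane
induced by the (3,3)-curve: along the relative interior of a cell, each of the two
vertices stays in a fixed relatively open cell of the latter. -/
def IsCompatibleStructure (a : Exps 3 → ℝ) (Ω : Set Params) (K : PolyComplex) : Prop :=
  K.support = Ω ∧ ∀ P ∈ K.cells, ∀ s ∈ intrinsicInterior ℝ P, ∀ t ∈ intrinsicInterior ℝ P,
    active a (vert0 s) = active a (vert0 t) ∧ active a (vert1 s) = active a (vert1 t)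

/-- Dimension of a collection of polyhedra: the largest dimension of a member (`⊥` if there
is none). -/
def complexDim (S : Set (Set Params)) : WithBot ℕ∞ :=
  ⨆ P ∈ S, ((Module.finrank ℝ (vectorSpan ℝ P) : ℕ∞) : WithBot ℕ∞)

/-! ## The bounded complex and the non-special bounded complex -/

/-- The trivalent members with a vertex in the open chamber dual to a corner of the Newton
square: `v₀` in the chamber of `(0,0)` or `v₁` in that of `(3,3)` if the edge has slope `1`,
and `v₀` in the chamber of `(3,0)` or `v₁` in that of `(0,3)` if it has slope `-1`. -/
def InCornerChamber (a : Exps 3 → ℝ) (t : Params) : Prop :=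
  (0 < t.2 ∧ (active a (vert0 t) = {(0, 0)} ∨ active a (vert1 t) = {(3, 3)})) ∨
  (t.2 < 0 ∧ (active a (vert0 t) = {(3, 0)} ∨ active a (vert1 t) = {(0, 3)}))

/-- The trivalent members with a vertex on an edge of the (3,3)-curve that bounds a corner
chamber and is parallel to the edge of the member, except when that vertex is the end of
the edge that faces the interior. -/
def OnCornerEdge (a : Exps 3 → ℝ) (t : Params) : Prop :=
  (0 < t.2 ∧ {(1, 0), (0, 1)} ⊆ active a (vert0 t) ∧
    (0, 2) ∉ active a (vert0 t) ∧ (1, 1) ∉ active a (vert0 t) ∧ (2, 0) ∉ active a (vert0 t)) ∨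
  (0 < t.2 ∧ {(2, 3), (3, 2)} ⊆ active a (vert1 t) ∧
    (1, 3) ∉ active a (vert1 t) ∧ (2, 2) ∉ active a (vert1 t) ∧ (3, 1) ∉ active a (vert1 t)) ∨
  (t.2 < 0 ∧ {(2, 0), (3, 1)} ⊆ active a (vert0 t) ∧
    (1, 0) ∉ active a (vert0 t) ∧ (2, 1) ∉ active a (vert0 t) ∧ (3, 2) ∉ active a (vert0 t)) ∨
  (t.2 < 0 ∧ {(0, 2), (1, 3)} ⊆ active a (vert1 t) ∧
    (0, 1) ∉ active a (vert1 t) ∧ (1, 2) ∉ active a (vert1 t) ∧ (2, 3) ∉ active a (vert1 t))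

/-- The bounded complex: the cells of `K` that remain after removing those with a member of
one of the two kinds above in their relative interior. -/
def boundedCells (a : Exps 3 → ℝ) (K : PolyComplex) : Set (Set Params) :=
  {P ∈ K.cells | ¬ ∃ t ∈ intrinsicInterior ℝ P, InCornerChamber a t ∨ OnCornerEdge a t}

/-- The non-special bounded complex: the cells of the bounded complex without a special
tritangent in their relative interior. -/
def nonSpecialBoundedCells (a : Exps 3 → ℝ) (K : PolyComplex) : Set (Set Params) :=
  {P ∈ boundedCells a K | ¬ ∃ t ∈ intrinsicInterior ℝ P, IsSpecial a t}

/-! ## Generic edge lengths -/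

/-- A nonzero integral linear form in the coefficients of a (3,3)-curve that does not change
when an affine function of the exponent is added to the coefficients (which translates the
curve). On the smooth curves of a given combinatorial type these are the nontrivial
integral linear forms in the lattice lengths of the bounded edges. -/
def IsLengthForm (c : Exps 3 → ℤ) : Prop :=
  c ≠ 0 ∧ ∑ u, c u = 0 ∧ ∑ u, ((u.1 : ℕ) : ℤ) * c u = 0 ∧ ∑ u, ((u.2 : ℕ) : ℤ) * c u = 0

/-- None of the length forms in `H` vanishes on the curve with coefficients `a`. -/
def AvoidsLengthForms (H : Finset (Exps 3 → ℤ)) (a : Exps 3 → ℝ) : Prop :=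
  ∀ c ∈ H, ∑ u, (c u : ℝ) * a u ≠ 0

end

end Tritangent

/-! Write v₀, v₁ for the vertices of a (1,1)-curve. Along a horizontal line the first exponents of
the active monomials of Γ increase weakly from left to right, between 0 and 3. So the crossings on a
horizontal leg have total width at most 3, whereas two tangencies need 4. A leg can carry two
tangencies only if one of them takes half of its divisor from the origin of the leg or from beyond
it. Then the leg runs back from its origin inside an unbounded edge (an end) of Γ to the vertex A of
that end. Hence every special tritangent has a vertex on an end (`IsSpecial.onEnd`).

Since an end has codimension one, a three-dimensional cell contains no special member
(`not_isSpecial_of_finrank`). This proves (2): if the non-special complex has dimension 2, the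
bounded complex has no cell of dimension 3; if it has dimension 3, there is nothing larger.

For (1) it suffices that a bounded cell P with a special member is matched by a non-special bounded
cell of at least the same dimension (`exists_nonSpecial_cell`). The reflections of the Newton square
(`Symmetry`) reduce to a special left leg with l ≥ 0 (`IsSpecial.induction`). Then A is dual to
(2,j₁), (3,j), (3,j+1). For generic lengths no vertex of Γ lies to the left of A at the height of
the end, so the other tangency on the leg is a single crossing of an edge dual to (0,j₀), (2,j₁).
The middle end j = 1 is impossible, because the lower leg would have a component of multiplicity
one. For j = 2 the curve is cut off if l > 0 and is reflected to j = 0 if l = 0. What remains is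
`EndConfig`, with v₀ on the end dual to (3,0), (3,1).

There two tangencies are used up by the left leg. If the member is not cut off, the third is
controlled by the upper boundary of the chamber of (3,1) (`EndConfig.classification`). Inside the
class one can slide v₀ back along the end to A, changing l, and then push v₀ off the end. How this
is done depends on j₁: for j₁ ≤ 1 along the diagonal through A; for j₁ = 2 by means of the slope-one
edge of Γ at A; for j₁ = 3 by splitting a 4-valent curve at A into l < 0. The result is a
`GoodFamily`, an arc p + s v + s² w of tritangents in the class whose vertices are in positions that
are neither removed nor on an end, so that each cell with such a point in its relative interior is
bounded and non-special.

The arcs measure dimension. By pigeonhole some cell contains infinitely many points of the arc. If v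
and w are independent, three such points already force dimension at least 2; a straight arc forces
dimension at least 1. The construction gives only a straight arc in certain cases where Γ has a
vertex of the same abscissa as v₁. If P has dimension 2 while v₀ stays on the end, the abscissa of
v₁ is not constant on P; as Γ has finitely many vertices, one can first move inside P to avoid them
(`EndConfig.isMovable`). -/

namespace Tritangent

/-! ## Active exponents along lines -/

section Active

variable {n : ℕ} {a : Exps n → ℝ} {u v w : Exps n} {p q d : ℝ × ℝ} {s : ℝ}

/-- The derivative of the monomial `u` in direction `d`. -/
def slope (u : Exps n) (d : ℝ × ℝ) : ℝ := ((u.1 : ℕ) : ℝ) * d.1 + ((u.2 : ℕ) : ℝ) * d.2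

theorem term_add_smul (a : Exps n → ℝ) (u : Exps n) (p d : ℝ × ℝ) (s : ℝ) :
    term a u (p + s • d) = term a u p + s * slope u d := by
  simp only [term, slope, Prod.fst_add, Prod.snd_add, Prod.smul_fst, Prod.smul_snd, smul_eq_mul]
  ring

theorem continuous_term (a : Exps n → ℝ) (u : Exps n) : Continuous (term a u) := by
  unfold term; fun_prop

theorem active_nonempty (a : Exps n → ℝ) (p : ℝ × ℝ) : (active a p).Nonempty := by
  obtain ⟨u, hu⟩ := Finite.exists_max (fun u => term a u p)
  exact ⟨u, hu⟩

theorem term_eq_of_mem (hu : u ∈ active a p) (hv : v ∈ active a p) :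
    term a u p = term a v p := le_antisymm (hv u) (hu v)

theorem mem_active_of_le (hu : u ∈ active a p) (h : term a u p ≤ term a w p) :
    w ∈ active a p := fun v => (hu v).trans h

theorem lt_of_not_mem (hu : u ∈ active a p) (hw : w ∉ active a p) :
    term a w p < term a u p := by
  by_contra h
  exact hw (mem_active_of_le hu (not_lt.1 h))

/-- The amount by which `w` falls short of the common maximiser `u` is affine along the segment and
nonnegative at both ends. At an interior point it vanishes only if it vanishes at both ends. -/
theorem active_openSegment (hp : u ∈ active a p) (hq : u ∈ active a q) {z : ℝ × ℝ}
    (hz : z ∈ openSegment ℝ p q) : active a z = active a p ∩ active a q := by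
  obtain ⟨α, β, hα, hβ, hαβ, rfl⟩ := hz
  have key : ∀ w, term a w (α • p + β • q) = α * term a w p + β * term a w q := by
    intro w
    have : α = 1 - β := by linarith
    subst this
    simp only [term, Prod.fst_add, Prod.snd_add, Prod.smul_fst, Prod.smul_snd, smul_eq_mul]
    ring
  have hu : u ∈ active a (α • p + β • q) := by
    intro w
    rw [key, key]
    have := hp w
    have := hq w
    gcongr
  ext w
  constructor
  · intro hw
    have h1 := hw u
    rw [key, key] at h1
    have h2 := hp w
    have h3 := hq w
    constructor
    · apply mem_active_of_le hp
      by_contra h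
      nlinarith
    · apply mem_active_of_le hq
      by_contra h
      nlinarith
  · rintro ⟨h1, h2⟩
    apply mem_active_of_le hu
    rw [key, key, term_eq_of_mem hp h1, term_eq_of_mem hq h2]

/-- A monomial of globally maximal slope is never overtaken, so it stays active on the whole ray,
and of the monomials tied with it exactly those of the same slope survive. This describes Γ along a
leg once the leg has reached an end or an unbounded chamber. -/
theorem active_ray (hu : u ∈ active a p) (hd : ∀ w : Exps n, slope w d ≤ slope u d)
    (hs : 0 < s) : active a (p + s • d) = {w ∈ active a p | slope w d = slope u d} := by
  have hu' : u ∈ active a (p + s • d) := by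
    intro w
    rw [term_add_smul, term_add_smul]
    have := hu w
    have := hd w
    gcongr
  ext w
  constructor
  · intro hw
    have h1 := hw u
    rw [term_add_smul, term_add_smul] at h1
    have h2 := hu w
    have h3 := hd w
    constructor
    · apply mem_active_of_le hu
      nlinarith
    · apply le_antisymm h3
      by_contra h
      nlinarith
  · rintro ⟨h1, h2⟩
    apply mem_active_of_le hu'
    rw [term_add_smul, term_add_smul, h2, term_eq_of_mem hu h1]

/-- Convexity of the maximum: along a ray the slopes of the active monomials can only increase. -/
theorem slope_le_of_ray (hu : u ∈ active a p) (hs : 0 < s) (hw : w ∈ active a (p + s • d)) :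
    slope u d ≤ slope w d := by
  have h1 := hu w
  have h2 := hw u
  rw [term_add_smul, term_add_smul] at h2
  by_contra h
  nlinarith

theorem mem_active_ray_of_slope_eq (hu : u ∈ active a p) (hw : w ∈ active a (p + s • d))
    (h : slope u d = slope w d) : u ∈ active a (p + s • d) := by
  have h2 := hu w
  apply mem_active_of_le hw
  rw [term_add_smul, term_add_smul, h]
  linarith

open Filter Topology in
/-- The active set is upper semicontinuous. -/
theorem eventually_active_subset (a : Exps n → ℝ) (p : ℝ × ℝ) :
    ∀ᶠ q in 𝓝 p, active a q ⊆ active a p := by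
  obtain ⟨u, hu⟩ := active_nonempty a p
  have : ∀ w : Exps n, ∀ᶠ q in 𝓝 p, w ∈ active a q → w ∈ active a p := by
    intro w
    by_cases hw : w ∈ active a p
    · exact Eventually.of_forall fun _ _ => hw
    · have := (continuous_term a w).continuousAt.eventually_lt
        (continuous_term a u).continuousAt (lt_of_not_mem hu hw)
      filter_upwards [this] with q hq hwq
      exact absurd (hwq u) (not_le.2 hq)
  filter_upwards [eventually_all.2 this] with q hq w hw using hq w hw

open Filter Topology in
/-- Along a short piece of a ray the active exponents are those of maximal slope. -/
theorem eventually_active_ray (hu : u ∈ active a p)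
    (hmax : ∀ w ∈ active a p, slope w d ≤ slope u d) :
    ∀ᶠ s in 𝓝[>] (0 : ℝ),
      active a (p + s • d) = {w ∈ active a p | slope w d = slope u d} := by
  have hc : Tendsto (fun s : ℝ => p + s • d) (𝓝[>] 0) (𝓝 p) := by
    have : Continuous fun s : ℝ => p + s • d := by fun_prop
    have h := this.tendsto 0
    simp only [zero_smul, add_zero] at h
    exact h.mono_left nhdsWithin_le_nhds
  filter_upwards [hc.eventually (eventually_active_subset a p), self_mem_nhdsWithin] with s hs hpos
  have hpos : 0 < s := hpos
  obtain ⟨v, hv⟩ := active_nonempty a (p + s • d)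
  have hvp := hs hv
  have huv : slope u d = slope v d :=
    le_antisymm (slope_le_of_ray hu hpos hv) (hmax v hvp)
  ext w
  constructor
  · intro hw
    exact ⟨hs hw, le_antisymm (hmax w (hs hw)) (slope_le_of_ray hu hpos hw)⟩
  · rintro ⟨h1, h2⟩
    exact mem_active_ray_of_slope_eq h1 hv (h2.trans huv)

/-- Leaving the region where `u` is active, one meets a point where `u` is active together
with a monomial of larger slope. -/
theorem exists_exit (hu : u ∈ active a p) (hs : 0 < s) (hu' : u ∉ active a (p + s • d)) :
    ∃ r : ℝ, 0 ≤ r ∧ r < s ∧ u ∈ active a (p + r • d) ∧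
      ∃ w ∈ active a (p + r • d), slope u d < slope w d := by
  classical
  let T : Finset (Exps n) := Finset.univ.filter fun w => slope u d < slope w d
  have hT : T.Nonempty := by
    obtain ⟨w, hw⟩ := active_nonempty a (p + s • d)
    refine ⟨w, Finset.mem_filter.2 ⟨Finset.mem_univ _, ?_⟩⟩
    refine lt_of_le_of_ne (slope_le_of_ray hu hs hw) fun h => hu' ?_
    exact mem_active_ray_of_slope_eq hu hw h
  -- The exit time is the first time at which some steeper monomial catches up with `u`.
  obtain ⟨w, hwT, hmin⟩ := T.exists_min_image
    (fun w => (term a u p - term a w p) / (slope w d - slope u d)) hT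
  have hw : slope u d < slope w d := (Finset.mem_filter.1 hwT).2
  set r := (term a u p - term a w p) / (slope w d - slope u d) with hr
  have hpos : 0 < slope w d - slope u d := sub_pos.2 hw
  have hr0 : 0 ≤ r := div_nonneg (sub_nonneg.2 (hu w)) hpos.le
  have hur : ∀ r', 0 ≤ r' → r' ≤ r → u ∈ active a (p + r' • d) := by
    intro r' h0 hr' v
    rw [term_add_smul, term_add_smul]
    by_cases hv : slope u d < slope v d
    · have h1 : r ≤ (term a u p - term a v p) / (slope v d - slope u d) :=
        hmin v (Finset.mem_filter.2 ⟨Finset.mem_univ _, hv⟩)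
      rw [le_div_iff₀ (sub_pos.2 hv)] at h1
      nlinarith [sub_pos.2 hv]
    · have := hu v
      have : r' * slope v d ≤ r' * slope u d := by
        gcongr
        exact not_lt.1 hv
      linarith
  refine ⟨r, hr0, ?_, hur r hr0 le_rfl, w, ?_, hw⟩
  · by_contra h
    exact hu' (hur s hs.le (not_lt.1 h))
  · apply mem_active_of_le (hur r hr0 le_rfl)
    rw [term_add_smul, term_add_smul]
    have : r * (slope w d - slope u d) = term a u p - term a w p := by
      rw [hr]; field_simp
    linarith

/-- An edge, followed in a direction in which it is bounded, ends at a vertex. -/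
theorem exists_edge_end (hu : u ∈ active a p) (hv : v ∈ active a p)
    (huv : slope u d = slope v d) (hw : slope u d < slope w d) :
    ∃ r : ℝ, 0 ≤ r ∧ u ∈ active a (p + r • d) ∧ v ∈ active a (p + r • d) ∧
      ∃ z ∈ active a (p + r • d), slope u d < slope z d := by
  have hpos : 0 < slope w d - slope u d := sub_pos.2 hw
  -- At the quotient `w` catches up with `u`; one unit later `u` is certainly no longer active.
  set s := (term a u p - term a w p) / (slope w d - slope u d) + 1 with hs
  have hs0 : 0 < s := by
    have := div_nonneg (sub_nonneg.2 (hu w)) hpos.le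
    linarith
  have : u ∉ active a (p + s • d) := by
    intro h
    have h1 := h w
    rw [term_add_smul, term_add_smul] at h1
    have : s * (slope w d - slope u d) = term a u p - term a w p + (slope w d - slope u d) := by
      rw [hs]; field_simp
    nlinarith
  obtain ⟨r, hr0, -, hur, z, hz, hz'⟩ := exists_exit hu hs0 this
  exact ⟨r, hr0, hur, mem_active_ray_of_slope_eq hv hur huv.symm, z, hz, hz'⟩

theorem isClosed_active (a : Exps n → ℝ) (u : Exps n) : IsClosed {p | u ∈ active a p} := by
  have : {p | u ∈ active a p} = ⋂ w, {p | term a w p ≤ term a u p} := by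
    ext p; simp [active]
  rw [this]
  exact isClosed_iInter fun w => isClosed_le (continuous_term a w) (continuous_term a u)

theorem isClosed_curve (a : Exps n → ℝ) : IsClosed (curve a) := by
  have : curve a = ⋃ x ∈ {x : Exps n × Exps n | x.1 ≠ x.2},
      {p | x.1 ∈ active a p} ∩ {p | x.2 ∈ active a p} := by
    ext p
    simp only [curve, Set.Nontrivial, mem_iUnion]
    constructor
    · rintro ⟨x, hx, y, hy, h⟩; exact ⟨(x, y), h, hx, hy⟩
    · rintro ⟨⟨x, y⟩, h, hx, hy⟩; exact ⟨x, hx, y, hy, h⟩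
  rw [this]
  exact (Set.toFinite _).isClosed_biUnion fun x _ =>
    (isClosed_active a x.1).inter (isClosed_active a x.2)

theorem not_mem_curve_of_eq_singleton (h : active a p = {u}) : p ∉ curve a := by
  simp [curve, h]

theorem mem_curve_of_mem (hu : u ∈ active a p) (hv : v ∈ active a p) (h : u ≠ v) :
    p ∈ curve a := ⟨u, hu, v, hv, h⟩

end Active


/-! ## Mixed areas -/

theorem mixedArea_comm (P Q : Set (ℝ × ℝ)) : mixedArea P Q = mixedArea Q P := by
  unfold mixedArea; rw [add_comm P Q]; ring

theorem vertical_segment_eq (x y : ℝ) :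
    convexHull ℝ {(x, y), (x, y + 1)} = ({x} ×ˢ Icc y (y + 1) : Set (ℝ × ℝ)) := by
  rw [convexHull_pair]
  ext ⟨z, t⟩
  simp only [segment, mem_prod, mem_singleton_iff, mem_Icc]
  constructor
  · rintro ⟨α, β, hα, hβ, h, he⟩
    simp only [Prod.smul_mk, smul_eq_mul, Prod.mk_add_mk, Prod.mk.injEq] at he
    obtain ⟨rfl, rfl⟩ := he
    have : α = 1 - β := by linarith
    subst this
    refine ⟨by ring, by nlinarith, by nlinarith⟩
  · rintro ⟨rfl, h1, h2⟩
    refine ⟨1 - (t - y), t - y, by linarith, by linarith, by ring, ?_⟩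
    simp only [Prod.smul_mk, smul_eq_mul, Prod.mk_add_mk, Prod.mk.injEq]
    constructor <;> ring

/-- The mixed area with a vertical unit segment is the horizontal width. -/
theorem mixedArea_vertical {P : Set (ℝ × ℝ)} (hP : IsCompact P) (hc : Convex ℝ P) {m M x y : ℝ}
    (hle : ∀ p ∈ P, m ≤ p.1 ∧ p.1 ≤ M) (hm : ∃ p ∈ P, p.1 = m) (hM : ∃ p ∈ P, p.1 = M) :
    mixedArea P (convexHull ℝ {(x, y), (x, y + 1)}) = M - m := by
  rw [vertical_segment_eq]
  obtain ⟨p₁, hp₁, e₁⟩ := hm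
  obtain ⟨p₂, hp₂, e₂⟩ := hM
  have hmM : m ≤ M := by rw [← e₁]; exact (hle p₁ hp₁).2
  have hV : IsCompact ({x} ×ˢ Icc y (y + 1) : Set (ℝ × ℝ)) := isCompact_singleton.prod isCompact_Icc
  have hslice : ∀ z ∈ Icc m M, ∃ α β, α ≤ β ∧ Prod.mk z ⁻¹' P = Icc α β := by
    intro z hz
    have hne : (Prod.mk z ⁻¹' P).Nonempty := by
      have h1 : Convex ℝ (Prod.fst '' P) := hc.is_linear_image (IsLinearMap.mk (by simp) (by simp))
      have h2 : z ∈ Prod.fst '' P :=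
        (h1.ordConnected.out ⟨p₁, hp₁, e₁⟩ ⟨p₂, hp₂, e₂⟩) hz
      obtain ⟨⟨z', t⟩, hp, rfl⟩ := h2
      exact ⟨t, hp⟩
    have hcomp : IsCompact (Prod.mk z ⁻¹' P) := by
      have : Prod.mk z ⁻¹' P = Prod.snd '' (P ∩ {p | p.1 = z}) := by
        ext t
        constructor
        · intro h; exact ⟨(z, t), ⟨h, rfl⟩, rfl⟩
        · rintro ⟨⟨z', t'⟩, ⟨h, rfl⟩, rfl⟩; exact h
      rw [this]
      exact (hP.inter_right (isClosed_eq continuous_fst continuous_const)).image continuous_snd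
    have hconv : Convex ℝ (Prod.mk z ⁻¹' P) := by
      intro s hs t ht α β hα hβ hαβ
      have h := hc hs ht hα hβ hαβ
      simp only [Prod.smul_mk, smul_eq_mul, Prod.mk_add_mk] at h
      rw [← add_mul, hαβ, one_mul] at h
      exact h
    have hconn : IsConnected (Prod.mk z ⁻¹' P) := ⟨hne, hconv.isPreconnected⟩
    have h := eq_Icc_of_connected_compact hconn hcomp
    refine ⟨_, _, ?_, h⟩
    rw [h] at hne
    exact nonempty_Icc.1 hne
  have hempty : ∀ z, z ∉ Icc m M → Prod.mk z ⁻¹' P = ∅ := by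
    intro z hz
    ext t
    simp only [mem_preimage, mem_empty_iff_false, iff_false]
    intro h
    exact hz (hle _ h)
  have hsum : ∀ z, Prod.mk z ⁻¹' (P + ({x} ×ˢ Icc y (y + 1) : Set (ℝ × ℝ)))
      = Prod.mk (z - x) ⁻¹' P + Icc y (y + 1) := by
    intro z
    ext t
    simp only [mem_preimage, Set.mem_add, mem_prod, mem_singleton_iff, Prod.exists, Prod.mk_add_mk,
      Prod.mk.injEq]
    constructor
    · rintro ⟨z', t', h, x', s, ⟨rfl, hs⟩, rfl, rfl⟩
      exact ⟨t', by simpa using h, s, hs, rfl⟩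
    · rintro ⟨t', h, s, hs, rfl⟩
      exact ⟨z - x, t', h, x, s, ⟨rfl, hs⟩, by ring, rfl⟩
  -- Every nonempty vertical slice of `P` is an interval and grows by exactly one. By Fubini the
  -- area of the sum exceeds that of `P` by the length of the projection of `P`.
  have hvol : ∀ z, volume (Prod.mk z ⁻¹' P + Icc y (y + 1))
      = volume (Prod.mk z ⁻¹' P) + (Icc m M).indicator 1 z := by
    intro z
    by_cases hz : z ∈ Icc m M
    · obtain ⟨α, β, hαβ, h⟩ := hslice z hz
      rw [h, Icc_add_Icc hαβ (by linarith), Real.volume_Icc, Real.volume_Icc,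
        indicator_of_mem hz, Pi.one_apply, ← ENNReal.ofReal_one,
        ← ENNReal.ofReal_add (by linarith) zero_le_one]
      congr 1; ring
    · rw [hempty z hz, indicator_of_notMem hz]
      simp
  have hfin : volume P ≠ ⊤ := hP.measure_lt_top.ne
  have key : volume (P + ({x} ×ˢ Icc y (y + 1) : Set (ℝ × ℝ)))
      = volume P + ENNReal.ofReal (M - m) := by
    rw [Measure.volume_eq_prod, Measure.prod_apply (hP.add hV).isClosed.measurableSet,
      Measure.prod_apply hP.isClosed.measurableSet]
    simp_rw [hsum, hvol]
    rw [lintegral_sub_right_eq_self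
      (fun z => volume (Prod.mk z ⁻¹' P) + (Icc m M).indicator 1 z) x,
      lintegral_add_right _ (measurable_one.indicator measurableSet_Icc),
      lintegral_indicator_one measurableSet_Icc, Real.volume_Icc]
  have hV0 : volume ({x} ×ˢ Icc y (y + 1) : Set (ℝ × ℝ)) = 0 := by
    rw [Measure.volume_eq_prod, Measure.prod_prod]; simp
  unfold mixedArea
  rw [measureReal_def, measureReal_def, measureReal_def, key, hV0,
    ENNReal.toReal_add hfin ENNReal.ofReal_ne_top, ENNReal.toReal_ofReal (by linarith)]
  simp

/-- The area between two graphs. -/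
theorem volume_real_region {f g : ℝ → ℝ} (hf : Continuous f) (hg : Continuous g) {a b : ℝ}
    (hab : a ≤ b) (hfg : ∀ x ∈ Icc a b, f x ≤ g x) :
    volume.real {p : ℝ × ℝ | p.1 ∈ Icc a b ∧ f p.1 ≤ p.2 ∧ p.2 ≤ g p.1}
      = ∫ x in a..b, (g x - f x) := by
  have hcl : IsClosed {p : ℝ × ℝ | p.1 ∈ Icc a b ∧ f p.1 ≤ p.2 ∧ p.2 ≤ g p.1} := by
    refine (isClosed_Icc.preimage continuous_fst).inter
      (IsClosed.inter (isClosed_le (hf.comp continuous_fst) continuous_snd)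
        (isClosed_le continuous_snd (hg.comp continuous_fst)))
  have hsl : ∀ x, volume (Prod.mk x ⁻¹' {p : ℝ × ℝ | p.1 ∈ Icc a b ∧ f p.1 ≤ p.2 ∧ p.2 ≤ g p.1})
      = (Icc a b).indicator (fun x => ENNReal.ofReal (g x - f x)) x := by
    intro x
    by_cases hx : x ∈ Icc a b
    · rw [indicator_of_mem hx, ← Real.volume_Icc]
      congr 1
      ext y
      exact ⟨fun h => h.2, fun h => ⟨hx, h⟩⟩
    · rw [indicator_of_notMem hx]
      convert measure_empty (μ := (volume : Measure ℝ))
      ext y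
      exact ⟨fun h => hx h.1, fun h => h.elim⟩
  rw [measureReal_def, Measure.volume_eq_prod, Measure.prod_apply hcl.measurableSet]
  simp_rw [hsl]
  rw [lintegral_indicator measurableSet_Icc, intervalIntegral.integral_of_le hab,
    ← integral_Icc_eq_integral_Ioc, integral_eq_lintegral_of_nonneg_ae]
  · exact (ae_restrict_mem measurableSet_Icc).mono fun x hx => sub_nonneg.2 (hfg x hx)
  · exact (hg.sub hf).aestronglyMeasurable

/-- A trapezoid with two vertical sides at distance one. -/
def trapezoid (x c d p q : ℝ) : Set (ℝ × ℝ) :=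
  {z | z.1 ∈ Icc x (x + 1) ∧ c + p * (z.1 - x) ≤ z.2 ∧ z.2 ≤ d + q * (z.1 - x)}

theorem vertical_mem {K : Set (ℝ × ℝ)} (hc : Convex ℝ K) {x l y h : ℝ} (lo : (x, l) ∈ K)
    (hi : (x, h) ∈ K) (h1 : l ≤ y) (h2 : y ≤ h) : (x, y) ∈ K := by
  rcases h1.eq_or_lt with rfl | h1'
  · exact lo
  have hlh : 0 < h - l := by linarith
  have := hc lo hi (a := (h - y) / (h - l)) (b := (y - l) / (h - l))
    (div_nonneg (by linarith) hlh.le) (div_nonneg (by linarith) hlh.le) (by field_simp; ring)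
  convert this using 1
  simp only [Prod.smul_mk, smul_eq_mul, Prod.mk_add_mk, Prod.mk.injEq]
  constructor
  · field_simp; ring
  · field_simp; ring

theorem convexHull_eq_trapezoid {x c d c' d' : ℝ} (h : c ≤ d) (h' : c' ≤ d') :
    convexHull ℝ {(x, c), (x, d), (x + 1, c'), (x + 1, d')}
      = trapezoid x c d (c' - c) (d' - d) := by
  apply Subset.antisymm
  · apply convexHull_min
    · rintro z (rfl | rfl | rfl | rfl) <;>
        simp only [trapezoid, mem_ofPred_eq, mem_Icc] <;>
        refine ⟨⟨by linarith, by linarith⟩, by linarith, by linarith⟩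
    · rintro ⟨z1, z2⟩ ⟨⟨hz1, hz2⟩, hz3, hz4⟩ ⟨w1, w2⟩ ⟨⟨hw1, hw2⟩, hw3, hw4⟩ α β hα hβ hαβ
      have : α = 1 - β := by linarith
      subst this
      simp only [trapezoid, mem_ofPred_eq, mem_Icc, Prod.smul_mk, smul_eq_mul, Prod.mk_add_mk] at *
      refine ⟨⟨by nlinarith, by nlinarith⟩, by nlinarith, by nlinarith⟩
  · rintro ⟨z1, z2⟩ ⟨⟨hz1, hz2⟩, hz3, hz4⟩
    simp only at hz1 hz2 hz3 hz4
    have hc := convex_convexHull ℝ ({(x, c), (x, d), (x + 1, c'), (x + 1, d')} : Set (ℝ × ℝ))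
    set K := convexHull ℝ ({(x, c), (x, d), (x + 1, c'), (x + 1, d')} : Set (ℝ × ℝ)) with hK
    have hsub : ({(x, c), (x, d), (x + 1, c'), (x + 1, d')} : Set (ℝ × ℝ)) ⊆ K :=
      subset_convexHull _ _
    set θ := z1 - x with hθ
    have hz : z1 = x + θ := by rw [hθ]; ring
    have lo : (z1, c + (c' - c) * θ) ∈ K := by
      have := hc (hsub (a := (x, c)) (by simp)) (hsub (a := (x + 1, c')) (by simp))
        (a := 1 - θ) (b := θ) (by linarith) (by linarith) (by ring)
      convert this using 1
      simp only [Prod.smul_mk, smul_eq_mul, Prod.mk_add_mk, Prod.mk.injEq]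
      constructor
      · rw [hz]; ring
      · ring
    have hi : (z1, d + (d' - d) * θ) ∈ K := by
      have := hc (hsub (a := (x, d)) (by simp)) (hsub (a := (x + 1, d')) (by simp))
        (a := 1 - θ) (b := θ) (by linarith) (by linarith) (by ring)
      convert this using 1
      simp only [Prod.smul_mk, smul_eq_mul, Prod.mk_add_mk, Prod.mk.injEq]
      constructor
      · rw [hz]; ring
      · ring
    exact vertical_mem hc lo hi hz3 hz4

theorem integral_affine (X α β : ℝ) : ∫ x in X..X + 1, (α + β * (x - X)) = α + β / 2 := by
  have h := intervalIntegral.integral_comp_sub_right (a := X) (b := X + 1)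
    (fun x => α + β * x) X
  simp only [sub_self, add_sub_cancel_left] at h
  rw [h, intervalIntegral.integral_add (by simp) (by
    exact (continuous_const.mul continuous_id).intervalIntegrable _ _)]
  rw [intervalIntegral.integral_const_mul, integral_id]
  simp; ring

theorem volume_real_trapezoid {x c d p q : ℝ} (h : c ≤ d) (h' : c + p ≤ d + q) :
    volume.real (trapezoid x c d p q) = (d - c) + (q - p) / 2 := by
  have := volume_real_region (f := fun z => c + p * (z - x)) (g := fun z => d + q * (z - x))
    (by fun_prop) (by fun_prop) (a := x) (b := x + 1) (by linarith) (by
      rintro z ⟨h1, h2⟩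
      nlinarith)
  rw [trapezoid, this, ← integral_affine x]
  congr 1
  ext z; ring

/-- The boundary of a Minkowski sum consists of the edges of both summands sorted by slope: below,
the smaller slope comes first, above, the larger one. Over two unit strips each boundary is thus a
broken line, written as a maximum below and as a minimum above. -/
theorem add_trapezoid {x c d p q x' c' d' p' q' : ℝ} (h : c ≤ d) (h1 : c + p ≤ d + q)
    (h' : c' ≤ d') (h1' : c' + p' ≤ d' + q') :
    trapezoid x c d p q + trapezoid x' c' d' p' q' =
      {z | z.1 ∈ Icc (x + x') (x + x' + 1 + 1) ∧
        c + c' + max (min p p' * (z.1 - (x + x')))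
          (min p p' + max p p' * (z.1 - (x + x' + 1))) ≤ z.2 ∧
        z.2 ≤ d + d' + min (max q q' * (z.1 - (x + x')))
          (max q q' + min q q' * (z.1 - (x + x' + 1)))} := by
  have hconv : ∀ x c d p q : ℝ, Convex ℝ (trapezoid x c d p q) := by
    rintro x c d p q ⟨z1, z2⟩ ⟨⟨hz1, hz2⟩, hz3, hz4⟩ ⟨w1, w2⟩ ⟨⟨hw1, hw2⟩, hw3, hw4⟩ α β hα hβ hαβ
    have : α = 1 - β := by linarith
    subst this
    simp only [trapezoid, mem_ofPred_eq, mem_Icc, Prod.smul_mk, smul_eq_mul, Prod.mk_add_mk] at *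
    refine ⟨⟨by nlinarith, by nlinarith⟩, by nlinarith, by nlinarith⟩
  apply Subset.antisymm
  · rintro _ ⟨⟨z1, z2⟩, ⟨⟨hz1, hz2⟩, hz3, hz4⟩, ⟨w1, w2⟩, ⟨⟨hw1, hw2⟩, hw3, hw4⟩, rfl⟩
    simp only [mem_ofPred_eq, mem_Icc, Prod.mk_add_mk] at *
    refine ⟨⟨by linarith, by linarith⟩, ?_, ?_⟩
    · rcases le_total p p' with hp | hp
      · rw [min_eq_left hp, max_eq_right hp]
        have : max (p * (z1 + w1 - (x + x'))) (p + p' * (z1 + w1 - (x + x' + 1)))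
          ≤ p * (z1 - x) + p' * (w1 - x') := max_le (by nlinarith) (by nlinarith)
        linarith
      · rw [min_eq_right hp, max_eq_left hp]
        have : max (p' * (z1 + w1 - (x + x'))) (p' + p * (z1 + w1 - (x + x' + 1)))
          ≤ p * (z1 - x) + p' * (w1 - x') := max_le (by nlinarith) (by nlinarith)
        linarith
    · rcases le_total q q' with hp | hp
      · rw [min_eq_left hp, max_eq_right hp]
        have : q * (z1 - x) + q' * (w1 - x') ≤
          min (q' * (z1 + w1 - (x + x'))) (q' + q * (z1 + w1 - (x + x' + 1))) :=
          le_min (by nlinarith) (by nlinarith)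
        linarith
      · rw [min_eq_right hp, max_eq_left hp]
        have : q * (z1 - x) + q' * (w1 - x') ≤
          min (q * (z1 + w1 - (x + x'))) (q + q' * (z1 + w1 - (x + x' + 1))) :=
          le_min (by nlinarith) (by nlinarith)
        linarith
  · rintro ⟨z1, z2⟩ ⟨⟨hz1, hz2⟩, hz3, hz4⟩
    simp only at hz1 hz2 hz3 hz4
    have hc : Convex ℝ (trapezoid x c d p q + trapezoid x' c' d' p' q') :=
      (hconv _ _ _ _ _).add (hconv _ _ _ _ _)
    set θ := z1 - (x + x') with hθ
    have hθ1 : z1 - (x + x' + 1) = θ - 1 := by rw [hθ]; ring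
    rw [hθ1] at hz3 hz4
    have mem : ∀ s t e, 0 ≤ s → s ≤ 1 → 0 ≤ t → t ≤ 1 → s + t = θ →
        (e = c + c' + (p * s + p' * t) ∨ e = d + d' + (q * s + q' * t)) →
        (z1, e) ∈ trapezoid x c d p q + trapezoid x' c' d' p' q' := by
      rintro s t e hs0 hs1 ht0 ht1 hst (rfl | rfl)
      · refine ⟨(x + s, c + p * s), ⟨⟨by simp only; linarith, by simp only; linarith⟩, ?_, ?_⟩,
          (x' + t, c' + p' * t), ⟨⟨by simp only; linarith, by simp only; linarith⟩, ?_, ?_⟩, ?_⟩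
        · simp only; linarith
        · simp only; nlinarith
        · simp only; linarith
        · simp only; nlinarith
        · simp only [Prod.mk_add_mk, Prod.mk.injEq]; constructor <;> linarith
      · refine ⟨(x + s, d + q * s), ⟨⟨by simp only; linarith, by simp only; linarith⟩, ?_, ?_⟩,
          (x' + t, d' + q' * t), ⟨⟨by simp only; linarith, by simp only; linarith⟩, ?_, ?_⟩, ?_⟩
        · simp only; nlinarith
        · simp only; linarith
        · simp only; nlinarith
        · simp only; linarith
        · simp only [Prod.mk_add_mk, Prod.mk.injEq]; constructor <;> linarith
    have h0 : 0 ≤ θ := by linarith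
    have h2 : θ ≤ 2 := by linarith
    have lo : (z1, c + c' + max (min p p' * θ) (min p p' + max p p' * (θ - 1)))
        ∈ trapezoid x c d p q + trapezoid x' c' d' p' q' := by
      rcases le_total θ 1 with h01 | h01
      · rcases le_total p p' with hp | hp
        · refine mem θ 0 _ h0 h01 le_rfl zero_le_one (by ring) (Or.inl ?_)
          rw [min_eq_left hp, max_eq_right hp, max_eq_left (by nlinarith)]; ring
        · refine mem 0 θ _ le_rfl zero_le_one h0 h01 (by ring) (Or.inl ?_)
          rw [min_eq_right hp, max_eq_left hp, max_eq_left (by nlinarith)]; ring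
      · rcases le_total p p' with hp | hp
        · refine mem 1 (θ - 1) _ zero_le_one le_rfl (by linarith) (by linarith) (by ring) (Or.inl ?_)
          rw [min_eq_left hp, max_eq_right hp, max_eq_right (by nlinarith)]; ring
        · refine mem (θ - 1) 1 _ (by linarith) (by linarith) zero_le_one le_rfl (by ring) (Or.inl ?_)
          rw [min_eq_right hp, max_eq_left hp, max_eq_right (by nlinarith)]; ring
    have hi : (z1, d + d' + min (max q q' * θ) (max q q' + min q q' * (θ - 1)))
        ∈ trapezoid x c d p q + trapezoid x' c' d' p' q' := by
      rcases le_total θ 1 with h01 | h01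
      · rcases le_total q q' with hp | hp
        · refine mem 0 θ _ le_rfl zero_le_one h0 h01 (by ring) (Or.inr ?_)
          rw [min_eq_left hp, max_eq_right hp, min_eq_left (by nlinarith)]; ring
        · refine mem θ 0 _ h0 h01 le_rfl zero_le_one (by ring) (Or.inr ?_)
          rw [min_eq_right hp, max_eq_left hp, min_eq_left (by nlinarith)]; ring
      · rcases le_total q q' with hp | hp
        · refine mem (θ - 1) 1 _ (by linarith) (by linarith) zero_le_one le_rfl (by ring) (Or.inr ?_)
          rw [min_eq_left hp, max_eq_right hp, min_eq_right (by nlinarith)]; ring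
        · refine mem 1 (θ - 1) _ zero_le_one le_rfl (by linarith) (by linarith) (by ring) (Or.inr ?_)
          rw [min_eq_right hp, max_eq_left hp, min_eq_right (by nlinarith)]; ring
    exact vertical_mem hc lo hi hz3 hz4

/-- Integrating between the broken lines strip by strip, everything but a linear expression cancels.
Segments and triangles are the degenerate cases in which one or both vertical sides have length
zero, so this evaluates the multiplicities at vertices of a (1,1)-curve for which the width formulas
are not enough. -/
theorem mixedArea_trapezoid {x c d p q x' c' d' p' q' : ℝ} (h : c ≤ d) (h1 : c + p ≤ d + q)
    (h' : c' ≤ d') (h1' : c' + p' ≤ d' + q') :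
    mixedArea (trapezoid x c d p q) (trapezoid x' c' d' p' q')
      = (d - c) + (d' - c') + max q q' - min p p' := by
  unfold mixedArea
  rw [volume_real_trapezoid h h1, volume_real_trapezoid h' h1', add_trapezoid h h1 h' h1']
  set X := x + x' with hX
  set f : ℝ → ℝ := fun z => c + c' + max (min p p' * (z - X))
    (min p p' + max p p' * (z - (X + 1))) with hf
  set g : ℝ → ℝ := fun z => d + d' + min (max q q' * (z - X))
    (max q q' + min q q' * (z - (X + 1))) with hg
  have hfc : Continuous f := by fun_prop
  have hgc : Continuous g := by fun_prop
  have hpp : min p p' ≤ max p p' := min_le_max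
  have hqq : min q q' ≤ max q q' := min_le_max
  have hps : min p p' + max p p' = p + p' := min_add_max p p'
  have hqs : min q q' + max q q' = q + q' := min_add_max q q'
  have f1 : ∀ z ∈ Icc X (X + 1), g z - f z =
      (d + d' - (c + c')) + (max q q' - min p p') * (z - X) := by
    rintro z ⟨h1, h2⟩
    simp only [hf, hg]
    have e1 : min p p' + max p p' * (z - (X + 1)) ≤ min p p' * (z - X) := by nlinarith
    have e2 : max q q' * (z - X) ≤ max q q' + min q q' * (z - (X + 1)) := by nlinarith
    rw [max_eq_left e1, min_eq_left e2]
    ring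
  have f2 : ∀ z ∈ Icc (X + 1) (X + 1 + 1), g z - f z =
      (d + d' - (c + c') + max q q' - min p p') + (min q q' - max p p') * (z - (X + 1)) := by
    rintro z ⟨h1, h2⟩
    simp only [hf, hg]
    have e1 : min p p' * (z - X) ≤ min p p' + max p p' * (z - (X + 1)) := by nlinarith
    have e2 : max q q' + min q q' * (z - (X + 1)) ≤ max q q' * (z - X) := by nlinarith
    rw [max_eq_right e1, min_eq_right e2]
    ring
  have hm : 0 ≤ d + d' - (c + c') + max q q' - min p p' := by
    rcases le_total 0 (max q q' - min p p') with h0 | h0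
    · linarith
    · linarith [le_max_left q q', min_le_left p p', le_max_right q q', min_le_right p p']
  have hle : ∀ z ∈ Icc X (X + 1 + 1), f z ≤ g z := by
    intro z hz
    rcases le_total z (X + 1) with h3 | h3
    · have := f1 z ⟨hz.1, h3⟩
      have : 0 ≤ g z - f z := by rw [this]; nlinarith [hz.1, hz.2]
      linarith
    · have h4 := f2 z ⟨h3, hz.2⟩
      have h5 : 0 ≤ (d + d' - (c + c') + max q q' - min p p') + (min q q' - max p p') := by
        linarith
      have : 0 ≤ g z - f z := by rw [h4]; nlinarith [hz.1, hz.2]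
      linarith
  have hreg := volume_real_region hfc hgc (by linarith : X ≤ X + 1 + 1) hle
  have e1 : ∫ z in X..X + 1, (g z - f z)
      = (d + d' - (c + c')) + (max q q' - min p p') / 2 := by
    rw [← integral_affine X]
    apply intervalIntegral.integral_congr
    intro z hz
    rw [uIcc_of_le (by linarith)] at hz
    exact f1 z hz
  have e2 : ∫ z in X + 1..X + 1 + 1, (g z - f z)
      = (d + d' - (c + c') + max q q' - min p p') + (min q q' - max p p') / 2 := by
    rw [← integral_affine (X + 1)]
    apply intervalIntegral.integral_congr
    intro z hz
    rw [uIcc_of_le (by linarith)] at hz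
    exact f2 z hz
  have hint : ∀ a b, IntervalIntegrable (fun z => g z - f z) volume a b := fun a b =>
    (hgc.sub hfc).intervalIntegrable a b
  rw [← intervalIntegral.integral_add_adjacent_intervals (hint X (X + 1)) (hint _ _), e1, e2]
    at hreg
  rw [hreg]
  linarith

theorem mixedArea_convexHull {x c d c₁ d₁ x' c' d' c₁' d₁' : ℝ} (h : c ≤ d) (h1 : c₁ ≤ d₁)
    (h' : c' ≤ d') (h1' : c₁' ≤ d₁') :
    mixedArea (convexHull ℝ {(x, c), (x, d), (x + 1, c₁), (x + 1, d₁)})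
        (convexHull ℝ {(x', c'), (x', d'), (x' + 1, c₁'), (x' + 1, d₁')})
      = (d - c) + (d' - c') + max (d₁ - d) (d₁' - d') - min (c₁ - c) (c₁' - c') := by
  rw [convexHull_eq_trapezoid h h1, convexHull_eq_trapezoid h' h1',
    mixedArea_trapezoid h (by linarith) h' (by linarith)]

/-- Mixed areas are invariant under area preserving affine maps. -/
theorem mixedArea_image (f : (ℝ × ℝ) →ₗ[ℝ] (ℝ × ℝ)) (hf : MeasurePreserving f volume volume)
    (he : MeasurableEmbedding f) (c c' : ℝ × ℝ) (P Q : Set (ℝ × ℝ)) :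
    mixedArea ((fun p => f p + c) '' P) ((fun p => f p + c') '' Q) = mixedArea P Q := by
  have hvol : ∀ (c : ℝ × ℝ) (P : Set (ℝ × ℝ)), volume.real ((fun p => f p + c) '' P)
      = volume.real P := by
    intro c P
    have h1 : (fun p => f p + c) '' P = (fun p => p + c) '' (f '' P) := by
      rw [image_image]
    have h2 : volume ((fun p => p + c) '' (f '' P)) = volume (f '' P) := by
      rw [image_add_right, measure_preimage_add_right]
    rw [measureReal_def, measureReal_def, h1, h2, ← hf.measure_preimage_emb he,
      preimage_image_eq _ he.injective]
  have hadd : (fun p => f p + c) '' P + (fun p => f p + c') '' Q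
      = (fun p => f p + (c + c')) '' (P + Q) := by
    ext z
    constructor
    · rintro ⟨_, ⟨p, hp, rfl⟩, _, ⟨q, hq, rfl⟩, rfl⟩
      exact ⟨p + q, ⟨p, hp, q, hq, rfl⟩, by simp only [map_add]; abel⟩
    · rintro ⟨_, ⟨p, hp, q, hq, rfl⟩, rfl⟩
      exact ⟨_, ⟨p, hp, rfl⟩, _, ⟨q, hq, rfl⟩, by simp only [map_add]; abel⟩
  unfold mixedArea
  rw [hadd, hvol, hvol, hvol]


/-! ## Widths of lattice polygons -/

section Widths

variable {n : ℕ} {S : Set (Exps n)}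

theorem isCompact_hull (S : Set (Exps n)) : IsCompact (convexHull ℝ (toPlane '' S)) :=
  ((Set.toFinite S).image _).isCompact_convexHull ℝ

/-- The reflection in the diagonal. -/
def swapMap : (ℝ × ℝ) →ₗ[ℝ] (ℝ × ℝ) := (LinearMap.snd ℝ ℝ ℝ).prod (LinearMap.fst ℝ ℝ ℝ)

/-- The reflection in the vertical axis. -/
def reflMap : (ℝ × ℝ) →ₗ[ℝ] (ℝ × ℝ) := (-LinearMap.fst ℝ ℝ ℝ).prod (LinearMap.snd ℝ ℝ ℝ)

/-- The shear that makes the antidiagonal direction vertical. -/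
def shearMap : (ℝ × ℝ) →ₗ[ℝ] (ℝ × ℝ) :=
  (LinearMap.fst ℝ ℝ ℝ + LinearMap.snd ℝ ℝ ℝ).prod (LinearMap.snd ℝ ℝ ℝ)

@[simp] theorem swapMap_apply (p : ℝ × ℝ) : swapMap p = (p.2, p.1) := rfl
@[simp] theorem reflMap_apply (p : ℝ × ℝ) : reflMap p = (-p.1, p.2) := rfl
@[simp] theorem shearMap_apply (p : ℝ × ℝ) : shearMap p = (p.1 + p.2, p.2) := rfl

theorem measurePreserving_swapMap : MeasurePreserving swapMap volume volume :=
  Measure.measurePreserving_swap (μ := (volume : Measure ℝ)) (ν := (volume : Measure ℝ))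

theorem measurePreserving_reflMap : MeasurePreserving reflMap volume volume :=
  (Measure.measurePreserving_neg (volume : Measure ℝ)).prod
    (MeasurePreserving.id (volume : Measure ℝ))

theorem measurePreserving_shearMap : MeasurePreserving shearMap volume volume :=
  measurePreserving_add_prod (volume : Measure ℝ) (volume : Measure ℝ)

theorem measurableEmbedding_swapMap : MeasurableEmbedding swapMap :=
  swapMap.continuous_of_finiteDimensional.measurableEmbedding fun p q h => by
    simp only [swapMap_apply, Prod.mk.injEq] at h; exact Prod.ext h.2 h.1

theorem measurableEmbedding_reflMap : MeasurableEmbedding reflMap :=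
  reflMap.continuous_of_finiteDimensional.measurableEmbedding fun p q h => by
    simp only [reflMap_apply, Prod.mk.injEq, neg_inj] at h; exact Prod.ext h.1 h.2

theorem measurableEmbedding_shearMap : MeasurableEmbedding shearMap :=
  shearMap.continuous_of_finiteDimensional.measurableEmbedding fun p q h => by
    simp only [shearMap_apply, Prod.mk.injEq] at h
    exact Prod.ext (by linarith [h.1, h.2]) h.2

theorem image_convexHull_affine (f : (ℝ × ℝ) →ₗ[ℝ] (ℝ × ℝ)) (c : ℝ × ℝ) (S : Set (ℝ × ℝ)) :
    (fun p => f p + c) '' convexHull ℝ S = convexHull ℝ ((fun p => f p + c) '' S) :=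
  (f.toAffineMap + AffineMap.const ℝ (ℝ × ℝ) c).image_convexHull S

theorem mixedArea_hull_vertical {m M : ℕ} (hle : ∀ u ∈ S, m ≤ (u.1 : ℕ) ∧ (u.1 : ℕ) ≤ M)
    (hm : ∃ u ∈ S, (u.1 : ℕ) = m) (hM : ∃ u ∈ S, (u.1 : ℕ) = M) (x y : ℝ) :
    mixedArea (convexHull ℝ (toPlane '' S)) (convexHull ℝ {(x, y), (x, y + 1)}) = M - m := by
  obtain ⟨u, hu, rfl⟩ := hm
  obtain ⟨v, hv, rfl⟩ := hM
  refine mixedArea_vertical (isCompact_hull S) (convex_convexHull _ _) ?_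
    ⟨toPlane u, subset_convexHull _ _ ⟨u, hu, rfl⟩, rfl⟩
    ⟨toPlane v, subset_convexHull _ _ ⟨v, hv, rfl⟩, rfl⟩
  have hc : Convex ℝ {p : ℝ × ℝ | ((u.1 : ℕ) : ℝ) ≤ p.1 ∧ p.1 ≤ ((v.1 : ℕ) : ℝ)} := by
    have := (convex_Icc ((u.1 : ℕ) : ℝ) ((v.1 : ℕ) : ℝ)).linear_preimage
      (LinearMap.fst ℝ ℝ ℝ)
    exact this
  refine fun p hp => (convexHull_min ?_ hc) hp
  rintro _ ⟨w, hw, rfl⟩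
  have := hle w hw
  simp only [toPlane, mem_ofPred_eq, Nat.cast_le]
  exact this

theorem mixedArea_hull_horizontal {m M : ℕ} (hle : ∀ u ∈ S, m ≤ (u.2 : ℕ) ∧ (u.2 : ℕ) ≤ M)
    (hm : ∃ u ∈ S, (u.2 : ℕ) = m) (hM : ∃ u ∈ S, (u.2 : ℕ) = M) (x y : ℝ) :
    mixedArea (convexHull ℝ (toPlane '' S)) (convexHull ℝ {(x, y), (x + 1, y)}) = M - m := by
  obtain ⟨u, hu, rfl⟩ := hm
  obtain ⟨v, hv, rfl⟩ := hM
  rw [← mixedArea_image swapMap measurePreserving_swapMap measurableEmbedding_swapMap 0 0,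
    image_convexHull_affine, image_convexHull_affine]
  have e : (fun p => swapMap p + 0) '' ({(x, y), (x + 1, y)} : Set (ℝ × ℝ))
      = {(y, x), (y, x + 1)} := by simp [image_pair]
  rw [e]
  refine mixedArea_vertical ?_ (convex_convexHull _ _) ?_
    ⟨swapMap (toPlane u) + 0, subset_convexHull _ _ ⟨_, ⟨u, hu, rfl⟩, rfl⟩, by simp [toPlane]⟩
    ⟨swapMap (toPlane v) + 0, subset_convexHull _ _ ⟨_, ⟨v, hv, rfl⟩, rfl⟩, by simp [toPlane]⟩
  · exact (((Set.toFinite S).image _).image _).isCompact_convexHull ℝ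
  have hc : Convex ℝ {p : ℝ × ℝ | ((u.2 : ℕ) : ℝ) ≤ p.1 ∧ p.1 ≤ ((v.2 : ℕ) : ℝ)} := by
    have := (convex_Icc ((u.2 : ℕ) : ℝ) ((v.2 : ℕ) : ℝ)).linear_preimage
      (LinearMap.fst ℝ ℝ ℝ)
    exact this
  refine fun p hp => (convexHull_min ?_ hc) hp
  rintro _ ⟨_, ⟨w, hw, rfl⟩, rfl⟩
  have := hle w hw
  simp only [toPlane, mem_ofPred_eq, Nat.cast_le, swapMap_apply, add_zero]
  exact this

theorem mixedArea_hull_diagonal {m M : ℕ}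
    (hle : ∀ u ∈ S, m ≤ (u.1 : ℕ) + u.2 ∧ (u.1 : ℕ) + u.2 ≤ M)
    (hm : ∃ u ∈ S, (u.1 : ℕ) + u.2 = m) (hM : ∃ u ∈ S, (u.1 : ℕ) + u.2 = M) (x y : ℝ) :
    mixedArea (convexHull ℝ (toPlane '' S)) (convexHull ℝ {(x + 1, y), (x, y + 1)}) = M - m := by
  obtain ⟨u, hu, rfl⟩ := hm
  obtain ⟨v, hv, rfl⟩ := hM
  rw [← mixedArea_image shearMap measurePreserving_shearMap measurableEmbedding_shearMap 0 0,
    image_convexHull_affine, image_convexHull_affine]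
  have e : (fun p => shearMap p + 0) '' ({(x + 1, y), (x, y + 1)} : Set (ℝ × ℝ))
      = {(x + 1 + y, y), (x + 1 + y, y + 1)} := by
    simp [image_pair]; ring_nf
  rw [e]
  refine mixedArea_vertical ?_ (convex_convexHull _ _) ?_
    ⟨shearMap (toPlane u) + 0, subset_convexHull _ _ ⟨_, ⟨u, hu, rfl⟩, rfl⟩, by simp [toPlane]⟩
    ⟨shearMap (toPlane v) + 0, subset_convexHull _ _ ⟨_, ⟨v, hv, rfl⟩, rfl⟩, by simp [toPlane]⟩
  · exact (((Set.toFinite S).image _).image _).isCompact_convexHull ℝ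
  have hc : Convex ℝ {p : ℝ × ℝ | (((u.1 : ℕ) + (u.2 : ℕ) : ℕ) : ℝ) ≤ p.1 ∧
      p.1 ≤ (((v.1 : ℕ) + (v.2 : ℕ) : ℕ) : ℝ)} := by
    have := (convex_Icc (((u.1 : ℕ) + (u.2 : ℕ) : ℕ) : ℝ)
      (((v.1 : ℕ) + (v.2 : ℕ) : ℕ) : ℝ)).linear_preimage
      (LinearMap.fst ℝ ℝ ℝ)
    exact this
  refine fun p hp => (convexHull_min ?_ hc) hp
  rintro _ ⟨_, ⟨w, hw, rfl⟩, rfl⟩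
  have := hle w hw
  simp only [toPlane, mem_ofPred_eq, shearMap_apply, add_zero, ← Nat.cast_add,
    Nat.cast_le]
  exact this

end Widths

/-! ## The pieces of a (1,1)-curve -/

/-- The legs are open: their origins are counted with the bounded edge, which is taken closed and
reduces to a point when l = 0. -/
def lft (v : ℝ × ℝ) : Set (ℝ × ℝ) := {p | p.2 = v.2 ∧ p.1 < v.1}
def rgt (v : ℝ × ℝ) : Set (ℝ × ℝ) := {p | p.2 = v.2 ∧ v.1 < p.1}
def dwn (v : ℝ × ℝ) : Set (ℝ × ℝ) := {p | p.1 = v.1 ∧ p.2 < v.2}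
def upw (v : ℝ × ℝ) : Set (ℝ × ℝ) := {p | p.1 = v.1 ∧ v.2 < p.2}

section Line

variable {t : Params} {p : ℝ × ℝ}

theorem term_line_zero_zero : term (lineCoeff t) (0, 0) p = 0 := by simp [term, lineCoeff]
theorem term_line_one_zero : term (lineCoeff t) (1, 0) p = p.1 - t.1.1 := by
  simp [term, lineCoeff]; ring
theorem term_line_zero_one : term (lineCoeff t) (0, 1) p = p.2 - t.1.2 + min t.2 0 := by
  simp [term, lineCoeff]; ring
theorem term_line_one_one :
    term (lineCoeff t) (1, 1) p = p.1 - t.1.1 + (p.2 - t.1.2) - max t.2 0 := by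
  simp [term, lineCoeff]; ring

theorem exps_one_cases (u : Exps 1) : u = (0, 0) ∨ u = (0, 1) ∨ u = (1, 0) ∨ u = (1, 1) := by
  revert u; decide

theorem mem_active_line {u : Exps 1} : u ∈ active (lineCoeff t) p ↔
    (0 ≤ term (lineCoeff t) u p ∧ p.2 - t.1.2 + min t.2 0 ≤ term (lineCoeff t) u p ∧
    p.1 - t.1.1 ≤ term (lineCoeff t) u p ∧
      p.1 - t.1.1 + (p.2 - t.1.2) - max t.2 0 ≤ term (lineCoeff t) u p) := by
  rw [← term_line_one_one, ← term_line_zero_one, ← term_line_one_zero,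
    ← term_line_zero_zero (t := t) (p := p)]
  refine ⟨fun h => ⟨h _, h _, h _, h _⟩, fun ⟨h1, h2, h3, h4⟩ w => ?_⟩
  rcases exps_one_cases w with rfl | rfl | rfl | rfl <;> assumption

theorem active_line_left (h : 0 ≤ t.2) (hp : p ∈ lft (vert0 t)) :
    active (lineCoeff t) p = {(0, 0), (0, 1)} := by
  obtain ⟨h1, h2⟩ := hp
  simp only [vert0, vert1, abs_of_nonneg h] at h1 h2
  ext u
  rw [mem_active_line, min_eq_right h, max_eq_left h]
  rcases exps_one_cases u with rfl | rfl | rfl | rfl <;>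
  simp [term_line_zero_zero, term_line_one_zero, term_line_zero_one, term_line_one_one, min_eq_right h, max_eq_left h]
  all_goals first
    | (refine ⟨?_, ?_, ?_⟩ <;> linarith)
    | (intros; linarith)

theorem active_line_right (h : 0 ≤ t.2) (hp : p ∈ rgt (vert1 t)) :
    active (lineCoeff t) p = {(1, 0), (1, 1)} := by
  obtain ⟨h1, h2⟩ := hp
  simp only [vert0, vert1, abs_of_nonneg h] at h1 h2
  ext u
  rw [mem_active_line, min_eq_right h, max_eq_left h]
  rcases exps_one_cases u with rfl | rfl | rfl | rfl <;>
  simp [term_line_zero_zero, term_line_one_zero, term_line_zero_one, term_line_one_one, min_eq_right h, max_eq_left h]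
  all_goals first
    | (refine ⟨?_, ?_, ?_⟩ <;> linarith)
    | (intros; linarith)

theorem active_line_down (h : 0 ≤ t.2) (hp : p ∈ dwn (vert0 t)) :
    active (lineCoeff t) p = {(0, 0), (1, 0)} := by
  obtain ⟨h1, h2⟩ := hp
  simp only [vert0, vert1, abs_of_nonneg h] at h1 h2
  ext u
  rw [mem_active_line, min_eq_right h, max_eq_left h]
  rcases exps_one_cases u with rfl | rfl | rfl | rfl <;>
  simp [term_line_zero_zero, term_line_one_zero, term_line_zero_one, term_line_one_one, min_eq_right h, max_eq_left h]
  all_goals first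
    | (refine ⟨?_, ?_, ?_⟩ <;> linarith)
    | (intros; linarith)

theorem active_line_up (h : 0 ≤ t.2) (hp : p ∈ upw (vert1 t)) :
    active (lineCoeff t) p = {(0, 1), (1, 1)} := by
  obtain ⟨h1, h2⟩ := hp
  simp only [vert0, vert1, abs_of_nonneg h] at h1 h2
  ext u
  rw [mem_active_line, min_eq_right h, max_eq_left h]
  rcases exps_one_cases u with rfl | rfl | rfl | rfl <;>
  simp [term_line_zero_zero, term_line_one_zero, term_line_zero_one, term_line_one_one, min_eq_right h, max_eq_left h]
  all_goals first
    | (refine ⟨?_, ?_, ?_⟩ <;> linarith)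
    | (intros; linarith)

theorem active_line_edge (h : 0 ≤ t.2) (hp : p ∈ openSegment ℝ (vert0 t) (vert1 t)) (h0 : t.2 ≠ 0) :
    active (lineCoeff t) p = {(1, 0), (0, 1)} := by
  obtain ⟨α, β, hα, hβ, hαβ, rfl⟩ := hp
  obtain rfl : α = 1 - β := by linarith
  simp only [vert0, vert1, abs_of_nonneg h, Prod.smul_mk, smul_eq_mul, Prod.mk_add_mk, Prod.smul_def]
  have hl : 0 < t.2 := lt_of_le_of_ne h h0.symm
  have k1 := mul_pos hβ hl
  have k2 := mul_pos hα hl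
  ext u
  rw [mem_active_line, min_eq_right h, max_eq_left h]
  rcases exps_one_cases u with rfl | rfl | rfl | rfl <;>
  simp [term_line_zero_zero, term_line_one_zero, term_line_zero_one, term_line_one_one, min_eq_right h, max_eq_left h]
  all_goals first
    | (refine ⟨?_, ?_, ?_⟩ <;> linarith)
    | (intros; linarith)

theorem active_line_vert0 (h : 0 ≤ t.2) (hp : p = vert0 t) (h0 : t.2 ≠ 0) :
    active (lineCoeff t) p = {(0, 0), (1, 0), (0, 1)} := by
  subst hp
  have hl : 0 < t.2 := lt_of_le_of_ne h h0.symm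
  simp only [vert0]
  ext u
  rw [mem_active_line, min_eq_right h, max_eq_left h]
  rcases exps_one_cases u with rfl | rfl | rfl | rfl <;>
  simp [term_line_zero_zero, term_line_one_zero, term_line_zero_one, term_line_one_one, min_eq_right h, max_eq_left h]
  all_goals linarith

theorem active_line_vert1 (h : 0 ≤ t.2) (hp : p = vert1 t) (h0 : t.2 ≠ 0) :
    active (lineCoeff t) p = {(1, 0), (0, 1), (1, 1)} := by
  subst hp
  have hl : 0 < t.2 := lt_of_le_of_ne h h0.symm
  simp only [vert1, abs_of_nonneg h]
  ext u
  rw [mem_active_line, min_eq_right h, max_eq_left h]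
  rcases exps_one_cases u with rfl | rfl | rfl | rfl <;>
  simp [term_line_zero_zero, term_line_one_zero, term_line_zero_one, term_line_one_one, min_eq_right h, max_eq_left h]
  all_goals linarith

theorem active_line_vert (h : 0 ≤ t.2) (hp : p = vert0 t) (h0 : t.2 = 0) :
    active (lineCoeff t) p = {(0, 0), (1, 0), (0, 1), (1, 1)} := by
  subst hp
  simp only [vert0]
  ext u
  rw [mem_active_line, min_eq_right h, max_eq_left h]
  rcases exps_one_cases u with rfl | rfl | rfl | rfl <;>
  simp [term_line_zero_zero, term_line_one_zero, term_line_zero_one, term_line_one_one, min_eq_right h, max_eq_left h]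
  all_goals linarith

theorem active_line_left_neg (h : t.2 < 0) (hp : p ∈ lft (vert1 t)) :
    active (lineCoeff t) p = {(0, 0), (0, 1)} := by
  obtain ⟨h1, h2⟩ := hp
  simp only [vert0, vert1, abs_of_neg h] at h1 h2
  ext u
  rw [mem_active_line, min_eq_left h.le, max_eq_right h.le]
  rcases exps_one_cases u with rfl | rfl | rfl | rfl <;>
  simp [term_line_zero_zero, term_line_one_zero, term_line_zero_one, term_line_one_one, min_eq_left h.le, max_eq_right h.le]
  all_goals first
    | (refine ⟨?_, ?_, ?_⟩ <;> linarith)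
    | (intros; linarith)

theorem active_line_right_neg (h : t.2 < 0) (hp : p ∈ rgt (vert0 t)) :
    active (lineCoeff t) p = {(1, 0), (1, 1)} := by
  obtain ⟨h1, h2⟩ := hp
  simp only [vert0, vert1, abs_of_neg h] at h1 h2
  ext u
  rw [mem_active_line, min_eq_left h.le, max_eq_right h.le]
  rcases exps_one_cases u with rfl | rfl | rfl | rfl <;>
  simp [term_line_zero_zero, term_line_one_zero, term_line_zero_one, term_line_one_one, min_eq_left h.le, max_eq_right h.le]
  all_goals first
    | (refine ⟨?_, ?_, ?_⟩ <;> linarith)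
    | (intros; linarith)

theorem active_line_down_neg (h : t.2 < 0) (hp : p ∈ dwn (vert0 t)) :
    active (lineCoeff t) p = {(0, 0), (1, 0)} := by
  obtain ⟨h1, h2⟩ := hp
  simp only [vert0, vert1, abs_of_neg h] at h1 h2
  ext u
  rw [mem_active_line, min_eq_left h.le, max_eq_right h.le]
  rcases exps_one_cases u with rfl | rfl | rfl | rfl <;>
  simp [term_line_zero_zero, term_line_one_zero, term_line_zero_one, term_line_one_one, min_eq_left h.le, max_eq_right h.le]
  all_goals first
    | (refine ⟨?_, ?_, ?_⟩ <;> linarith)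
    | (intros; linarith)

theorem active_line_up_neg (h : t.2 < 0) (hp : p ∈ upw (vert1 t)) :
    active (lineCoeff t) p = {(0, 1), (1, 1)} := by
  obtain ⟨h1, h2⟩ := hp
  simp only [vert0, vert1, abs_of_neg h] at h1 h2
  ext u
  rw [mem_active_line, min_eq_left h.le, max_eq_right h.le]
  rcases exps_one_cases u with rfl | rfl | rfl | rfl <;>
  simp [term_line_zero_zero, term_line_one_zero, term_line_zero_one, term_line_one_one, min_eq_left h.le, max_eq_right h.le]
  all_goals first
    | (refine ⟨?_, ?_, ?_⟩ <;> linarith)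
    | (intros; linarith)

theorem active_line_edge_neg (h : t.2 < 0) (hp : p ∈ openSegment ℝ (vert0 t) (vert1 t)) :
    active (lineCoeff t) p = {(0, 0), (1, 1)} := by
  obtain ⟨α, β, hα, hβ, hαβ, rfl⟩ := hp
  obtain rfl : α = 1 - β := by linarith
  simp only [vert0, vert1, abs_of_neg h, Prod.smul_mk, smul_eq_mul, Prod.mk_add_mk, Prod.smul_def]
  have k1 := mul_pos hβ (neg_pos.2 h)
  have k2 := mul_pos hα (neg_pos.2 h)
  ext u
  rw [mem_active_line, min_eq_left h.le, max_eq_right h.le]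
  rcases exps_one_cases u with rfl | rfl | rfl | rfl <;>
  simp [term_line_zero_zero, term_line_one_zero, term_line_zero_one, term_line_one_one, min_eq_left h.le, max_eq_right h.le]
  all_goals first
    | (refine ⟨?_, ?_, ?_⟩ <;> linarith)
    | (intros; linarith)

theorem active_line_vert0_neg (h : t.2 < 0) (hp : p = vert0 t) :
    active (lineCoeff t) p = {(0, 0), (1, 0), (1, 1)} := by
  subst hp
  simp only [vert0]
  ext u
  rw [mem_active_line, min_eq_left h.le, max_eq_right h.le]
  rcases exps_one_cases u with rfl | rfl | rfl | rfl <;>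
  simp [term_line_zero_zero, term_line_one_zero, term_line_zero_one, term_line_one_one, min_eq_left h.le, max_eq_right h.le]
  all_goals linarith

theorem active_line_vert1_neg (h : t.2 < 0) (hp : p = vert1 t) :
    active (lineCoeff t) p = {(0, 0), (0, 1), (1, 1)} := by
  subst hp
  simp only [vert1, abs_of_neg h]
  ext u
  rw [mem_active_line, min_eq_left h.le, max_eq_right h.le]
  rcases exps_one_cases u with rfl | rfl | rfl | rfl <;>
  simp [term_line_zero_zero, term_line_one_zero, term_line_zero_one, term_line_one_one, min_eq_left h.le, max_eq_right h.le]
  all_goals linarith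

end Line


/-! ### The (1,1)-curve as four open legs and a closed edge -/

section Line

variable {t : Params} {p : ℝ × ℝ}

theorem exists_eq_of_mem_curve_line (hp : p ∈ curve (lineCoeff t)) :
    ∃ u ∈ active (lineCoeff t) p, ∃ v ∈ active (lineCoeff t) p,
      (u = (0, 0) ∧ v = (0, 1)) ∨ (u = (0, 0) ∧ v = (1, 0)) ∨ (u = (0, 0) ∧ v = (1, 1)) ∨
      (u = (0, 1) ∧ v = (1, 0)) ∨ (u = (0, 1) ∧ v = (1, 1)) ∨ (u = (1, 0) ∧ v = (1, 1)) := by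
  obtain ⟨u, hu, v, hv, huv⟩ := hp
  rcases exps_one_cases u with rfl | rfl | rfl | rfl <;>
  rcases exps_one_cases v with rfl | rfl | rfl | rfl <;>
  first
    | exact absurd rfl huv
    | (refine ⟨_, hu, _, hv, ?_⟩; simp; done)
    | (refine ⟨_, hv, _, hu, ?_⟩; simp; done)

theorem mem_segment_diag {x y l s : ℝ} (h0 : 0 ≤ s) (hl : s ≤ l) :
    (x + s, y + s) ∈ segment ℝ (x, y) (x + l, y + l) := by
  rcases h0.eq_or_lt with rfl | h0'
  · simpa using left_mem_segment ℝ (x, y) (x + l, y + l)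
  have hlp : 0 < l := h0'.trans_le hl
  refine ⟨1 - s / l, s / l, sub_nonneg.2 ((div_le_one hlp).2 hl), by positivity, by ring, ?_⟩
  simp only [Prod.smul_mk, smul_eq_mul, Prod.mk_add_mk, Prod.mk.injEq]
  constructor <;> field_simp <;> ring

theorem mem_openSegment_diag {x y l s : ℝ} (h0 : 0 < s) (hl : s < l) :
    (x + s, y + s) ∈ openSegment ℝ (x, y) (x + l, y + l) := by
  have hlp : 0 < l := h0.trans hl
  refine ⟨1 - s / l, s / l, sub_pos.2 ((div_lt_one hlp).2 hl), by positivity, by ring, ?_⟩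
  simp only [Prod.smul_mk, smul_eq_mul, Prod.mk_add_mk, Prod.mk.injEq]
  constructor <;> field_simp <;> ring

theorem mem_segment_antidiag {x y m s : ℝ} (h0 : 0 ≤ s) (hl : s ≤ m) :
    (x - s, y + s) ∈ segment ℝ (x, y) (x - m, y + m) := by
  rcases h0.eq_or_lt with rfl | h0'
  · simpa using left_mem_segment ℝ (x, y) (x - m, y + m)
  have hlp : 0 < m := h0'.trans_le hl
  refine ⟨1 - s / m, s / m, sub_nonneg.2 ((div_le_one hlp).2 hl), by positivity, by ring, ?_⟩
  simp only [Prod.smul_mk, smul_eq_mul, Prod.mk_add_mk, Prod.mk.injEq]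
  constructor <;> field_simp <;> ring

theorem curve_line_subset (h : 0 ≤ t.2) (hp : p ∈ curve (lineCoeff t)) :
    p ∈ lft (vert0 t) ∨ p ∈ dwn (vert0 t) ∨ p ∈ rgt (vert1 t) ∨ p ∈ upw (vert1 t) ∨
      p ∈ segment ℝ (vert0 t) (vert1 t) := by
  obtain ⟨⟨x0, y0⟩, l⟩ := t
  obtain ⟨x, y⟩ := p
  simp only at h
  have hseg : ∀ s, 0 ≤ s → s ≤ l → x = x0 + s → y = y0 + s →
      (x, y) ∈ segment ℝ (vert0 ((x0, y0), l)) (vert1 ((x0, y0), l)) := by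
    rintro s h0 hl rfl rfl
    simp only [vert0, vert1, abs_of_nonneg h]
    exact mem_segment_diag h0 hl
  simp only [lft, dwn, rgt, upw, vert0, vert1, mem_ofPred_eq, abs_of_nonneg h] at hseg ⊢
  obtain ⟨u, hu, v, hv, huv⟩ := exists_eq_of_mem_curve_line hp
  rw [mem_active_line] at hu hv
  simp only [min_eq_right h, max_eq_left h] at hu hv
  rcases huv with ⟨rfl, rfl⟩ | ⟨rfl, rfl⟩ | ⟨rfl, rfl⟩ | ⟨rfl, rfl⟩ | ⟨rfl, rfl⟩ | ⟨rfl, rfl⟩ <;>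
  simp only [term_line_zero_zero, term_line_one_zero, term_line_zero_one, term_line_one_one,
    min_eq_right h, max_eq_left h] at hu hv <;>
  obtain ⟨a1, a2, a3, a4⟩ := hu <;> obtain ⟨b1, b2, b3, b4⟩ := hv
  · rcases lt_or_ge x x0 with h1 | h1
    · exact Or.inl ⟨by linarith, h1⟩
    · exact Or.inr (Or.inr (Or.inr (Or.inr (hseg 0 le_rfl h (by linarith) (by linarith)))))
  · rcases lt_or_ge y y0 with h1 | h1
    · exact Or.inr (Or.inl ⟨by linarith, h1⟩)
    · exact Or.inr (Or.inr (Or.inr (Or.inr (hseg 0 le_rfl h (by linarith) (by linarith)))))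
  · exact Or.inr (Or.inr (Or.inr (Or.inr (hseg 0 le_rfl h (by linarith) (by linarith)))))
  · exact Or.inr (Or.inr (Or.inr (Or.inr
      (hseg (x - x0) (by linarith) (by linarith) (by linarith) (by linarith)))))
  · rcases lt_or_ge (y0 + l) y with h1 | h1
    · exact Or.inr (Or.inr (Or.inr (Or.inl ⟨by linarith, h1⟩)))
    · exact Or.inr (Or.inr (Or.inr (Or.inr (hseg l h le_rfl (by linarith) (by linarith)))))
  · rcases lt_or_ge (x0 + l) x with h1 | h1
    · exact Or.inr (Or.inr (Or.inl ⟨by linarith, h1⟩))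
    · exact Or.inr (Or.inr (Or.inr (Or.inr (hseg l h le_rfl (by linarith) (by linarith)))))

theorem curve_line_subset_neg (h : t.2 < 0) (hp : p ∈ curve (lineCoeff t)) :
    p ∈ lft (vert1 t) ∨ p ∈ dwn (vert0 t) ∨ p ∈ rgt (vert0 t) ∨ p ∈ upw (vert1 t) ∨
      p ∈ segment ℝ (vert0 t) (vert1 t) := by
  obtain ⟨⟨x0, y0⟩, l⟩ := t
  obtain ⟨x, y⟩ := p
  simp only at h
  have hseg : ∀ s, 0 ≤ s → s ≤ -l → x = x0 - s → y = y0 + s →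
      (x, y) ∈ segment ℝ (vert0 ((x0, y0), l)) (vert1 ((x0, y0), l)) := by
    rintro s h0 hl rfl rfl
    have := mem_segment_antidiag (x := x0) (y := y0) h0 hl
    rw [sub_neg_eq_add] at this
    simpa only [vert0, vert1, abs_of_neg h] using this
  simp only [lft, dwn, rgt, upw, vert0, vert1, mem_ofPred_eq, abs_of_neg h] at hseg ⊢
  obtain ⟨u, hu, v, hv, huv⟩ := exists_eq_of_mem_curve_line hp
  rw [mem_active_line] at hu hv
  simp only [min_eq_left h.le, max_eq_right h.le] at hu hv
  rcases huv with ⟨rfl, rfl⟩ | ⟨rfl, rfl⟩ | ⟨rfl, rfl⟩ | ⟨rfl, rfl⟩ | ⟨rfl, rfl⟩ | ⟨rfl, rfl⟩ <;>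
  simp only [term_line_zero_zero, term_line_one_zero, term_line_zero_one, term_line_one_one,
    min_eq_left h.le, max_eq_right h.le] at hu hv <;>
  obtain ⟨a1, a2, a3, a4⟩ := hu <;> obtain ⟨b1, b2, b3, b4⟩ := hv
  · rcases lt_or_ge x (x0 + l) with h1 | h1
    · exact Or.inl ⟨by linarith, h1⟩
    · exact Or.inr (Or.inr (Or.inr (Or.inr
        (hseg (-l) (by linarith) le_rfl (by linarith) (by linarith)))))
  · rcases lt_or_ge y y0 with h1 | h1
    · exact Or.inr (Or.inl ⟨by linarith, h1⟩)
    · exact Or.inr (Or.inr (Or.inr (Or.inr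
        (hseg 0 le_rfl (by linarith) (by linarith) (by linarith)))))
  · exact Or.inr (Or.inr (Or.inr (Or.inr
      (hseg (y - y0) (by linarith) (by linarith) (by linarith) (by linarith)))))
  · exfalso; linarith
  · rcases lt_or_ge (y0 + -l) y with h1 | h1
    · exact Or.inr (Or.inr (Or.inr (Or.inl ⟨by linarith, h1⟩)))
    · exact Or.inr (Or.inr (Or.inr (Or.inr
        (hseg (-l) (by linarith) le_rfl (by linarith) (by linarith)))))
  · rcases lt_or_ge x0 x with h1 | h1
    · exact Or.inr (Or.inr (Or.inl ⟨by linarith, h1⟩))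
    · exact Or.inr (Or.inr (Or.inr (Or.inr
        (hseg 0 le_rfl (by linarith) (by linarith) (by linarith)))))

theorem segment_cases {x y z : ℝ × ℝ} (h : z ∈ segment ℝ x y) :
    z = x ∨ z = y ∨ z ∈ openSegment ℝ x y := by
  rw [← insert_endpoints_openSegment] at h
  simpa using h

theorem curve_line (h : 0 ≤ t.2) : curve (lineCoeff t) =
    lft (vert0 t) ∪ dwn (vert0 t) ∪ rgt (vert1 t) ∪ upw (vert1 t) ∪
      segment ℝ (vert0 t) (vert1 t) := by
  apply Subset.antisymm
  · intro p hp
    simp only [mem_union]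
    have := curve_line_subset h hp
    tauto
  · rintro p ((((hp | hp) | hp) | hp) | hp)
    · exact mem_curve_of_mem (u := (0, 0)) (v := (0, 1)) (by simp [active_line_left h hp])
        (by simp [active_line_left h hp]) (by simp)
    · exact mem_curve_of_mem (u := (0, 0)) (v := (1, 0)) (by simp [active_line_down h hp])
        (by simp [active_line_down h hp]) (by simp)
    · exact mem_curve_of_mem (u := (1, 0)) (v := (1, 1)) (by simp [active_line_right h hp])
        (by simp [active_line_right h hp]) (by simp)
    · exact mem_curve_of_mem (u := (0, 1)) (v := (1, 1)) (by simp [active_line_up h hp])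
        (by simp [active_line_up h hp]) (by simp)
    · apply mem_curve_of_mem (u := (1, 0)) (v := (0, 1)) _ _ (by simp)
      all_goals
        by_cases h0 : t.2 = 0
        · have e : vert1 t = vert0 t := by simp [vert0, vert1, h0]
          rw [e, segment_same] at hp
          simp [active_line_vert h hp h0]
        · rcases segment_cases hp with hp | hp | hp
          · simp [active_line_vert0 h hp h0]
          · simp [active_line_vert1 h hp h0]
          · simp [active_line_edge h hp h0]

theorem curve_line_neg (h : t.2 < 0) : curve (lineCoeff t) =
    lft (vert1 t) ∪ dwn (vert0 t) ∪ rgt (vert0 t) ∪ upw (vert1 t) ∪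
      segment ℝ (vert0 t) (vert1 t) := by
  apply Subset.antisymm
  · intro p hp
    simp only [mem_union]
    have := curve_line_subset_neg h hp
    tauto
  · rintro p ((((hp | hp) | hp) | hp) | hp)
    · exact mem_curve_of_mem (u := (0, 0)) (v := (0, 1)) (by simp [active_line_left_neg h hp])
        (by simp [active_line_left_neg h hp]) (by simp)
    · exact mem_curve_of_mem (u := (0, 0)) (v := (1, 0)) (by simp [active_line_down_neg h hp])
        (by simp [active_line_down_neg h hp]) (by simp)
    · exact mem_curve_of_mem (u := (1, 0)) (v := (1, 1)) (by simp [active_line_right_neg h hp])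
        (by simp [active_line_right_neg h hp]) (by simp)
    · exact mem_curve_of_mem (u := (0, 1)) (v := (1, 1)) (by simp [active_line_up_neg h hp])
        (by simp [active_line_up_neg h hp]) (by simp)
    · apply mem_curve_of_mem (u := (0, 0)) (v := (1, 1)) _ _ (by simp)
      all_goals
        rcases segment_cases hp with hp | hp | hp
        · simp [active_line_vert0_neg h hp]
        · simp [active_line_vert1_neg h hp]
        · simp [active_line_edge_neg h hp]

end Line

/-! ## Widths of sets of exponents and multiplicities on the pieces -/

section Width

variable {n : ℕ} {f : Exps n → ℕ} {U : Set (Exps n)}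

def xdeg (u : Exps n) : ℕ := u.1
def ydeg (u : Exps n) : ℕ := u.2
def tdeg (u : Exps n) : ℕ := (u.1 : ℕ) + u.2

noncomputable def wMin (f : Exps n → ℕ) (U : Set (Exps n)) : ℕ := sInf (f '' U)
noncomputable def wMax (f : Exps n → ℕ) (U : Set (Exps n)) : ℕ := sSup (f '' U)

/-- The width of a set of exponents in the direction `f`. -/
noncomputable def width (f : Exps n → ℕ) (U : Set (Exps n)) : ℝ := wMax f U - wMin f U

theorem wMin_le {u : Exps n} (hu : u ∈ U) : wMin f U ≤ f u := Nat.sInf_le ⟨u, hu, rfl⟩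
theorem le_wMax {u : Exps n} (hu : u ∈ U) : f u ≤ wMax f U :=
  le_csSup ((Set.toFinite U).image f).bddAbove ⟨u, hu, rfl⟩
theorem exists_eq_wMin (h : U.Nonempty) : ∃ u ∈ U, f u = wMin f U := Nat.sInf_mem (h.image f)
theorem exists_eq_wMax (h : U.Nonempty) : ∃ u ∈ U, f u = wMax f U :=
  Nat.sSup_mem (h.image f) ((Set.toFinite U).image f).bddAbove

theorem width_eq {m M : ℕ} (hle : ∀ u ∈ U, m ≤ f u ∧ f u ≤ M) (hm : ∃ u ∈ U, f u = m)
    (hM : ∃ u ∈ U, f u = M) : width f U = M - m := by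
  obtain ⟨u, hu, rfl⟩ := hm
  obtain ⟨v, hv, rfl⟩ := hM
  have h1 : wMin f U = f u := by
    obtain ⟨w, hw, e⟩ := exists_eq_wMin (f := f) ⟨u, hu⟩
    exact le_antisymm (wMin_le hu) (e ▸ (hle w hw).1)
  have h2 : wMax f U = f v := by
    obtain ⟨w, hw, e⟩ := exists_eq_wMax (f := f) ⟨u, hu⟩
    exact le_antisymm (e ▸ (hle w hw).2) (le_wMax hv)
  rw [width, h1, h2]

theorem width_eq_zero (h : ∀ u ∈ U, ∀ v ∈ U, f u = f v) (hne : U.Nonempty) : width f U = 0 := by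
  obtain ⟨u, hu⟩ := hne
  rw [width_eq (m := f u) (M := f u) (fun v hv => ⟨(h u hu v hv).le, (h u hu v hv).ge⟩)
    ⟨u, hu, rfl⟩ ⟨u, hu, rfl⟩, sub_self]

theorem mixedArea_hull_vertical' (hU : U.Nonempty) (x y : ℝ) :
    mixedArea (convexHull ℝ (toPlane '' U)) (convexHull ℝ {(x, y), (x, y + 1)})
      = width xdeg U :=
  mixedArea_hull_vertical (fun _ hu => ⟨wMin_le (f := xdeg) hu, le_wMax (f := xdeg) hu⟩)
    (exists_eq_wMin (f := xdeg) hU) (exists_eq_wMax (f := xdeg) hU) x y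

theorem mixedArea_hull_horizontal' (hU : U.Nonempty) (x y : ℝ) :
    mixedArea (convexHull ℝ (toPlane '' U)) (convexHull ℝ {(x, y), (x + 1, y)})
      = width ydeg U :=
  mixedArea_hull_horizontal (fun _ hu => ⟨wMin_le (f := ydeg) hu, le_wMax (f := ydeg) hu⟩)
    (exists_eq_wMin (f := ydeg) hU) (exists_eq_wMax (f := ydeg) hU) x y

theorem mixedArea_hull_diagonal' (hU : U.Nonempty) (x y : ℝ) :
    mixedArea (convexHull ℝ (toPlane '' U)) (convexHull ℝ {(x + 1, y), (x, y + 1)})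
      = width tdeg U :=
  mixedArea_hull_diagonal (fun _ hu => ⟨wMin_le (f := tdeg) hu, le_wMax (f := tdeg) hu⟩)
    (exists_eq_wMin (f := tdeg) hU) (exists_eq_wMax (f := tdeg) hU) x y

end Width

section Mult

variable {m n : ℕ} {a : Exps n → ℝ} {b : Exps m → ℝ} {t : Params} {p : ℝ × ℝ}

/-- A point of a horizontal leg is dual to a vertical unit segment, for which mixed area is
horizontal width. In this way multiplicities on legs become differences of exponents. -/
theorem stableMult_of_vertical {u v : Exps m} (h : active b p = {u, v}) (h1 : u.1 = v.1)
    (h2 : (v.2 : ℕ) = u.2 + 1) : stableMult a b p = width xdeg (active a p) := by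
  have e : toPlane '' ({u, v} : Set (Exps m)) =
      {(((u.1 : ℕ) : ℝ), ((u.2 : ℕ) : ℝ)), (((u.1 : ℕ) : ℝ), ((u.2 : ℕ) : ℝ) + 1)} := by
    rw [image_pair]; simp [toPlane, h1, h2]
  rw [stableMult, dualCell, dualCell, h, e, mixedArea_hull_vertical' (active_nonempty a p)]

theorem stableMult_of_horizontal {u v : Exps m} (h : active b p = {u, v}) (h1 : u.2 = v.2)
    (h2 : (v.1 : ℕ) = u.1 + 1) : stableMult a b p = width ydeg (active a p) := by
  have e : toPlane '' ({u, v} : Set (Exps m)) =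
      {(((u.1 : ℕ) : ℝ), ((u.2 : ℕ) : ℝ)), (((u.1 : ℕ) : ℝ) + 1, ((u.2 : ℕ) : ℝ))} := by
    rw [image_pair]; simp [toPlane, h1, h2]
  rw [stableMult, dualCell, dualCell, h, e, mixedArea_hull_horizontal' (active_nonempty a p)]

theorem stableMult_of_vertical_left {u v : Exps n} (h : active a p = {u, v}) (h1 : u.1 = v.1)
    (h2 : (v.2 : ℕ) = u.2 + 1) : stableMult a b p = width xdeg (active b p) := by
  rw [stableMult, mixedArea_comm]
  exact stableMult_of_vertical h h1 h2

theorem stableMult_of_horizontal_left {u v : Exps n} (h : active a p = {u, v}) (h1 : u.2 = v.2)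
    (h2 : (v.1 : ℕ) = u.1 + 1) : stableMult a b p = width ydeg (active b p) := by
  rw [stableMult, mixedArea_comm]
  exact stableMult_of_horizontal h h1 h2

theorem stableMult_left (h : 0 ≤ t.2) (hp : p ∈ lft (vert0 t)) :
    stableMult a (lineCoeff t) p = width xdeg (active a p) :=
  stableMult_of_vertical (active_line_left h hp) rfl rfl

theorem stableMult_right (h : 0 ≤ t.2) (hp : p ∈ rgt (vert1 t)) :
    stableMult a (lineCoeff t) p = width xdeg (active a p) :=
  stableMult_of_vertical (active_line_right h hp) rfl rfl

theorem stableMult_down (h : 0 ≤ t.2) (hp : p ∈ dwn (vert0 t)) :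
    stableMult a (lineCoeff t) p = width ydeg (active a p) :=
  stableMult_of_horizontal (active_line_down h hp) rfl rfl

theorem stableMult_up (h : 0 ≤ t.2) (hp : p ∈ upw (vert1 t)) :
    stableMult a (lineCoeff t) p = width ydeg (active a p) :=
  stableMult_of_horizontal (active_line_up h hp) rfl rfl

theorem stableMult_left_neg (h : t.2 < 0) (hp : p ∈ lft (vert1 t)) :
    stableMult a (lineCoeff t) p = width xdeg (active a p) :=
  stableMult_of_vertical (active_line_left_neg h hp) rfl rfl

theorem stableMult_edge (h : 0 ≤ t.2) (h0 : t.2 ≠ 0)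
    (hp : p ∈ openSegment ℝ (vert0 t) (vert1 t)) :
    stableMult a (lineCoeff t) p = width tdeg (active a p) := by
  have e : toPlane '' ({(1, 0), (0, 1)} : Set (Exps 1)) =
      {((0 : ℝ) + 1, (0 : ℝ)), (0, (0 : ℝ) + 1)} := by
    rw [image_pair]; simp [toPlane]
  rw [stableMult, dualCell, dualCell, active_line_edge h hp h0, e,
    mixedArea_hull_diagonal' (active_nonempty a p)]

end Mult


/-! ## Components of the intersection -/

section Finsum

variable {α : Type*} {C : Set α} {f : α → ℝ}

/-- A component is in general an infinite set. Its multiplicity is evaluated by listing finitely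
many points outside of which the stable intersection vanishes; the listed points may have value zero
as well. -/
theorem finsum_mem_eq_one {x : α} (hx : x ∈ C) (h : ∀ p ∈ C, p ≠ x → f p = 0) :
    ∑ᶠ p ∈ C, f p = f x := by
  have : ∑ᶠ p ∈ C, f p = ∑ p ∈ {x}, f p := by
    apply finsum_mem_eq_sum_of_inter_support_eq
    ext p
    simp only [mem_inter_iff, Function.mem_support, Finset.coe_singleton, mem_singleton_iff]
    constructor
    · rintro ⟨h1, h2⟩
      by_contra h3
      exact h2 (h p h1 fun e => h3 ⟨e, h2⟩)
    · rintro ⟨rfl, h2⟩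
      exact ⟨hx, h2⟩
  rw [this, Finset.sum_singleton]

theorem finsum_mem_eq_two {x y : α} (hx : x ∈ C) (hy : y ∈ C) (hxy : x ≠ y)
    (h : ∀ p ∈ C, p ≠ x → p ≠ y → f p = 0) : ∑ᶠ p ∈ C, f p = f x + f y := by
  classical
  have : ∑ᶠ p ∈ C, f p = ∑ p ∈ {x, y}, f p := by
    apply finsum_mem_eq_sum_of_inter_support_eq
    ext p
    simp only [mem_inter_iff, Function.mem_support, Finset.coe_insert, Finset.coe_singleton,
      mem_insert_iff, mem_singleton_iff]
    constructor
    · rintro ⟨h1, h2⟩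
      by_contra h3
      exact h2 (h p h1 (fun e => h3 ⟨Or.inl e, h2⟩) (fun e => h3 ⟨Or.inr e, h2⟩))
    · rintro ⟨rfl | rfl, h2⟩
      · exact ⟨hx, h2⟩
      · exact ⟨hy, h2⟩
  rw [this, Finset.sum_pair hxy]

end Finsum

section Components

variable {X C D E : Set (ℝ × ℝ)} {p : ℝ × ℝ}

theorem connectedComponentIn_eq_of_union (hX : X = C ∪ D) (hC : IsClosed C) (hD : IsClosed D)
    (hCD : Disjoint C D) (hc : IsPreconnected C) (hp : p ∈ C) :
    connectedComponentIn X p = C := by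
  have hpX : p ∈ X := hX ▸ Or.inl hp
  apply Subset.antisymm
  · have h1 : IsPreconnected (connectedComponentIn X p) := isPreconnected_connectedComponentIn
    have h2 : connectedComponentIn X p ⊆ C ∪ D := hX ▸ connectedComponentIn_subset X p
    rcases (isPreconnected_iff_subset_of_disjoint_closed.1 h1) C D hC hD h2 (by
      rw [hCD.inter_eq, inter_empty]) with h | h
    · exact h
    · exact absurd (h (mem_connectedComponentIn hpX)) (Set.disjoint_left.1 hCD hp)
  · exact hc.subset_connectedComponentIn hp (hX ▸ subset_union_left)

theorem connectedComponentIn_subset_of_union (hX : X = C ∪ D) (hC : IsClosed C) (hD : IsClosed D)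
    (hCD : Disjoint C D) (hp : p ∈ C) : connectedComponentIn X p ⊆ C := by
  have hpX : p ∈ X := hX ▸ Or.inl hp
  have h1 : IsPreconnected (connectedComponentIn X p) := isPreconnected_connectedComponentIn
  have h2 : connectedComponentIn X p ⊆ C ∪ D := hX ▸ connectedComponentIn_subset X p
  rcases (isPreconnected_iff_subset_of_disjoint_closed.1 h1) C D hC hD h2 (by
    rw [hCD.inter_eq, inter_empty]) with h | h
  · exact h
  · exact absurd (h (mem_connectedComponentIn hpX)) (Set.disjoint_left.1 hCD hp)

variable {m n : ℕ} {a : Exps m → ℝ} {b : Exps n → ℝ}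

theorem interComponents_eq_three (hX : curve a ∩ curve b = C ∪ D ∪ E) (hC : IsClosed C)
    (hD : IsClosed D) (hE : IsClosed E) (hCD : Disjoint C D) (hCE : Disjoint C E)
    (hDE : Disjoint D E) (c1 : IsConnected C) (c2 : IsConnected D) (c3 : IsConnected E) :
    interComponents a b = {C, D, E} := by
  have e1 : ∀ p ∈ C, connectedComponentIn (curve a ∩ curve b) p = C := fun p hp =>
    connectedComponentIn_eq_of_union (hX.trans (union_assoc _ _ _)) hC (hD.union hE)
      (hCD.union_right hCE) c1.isPreconnected hp
  have e2 : ∀ p ∈ D, connectedComponentIn (curve a ∩ curve b) p = D := fun p hp =>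
    connectedComponentIn_eq_of_union (hX.trans (by rw [union_comm C D, union_assoc])) hD
      (hC.union hE) (hCD.symm.union_right hDE) c2.isPreconnected hp
  have e3 : ∀ p ∈ E, connectedComponentIn (curve a ∩ curve b) p = E := fun p hp =>
    connectedComponentIn_eq_of_union (hX.trans (union_comm _ _)) hE
      (hC.union hD) (hCE.symm.union_right hDE.symm) c3.isPreconnected hp
  ext K
  simp only [interComponents, mem_insert_iff, mem_singleton_iff]
  constructor
  · rintro ⟨p, hp, rfl⟩
    rw [hX] at hp
    rcases hp with (hp | hp) | hp
    · exact Or.inl (e1 p hp)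
    · exact Or.inr (Or.inl (e2 p hp))
    · exact Or.inr (Or.inr (e3 p hp))
  · rintro (rfl | rfl | rfl)
    · obtain ⟨p, hp⟩ := c1.nonempty
      exact ⟨p, hX ▸ Or.inl (Or.inl hp), (e1 p hp).symm⟩
    · obtain ⟨p, hp⟩ := c2.nonempty
      exact ⟨p, hX ▸ Or.inl (Or.inr hp), (e2 p hp).symm⟩
    · obtain ⟨p, hp⟩ := c3.nonempty
      exact ⟨p, hX ▸ Or.inr hp, (e3 p hp).symm⟩

theorem interComponents_eq_two (hX : curve a ∩ curve b = C ∪ D) (hC : IsClosed C)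
    (hD : IsClosed D) (hCD : Disjoint C D) (c1 : IsConnected C) (c2 : IsConnected D) :
    interComponents a b = {C, D} := by
  have e1 : ∀ p ∈ C, connectedComponentIn (curve a ∩ curve b) p = C := fun p hp =>
    connectedComponentIn_eq_of_union hX hC hD hCD c1.isPreconnected hp
  have e2 : ∀ p ∈ D, connectedComponentIn (curve a ∩ curve b) p = D := fun p hp =>
    connectedComponentIn_eq_of_union (hX.trans (union_comm _ _)) hD hC hCD.symm
      c2.isPreconnected hp
  ext K
  simp only [interComponents, mem_insert_iff, mem_singleton_iff]
  constructor
  · rintro ⟨p, hp, rfl⟩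
    rw [hX] at hp
    rcases hp with hp | hp
    · exact Or.inl (e1 p hp)
    · exact Or.inr (e2 p hp)
  · rintro (rfl | rfl)
    · obtain ⟨p, hp⟩ := c1.nonempty
      exact ⟨p, hX ▸ Or.inl hp, (e1 p hp).symm⟩
    · obtain ⟨p, hp⟩ := c2.nonempty
      exact ⟨p, hX ▸ Or.inr hp, (e2 p hp).symm⟩

theorem ne_of_disjoint_connected (c1 : IsConnected C) (hCD : Disjoint C D) : C ≠ D := by
  rintro rfl
  exact c1.nonempty.ne_empty (disjoint_self.1 hCD)

end Components

/-! ### Tritangency read off from a decomposition of the intersection -/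

section Criteria

variable {C D E : Set (ℝ × ℝ)} {a : Exps 3 → ℝ} {t : Params}

theorem isTritangent_of_three (hX : curve a ∩ curve (lineCoeff t) = C ∪ D ∪ E)
    (hC : IsClosed C) (hD : IsClosed D) (hE : IsClosed E) (hCD : Disjoint C D)
    (hCE : Disjoint C E) (hDE : Disjoint D E) (c1 : IsConnected C) (c2 : IsConnected D)
    (c3 : IsConnected E) (m1 : componentMult a (lineCoeff t) C = 2)
    (m2 : componentMult a (lineCoeff t) D = 2) (m3 : componentMult a (lineCoeff t) E = 2) :
    IsTritangent a t := by
  have h := interComponents_eq_three hX hC hD hE hCD hCE hDE c1 c2 c3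
  left
  rw [h]
  refine ⟨Set.ncard_eq_three.2 ⟨C, D, E, ne_of_disjoint_connected c1 hCD,
    ne_of_disjoint_connected c1 hCE, ne_of_disjoint_connected c2 hDE, rfl⟩, ?_⟩
  rintro K (rfl | rfl | rfl) <;> assumption

theorem isTritangent_of_two (hX : curve a ∩ curve (lineCoeff t) = C ∪ D)
    (hC : IsClosed C) (hD : IsClosed D) (hCD : Disjoint C D) (c1 : IsConnected C)
    (c2 : IsConnected D) (m1 : componentMult a (lineCoeff t) C = 2)
    (m2 : componentMult a (lineCoeff t) D = 4) : IsTritangent a t :=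
  Or.inr (Or.inl ⟨C, D, ne_of_disjoint_connected c1 hCD,
    interComponents_eq_two hX hC hD hCD c1 c2, m1, m2⟩)

theorem IsTritangent.componentMult_mem (h : IsTritangent a t) {K : Set (ℝ × ℝ)}
    (hK : K ∈ interComponents a (lineCoeff t)) :
    componentMult a (lineCoeff t) K = 2 ∨ componentMult a (lineCoeff t) K = 4 ∨
      componentMult a (lineCoeff t) K = 6 := by
  rcases h with ⟨-, h⟩ | ⟨C, C', -, h, h1, h2⟩ | ⟨C, h, h1⟩
  · exact Or.inl (h K hK)
  · rw [h] at hK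
    rcases hK with rfl | rfl
    · exact Or.inl h1
    · exact Or.inr (Or.inl h2)
  · rw [h] at hK
    rw [mem_singleton_iff.1 hK]
    exact Or.inr (Or.inr h1)

/-- If two components of multiplicity two of a tritangent are known, the remaining part of the
intersection is the third component. -/
theorem IsTritangent.third_component (h : IsTritangent a t)
    (hX : curve a ∩ curve (lineCoeff t) = C ∪ D ∪ E)
    (hC : IsClosed C) (hD : IsClosed D) (hE : IsClosed E) (hCD : Disjoint C D)
    (hCE : Disjoint C E) (hDE : Disjoint D E) (c1 : IsConnected C) (c2 : IsConnected D)
    (m1 : componentMult a (lineCoeff t) C = 2) (m2 : componentMult a (lineCoeff t) D = 2) :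
    IsConnected E ∧ componentMult a (lineCoeff t) E = 2 := by
  set X := curve a ∩ curve (lineCoeff t) with hXdef
  have e1 : ∀ p ∈ C, connectedComponentIn X p = C := fun p hp =>
    connectedComponentIn_eq_of_union (hX.trans (union_assoc _ _ _)) hC (hD.union hE)
      (hCD.union_right hCE) c1.isPreconnected hp
  have e2 : ∀ p ∈ D, connectedComponentIn X p = D := fun p hp =>
    connectedComponentIn_eq_of_union (hX.trans (by rw [union_comm C D, union_assoc])) hD
      (hC.union hE) (hCD.symm.union_right hDE) c2.isPreconnected hp
  have s3 : ∀ p ∈ E, connectedComponentIn X p ⊆ E := fun p hp =>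
    connectedComponentIn_subset_of_union (hX.trans (union_comm _ _)) hE
      (hC.union hD) (hCE.symm.union_right hDE.symm) hp
  have hCmem : C ∈ interComponents a (lineCoeff t) := by
    obtain ⟨p, hp⟩ := c1.nonempty
    exact ⟨p, by rw [← hXdef, hX]; exact Or.inl (Or.inl hp), (e1 p hp).symm⟩
  have hDmem : D ∈ interComponents a (lineCoeff t) := by
    obtain ⟨p, hp⟩ := c2.nonempty
    exact ⟨p, by rw [← hXdef, hX]; exact Or.inl (Or.inr hp), (e2 p hp).symm⟩
  have hne : C ≠ D := ne_of_disjoint_connected c1 hCD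
  rcases h with ⟨hcard, hm⟩ | ⟨K, K', -, hK, k1, k2⟩ | ⟨K, hK, k1⟩
  · obtain ⟨K1, K2, K3, h12, h13, h23, hK⟩ := Set.ncard_eq_three.1 hcard
    have hthird : ∃ F ∈ interComponents a (lineCoeff t), F ≠ C ∧ F ≠ D ∧
        ∀ G ∈ interComponents a (lineCoeff t), G = C ∨ G = D ∨ G = F := by
      rw [hK] at hCmem hDmem ⊢
      simp only [mem_insert_iff, mem_singleton_iff] at hCmem hDmem
      rcases hCmem with rfl | rfl | rfl <;> rcases hDmem with rfl | rfl | rfl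
      · exact absurd rfl hne
      · exact ⟨K3, by simp, h13.symm, h23.symm, by simp⟩
      · exact ⟨K2, by simp, h12.symm, h23, by rintro G (rfl | rfl | rfl) <;> simp⟩
      · exact ⟨K3, by simp, h23.symm, h13.symm, by rintro G (rfl | rfl | rfl) <;> simp⟩
      · exact absurd rfl hne
      · exact ⟨K1, by simp, h12, h13, by rintro G (rfl | rfl | rfl) <;> simp⟩
      · exact ⟨K2, by simp, h23, h12.symm, by rintro G (rfl | rfl | rfl) <;> simp⟩
      · exact ⟨K1, by simp, h13, h12, by rintro G (rfl | rfl | rfl) <;> simp⟩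
      · exact absurd rfl hne
    obtain ⟨F, hF, hFC, hFD, hall⟩ := hthird
    obtain ⟨q, hq, hFq⟩ := id hF
    have hqF : q ∈ F := hFq ▸ mem_connectedComponentIn hq
    -- A component that starts in `E` stays in `E` and is neither `C` nor `D`, so it is `F`;
    -- conversely `F` can only be met inside `E`.
    have hFE : F = E := by
      apply Subset.antisymm
      · have hqX := hq
        change q ∈ X at hqX
        rw [hX] at hqX
        rcases hqX with (hqX | hqX) | hqX
        · exact absurd (hFq.trans (e1 q hqX)) hFC
        · exact absurd (hFq.trans (e2 q hqX)) hFD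
        · rw [hFq]; exact s3 q hqX
      · intro p hp
        have hpX : p ∈ X := hX ▸ Or.inr hp
        have hself := mem_connectedComponentIn hpX
        rcases hall _ ⟨p, hpX, rfl⟩ with h | h | h
        · exact absurd (h ▸ hself) (Set.disjoint_right.1 hCE hp)
        · exact absurd (h ▸ hself) (Set.disjoint_right.1 hDE hp)
        · exact h ▸ hself
    subst hFE
    refine ⟨⟨⟨q, hqF⟩, ?_⟩, hm _ hF⟩
    rw [hFq]; exact isPreconnected_connectedComponentIn
  · exfalso
    rw [hK] at hCmem hDmem
    rcases hCmem with rfl | rfl <;> rcases hDmem with rfl | rfl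
    · exact hne rfl
    · rw [m2] at k2; norm_num at k2
    · rw [m1] at k2; norm_num at k2
    · exact hne rfl
  · exfalso
    rw [hK] at hCmem hDmem
    exact hne ((mem_singleton_iff.1 hCmem).trans (mem_singleton_iff.1 hDmem).symm)

end Criteria


/-! ## Horizontal and vertical lines -/

section Directions

variable {a : Exps 3 → ℝ} {x y x' y' : ℝ} {u v w : Exps 3}

theorem mem_openSegment_horizontal {x₁ x₂ : ℝ} (h1 : x₁ < x) (h2 : x < x₂) :
    (x, y) ∈ openSegment ℝ (x₁, y) (x₂, y) := by
  have h : 0 < x₂ - x₁ := by linarith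
  refine ⟨(x₂ - x) / (x₂ - x₁), (x - x₁) / (x₂ - x₁), div_pos (by linarith) h,
    div_pos (by linarith) h, by field_simp; ring, ?_⟩
  simp only [Prod.smul_mk, smul_eq_mul, Prod.mk_add_mk, Prod.mk.injEq]
  constructor <;> field_simp <;> ring

theorem mem_openSegment_vertical {y₁ y₂ : ℝ} (h1 : y₁ < y) (h2 : y < y₂) :
    (x, y) ∈ openSegment ℝ (x, y₁) (x, y₂) := by
  have h : 0 < y₂ - y₁ := by linarith
  refine ⟨(y₂ - y) / (y₂ - y₁), (y - y₁) / (y₂ - y₁), div_pos (by linarith) h,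
    div_pos (by linarith) h, by field_simp; ring, ?_⟩
  simp only [Prod.smul_mk, smul_eq_mul, Prod.mk_add_mk, Prod.mk.injEq]
  constructor <;> field_simp <;> ring

theorem slope_mk (u : Exps 3) (d e : ℝ) :
    slope u (d, e) = ((u.1 : ℕ) : ℝ) * d + ((u.2 : ℕ) : ℝ) * e := rfl

theorem exps_fst_le (u : Exps 3) : ((u.1 : ℕ) : ℝ) ≤ 3 := by
  have := u.1.isLt; exact_mod_cast Nat.lt_succ_iff.1 this

theorem exps_snd_le (u : Exps 3) : ((u.2 : ℕ) : ℝ) ≤ 3 := by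
  have := u.2.isLt; exact_mod_cast Nat.lt_succ_iff.1 this

/-- To the right, the exponents of the last column have maximal slope. Once one of them is active,
only the active ones of that column persist. The next three lemmas are the analogues for the other
sides of the square. -/
theorem active_right (hu : u ∈ active a (x, y)) (h3 : u.1 = 3) (hx : x < x') :
    active a (x', y) = {w ∈ active a (x, y) | w.1 = 3} := by
  have e : ((x', y) : ℝ × ℝ) = (x, y) + (x' - x) • ((1 : ℝ), (0 : ℝ)) := by simp
  rw [e, active_ray hu (fun w => ?_) (sub_pos.2 hx)]
  · ext w
    simp only [mem_sep_iff, slope_mk, h3]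
    refine and_congr_right fun _ => ?_
    rw [Fin.ext_iff, ← @Nat.cast_inj ℝ]
    constructor <;> intro h <;> simpa using h
  · have := exps_fst_le w
    simp only [slope_mk, h3]
    simpa using this

theorem active_left (hu : u ∈ active a (x, y)) (h3 : u.1 = 0) (hx : x' < x) :
    active a (x', y) = {w ∈ active a (x, y) | w.1 = 0} := by
  have e : ((x', y) : ℝ × ℝ) = (x, y) + (x - x') • ((-1 : ℝ), (0 : ℝ)) := by simp
  rw [e, active_ray hu (fun w => ?_) (sub_pos.2 hx)]
  · ext w
    simp only [mem_sep_iff, slope_mk, h3]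
    refine and_congr_right fun _ => ?_
    rw [Fin.ext_iff, ← @Nat.cast_inj ℝ]
    constructor <;> intro h <;> simpa using h
  · simp [slope_mk, h3]

theorem active_up (hu : u ∈ active a (x, y)) (h3 : u.2 = 3) (hx : y < y') :
    active a (x, y') = {w ∈ active a (x, y) | w.2 = 3} := by
  have e : ((x, y') : ℝ × ℝ) = (x, y) + (y' - y) • ((0 : ℝ), (1 : ℝ)) := by simp
  rw [e, active_ray hu (fun w => ?_) (sub_pos.2 hx)]
  · ext w
    simp only [mem_sep_iff, slope_mk, h3]
    refine and_congr_right fun _ => ?_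
    rw [Fin.ext_iff, ← @Nat.cast_inj ℝ]
    constructor <;> intro h <;> simpa using h
  · have := exps_snd_le w
    simp only [slope_mk, h3]
    simpa using this

theorem active_down (hu : u ∈ active a (x, y)) (h3 : u.2 = 0) (hx : y' < y) :
    active a (x, y') = {w ∈ active a (x, y) | w.2 = 0} := by
  have e : ((x, y') : ℝ × ℝ) = (x, y) + (y - y') • ((0 : ℝ), (-1 : ℝ)) := by simp
  rw [e, active_ray hu (fun w => ?_) (sub_pos.2 hx)]
  · ext w
    simp only [mem_sep_iff, slope_mk, h3]
    refine and_congr_right fun _ => ?_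
    rw [Fin.ext_iff, ← @Nat.cast_inj ℝ]
    constructor <;> intro h <;> simpa using h
  · simp [slope_mk, h3]

/-- Exponents increase along a horizontal line. -/
theorem fst_le_of_right (hu : u ∈ active a (x, y)) (hw : w ∈ active a (x', y)) (hx : x < x') :
    u.1 ≤ w.1 := by
  have e : ((x', y) : ℝ × ℝ) = (x, y) + (x' - x) • ((1 : ℝ), (0 : ℝ)) := by simp
  rw [e] at hw
  have := slope_le_of_ray hu (sub_pos.2 hx) hw
  simp only [slope_mk] at this
  rw [Fin.le_def, ← @Nat.cast_le ℝ]
  linarith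

theorem snd_le_of_up (hu : u ∈ active a (x, y)) (hw : w ∈ active a (x, y')) (hx : y < y') :
    u.2 ≤ w.2 := by
  have e : ((x, y') : ℝ × ℝ) = (x, y) + (y' - y) • ((0 : ℝ), (1 : ℝ)) := by simp
  rw [e] at hw
  have := slope_le_of_ray hu (sub_pos.2 hx) hw
  simp only [slope_mk] at this
  rw [Fin.le_def, ← @Nat.cast_le ℝ]
  linarith

/-- On a horizontal line monomials of the same first exponent keep their difference. -/
theorem mem_active_of_fst_eq (hu : u ∈ active a (x, y)) (hw : w ∈ active a (x', y))
    (h : u.1 = w.1) : w ∈ active a (x, y) := by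
  have h2 := hw u
  apply mem_active_of_le hu
  simp only [term, h] at h2 ⊢
  linarith

end Directions

/-! ## A vertex on a horizontal end of the curve -/

/-- The line at height `y` first crosses the edge dual to `(0,j₀), (2,j₁)` and then runs into the
end dual to `(3,0), (3,1)` at the vertex `(xA, y)`. -/
structure EndConfig (a : Exps 3 → ℝ) (xA y xP : ℝ) (j₀ j₁ : Fin 4) : Prop where
  smooth : IsSmooth a
  lt : xP < xA
  cross : active a (xP, y) = {(0, j₀), (2, j₁)}
  vertex : active a (xA, y) = {(2, j₁), (3, 0), (3, 1)}

section Config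

variable {a : Exps 3 → ℝ} {xA y xP x l : ℝ} {j₀ j₁ : Fin 4}

theorem vert1_mk (h : 0 ≤ l) : vert1 ((x, y), l) = (x + l, y + l) := by
  simp [vert1, abs_of_nonneg h]

theorem vert0_mk : vert0 ((x, y), l) = (x, y) := rfl

/-- A leg crossing a single edge. -/
theorem curve_inter_left {P v : ℝ × ℝ} {u w : Exps 3} (hP : active a P = {u, w}) (h0 : u.1 = 0)
    (hw0 : w.1 ≠ 0) (hv : w ∈ active a v) (hv' : u ∉ active a v) (hy : P.2 = v.2)
    (hx : P.1 < v.1) : curve a ∩ lft v = {P} := by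
  obtain ⟨xP, y⟩ := P
  obtain ⟨xv, y'⟩ := v
  simp only at hy hx
  subst hy
  have huw : u ≠ w := fun h => hw0 (h ▸ h0)
  apply Subset.antisymm
  · rintro ⟨x, y'⟩ ⟨hc, hy', hx'⟩
    simp only at hy' hx'
    subst hy'
    rcases lt_trichotomy x xP with h | rfl | h
    · refine absurd hc (not_mem_curve_of_eq_singleton (u := u) ?_)
      rw [active_left (u := u) (by rw [hP]; simp) h0 h, hP]
      ext z
      simp only [mem_sep_iff, mem_insert_iff, mem_singleton_iff]
      constructor
      · rintro ⟨rfl | rfl, h⟩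
        · rfl
        · exact absurd h hw0
      · rintro rfl; exact ⟨Or.inl rfl, h0⟩
    · rfl
    · refine absurd hc (not_mem_curve_of_eq_singleton (u := w) ?_)
      rw [active_openSegment (u := w) (by rw [hP]; simp) hv (mem_openSegment_horizontal h hx'), hP]
      ext z
      simp only [mem_inter_iff, mem_insert_iff, mem_singleton_iff]
      constructor
      · rintro ⟨rfl | rfl, h⟩
        · exact absurd h hv'
        · rfl
      · rintro rfl; exact ⟨Or.inr rfl, hv⟩
  · rintro _ rfl
    exact ⟨mem_curve_of_mem (u := u) (v := w) (by rw [hP]; simp) (by rw [hP]; simp) huw, rfl, hx⟩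

theorem width_pair {n : ℕ} {f : Exps n → ℕ} {u v : Exps n} (h : f u ≤ f v) :
    width f {u, v} = f v - f u := by
  apply width_eq
  · rintro w (rfl | rfl)
    · exact ⟨le_rfl, h⟩
    · exact ⟨h, le_rfl⟩
  · exact ⟨u, by simp, rfl⟩
  · exact ⟨v, by simp, rfl⟩

namespace EndConfig

variable (c : EndConfig a xA y xP j₀ j₁)
include c

theorem active_ray (hx : xA < x) : active a (x, y) = {(3, 0), (3, 1)} := by
  rw [active_right (u := (3, 0)) (by rw [c.vertex]; simp) rfl hx, c.vertex]
  ext w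
  simp only [mem_sep_iff, mem_insert_iff, mem_singleton_iff]
  constructor
  · rintro ⟨rfl | rfl | rfl, h⟩
    · simp at h
    · simp
    · simp
  · rintro (rfl | rfl) <;> simp

/-- Left of A = (xA, y) the line crosses Γ once, since (2,j₁) is active at the crossing and at A and
(0,j₀) is not active at A. From A on, the leg lies inside the end. -/
theorem curve_inter_lft (hx : xA < x) :
    curve a ∩ lft (x, y) = {(xP, y)} ∪ {p | p.2 = y ∧ xA ≤ p.1 ∧ p.1 < x} := by
  have h1 : curve a ∩ lft (xA, y) = {(xP, y)} :=
    curve_inter_left c.cross rfl (by simp) (by rw [c.vertex]; simp) (by rw [c.vertex]; simp)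
      rfl c.lt
  ext ⟨z, y'⟩
  constructor
  · rintro ⟨hc, hy, hz⟩
    simp only at hy hz
    subst hy
    by_cases h : z < xA
    · left; rw [← h1]; exact ⟨hc, rfl, h⟩
    · right; exact ⟨rfl, not_lt.1 h, hz⟩
  · rintro (h | ⟨hy, hz, hz'⟩)
    · rw [← h1] at h
      exact ⟨h.1, h.2.1, h.2.2.trans hx⟩
    · simp only at hy hz hz'
      subst hy
      refine ⟨?_, rfl, hz'⟩
      rcases hz.eq_or_lt with rfl | hz
      · exact mem_curve_of_mem (u := (3, 0)) (v := (3, 1)) (by rw [c.vertex]; simp)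
          (by rw [c.vertex]; simp) (by simp)
      · exact mem_curve_of_mem (u := (3, 0)) (v := (3, 1)) (by rw [c.active_ray hz]; simp)
          (by rw [c.active_ray hz]; simp) (by simp)

theorem mem_curve (hx : xA ≤ x) : (x, y) ∈ curve a := by
  have : ((x, y) : ℝ × ℝ) ∈ curve a ∩ lft (x + 1, y) := by
    rw [c.curve_inter_lft (by linarith)]
    exact Or.inr ⟨rfl, hx, by simp⟩
  exact this.1

theorem curve_inter_dwn (hx : xA < x) : curve a ∩ dwn (x, y) = ∅ := by
  ext ⟨z, y'⟩
  simp only [mem_inter_iff, mem_empty_iff_false, iff_false]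
  rintro ⟨hc, hz, hy⟩
  simp only at hz hy
  subst hz
  refine absurd hc (not_mem_curve_of_eq_singleton (u := (3, 0)) ?_)
  rw [active_down (u := (3, 0)) (by rw [c.active_ray hx]; simp) rfl hy, c.active_ray hx]
  ext w
  simp only [mem_sep_iff, mem_insert_iff, mem_singleton_iff]
  constructor
  · rintro ⟨rfl | rfl, h⟩
    · rfl
    · simp at h
  · rintro rfl; simp

omit c in
theorem width_cross : width xdeg ({(0, j₀), (2, j₁)} : Set (Exps 3)) = 2 := by
  rw [width_pair (by simp [xdeg])]; simp [xdeg]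

omit c in
theorem width_vertex : width xdeg ({(2, j₁), (3, 0), (3, 1)} : Set (Exps 3)) = 1 := by
  rw [width_eq (m := 2) (M := 3)]
  · norm_num
  · rintro w (rfl | rfl | rfl) <;> simp [xdeg]
  · exact ⟨(2, j₁), by simp, rfl⟩
  · exact ⟨(3, 0), by simp, rfl⟩

omit c in
theorem width_end : width xdeg ({(3, 0), (3, 1)} : Set (Exps 3)) = 0 := by
  rw [width_pair (by simp [xdeg])]; simp [xdeg]

end EndConfig

/-- The part of the intersection off the left and the lower leg. -/
def rest (a : Exps 3 → ℝ) (t : Params) : Set (ℝ × ℝ) :=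
  curve a ∩ (openSegment ℝ (vert0 t) (vert1 t) ∪ {vert1 t} ∪ rgt (vert1 t) ∪ upw (vert1 t))

theorem mem_segment_horizontal {p : ℝ × ℝ} {x₁ x₂ : ℝ} (h : x₁ ≤ x₂) :
    p ∈ segment ℝ (x₁, y) (x₂, y) ↔ p.2 = y ∧ x₁ ≤ p.1 ∧ p.1 ≤ x₂ := by
  obtain ⟨x, y'⟩ := p
  constructor
  · rintro ⟨α, β, hα, hβ, hαβ, he⟩
    simp only [Prod.smul_mk, smul_eq_mul, Prod.mk_add_mk, Prod.mk.injEq] at he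
    obtain ⟨rfl, rfl⟩ := he
    obtain rfl : α = 1 - β := by linarith
    exact ⟨by ring, by simp only; nlinarith, by simp only; nlinarith⟩
  · rintro ⟨rfl, h1, h2⟩
    simp only at h1 h2
    rcases h1.eq_or_lt with rfl | h1
    · exact left_mem_segment _ _ _
    rcases h2.eq_or_lt with rfl | h2
    · exact right_mem_segment _ _ _
    exact openSegment_subset_segment _ _ _ (mem_openSegment_horizontal h1 h2)

theorem isConnected_segment (p q : ℝ × ℝ) : IsConnected (segment ℝ p q) :=
  ⟨⟨p, left_mem_segment _ _ _⟩, (convex_segment p q).isPreconnected⟩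

theorem isClosed_segment (p q : ℝ × ℝ) : IsClosed (segment ℝ p q) := by
  rw [← convexHull_pair]
  exact ((Set.toFinite {p, q}).isCompact_convexHull ℝ).isClosed

namespace EndConfig

variable (c : EndConfig a xA y xP j₀ j₁)
include c

theorem inter_eq (hx : xA < x) (hl : 0 < l) :
    curve a ∩ curve (lineCoeff ((x, y), l)) =
      {(xP, y)} ∪ segment ℝ (xA, y) (x, y) ∪ rest a ((x, y), l) := by
  have hseg : segment ℝ (xA, y) (x, y) = {p | p.2 = y ∧ xA ≤ p.1 ∧ p.1 < x} ∪ {(x, y)} := by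
    ext ⟨z, y'⟩
    rw [mem_segment_horizontal hx.le]
    simp only [mem_union, mem_ofPred_eq, mem_singleton_iff, Prod.mk.injEq]
    constructor
    · rintro ⟨rfl, h1, h2⟩
      rcases h2.eq_or_lt with rfl | h2
      · exact Or.inr ⟨rfl, rfl⟩
      · exact Or.inl ⟨rfl, h1, h2⟩
    · rintro (⟨rfl, h1, h2⟩ | ⟨rfl, rfl⟩)
      · exact ⟨rfl, h1, h2.le⟩
      · exact ⟨rfl, hx.le, le_rfl⟩
  have h1 := c.curve_inter_lft hx
  have h2 := c.curve_inter_dwn hx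
  have h3 : curve a ∩ {(x, y)} = {(x, y)} :=
    inter_eq_right.2 (singleton_subset_iff.2 (c.mem_curve hx.le))
  rw [hseg, ← union_assoc, ← h1, ← h3, rest, curve_line hl.le, vert0_mk,
    ← insert_endpoints_openSegment]
  have h2' : ∀ p, p ∈ curve a → p ∉ dwn (x, y) := fun p hp hd => by
    have : p ∈ curve a ∩ dwn (x, y) := ⟨hp, hd⟩
    rw [h2] at this; exact this
  ext p
  have := h2' p
  simp only [mem_inter_iff, mem_union, mem_insert_iff, mem_singleton_iff]
  tauto

/-- Above the end lies the chamber of (3,1), because (3,1) is steeper than (3,0) in both directions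
(1,1) and (0,1). The bounded edge and the upper leg therefore leave Γ at once. -/
theorem exists_gap (hx : xA < x) :
    ∃ ε > 0, ∀ s, 0 < s → s < ε → active a (x + s, y + s) = {(3, 1)} ∧
      active a (x, y + s) = {(3, 1)} := by
  have hv := c.active_ray hx
  have key : ∀ d : ℝ, ∀ᶠ s in nhdsWithin (0 : ℝ) (Ioi 0),
      active a ((x, y) + s • (d, (1 : ℝ))) = {(3, 1)} := by
    intro d
    have h := eventually_active_ray (a := a) (p := (x, y)) (u := (3, 1)) (d := (d, (1 : ℝ)))
      (by rw [hv]; simp) (by rw [hv]; rintro w (rfl | rfl) <;> simp [slope_mk])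
    filter_upwards [h] with s hs
    rw [hs, hv]
    ext w
    simp only [mem_sep_iff, mem_insert_iff, mem_singleton_iff]
    constructor
    · rintro ⟨rfl | rfl, h⟩
      · simp [slope_mk] at h
      · rfl
    · rintro rfl; simp
  have := (key 1).and (key 0)
  rw [eventually_nhdsWithin_iff, Metric.eventually_nhds_iff] at this
  obtain ⟨ε, hε, h⟩ := this
  refine ⟨ε, hε, fun s h0 hs => ?_⟩
  have := h (y := s) (by simpa [abs_of_pos h0] using hs) h0
  simpa using this

/-- `rest` is cut out by sets that are not closed at v₀. The uniform gap shows that it is closed all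
the same and disjoint from the segment on the end, so that the remaining intersection can be treated
as a separate piece. -/
theorem exists_rest_gap (hx : xA < x) (hl : 0 < l) :
    ∃ ε > 0, ∀ p ∈ rest a ((x, y), l), x + ε ≤ p.1 := by
  obtain ⟨ε, hε, h⟩ := c.exists_gap hx
  refine ⟨min ε l, lt_min hε hl, ?_⟩
  rintro ⟨z, w⟩ ⟨hc, ((hp | hp) | hp) | hp⟩
  · rw [vert0_mk, vert1_mk hl.le] at hp
    obtain ⟨α, β, hα, hβ, hαβ, he⟩ := hp
    simp only [Prod.smul_mk, smul_eq_mul, Prod.mk_add_mk, Prod.mk.injEq] at he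
    obtain ⟨rfl, rfl⟩ := he
    obtain rfl : α = 1 - β := by linarith
    have e1 : (1 - β) * x + β * (x + l) = x + β * l := by ring
    have e2 : (1 - β) * y + β * (y + l) = y + β * l := by ring
    rw [e1, e2] at hc
    simp only
    rw [e1]
    by_contra hlt
    push Not at hlt
    have h1 : β * l < ε := by linarith [min_le_left ε l]
    exact not_mem_curve_of_eq_singleton (h (β * l) (mul_pos hβ hl) h1).1 hc
  · rw [vert1_mk hl.le, mem_singleton_iff, Prod.mk.injEq] at hp
    simp only [hp.1]; linarith [min_le_right ε l]
  · rw [vert1_mk hl.le] at hp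
    obtain ⟨-, h2⟩ := hp
    simp only at h2 ⊢
    linarith [min_le_right ε l]
  · rw [vert1_mk hl.le] at hp
    obtain ⟨h2, -⟩ := hp
    simp only at h2 ⊢
    linarith [min_le_right ε l]

theorem isClosed_rest (hx : xA < x) (hl : 0 < l) : IsClosed (rest a ((x, y), l)) := by
  obtain ⟨ε, hε, h⟩ := c.exists_rest_gap hx hl
  have : rest a ((x, y), l) =
      (curve a ∩ curve (lineCoeff ((x, y), l))) ∩ {p | x + ε ≤ p.1} := by
    apply Subset.antisymm
    · intro p hp
      refine ⟨?_, h p hp⟩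
      rw [c.inter_eq hx hl]; exact Or.inr hp
    · rintro p ⟨hp, hp'⟩
      rw [c.inter_eq hx hl] at hp
      rcases hp with (rfl | hp) | hp
      · have := c.lt
        simp only [mem_ofPred_eq] at hp'
        linarith
      · rw [mem_segment_horizontal hx.le] at hp
        simp only [mem_ofPred_eq] at hp'
        linarith
      · exact hp
  rw [this]
  exact ((isClosed_curve a).inter (isClosed_curve _)).inter
    (isClosed_le continuous_const continuous_fst)

theorem componentMult_cross (hx : xA ≤ x) (hl : 0 ≤ l) :
    componentMult a (lineCoeff ((x, y), l)) {(xP, y)} = 2 := by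
  rw [componentMult, finsum_mem_singleton, stableMult_left (t := ((x, y), l)) (p := (xP, y)) hl ⟨rfl, c.lt.trans_le hx⟩, c.cross,
    width_cross]

theorem stableMult_end (hx : xA < x) (hl : 0 ≤ l) :
    stableMult a (lineCoeff ((x, y), l)) (x, y) = 1 := by
  have hv := c.active_ray hx
  rw [stableMult_of_vertical_left hv rfl rfl]
  rcases hl.eq_or_lt with rfl | hl
  · rw [active_line_vert (t := ((x, y), 0)) (p := (x, y)) le_rfl rfl rfl, width_eq (m := 0) (M := 1)]
    · norm_num
    · rintro w (rfl | rfl | rfl | rfl) <;> simp [xdeg]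
    · exact ⟨(0, 0), by simp, rfl⟩
    · exact ⟨(1, 0), by simp, rfl⟩
  · rw [active_line_vert0 (t := ((x, y), l)) (p := (x, y)) hl.le rfl hl.ne', width_eq (m := 0) (M := 1)]
    · norm_num
    · rintro w (rfl | rfl | rfl) <;> simp [xdeg]
    · exact ⟨(0, 0), by simp, rfl⟩
    · exact ⟨(1, 0), by simp, rfl⟩

/-- The multiplicity is 1 + 1. At A the first exponents range from 2 to 3; at v₀ the end is dual to
a vertical unit segment and the cell of the (1,1)-curve has horizontal width one. Points in between
have width zero. -/
theorem componentMult_segment (hx : xA < x) (hl : 0 ≤ l) :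
    componentMult a (lineCoeff ((x, y), l)) (segment ℝ (xA, y) (x, y)) = 2 := by
  rw [componentMult, finsum_mem_eq_two (x := (xA, y)) (y := (x, y)) (left_mem_segment _ _ _)
    (right_mem_segment _ _ _) (by simp [hx.ne])]
  · rw [c.stableMult_end hx hl, stableMult_left (t := ((x, y), l)) (p := (xA, y)) hl ⟨rfl, hx⟩, c.vertex, width_vertex]
    norm_num
  · rintro ⟨z, y'⟩ hz h1 h2
    rw [mem_segment_horizontal hx.le] at hz
    obtain ⟨rfl, h3, h4⟩ := hz
    have h3' : xA < z := lt_of_le_of_ne h3 fun e => h1 (by rw [e])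
    have h4' : z < x := lt_of_le_of_ne h4 fun e => h2 (by rw [e])
    rw [stableMult_left (t := ((x, y'), l)) (p := (z, y')) hl ⟨rfl, h4'⟩, c.active_ray h3', width_end]

theorem disjoint_cross_segment (hx : xA < x) :
    Disjoint {(xP, y)} (segment ℝ (xA, y) (x, y)) := by
  rw [disjoint_singleton_left, mem_segment_horizontal hx.le]
  rintro ⟨-, h, -⟩
  exact absurd c.lt (not_lt.2 h)

theorem disjoint_cross_rest (hx : xA < x) (hl : 0 < l) :
    Disjoint {(xP, y)} (rest a ((x, y), l)) := by
  obtain ⟨ε, hε, h⟩ := c.exists_rest_gap hx hl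
  rw [disjoint_singleton_left]
  intro hp
  have h1 := h _ hp
  have h2 := c.lt
  simp only at h1
  linarith

theorem disjoint_segment_rest (hx : xA < x) (hl : 0 < l) :
    Disjoint (segment ℝ (xA, y) (x, y)) (rest a ((x, y), l)) := by
  obtain ⟨ε, hε, h⟩ := c.exists_rest_gap hx hl
  rw [Set.disjoint_left]
  intro p hp hp'
  rw [mem_segment_horizontal hx.le] at hp
  have := h p hp'
  linarith

theorem isTritangent_of_rest (hx : xA < x) (hl : 0 < l) (h : IsConnected (rest a ((x, y), l)))
    (hm : componentMult a (lineCoeff ((x, y), l)) (rest a ((x, y), l)) = 2) :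
    IsTritangent a ((x, y), l) :=
  isTritangent_of_three (c.inter_eq hx hl) isClosed_singleton (isClosed_segment _ _)
    (c.isClosed_rest hx hl) (c.disjoint_cross_segment hx) (c.disjoint_cross_rest hx hl)
    (c.disjoint_segment_rest hx hl) isConnected_singleton (isConnected_segment _ _) h
    (c.componentMult_cross hx.le hl.le) (c.componentMult_segment hx hl.le) hm

/-- The crossing and the segment on the end already are two tangencies of multiplicity two, so
everything else must form the third. -/
theorem rest_of_isTritangent (hx : xA < x) (hl : 0 < l) (h : IsTritangent a ((x, y), l)) :
    IsConnected (rest a ((x, y), l)) ∧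
      componentMult a (lineCoeff ((x, y), l)) (rest a ((x, y), l)) = 2 :=
  h.third_component (c.inter_eq hx hl) isClosed_singleton (isClosed_segment _ _)
    (c.isClosed_rest hx hl) (c.disjoint_cross_segment hx) (c.disjoint_cross_rest hx hl)
    (c.disjoint_segment_rest hx hl) isConnected_singleton (isConnected_segment _ _)
    (c.componentMult_cross hx.le hl.le) (c.componentMult_segment hx hl.le)

end EndConfig

end Config


/-! ### The third tangency on the upper leg -/

section

variable {a : Exps 3 → ℝ} {xA y xP x l : ℝ} {j₀ j₁ : Fin 4}

theorem stableMult_trapezoid {m n : ℕ} {a : Exps m → ℝ} {b : Exps n → ℝ} {p : ℝ × ℝ}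
    {S : Set (Exps m)} {T : Set (Exps n)} (hS : active a p = S) (hT : active b p = T)
    {x c d c₁ d₁ x' c' d' c₁' d₁' : ℝ}
    (eS : toPlane '' S = {(x, c), (x, d), (x + 1, c₁), (x + 1, d₁)})
    (eT : toPlane '' T = {(x', c'), (x', d'), (x' + 1, c₁'), (x' + 1, d₁')})
    (h : c ≤ d) (h1 : c₁ ≤ d₁) (h' : c' ≤ d') (h1' : c₁' ≤ d₁') :
    stableMult a b p
      = (d - c) + (d' - c') + max (d₁ - d) (d₁' - d') - min (c₁ - c) (c₁' - c') := by
  rw [stableMult, dualCell, dualCell, hS, hT, eS, eT, mixedArea_convexHull h h1 h' h1']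

theorem toPlane_lower : toPlane '' ({(0, 0), (1, 0), (0, 1)} : Set (Exps 1)) =
    {((0 : ℝ), (0 : ℝ)), (0, 1), (0 + 1, 0), (0 + 1, 0)} := by
  simp only [image_insert_eq, image_singleton, toPlane]
  ext z; simp; tauto

theorem toPlane_upper : toPlane '' ({(1, 0), (0, 1), (1, 1)} : Set (Exps 1)) =
    {((0 : ℝ), (1 : ℝ)), (0, 1), (0 + 1, 0), (0 + 1, 1)} := by
  simp only [image_insert_eq, image_singleton, toPlane]
  ext z; simp; tauto

/-- The part of the curve above `p` is connected, of multiplicity two with a vertical line. -/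
def UpGood (a : Exps 3 → ℝ) (p : ℝ × ℝ) : Prop :=
  IsConnected (curve a ∩ upw p) ∧ ∑ᶠ q ∈ curve a ∩ upw p, width ydeg (active a q) = 2

theorem curve_inter_upw_eq {y₁ y₂ : ℝ} (h : y₁ ≤ y₂)
    (hn : ∀ z, y₁ < z → z ≤ y₂ → (x, z) ∉ curve a) :
    curve a ∩ upw (x, y₁) = curve a ∩ upw (x, y₂) := by
  ext ⟨x', z⟩
  simp only [upw, mem_inter_iff, mem_ofPred_eq]
  constructor
  · rintro ⟨hc, rfl, hz⟩
    refine ⟨hc, rfl, ?_⟩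
    by_contra hlt
    exact hn z hz (not_lt.1 hlt) hc
  · rintro ⟨hc, rfl, hz⟩
    exact ⟨hc, rfl, h.trans_lt hz⟩

theorem UpGood.congr {y₁ y₂ : ℝ} (h : y₁ ≤ y₂)
    (hn : ∀ z, y₁ < z → z ≤ y₂ → (x, z) ∉ curve a) :
    UpGood a (x, y₁) ↔ UpGood a (x, y₂) := by
  rw [UpGood, UpGood, curve_inter_upw_eq h hn]

/-- An upward ray that crosses a single edge, of the right multiplicity. -/
theorem upGood_of_crossing {y₁ yq : ℝ} {k : Fin 4} (h1 : active a (x, y₁) = {(3, 1)})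
    (hy : y₁ < yq) (hq : (3, 1) ∈ active a (x, yq)) (hk : (k, 3) ∈ active a (x, yq))
    (hu : ∀ w ∈ active a (x, yq), w.2 = 3 → w = (k, 3)) : UpGood a (x, y₁) := by
  have hset : curve a ∩ upw (x, y₁) = {(x, yq)} := by
    apply Subset.antisymm
    · rintro ⟨x', z⟩ ⟨hc, hx, hz⟩
      simp only at hx hz
      subst hx
      rcases lt_trichotomy z yq with h | rfl | h
      · refine absurd hc (not_mem_curve_of_eq_singleton (u := (3, 1)) ?_)
        rw [active_openSegment (u := (3, 1)) (by rw [h1]; rfl) hq (mem_openSegment_vertical hz h),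
          h1, inter_eq_left.2 (singleton_subset_iff.2 hq)]
      · rfl
      · refine absurd hc (not_mem_curve_of_eq_singleton (u := (k, 3)) ?_)
        rw [active_up hk rfl h]
        ext w
        constructor
        · rintro ⟨hw, hw'⟩; exact hu w hw hw'
        · rintro rfl; exact ⟨hk, rfl⟩
    · rintro _ rfl
      exact ⟨mem_curve_of_mem hq hk (by simp), rfl, hy⟩
  rw [UpGood, hset, finsum_mem_singleton]
  refine ⟨isConnected_singleton, ?_⟩
  -- Second exponents increase weakly along the upward ray, which starts in the chamber of (3,1) and
  -- meets the top row at the crossing, so they range from 1 to 3 there.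
  rw [width_eq (m := 1) (M := 3)]
  · norm_num
  · intro w hw
    have h2 : (3, 1) ∈ active a (x, y₁) := by rw [h1]; rfl
    have := snd_le_of_up h2 hw hy
    have h3 := w.2.isLt
    simp only [Fin.le_def] at this
    exact ⟨this, Nat.lt_succ_iff.1 h3⟩
  · exact ⟨_, hq, rfl⟩
  · exact ⟨_, hk, rfl⟩

namespace EndConfig

variable (c : EndConfig a xA y xP j₀ j₁)
include c

/-- The monomials (3,0) and (3,1) tie only at the height of the end. Strictly above it (3,0) has
been beaten, and (3,1) alone remains. -/
theorem active_edge (hx : xA < x) {p q : ℝ × ℝ} (hq : (3, 1) ∈ active a q) (hy : y < q.2)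
    (hp : p ∈ openSegment ℝ (x, y) q) : active a p = {(3, 1)} := by
  rw [active_openSegment (u := (3, 1)) (by rw [c.active_ray hx]; simp) hq hp, c.active_ray hx]
  ext w
  simp only [mem_inter_iff, mem_insert_iff, mem_singleton_iff]
  constructor
  · rintro ⟨rfl | rfl, h⟩
    · have e1 : (3, 0) ∈ active a (x, y) := by rw [c.active_ray hx]; simp
      have e2 : (3, 1) ∈ active a (x, y) := by rw [c.active_ray hx]; simp
      have h1 := term_eq_of_mem e1 e2
      have h2 := term_eq_of_mem h hq
      simp only [term] at h1 h2
      norm_num at h1 h2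
      linarith
    · rfl
  · rintro rfl; exact ⟨Or.inr rfl, hq⟩

theorem rest_eq_up (hx : xA < x) (hl : 0 < l) (hv : active a (x + l, y + l) = {(3, 1)}) :
    rest a ((x, y), l) = curve a ∩ upw (x + l, y + l) := by
  rw [rest, vert0_mk, vert1_mk hl.le]
  apply Subset.antisymm
  · rintro p ⟨hc, ((hp | rfl) | hp) | hp⟩
    · exact absurd hc (not_mem_curve_of_eq_singleton
        (c.active_edge hx (by rw [hv]; rfl) (by simpa using hl) hp))
    · exact absurd hc (not_mem_curve_of_eq_singleton hv)
    · obtain ⟨z, w⟩ := p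
      obtain ⟨hw, hz⟩ := hp
      simp only at hw hz
      subst hw
      refine absurd hc (not_mem_curve_of_eq_singleton (u := (3, 1)) ?_)
      rw [active_right (u := (3, 1)) (by rw [hv]; rfl) rfl hz, hv]
      ext u
      simp only [mem_sep_iff, mem_singleton_iff]
      exact ⟨fun h => h.1, fun h => ⟨h, by rw [h]⟩⟩
    · exact ⟨hc, hp⟩
  · rintro p ⟨hc, hp⟩
    exact ⟨hc, Or.inr hp⟩

theorem componentMult_up (hl : 0 ≤ l) :
    componentMult a (lineCoeff ((x, y), l)) (curve a ∩ upw (x + l, y + l)) =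
      ∑ᶠ q ∈ curve a ∩ upw (x + l, y + l), width ydeg (active a q) := by
  apply finsum_mem_congr rfl
  rintro q ⟨-, hq⟩
  exact stableMult_up (t := ((x, y), l)) hl (by rw [vert1_mk hl]; exact hq)

theorem isTritangent_of_upGood (hx : xA < x) (hl : 0 < l)
    (hv : active a (x + l, y + l) = {(3, 1)}) (h : UpGood a (x + l, y + l)) :
    IsTritangent a ((x, y), l) := by
  apply c.isTritangent_of_rest hx hl
  · rw [c.rest_eq_up hx hl hv]; exact h.1
  · rw [c.rest_eq_up hx hl hv, c.componentMult_up hl.le]; exact h.2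

theorem upGood_of_isTritangent (hx : xA < x) (hl : 0 < l)
    (hv : active a (x + l, y + l) = {(3, 1)}) (h : IsTritangent a ((x, y), l)) :
    UpGood a (x + l, y + l) := by
  have := c.rest_of_isTritangent hx hl h
  rw [c.rest_eq_up hx hl hv, c.componentMult_up hl.le] at this
  exact this

/-- For l = 0 the right leg lies in the end as well, so the second tangency is the whole ray from A.
It still has multiplicity one at A and one at the 4-valent vertex and nothing elsewhere. -/
theorem upGood_of_isTritangent_zero (hx : xA < x) (h : IsTritangent a ((x, y), 0)) :
    UpGood a (x, y) := by
  set R : Set (ℝ × ℝ) := {p | p.2 = y ∧ xA ≤ p.1} with hR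
  have hX : curve a ∩ curve (lineCoeff ((x, y), 0)) = {(xP, y)} ∪ R ∪ (curve a ∩ upw (x, y)) := by
    have h1 := c.curve_inter_lft hx
    have h2 := c.curve_inter_dwn hx
    rw [curve_line (t := ((x, y), 0)) le_rfl, vert1_mk le_rfl, vert0_mk, add_zero, add_zero,
      segment_same]
    ext ⟨z, w⟩
    constructor
    · rintro ⟨hc, (((hp | hp) | hp) | hp) | hp⟩
      · have : (z, w) ∈ curve a ∩ lft (x, y) := ⟨hc, hp⟩
        rw [h1] at this
        rcases this with h | h
        · exact Or.inl (Or.inl h)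
        · exact Or.inl (Or.inr ⟨h.1, h.2.1⟩)
      · have : (z, w) ∈ curve a ∩ dwn (x, y) := ⟨hc, hp⟩
        rw [h2] at this
        exact this.elim
      · exact Or.inl (Or.inr ⟨hp.1, hx.le.trans hp.2.le⟩)
      · exact Or.inr ⟨hc, hp⟩
      · rw [mem_singleton_iff, Prod.mk.injEq] at hp
        exact Or.inl (Or.inr ⟨hp.2, hx.le.trans hp.1.ge⟩)
    · rintro ((hp | ⟨hw, hz⟩) | hp)
      · have : (z, w) ∈ curve a ∩ lft (x, y) := by rw [h1]; exact Or.inl hp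
        exact ⟨this.1, Or.inl (Or.inl (Or.inl (Or.inl this.2)))⟩
      · simp only at hw hz
        subst hw
        refine ⟨c.mem_curve hz, ?_⟩
        rcases lt_trichotomy z x with h | rfl | h
        · exact Or.inl (Or.inl (Or.inl (Or.inl ⟨rfl, h⟩)))
        · exact Or.inr rfl
        · exact Or.inl (Or.inl (Or.inr ⟨rfl, h⟩))
      · exact ⟨hp.1, Or.inl (Or.inr hp.2)⟩
  obtain ⟨ε, hε, hgap⟩ := c.exists_gap hx
  have hup : curve a ∩ upw (x, y) = curve a ∩ {p | p.1 = x ∧ y + ε ≤ p.2} := by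
    ext ⟨z, w⟩
    constructor
    · rintro ⟨hc, hz, hw⟩
      simp only at hz hw
      subst hz
      refine ⟨hc, rfl, ?_⟩
      by_contra hlt
      simp only [not_le] at hlt
      have := (hgap (w - y) (by linarith) (by linarith)).2
      rw [add_sub_cancel] at this
      exact not_mem_curve_of_eq_singleton this hc
    · rintro ⟨hc, hz, hw⟩
      exact ⟨hc, hz, by simp only at hw ⊢; linarith⟩
  have hclosed : IsClosed (curve a ∩ upw (x, y)) := by
    rw [hup]
    exact (isClosed_curve a).inter ((isClosed_eq continuous_fst continuous_const).inter
      (isClosed_le continuous_const continuous_snd))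
  have hRc : IsClosed R := (isClosed_eq continuous_snd continuous_const).inter
      (isClosed_le continuous_const continuous_fst)
  have hRconn : IsConnected R := by
    refine ⟨⟨(xA, y), rfl, le_rfl⟩, Convex.isPreconnected ?_⟩
    rintro ⟨z, w⟩ ⟨h1, h2⟩ ⟨z', w'⟩ ⟨h3, h4⟩ α β hα hβ hαβ
    simp only at h1 h2 h3 h4
    subst h1 h3
    refine ⟨?_, ?_⟩
    · simp only [Prod.smul_mk, smul_eq_mul, Prod.mk_add_mk]
      rw [← add_mul, hαβ, one_mul]
    · simp only [Prod.smul_mk, smul_eq_mul, Prod.mk_add_mk]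
      obtain rfl : α = 1 - β := by linarith
      nlinarith
  have d1 : Disjoint {(xP, y)} R := by
    rw [disjoint_singleton_left]
    rintro ⟨-, h⟩
    exact absurd c.lt (not_lt.2 h)
  have d2 : Disjoint {(xP, y)} (curve a ∩ upw (x, y)) := by
    rw [disjoint_singleton_left]
    rintro ⟨-, -, h⟩
    exact lt_irrefl _ h
  have d3 : Disjoint R (curve a ∩ upw (x, y)) := by
    rw [Set.disjoint_left]
    rintro p ⟨h1, -⟩ ⟨-, -, h⟩
    simp only at h
    linarith
  have mR : componentMult a (lineCoeff ((x, y), 0)) R = 2 := by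
    rw [componentMult, finsum_mem_eq_two (C := R) (x := (xA, y)) (y := (x, y)) ⟨rfl, le_rfl⟩
      ⟨rfl, hx.le⟩ (by simp [hx.ne])]
    · rw [c.stableMult_end hx le_rfl, stableMult_left (t := ((x, y), 0)) (p := (xA, y)) le_rfl
        ⟨rfl, hx⟩, c.vertex, width_vertex]
      norm_num
    · rintro ⟨z, w⟩ ⟨hw, hz⟩ h1 h2
      simp only at hw hz
      subst hw
      have h3' : xA < z := lt_of_le_of_ne hz fun e => h1 (by rw [e])
      rcases lt_trichotomy z x with h | rfl | h
      · rw [stableMult_left (t := ((x, w), 0)) (p := (z, w)) le_rfl ⟨rfl, h⟩, c.active_ray h3',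
          width_end]
      · exact absurd rfl h2
      · rw [stableMult_right (t := ((x, w), 0)) (p := (z, w)) le_rfl
          (by rw [vert1_mk le_rfl]; exact ⟨by simp, by simpa using h⟩), c.active_ray h3',
          width_end]
  have := h.third_component hX isClosed_singleton hRc hclosed d1 d2 d3 isConnected_singleton
    hRconn (c.componentMult_cross hx.le le_rfl) mR
  have hm := componentMult_up (x := x) (l := 0) c le_rfl
  rw [add_zero, add_zero] at hm
  rw [hm] at this
  exact this

end EndConfig

end


/-! ## Local structure and parts of the intersection -/

section Local

variable {n : ℕ}

/-- Near `p` the active exponents are those of `p` of maximal slope. -/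
theorem exists_local (a : Exps n → ℝ) (x y : ℝ) : ∃ δ > 0, ∀ d e : ℝ, |d| < δ → |e| < δ →
    active a (x + d, y + e) ⊆ active a (x, y) ∧
    ∀ u ∈ active a (x, y), (∀ w ∈ active a (x, y), slope w (d, e) ≤ slope u (d, e)) →
      active a (x + d, y + e) = {w ∈ active a (x, y) | slope w (d, e) = slope u (d, e)} := by
  have h := eventually_active_subset a (x, y)
  rw [Metric.eventually_nhds_iff] at h
  obtain ⟨δ, hδ, h⟩ := h
  refine ⟨δ, hδ, fun d e hd he => ?_⟩
  have hs : active a (x + d, y + e) ⊆ active a (x, y) := by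
    apply h
    rw [Prod.dist_eq, Real.dist_eq, Real.dist_eq]
    simpa using ⟨hd, he⟩
  refine ⟨hs, fun u hu hmax => ?_⟩
  have eq : ((x + d, y + e) : ℝ × ℝ) = (x, y) + (1 : ℝ) • (d, e) := by simp
  obtain ⟨v, hv⟩ := active_nonempty a (x + d, y + e)
  have hvp := hs hv
  have huv : slope u (d, e) = slope v (d, e) := by
    rw [eq] at hv
    exact le_antisymm (slope_le_of_ray hu one_pos hv) (hmax v hvp)
  ext w
  constructor
  · intro hw
    refine ⟨hs hw, ?_⟩
    have h1 := term_eq_of_mem hv hw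
    have h2 := term_eq_of_mem hvp (hs hw)
    rw [eq, term_add_smul, term_add_smul] at h1
    linarith
  · rintro ⟨hw, he⟩
    apply mem_active_of_le hv
    have h2 := term_eq_of_mem hvp hw
    rw [eq, term_add_smul, term_add_smul]
    linarith

theorem curve_inter_rgt_eq_empty {a : Exps 3 → ℝ} {v : ℝ × ℝ} {u : Exps 3} (hu : u ∈ active a v)
    (h3 : u.1 = 3) (h : ∀ w ∈ active a v, w.1 = 3 → w = u) : curve a ∩ rgt v = ∅ := by
  obtain ⟨x, y⟩ := v
  rw [eq_empty_iff_forall_notMem]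
  rintro ⟨z, w⟩ ⟨hc, hw, hz⟩
  simp only at hw hz
  subst hw
  refine not_mem_curve_of_eq_singleton (u := u) ?_ hc
  rw [active_right hu h3 hz]
  ext t
  simp only [mem_sep_iff, mem_singleton_iff]
  exact ⟨fun ht => h t ht.1 ht.2, fun ht => by rw [ht]; exact ⟨hu, h3⟩⟩

theorem curve_inter_upw_eq_empty {a : Exps 3 → ℝ} {v : ℝ × ℝ} {u : Exps 3} (hu : u ∈ active a v)
    (h3 : u.2 = 3) (h : ∀ w ∈ active a v, w.2 = 3 → w = u) : curve a ∩ upw v = ∅ := by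
  obtain ⟨x, y⟩ := v
  rw [eq_empty_iff_forall_notMem]
  rintro ⟨z, w⟩ ⟨hc, hw, hz⟩
  simp only at hw hz
  subst hw
  refine not_mem_curve_of_eq_singleton (u := u) ?_ hc
  rw [active_up hu h3 hz]
  ext t
  simp only [mem_sep_iff, mem_singleton_iff]
  exact ⟨fun ht => h t ht.1 ht.2, fun ht => by rw [ht]; exact ⟨hu, h3⟩⟩

theorem curve_inter_dwn_eq_empty {a : Exps 3 → ℝ} {v : ℝ × ℝ} {u : Exps 3} (hu : u ∈ active a v)
    (h3 : u.2 = 0) (h : ∀ w ∈ active a v, w.2 = 0 → w = u) : curve a ∩ dwn v = ∅ := by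
  obtain ⟨x, y⟩ := v
  rw [eq_empty_iff_forall_notMem]
  rintro ⟨z, w⟩ ⟨hc, hw, hz⟩
  simp only at hw hz
  subst hw
  refine not_mem_curve_of_eq_singleton (u := u) ?_ hc
  rw [active_down hu h3 hz]
  ext t
  simp only [mem_sep_iff, mem_singleton_iff]
  exact ⟨fun ht => h t ht.1 ht.2, fun ht => by rw [ht]; exact ⟨hu, h3⟩⟩

/-- A descending leg crossing a single edge. -/
theorem curve_inter_down {a : Exps 3 → ℝ} {P v : ℝ × ℝ} {u w : Exps 3} (hP : active a P = {u, w})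
    (h0 : u.2 = 0) (hw0 : w.2 ≠ 0) (hv : w ∈ active a v) (hv' : u ∉ active a v) (hy : P.1 = v.1)
    (hx : P.2 < v.2) : curve a ∩ dwn v = {P} := by
  obtain ⟨x, yP⟩ := P
  obtain ⟨x', yv⟩ := v
  simp only at hy hx
  subst hy
  have huw : u ≠ w := fun h => hw0 (h ▸ h0)
  apply Subset.antisymm
  · rintro ⟨x', y⟩ ⟨hc, hy', hx'⟩
    simp only at hy' hx'
    subst hy'
    rcases lt_trichotomy y yP with h | rfl | h
    · refine absurd hc (not_mem_curve_of_eq_singleton (u := u) ?_)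
      rw [active_down (u := u) (by rw [hP]; simp) h0 h, hP]
      ext z
      simp only [mem_sep_iff, mem_insert_iff, mem_singleton_iff]
      constructor
      · rintro ⟨rfl | rfl, h⟩
        · rfl
        · exact absurd h hw0
      · rintro rfl; exact ⟨Or.inl rfl, h0⟩
    · rfl
    · refine absurd hc (not_mem_curve_of_eq_singleton (u := w) ?_)
      rw [active_openSegment (u := w) (by rw [hP]; simp) hv (mem_openSegment_vertical h hx'), hP]
      ext z
      simp only [mem_inter_iff, mem_insert_iff, mem_singleton_iff]
      constructor
      · rintro ⟨rfl | rfl, h⟩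
        · exact absurd h hv'
        · rfl
      · rintro rfl; exact ⟨Or.inr rfl, hv⟩
  · rintro _ rfl
    exact ⟨mem_curve_of_mem (u := u) (v := w) (by rw [hP]; simp) (by rw [hP]; simp) huw, rfl, hx⟩

theorem curve_inter_line (a : Exps 3 → ℝ) {t : Params} (h : 0 ≤ t.2) :
    curve a ∩ curve (lineCoeff t) = curve a ∩ lft (vert0 t) ∪ curve a ∩ dwn (vert0 t) ∪
      curve a ∩ rgt (vert1 t) ∪ curve a ∩ upw (vert1 t) ∪
        curve a ∩ segment ℝ (vert0 t) (vert1 t) := by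
  rw [curve_line h]
  simp only [inter_union_distrib_left]

theorem mem_segment_diag_iff {x y l : ℝ} (hl : 0 ≤ l) {p : ℝ × ℝ} :
    p ∈ segment ℝ (x, y) (x + l, y + l) ↔ ∃ r, 0 ≤ r ∧ r ≤ l ∧ p = (x + r, y + r) := by
  constructor
  · rintro ⟨α, β, hα, hβ, hαβ, rfl⟩
    obtain rfl : α = 1 - β := by linarith
    refine ⟨β * l, mul_nonneg hβ hl, by nlinarith, ?_⟩
    simp only [Prod.smul_mk, smul_eq_mul, Prod.mk_add_mk, Prod.mk.injEq]
    constructor <;> ring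
  · rintro ⟨r, h0, h1, rfl⟩
    exact mem_segment_diag h0 h1

theorem isClosed_curve_inter_upw {a : Exps 3 → ℝ} {v : ℝ × ℝ} (hv : v ∉ curve a) :
    IsClosed (curve a ∩ upw v) := by
  have : curve a ∩ upw v = curve a ∩ {p | p.1 = v.1 ∧ v.2 ≤ p.2} := by
    ext p
    constructor
    · rintro ⟨h, h1, h2⟩; exact ⟨h, h1, h2.le⟩
    · rintro ⟨h, h1, h2⟩
      refine ⟨h, h1, lt_of_le_of_ne h2 fun e => hv ?_⟩
      rwa [show v = p from Prod.ext h1.symm e]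
  rw [this]
  exact (isClosed_curve a).inter ((isClosed_eq continuous_fst continuous_const).inter
    (isClosed_le continuous_const continuous_snd))

/-- A tritangent with one tangency on the left leg, one on the upper leg and one between. -/
theorem isTritangent_of_parts {a : Exps 3 → ℝ} {x y l : ℝ} {P : ℝ × ℝ} {D : Set (ℝ × ℝ)}
    (hl : 0 < l) (hP : curve a ∩ lft (x, y) = {P}) (wP : width xdeg (active a P) = 2)
    (hv : active a (x + l, y + l) = {(3, 1)}) (hU : UpGood a (x + l, y + l))
    (hd : curve a ∩ dwn (x, y) ∪ curve a ∩ segment ℝ (x, y) (x + l, y + l) = D)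
    (hDc : IsClosed D) (hD : IsConnected D)
    (mD : componentMult a (lineCoeff ((x, y), l)) D = 2) : IsTritangent a ((x, y), l) := by
  have hv' : (x + l, y + l) ∉ curve a := not_mem_curve_of_eq_singleton hv
  have hPl : P ∈ lft (x, y) := (hP.ge (mem_singleton P)).2
  have hr : curve a ∩ rgt (x + l, y + l) = ∅ :=
    curve_inter_rgt_eq_empty (u := (3, 1)) (by rw [hv]; rfl) rfl
      (by rw [hv]; rintro w rfl -; rfl)
  have hX : curve a ∩ curve (lineCoeff ((x, y), l)) = {P} ∪ D ∪ curve a ∩ upw (x + l, y + l) := by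
    rw [curve_inter_line a (t := ((x, y), l)) hl.le, vert0_mk, vert1_mk hl.le, hP, hr,
      union_empty, ← hd, ← union_assoc, union_right_comm]
  refine isTritangent_of_three hX isClosed_singleton hDc (isClosed_curve_inter_upw hv')
    ?_ ?_ ?_ isConnected_singleton hD hU.1 ?_ mD ?_
  · rw [disjoint_singleton_left, ← hd]
    rintro (⟨-, h, -⟩ | ⟨-, h⟩)
    · have := hPl.2
      simp only at this h
      linarith
    rw [mem_segment_diag_iff hl.le] at h
    obtain ⟨r, h0, h1, rfl⟩ := h
    have := hPl.2
    simp only at this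
    linarith
  · rw [disjoint_singleton_left]
    rintro ⟨-, h, -⟩
    have := hPl.2
    simp only at this h
    linarith
  · rw [Set.disjoint_left, ← hd]
    rintro p (⟨-, h, -⟩ | ⟨-, h⟩) ⟨-, h1, h2⟩
    · simp only at h h1
      linarith
    rw [mem_segment_diag_iff hl.le] at h
    obtain ⟨r, h0, h3, rfl⟩ := h
    simp only at h1 h2
    linarith
  · rw [componentMult, finsum_mem_singleton, stableMult_left (t := ((x, y), l)) (p := P) hl.le hPl,
      wP]
  · rw [← hU.2]
    apply finsum_mem_congr rfl
    rintro q ⟨-, hq⟩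
    exact stableMult_up (t := ((x, y), l)) hl.le (by rw [vert1_mk hl.le]; exact hq)

end Local

/-! ### Lower vertices at A and just off the end, when the vertex of the end is dual to (2,j₁) with
j₁ ≤ 1 -/

section Config

variable {a : Exps 3 → ℝ} {xA y xP x l : ℝ} {j₀ j₁ : Fin 4}

namespace EndConfig

variable (c : EndConfig a xA y xP j₀ j₁)
include c

/-- The crossing on the left leg persists near the vertex. -/
theorem exists_cross : ∃ δ > 0, ∀ d e : ℝ, |d| < δ → |e| < δ →
    (2, j₁) ∈ active a (xA + d, y + e) → ∃ P : ℝ × ℝ, P.1 < xA + d ∧ P.2 = y + e ∧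
      active a P = {(0, j₀), (2, j₁)} ∧ curve a ∩ lft (xA + d, y + e) = {P} := by
  obtain ⟨δ₁, h1, H1⟩ := exists_local a xP y
  obtain ⟨δ₂, h2, H2⟩ := exists_local a xA y
  -- The edge dual to (0,j₀), (2,j₁) has direction (k, 1): raising the leg by `e` shifts the
  -- crossing by `k * e`.
  set k : ℝ := (((j₀ : ℕ) : ℝ) - ((j₁ : ℕ) : ℝ)) / 2 with hk
  have hkb : |k| ≤ 2 := by
    have e0 := exps_snd_le (0, j₀)
    have e1 := exps_snd_le (0, j₁)
    simp only at e0 e1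
    rw [abs_le]
    constructor <;> simp only [hk] <;>
      linarith [Nat.cast_nonneg (α := ℝ) (j₀ : ℕ), Nat.cast_nonneg (α := ℝ) (j₁ : ℕ)]
  have hg : 0 < xA - xP := sub_pos.2 c.lt
  refine ⟨min (min (δ₁ / 2) δ₂) ((xA - xP) / 4), by positivity, fun d e hd he hm => ?_⟩
  obtain ⟨⟨he1, he2⟩, he3⟩ := (lt_min_iff.1 he).imp_left lt_min_iff.1
  obtain ⟨⟨hd1, hd2⟩, hd3⟩ := (lt_min_iff.1 hd).imp_left lt_min_iff.1
  have hke : |k * e| < 2 * min (δ₁ / 2) ((xA - xP) / 4) := by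
    rw [abs_mul]
    have : |k| * |e| ≤ 2 * |e| := mul_le_mul_of_nonneg_right hkb (abs_nonneg e)
    have h4 : |e| < min (δ₁ / 2) ((xA - xP) / 4) := lt_min he1 he3
    linarith
  have hke1 : |k * e| < δ₁ := by
    have := min_le_left (δ₁ / 2) ((xA - xP) / 4); linarith
  have hke2 : |k * e| < (xA - xP) / 2 := by
    have := min_le_right (δ₁ / 2) ((xA - xP) / 4); linarith
  have hP : active a (xP + k * e, y + e) = {(0, j₀), (2, j₁)} := by
    rw [(H1 (k * e) e hke1 (by linarith)).2 (0, j₀) (by rw [c.cross]; simp), c.cross]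
    · ext w
      simp only [mem_sep_iff, mem_insert_iff, mem_singleton_iff]
      refine ⟨fun h => h.1, fun h => ⟨h, ?_⟩⟩
      rcases h with rfl | rfl
      · rfl
      · simp only [slope_mk, hk]; norm_num; ring
    · rw [c.cross]
      rintro w (rfl | rfl)
      · rfl
      · apply le_of_eq; simp only [slope_mk, hk]; norm_num; ring
  have hlt : xP + k * e < xA + d := by
    have := (abs_lt.1 hke2).2
    have := (abs_lt.1 hd3).1
    linarith
  refine ⟨(xP + k * e, y + e), hlt, rfl, hP, ?_⟩
  refine curve_inter_left hP rfl (by simp) hm ?_ rfl hlt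
  intro h
  have := (H2 d e hd2 (by linarith)).1 h
  rw [c.vertex] at this
  simp at this

theorem vertex_mem_curve : (xA, y) ∈ curve a :=
  mem_curve_of_mem (u := (3, 0)) (v := (3, 1)) (by rw [c.vertex]; simp)
          (by rw [c.vertex]; simp) (by simp)

theorem diag_above {r r' : ℝ} (hv : (3, 1) ∈ active a (xA + r, y + r))
    (h2 : (2, j₁) ∉ active a (xA + r, y + r)) (h0 : 0 < r') (h1 : r' < r) :
    active a (xA + r', y + r') = {(3, 1)} := by
  rw [active_openSegment (u := (3, 1)) (by rw [c.vertex]; simp) hv (mem_openSegment_diag h0 h1),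
    c.vertex]
  ext w
  simp only [mem_inter_iff, mem_insert_iff, mem_singleton_iff]
  constructor
  · rintro ⟨rfl | rfl | rfl, h⟩
    · exact absurd h h2
    · have e2 : (3, 1) ∈ active a (xA, y) := by rw [c.vertex]; simp
      have e1 : (3, 0) ∈ active a (xA, y) := by rw [c.vertex]; simp
      have h1 := term_eq_of_mem e1 e2
      have h2 := term_eq_of_mem h hv
      simp only [term] at h1 h2
      norm_num at h1 h2
      linarith
    · rfl
  · rintro rfl; exact ⟨by simp, hv⟩

theorem curve_inter_lft_vertex : curve a ∩ lft (xA, y) = {(xP, y)} :=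
  curve_inter_left c.cross rfl (by simp) (by rw [c.vertex]; simp) (by rw [c.vertex]; simp)
      rfl c.lt

theorem curve_inter_dwn_vertex (h : j₁ ≠ 0) : curve a ∩ dwn (xA, y) = ∅ := by
  apply curve_inter_dwn_eq_empty (u := (3, 0)) (by rw [c.vertex]; simp) rfl
  rw [c.vertex]
  rintro w (rfl | rfl | rfl) hw
  · exact absurd hw h
  · rfl
  · simp at hw

/-- The lower vertex moves along the diagonal through the vertex `(xA, y)`. -/
theorem isTritangent_diag_zero (hj : j₁ = 0) : ∃ δ > 0, ∀ s, 0 < s → s < δ →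
    active a (xA - s, y - s) = {(2, 0)} ∧ ∀ r, 0 < r → active a (xA + r, y + r) = {(3, 1)} →
      UpGood a (xA + r, y + r) → IsTritangent a ((xA - s, y - s), r + s) := by
  subst hj
  obtain ⟨δ₁, h1, H1⟩ := exists_local a xA y
  obtain ⟨δ₂, h2, H2⟩ := c.exists_cross
  have hloc : ∀ s, 0 < s → s < δ₁ → active a (xA + -s, y + -s) = {(2, 0)} := by
    intro s h0 hs
    have habs : |-s| < δ₁ := by rwa [abs_neg, abs_of_pos h0]
    rw [(H1 (-s) (-s) habs habs).2 (2, 0) (by rw [c.vertex]; simp), c.vertex]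
    · ext w
      simp only [mem_sep_iff, mem_insert_iff, mem_singleton_iff]
      constructor
      · rintro ⟨rfl | rfl | rfl, h⟩
        · rfl
        · simp [slope_mk] at h; linarith
        · simp [slope_mk] at h; linarith
      · rintro rfl; simp
    · rw [c.vertex]
      rintro w (rfl | rfl | rfl) <;> simp [slope_mk] <;> linarith
  refine ⟨min δ₁ δ₂, lt_min h1 h2, fun s h0 hs => ?_⟩
  have hs1 : s < δ₁ := hs.trans_le (min_le_left _ _)
  have hs2 : s < δ₂ := hs.trans_le (min_le_right _ _)
  have hv0 := hloc s h0 hs1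
  refine ⟨by simpa only [sub_eq_add_neg] using hv0, fun r hr hv hU => ?_⟩
  obtain ⟨P, hP1, hP2, hP3, hP4⟩ := H2 (-s) (-s) (by rwa [abs_neg, abs_of_pos h0])
    (by rwa [abs_neg, abs_of_pos h0]) (by rw [hv0]; rfl)
  simp only [← sub_eq_add_neg] at hP4 hv0 hloc
  have ex : xA - s + (r + s) = xA + r := by ring
  have ey : y - s + (r + s) = y + r := by ring
  have hD : curve a ∩ segment ℝ (xA - s, y - s) (xA - s + (r + s), y - s + (r + s)) =
      {(xA, y)} := by
    apply Subset.antisymm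
    · rintro p ⟨hc, hp⟩
      rw [mem_segment_diag_iff (by linarith)] at hp
      obtain ⟨q, hq0, hq1, rfl⟩ := hp
      rcases lt_trichotomy q s with h | rfl | h
      · refine absurd hc (not_mem_curve_of_eq_singleton (u := (2, 0)) ?_)
        have := hloc (s - q) (by linarith) (by linarith)
        rw [← this]; congr 2 <;> ring
      · simp
      · refine absurd hc (not_mem_curve_of_eq_singleton (u := (3, 1)) ?_)
        rcases hq1.eq_or_lt with rfl | hq1
        · rw [ex, ey]; exact hv
        · have := c.diag_above (r := r) (r' := q - s) (by rw [hv]; rfl) (by rw [hv]; simp)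
            (by linarith) (by linarith)
          rw [← this]; congr 2 <;> ring
    · rintro _ rfl
      refine ⟨c.vertex_mem_curve, ?_⟩
      rw [mem_segment_diag_iff (by linarith)]
      exact ⟨s, h0.le, by linarith, by simp⟩
  have hd : curve a ∩ dwn (xA - s, y - s) = ∅ :=
    curve_inter_dwn_eq_empty (u := (2, 0)) (by rw [hv0]; rfl) rfl
      (by rw [hv0]; rintro w rfl -; rfl)
  apply isTritangent_of_parts (by linarith) hP4 (by rw [hP3, width_cross])
    (by rw [ex, ey]; exact hv) (by rw [ex, ey]; exact hU) (by rw [hd, empty_union, hD])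
    isClosed_singleton isConnected_singleton
  -- The bounded edge passes through A, where the total degrees 2, 3, 4 of (2,0), (3,0), (3,1) give
  -- multiplicity two.
  · rw [componentMult, finsum_mem_singleton, stableMult_edge (t := ((xA - s, y - s), r + s))
      (by simp only; linarith) (by simp only; linarith), c.vertex,
      width_eq (m := 2) (M := 4)]
    · norm_num
    · rintro w (rfl | rfl | rfl) <;> simp [tdeg]
    · exact ⟨(2, 0), by simp, rfl⟩
    · exact ⟨(3, 1), by simp, rfl⟩
    · rw [vert0_mk, vert1_mk (by linarith)]
      have := mem_openSegment_diag (x := xA - s) (y := y - s) (l := r + s) (s := s) h0 (by linarith)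
      simpa using this

/-- Here the edge of Γ dual to (2,1), (3,0) has slope one itself, and v₀ moves down along it. The
middle tangency is the segment from v₀ to A, with multiplicity one at each end. -/
theorem isTritangent_diag_one (hj : j₁ = 1) : ∃ δ > 0, ∀ s, 0 < s → s < δ →
    active a (xA - s, y - s) = {(2, 1), (3, 0)} ∧ ∀ r, 0 < r →
      active a (xA + r, y + r) = {(3, 1)} →
        UpGood a (xA + r, y + r) → IsTritangent a ((xA - s, y - s), r + s) := by
  subst hj
  obtain ⟨δ₁, h1, H1⟩ := exists_local a xA y
  obtain ⟨δ₂, h2, H2⟩ := c.exists_cross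
  have hloc : ∀ s, 0 < s → s < δ₁ → active a (xA + -s, y + -s) = {(2, 1), (3, 0)} := by
    intro s h0 hs
    have habs : |-s| < δ₁ := by rwa [abs_neg, abs_of_pos h0]
    rw [(H1 (-s) (-s) habs habs).2 (2, 1) (by rw [c.vertex]; simp), c.vertex]
    · ext w
      simp only [mem_sep_iff, mem_insert_iff, mem_singleton_iff]
      constructor
      · rintro ⟨rfl | rfl | rfl, h⟩
        · simp
        · simp
        · simp [slope_mk] at h; linarith
      · rintro (rfl | rfl)
        · simp
        · simp [slope_mk]; ring
    · rw [c.vertex]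
      rintro w (rfl | rfl | rfl) <;> simp [slope_mk] <;> linarith
  refine ⟨min δ₁ δ₂, lt_min h1 h2, fun s h0 hs => ?_⟩
  have hs1 : s < δ₁ := hs.trans_le (min_le_left _ _)
  have hs2 : s < δ₂ := hs.trans_le (min_le_right _ _)
  have hv0 := hloc s h0 hs1
  refine ⟨by simpa only [sub_eq_add_neg] using hv0, fun r hr hv hU => ?_⟩
  obtain ⟨P, hP1, hP2, hP3, hP4⟩ := H2 (-s) (-s) (by rwa [abs_neg, abs_of_pos h0])
    (by rwa [abs_neg, abs_of_pos h0]) (by rw [hv0]; simp)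
  simp only [← sub_eq_add_neg] at hP4 hv0 hloc
  have ex : xA - s + (r + s) = xA + r := by ring
  have ey : y - s + (r + s) = y + r := by ring
  have hneg : ∀ q, q < s → 0 ≤ q → active a (xA - s + q, y - s + q) = {(2, 1), (3, 0)} := by
    intro q hq h
    have := hloc (s - q) (by linarith) (by linarith)
    rw [← this]; congr 2 <;> ring
  have hD : curve a ∩ segment ℝ (xA - s, y - s) (xA - s + (r + s), y - s + (r + s)) =
      segment ℝ (xA - s, y - s) (xA - s + s, y - s + s) := by
    apply Subset.antisymm
    · rintro p ⟨hc, hp⟩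
      rw [mem_segment_diag_iff (by linarith)] at hp ⊢
      obtain ⟨q, hq0, hq1, rfl⟩ := hp
      refine ⟨q, hq0, ?_, rfl⟩
      by_contra h
      push Not at h
      refine absurd hc (not_mem_curve_of_eq_singleton (u := (3, 1)) ?_)
      rcases hq1.eq_or_lt with rfl | hq1
      · rw [ex, ey]; exact hv
      · have := c.diag_above (r := r) (r' := q - s) (by rw [hv]; rfl) (by rw [hv]; simp)
          (by linarith) (by linarith)
        rw [← this]; congr 2 <;> ring
    · intro p hp
      rw [mem_inter_iff, mem_segment_diag_iff (by linarith)]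
      rw [mem_segment_diag_iff h0.le] at hp
      obtain ⟨q, hq0, hq1, rfl⟩ := hp
      refine ⟨?_, q, hq0, by linarith, rfl⟩
      rcases hq1.eq_or_lt with rfl | hq1
      · simpa using c.vertex_mem_curve
      · exact mem_curve_of_mem (u := (2, 1)) (v := (3, 0)) (by rw [hneg q hq1 hq0]; simp)
          (by rw [hneg q hq1 hq0]; simp) (by simp)
  have hd : curve a ∩ dwn (xA - s, y - s) = ∅ := by
    apply curve_inter_dwn_eq_empty (u := (3, 0)) (by rw [hv0]; simp) rfl
    rw [hv0]
    rintro w (rfl | rfl) h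
    · simp at h
    · rfl
  apply isTritangent_of_parts (by linarith) hP4 (by rw [hP3, width_cross])
    (by rw [ex, ey]; exact hv) (by rw [ex, ey]; exact hU) (by rw [hd, empty_union, hD])
    (isClosed_segment _ _) (isConnected_segment _ _)
  · have hl : (0 : ℝ) < r + s := by linarith
    rw [componentMult, finsum_mem_eq_two (x := (xA - s, y - s)) (y := (xA - s + s, y - s + s))
      (left_mem_segment _ _ _) (right_mem_segment _ _ _) (by simp [h0.ne'])]
    · rw [stableMult_edge (t := ((xA - s, y - s), r + s)) (p := (xA - s + s, y - s + s))
        hl.le hl.ne' (by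
        rw [vert0_mk, vert1_mk hl.le]; exact mem_openSegment_diag h0 (by linarith)),
        sub_add_cancel, sub_add_cancel, c.vertex, width_eq (m := 3) (M := 4)]
      · have eS : toPlane '' ({(2, 1), (3, 0)} : Set (Exps 3)) =
            {((2 : ℝ), (1 : ℝ)), (2, 1), (2 + 1, 0), (2 + 1, 0)} := by
          simp only [image_insert_eq, image_singleton, toPlane]
          norm_num
        rw [stableMult_trapezoid hv0 (active_line_vert0 (t := ((xA - s, y - s), r + s)) hl.le rfl
          hl.ne') eS toPlane_lower (by norm_num) (by norm_num) (by norm_num) (by norm_num)]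
        norm_num
      · rintro w (rfl | rfl | rfl) <;> simp [tdeg]
      · exact ⟨(2, 1), by simp, rfl⟩
      · exact ⟨(3, 1), by simp, rfl⟩
    · intro p hp n1 n2
      rw [mem_segment_diag_iff h0.le] at hp
      obtain ⟨q, hq0, hq1, rfl⟩ := hp
      have h1 : 0 < q := lt_of_le_of_ne hq0 fun e => n1 (by simp [← e])
      have h2 : q < s := lt_of_le_of_ne hq1 fun e => n2 (by simp [e])
      rw [stableMult_edge (t := ((xA - s, y - s), r + s)) hl.le hl.ne' (by
        rw [vert0_mk, vert1_mk hl.le]; exact mem_openSegment_diag h1 (by linarith)),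
        hneg q h2 hq0, width_eq (m := 3) (M := 3)]
      · norm_num
      · rintro w (rfl | rfl) <;> simp [tdeg]
      · exact ⟨(2, 1), by simp, rfl⟩
      · exact ⟨(2, 1), by simp, rfl⟩

/-- The lower vertex lies at the vertex `(xA, y)`. -/
theorem isTritangent_vertex {r : ℝ} (hj : j₁ ≤ 1) (hr : 0 < r)
    (hv : active a (xA + r, y + r) = {(3, 1)}) (hU : UpGood a (xA + r, y + r)) :
    IsTritangent a ((xA, y), r) := by
  have hj' : ((j₁ : ℕ) : ℝ) ≤ 1 := by
    have : (j₁ : ℕ) ≤ 1 := hj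
    exact_mod_cast this
  have hj0 : (0 : ℝ) ≤ ((j₁ : ℕ) : ℝ) := Nat.cast_nonneg _
  have hD : curve a ∩ segment ℝ (xA, y) (xA + r, y + r) = {(xA, y)} := by
    apply Subset.antisymm
    · rintro p ⟨hc, hp⟩
      rw [mem_segment_diag_iff hr.le] at hp
      obtain ⟨q, hq0, hq1, rfl⟩ := hp
      rcases hq0.eq_or_lt with rfl | h
      · simp
      · refine absurd hc (not_mem_curve_of_eq_singleton (u := (3, 1)) ?_)
        rcases hq1.eq_or_lt with rfl | hq1
        · exact hv
        · exact c.diag_above (r := r) (by rw [hv]; rfl) (by rw [hv]; simp) h hq1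
    · rintro _ rfl
      exact ⟨c.vertex_mem_curve, left_mem_segment _ _ _⟩
  have mA : stableMult a (lineCoeff ((xA, y), r)) (xA, y) = 2 := by
    have eS : toPlane '' ({(2, j₁), (3, 0), (3, 1)} : Set (Exps 3)) =
        {((2 : ℝ), ((j₁ : ℕ) : ℝ)), (2, ((j₁ : ℕ) : ℝ)), (2 + 1, 0), (2 + 1, 1)} := by
      simp only [image_insert_eq, image_singleton, toPlane]
      norm_num
    rw [stableMult_trapezoid c.vertex
      (active_line_vert0 (t := ((xA, y), r)) hr.le rfl hr.ne') eS toPlane_lower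
      (by norm_num) (by norm_num) (by norm_num) (by norm_num), max_eq_left (by linarith),
      min_eq_left (by linarith)]
    ring
  have wP : width xdeg (active a (xP, y)) = 2 := by rw [c.cross, width_cross]
  -- For j₁ = 0 a vertical end dual to (2,0), (3,0) descends from A and contains the lower leg. It
  -- enlarges the component but adds no multiplicity, since both exponents have the same second
  -- coordinate.
  rcases eq_or_ne j₁ 0 with rfl | h
  · have hdn : ∀ z, z < y → active a (xA, z) = {(2, 0), (3, 0)} := by
      intro z hz
      rw [active_down (u := (3, 0)) (by rw [c.vertex]; simp) rfl hz, c.vertex]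
      ext w
      simp only [mem_sep_iff, mem_insert_iff, mem_singleton_iff]
      constructor
      · rintro ⟨rfl | rfl | rfl, h⟩ <;> simp at h ⊢
      · rintro (rfl | rfl) <;> simp
    have hd : curve a ∩ dwn (xA, y) ∪ curve a ∩ segment ℝ (xA, y) (xA + r, y + r) =
        {p | p.1 = xA ∧ p.2 ≤ y} := by
      rw [hD]
      ext ⟨z, w⟩
      constructor
      · rintro (⟨-, hz, hw⟩ | h)
        · exact ⟨hz, le_of_lt hw⟩
        · rw [mem_singleton_iff, Prod.mk.injEq] at h
          exact ⟨h.1, h.2.le⟩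
      · rintro ⟨hz, hw⟩
        simp only at hz hw
        subst hz
        rcases hw.eq_or_lt with rfl | hw
        · exact Or.inr rfl
        · refine Or.inl ⟨mem_curve_of_mem (u := (2, 0)) (v := (3, 0)) (by rw [hdn w hw]; simp)
            (by rw [hdn w hw]; simp) (by simp), rfl, hw⟩
    apply isTritangent_of_parts hr c.curve_inter_lft_vertex wP hv hU hd
    · exact (isClosed_eq continuous_fst continuous_const).inter
        (isClosed_le continuous_snd continuous_const)
    · refine ⟨⟨(xA, y), rfl, le_rfl⟩, Convex.isPreconnected ?_⟩
      exact (convex_hyperplane (f := fun p : ℝ × ℝ => p.1)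
        (LinearMap.fst ℝ ℝ ℝ).isLinear xA).inter (convex_halfSpace_le
          (f := fun p : ℝ × ℝ => p.2) (LinearMap.snd ℝ ℝ ℝ).isLinear y)
    · rw [componentMult, finsum_mem_eq_one (C := {p : ℝ × ℝ | p.1 = xA ∧ p.2 ≤ y}) (x := (xA, y))
        ⟨rfl, le_rfl⟩, mA]
      rintro ⟨z, w⟩ ⟨hz, hw⟩ hne
      simp only at hz hw
      subst hz
      have hw' : w < y := lt_of_le_of_ne hw fun e => hne (by rw [e])
      rw [stableMult_down (t := ((z, y), r)) (p := (z, w)) hr.le ⟨rfl, hw'⟩, hdn w hw',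
        width_pair (by simp [ydeg])]
      simp [ydeg]
  · apply isTritangent_of_parts hr c.curve_inter_lft_vertex wP hv hU
      (by rw [c.curve_inter_dwn_vertex h, empty_union, hD]) isClosed_singleton isConnected_singleton
    rw [componentMult, finsum_mem_singleton, mA]

end EndConfig

end Config


/-! ## Tritangents through an edge of slope one -/

theorem finsum_mem_eq_three {α : Type*} {C : Set α} {f : α → ℝ} {x y z : α} (hx : x ∈ C)
    (hy : y ∈ C) (hz : z ∈ C) (hxy : x ≠ y) (hxz : x ≠ z) (hyz : y ≠ z)
    (h : ∀ p ∈ C, p ≠ x → p ≠ y → p ≠ z → f p = 0) : ∑ᶠ p ∈ C, f p = f x + f y + f z := by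
  classical
  have : ∑ᶠ p ∈ C, f p = ∑ p ∈ {x, y, z}, f p := by
    apply finsum_mem_eq_sum_of_inter_support_eq
    ext p
    simp only [mem_inter_iff, Function.mem_support, Finset.coe_insert, Finset.coe_singleton,
      mem_insert_iff, mem_singleton_iff]
    constructor
    · rintro ⟨h1, h2⟩
      by_contra h3
      exact h2 (h p h1 (fun e => h3 ⟨Or.inl e, h2⟩) (fun e => h3 ⟨Or.inr (Or.inl e), h2⟩)
        (fun e => h3 ⟨Or.inr (Or.inr e), h2⟩))
    · rintro ⟨rfl | rfl | rfl, h2⟩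
      · exact ⟨hx, h2⟩
      · exact ⟨hy, h2⟩
      · exact ⟨hz, h2⟩
  rw [this, Finset.sum_insert (by simp [hxy, hxz]), Finset.sum_insert (by simp [hyz]),
    Finset.sum_singleton, add_assoc]

theorem IsSmooth.eq_triple {n : ℕ} {a : Exps n → ℝ} (h : IsSmooth a) {p : ℝ × ℝ} {u v w : Exps n}
    (hu : u ∈ active a p) (hv : v ∈ active a p) (hw : w ∈ active a p) (huv : u ≠ v) (huw : u ≠ w)
    (hvw : v ≠ w) : active a p = {u, v, w} := by
  symm
  refine Set.eq_of_subset_of_ncard_le ?_ ?_ (Set.toFinite _)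
  · rintro z (rfl | rfl | rfl) <;> assumption
  · rw [Set.ncard_eq_three.2 ⟨u, v, w, huv, huw, hvw, rfl⟩]
    exact (h p).1

theorem isConnected_ray_right (x y : ℝ) : IsConnected {p : ℝ × ℝ | p.2 = y ∧ x ≤ p.1} := by
  refine ⟨⟨(x, y), rfl, le_rfl⟩, Convex.isPreconnected ?_⟩
  exact (convex_hyperplane (f := fun p : ℝ × ℝ => p.2)
    (LinearMap.snd ℝ ℝ ℝ).isLinear y).inter (convex_halfSpace_ge
      (f := fun p : ℝ × ℝ => p.1) (LinearMap.fst ℝ ℝ ℝ).isLinear x)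

theorem isClosed_ray_right (x y : ℝ) : IsClosed {p : ℝ × ℝ | p.2 = y ∧ x ≤ p.1} :=
  (isClosed_eq continuous_snd continuous_const).inter
    (isClosed_le continuous_const continuous_fst)

theorem mem_segment_vertical {x y₁ y₂ : ℝ} {p : ℝ × ℝ} (h : y₁ ≤ y₂) :
    p ∈ segment ℝ (x, y₁) (x, y₂) ↔ p.1 = x ∧ y₁ ≤ p.2 ∧ p.2 ≤ y₂ := by
  obtain ⟨x', y⟩ := p
  constructor
  · rintro ⟨α, β, hα, hβ, hαβ, he⟩
    simp only [Prod.smul_mk, smul_eq_mul, Prod.mk_add_mk, Prod.mk.injEq] at he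
    obtain ⟨rfl, rfl⟩ := he
    obtain rfl : α = 1 - β := by linarith
    exact ⟨by ring, by simp only; nlinarith, by simp only; nlinarith⟩
  · rintro ⟨rfl, h1, h2⟩
    simp only at h1 h2
    rcases h1.eq_or_lt with rfl | h1
    · exact left_mem_segment _ _ _
    rcases h2.eq_or_lt with rfl | h2
    · exact right_mem_segment _ _ _
    exact openSegment_subset_segment _ _ _ (mem_openSegment_vertical h1 h2)

section Vertical

variable {a : Exps 3 → ℝ} {x y : ℝ}

/-- The vertical edge above a vertex dual to `(3,1), (2,2), (3,2)`. -/
theorem exists_vertical_edge (hs : IsSmooth a) (hB : active a (x, y) = {(3, 1), (2, 2), (3, 2)}) :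
    ∃ ρ > 0, ∃ k : Fin 4, active a (x, y + ρ) = {(2, 2), (3, 2), (k, 3)} ∧
      (∀ z, 0 < z → z < ρ → active a (x, y + z) = {(2, 2), (3, 2)}) ∧
      ∀ v, 0 ≤ v → v < ρ →
        curve a ∩ upw (x, y + v) = {p | p.1 = x ∧ y + v < p.2 ∧ p.2 ≤ y + ρ} := by
  obtain ⟨ρ, hρ, h1, h2, z, hz, hz'⟩ := exists_edge_end (a := a) (p := (x, y)) (u := (2, 2))
    (v := (3, 2)) (w := (3, 3)) (d := (0, 1)) (by rw [hB]; simp) (by rw [hB]; simp)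
    (by simp [slope_mk]) (by simp [slope_mk]; norm_num)
  have e : ((x, y) : ℝ × ℝ) + ρ • ((0 : ℝ), (1 : ℝ)) = (x, y + ρ) := by simp
  rw [e] at h1 h2 hz
  have hz3 : z.2 = 3 := by
    simp only [slope_mk, mul_zero, zero_add, mul_one, Nat.cast_lt] at hz'
    have := z.2.isLt
    apply Fin.ext
    have h2' : ((2 : Fin 4) : ℕ) = 2 := rfl
    have h3' : ((3 : Fin 4) : ℕ) = 3 := rfl
    simp only [h2'] at hz'
    simp only [h3']
    omega
  obtain ⟨k, z2⟩ := z
  simp only at hz3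
  subst hz3
  have hρ0 : 0 < ρ := by
    rcases hρ.eq_or_lt with rfl | h
    · rw [add_zero, hB] at hz
      simp at hz
    · exact h
  have hend := hs.eq_triple h1 h2 hz (by simp) (by simp) (by simp)
  have hmid : ∀ z, 0 < z → z < ρ → active a (x, y + z) = {(2, 2), (3, 2)} := by
    intro z h3 h4
    rw [active_openSegment (u := (2, 2)) (by rw [hB]; simp) h1
      (mem_openSegment_vertical (y₁ := y) (by linarith) (by linarith)), hB, hend]
    ext w
    simp only [mem_inter_iff, mem_insert_iff, mem_singleton_iff]
    constructor
    · rintro ⟨rfl | rfl | rfl, h⟩ <;> simp at h ⊢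
    · rintro (rfl | rfl) <;> simp
  refine ⟨ρ, hρ0, k, hend, hmid, fun v hv0 hv => ?_⟩
  apply Subset.antisymm
  · rintro ⟨x', w⟩ ⟨hc, hx, hw⟩
    simp only at hx hw
    subst hx
    refine ⟨rfl, hw, ?_⟩
    by_contra hlt
    push Not at hlt
    refine absurd hc (not_mem_curve_of_eq_singleton (u := (k, 3)) ?_)
    rw [active_up hz rfl hlt, hend]
    ext t
    simp only [mem_sep_iff, mem_insert_iff, mem_singleton_iff]
    constructor
    · rintro ⟨rfl | rfl | rfl, h⟩ <;> simp at h ⊢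
    · rintro rfl; simp
  · rintro ⟨x', w⟩ ⟨hx, hw, hw'⟩
    simp only at hx hw hw'
    subst hx
    refine ⟨?_, rfl, hw⟩
    rcases hw'.eq_or_lt with rfl | hw'
    · exact mem_curve_of_mem h1 h2 (by simp)
    · have := hmid (w - y) (by linarith) (by linarith)
      rw [add_sub_cancel] at this
      exact mem_curve_of_mem (u := (2, 2)) (v := (3, 2)) (by rw [this]; simp) (by rw [this]; simp)
        (by simp)

end Vertical

section Config

variable {a : Exps 3 → ℝ} {xA y xP α : ℝ} {j₀ : Fin 4}

namespace EndConfig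

variable (c : EndConfig a xA y xP j₀ 2)
include c

theorem active_slope_edge {z : Exps 3} (hB : active a (xA + α, y + α) = {(3, 1), (2, 2), z})
    (hz : z ∉ active a (xA, y)) {r : ℝ} (h0 : 0 < r) (h1 : r < α) :
    active a (xA + r, y + r) = {(3, 1), (2, 2)} := by
  rw [active_openSegment (u := (3, 1)) (by rw [c.vertex]; simp) (by rw [hB]; simp)
    (mem_openSegment_diag h0 h1), hB]
  ext w
  simp only [mem_inter_iff, mem_insert_iff, mem_singleton_iff]
  constructor
  · rintro ⟨h, rfl | rfl | rfl⟩
    · simp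
    · simp
    · exact absurd h hz
  · rintro (rfl | rfl) <;> simp [c.vertex]

theorem curve_inter_slope_edge {z : Exps 3} (hα : 0 < α)
    (hB : active a (xA + α, y + α) = {(3, 1), (2, 2), z}) (hz : z ∉ active a (xA, y)) :
    curve a ∩ segment ℝ (xA, y) (xA + α, y + α) = segment ℝ (xA, y) (xA + α, y + α) := by
  apply inter_eq_right.2
  intro p hp
  rw [mem_segment_diag_iff hα.le] at hp
  obtain ⟨r, h0, h1, rfl⟩ := hp
  rcases h0.eq_or_lt with rfl | h0
  · simpa using c.vertex_mem_curve
  rcases h1.eq_or_lt with rfl | h1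
  · exact mem_curve_of_mem (u := (3, 1)) (v := (2, 2)) (by rw [hB]; simp) (by rw [hB]; simp)
      (by simp)
  · have := c.active_slope_edge hB hz h0 h1
    exact mem_curve_of_mem (u := (3, 1)) (v := (2, 2)) (by rw [this]; simp) (by rw [this]; simp)
      (by simp)

theorem stableMult_slope_vertex (hα : 0 < α) :
    stableMult a (lineCoeff ((xA, y), α)) (xA, y) = 2 := by
  have eS : toPlane '' ({(2, 2), (3, 0), (3, 1)} : Set (Exps 3)) =
      {((2 : ℝ), (2 : ℝ)), (2, 2), (2 + 1, 0), (2 + 1, 1)} := by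
    simp only [image_insert_eq, image_singleton, toPlane]
    norm_num
  rw [stableMult_trapezoid c.vertex
    (active_line_vert0 (t := ((xA, y), α)) hα.le rfl hα.ne') eS toPlane_lower
    (by norm_num) (by norm_num) (by norm_num) (by norm_num)]
  norm_num

theorem stableMult_slope_edge {z : Exps 3} (hα : 0 < α)
    (hB : active a (xA + α, y + α) = {(3, 1), (2, 2), z}) (hz : z ∉ active a (xA, y)) {r : ℝ}
    (h0 : 0 < r) (h1 : r < α) : stableMult a (lineCoeff ((xA, y), α)) (xA + r, y + r) = 0 := by
  rw [stableMult_edge (t := ((xA, y), α)) hα.le hα.ne' (by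
    rw [vert0_mk, vert1_mk hα.le]; exact mem_openSegment_diag h0 h1),
    c.active_slope_edge hB hz h0 h1, width_pair (by simp [tdeg])]
  simp [tdeg]

/-- The bounded edge coincides with the edge of Γ from A to its end B = A + α(1,1), dual to (3,1),
(2,2). Its ends contribute 2 and 2, and the right and upper legs leave Γ at B, so the multiplicities
are 2 and 4. -/
theorem isTritangent_slope_lower (hα : 0 < α)
    (hB : active a (xA + α, y + α) = {(3, 1), (2, 2), (2, 3)}) : IsTritangent a ((xA, y), α) := by
  have hz : (2, 3) ∉ active a (xA, y) := by rw [c.vertex]; simp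
  have hX : curve a ∩ curve (lineCoeff ((xA, y), α)) =
      {(xP, y)} ∪ segment ℝ (xA, y) (xA + α, y + α) := by
    rw [curve_inter_line a (t := ((xA, y), α)) hα.le, vert0_mk, vert1_mk hα.le,
      c.curve_inter_lft_vertex, c.curve_inter_dwn_vertex (by decide),
      c.curve_inter_slope_edge hα hB hz,
      curve_inter_rgt_eq_empty (u := (3, 1)) (by rw [hB]; simp) rfl (by
        rw [hB]; rintro w (rfl | rfl | rfl) h <;> simp at h ⊢),
      curve_inter_upw_eq_empty (u := (2, 3)) (by rw [hB]; simp) rfl (by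
        rw [hB]; rintro w (rfl | rfl | rfl) h <;> simp at h ⊢)]
    simp only [union_empty]
  refine isTritangent_of_two hX isClosed_singleton (isClosed_segment _ _) ?_ isConnected_singleton
    (isConnected_segment _ _) (c.componentMult_cross le_rfl hα.le) ?_
  · rw [disjoint_singleton_left, mem_segment_diag_iff hα.le]
    rintro ⟨r, h0, h1, h⟩
    have := c.lt
    rw [Prod.mk.injEq] at h
    linarith
  · rw [componentMult, finsum_mem_eq_two (x := (xA, y)) (y := (xA + α, y + α))
      (left_mem_segment _ _ _) (right_mem_segment _ _ _) (by simp [hα.ne'])]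
    · have eS : toPlane '' ({(3, 1), (2, 2), (2, 3)} : Set (Exps 3)) =
          {((2 : ℝ), (2 : ℝ)), (2, 3), (2 + 1, 1), (2 + 1, 1)} := by
        simp only [image_insert_eq, image_singleton, toPlane]
        norm_num
        ext z; simp; tauto
      rw [c.stableMult_slope_vertex hα, stableMult_trapezoid hB
        (active_line_vert1 (t := ((xA, y), α)) hα.le (vert1_mk hα.le).symm hα.ne') eS toPlane_upper
        (by norm_num) (by norm_num) (by norm_num) (by norm_num)]
      norm_num
    · intro p hp n1 n2
      rw [mem_segment_diag_iff hα.le] at hp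
      obtain ⟨r, h0, h1, rfl⟩ := hp
      exact c.stableMult_slope_edge hα hB hz (lt_of_le_of_ne h0 fun e => n1 (by simp [← e]))
        (lt_of_le_of_ne h1 fun e => n2 (by simp [e]))

/-- As in the other case the bounded edge coincides with an edge of Γ from A to B, but now the right
leg runs inside the end dual to (3,1), (3,2), and the upper leg follows the vertical edge dual to
(2,2), (3,2) to its top. The multiplicity 4 is 2 at A, 1 at B and 1 at that top. -/
theorem isTritangent_slope_upper (hα : 0 < α)
    (hB : active a (xA + α, y + α) = {(3, 1), (2, 2), (3, 2)}) : IsTritangent a ((xA, y), α) := by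
  have hz : (3, 2) ∉ active a (xA, y) := by rw [c.vertex]; simp
  obtain ⟨ρ, hρ, k, hend, hmid, hup⟩ := exists_vertical_edge c.smooth hB
  set R : Set (ℝ × ℝ) := {p | p.2 = y + α ∧ xA + α ≤ p.1} with hR
  set V : Set (ℝ × ℝ) := segment ℝ (xA + α, y + α) (xA + α, y + α + ρ) with hV
  set S : Set (ℝ × ℝ) := segment ℝ (xA, y) (xA + α, y + α) with hS
  have memV : ∀ p, p ∈ V ↔ p.1 = xA + α ∧ y + α ≤ p.2 ∧ p.2 ≤ y + α + ρ := fun p =>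
    mem_segment_vertical (by linarith)
  have hray : ∀ z, xA + α < z → active a (z, y + α) = {(3, 1), (3, 2)} := by
    intro z hz
    rw [active_right (u := (3, 1)) (by rw [hB]; simp) rfl hz, hB]
    ext w
    simp only [mem_sep_iff, mem_insert_iff, mem_singleton_iff]
    constructor
    · rintro ⟨rfl | rfl | rfl, h⟩ <;> simp at h ⊢
    · rintro (rfl | rfl) <;> simp
  have hBS : (xA + α, y + α) ∈ S := right_mem_segment _ _ _
  have hBR : (xA + α, y + α) ∈ R := ⟨rfl, le_rfl⟩
  have hBV : (xA + α, y + α) ∈ V := left_mem_segment _ _ _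
  have hrgt : curve a ∩ rgt (xA + α, y + α) = {p | p.2 = y + α ∧ xA + α < p.1} := by
    apply inter_eq_right.2
    rintro ⟨z, w⟩ ⟨hw, hz⟩
    simp only at hw hz
    subst hw
    exact mem_curve_of_mem (u := (3, 1)) (v := (3, 2)) (by rw [hray z hz]; simp)
      (by rw [hray z hz]; simp) (by simp)
  have hX : curve a ∩ curve (lineCoeff ((xA, y), α)) = {(xP, y)} ∪ (S ∪ R ∪ V) := by
    have h1 := hup 0 le_rfl hρ
    rw [add_zero] at h1
    rw [curve_inter_line a (t := ((xA, y), α)) hα.le, vert0_mk, vert1_mk hα.le,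
      c.curve_inter_lft_vertex, c.curve_inter_dwn_vertex (by decide),
      c.curve_inter_slope_edge hα hB hz, hrgt, h1, union_empty]
    ext ⟨z, w⟩
    constructor
    · rintro (((h | ⟨h2, h3⟩) | ⟨h2, h3, h4⟩) | h)
      · exact Or.inl h
      · exact Or.inr (Or.inl (Or.inr ⟨h2, le_of_lt h3⟩))
      · exact Or.inr (Or.inr ((memV _).2 ⟨h2, le_of_lt h3, h4⟩))
      · exact Or.inr (Or.inl (Or.inl h))
    · rintro (h | ((h | ⟨h2, h3⟩) | h))
      · exact Or.inl (Or.inl (Or.inl h))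
      · exact Or.inr h
      · simp only at h2 h3
        subst h2
        rcases h3.eq_or_lt with rfl | h3
        · exact Or.inr hBS
        · exact Or.inl (Or.inl (Or.inr ⟨rfl, h3⟩))
      · obtain ⟨h2, h3, h4⟩ := (memV _).1 h
        simp only at h2 h3 h4
        subst h2
        rcases h3.eq_or_lt with rfl | h3
        · exact Or.inr hBS
        · exact Or.inl (Or.inr ⟨rfl, h3, h4⟩)
  refine isTritangent_of_two hX isClosed_singleton (((isClosed_segment _ _).union
    (isClosed_ray_right _ _)).union (isClosed_segment _ _)) ?_ isConnected_singleton
    (((isConnected_segment _ _).union ⟨_, hBS, hBR⟩ (isConnected_ray_right _ _)).union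
      ⟨_, Or.inl hBS, hBV⟩ (isConnected_segment _ _)) (c.componentMult_cross le_rfl hα.le) ?_
  · have := c.lt
    rw [disjoint_singleton_left]
    rintro ((h | ⟨-, h⟩) | h)
    · rw [mem_segment_diag_iff hα.le] at h
      obtain ⟨r, h0, h1, h⟩ := h
      rw [Prod.mk.injEq] at h
      linarith
    · simp only at h; linarith
    · have := ((memV _).1 h).1
      simp only at this; linarith
  · rw [componentMult, finsum_mem_eq_three (C := S ∪ R ∪ V) (x := (xA, y)) (y := (xA + α, y + α))
      (z := (xA + α, y + α + ρ)) (Or.inl (Or.inl (left_mem_segment _ _ _))) (Or.inl (Or.inl hBS))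
      (Or.inr (right_mem_segment _ _ _)) (by simp [hα.ne']) (by simp [hα.ne']) (by simp [hρ.ne'])]
    · have eS : toPlane '' ({(3, 1), (2, 2), (3, 2)} : Set (Exps 3)) =
          {((2 : ℝ), (2 : ℝ)), (2, 2), (2 + 1, 1), (2 + 1, 2)} := by
        simp only [image_insert_eq, image_singleton, toPlane]
        norm_num
        ext z; simp; tauto
      rw [c.stableMult_slope_vertex hα, stableMult_trapezoid hB
        (active_line_vert1 (t := ((xA, y), α)) hα.le (vert1_mk hα.le).symm hα.ne') eS toPlane_upper
        (by norm_num) (by norm_num) (by norm_num) (by norm_num),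
        stableMult_up (t := ((xA, y), α)) (p := (xA + α, y + α + ρ)) hα.le
        (by rw [vert1_mk hα.le]; exact ⟨rfl, by simpa using hρ⟩), hend, width_eq (m := 2) (M := 3)]
      · norm_num
      · rintro w (rfl | rfl | rfl) <;> simp [ydeg]
      · exact ⟨(2, 2), by simp, rfl⟩
      · exact ⟨(k, 3), by simp, rfl⟩
    · rintro ⟨z, w⟩ ((hp | ⟨hp, hp'⟩) | hp) n1 n2 n3
      · rw [mem_segment_diag_iff hα.le] at hp
        obtain ⟨r, h0, h1, he⟩ := hp
        rw [he] at n1 n2 ⊢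
        exact c.stableMult_slope_edge hα hB hz (lt_of_le_of_ne h0 fun e => n1 (by simp [← e]))
          (lt_of_le_of_ne h1 fun e => n2 (by simp [e]))
      · simp only at hp hp'
        subst hp
        have h1 : xA + α < z := lt_of_le_of_ne hp' fun e => n2 (by rw [e])
        rw [stableMult_right (t := ((xA, y), α)) (p := (z, y + α)) hα.le
          (by rw [vert1_mk hα.le]; exact ⟨rfl, h1⟩), hray z h1, width_pair (by simp [xdeg])]
        simp [xdeg]
      · obtain ⟨h1, h2, h3⟩ := (memV _).1 hp
        simp only at h1 h2 h3
        subst h1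
        have h4 : y + α < w := lt_of_le_of_ne h2 fun e => n2 (by rw [e])
        have h5 : w < y + α + ρ := lt_of_le_of_ne h3 fun e => n3 (by rw [e])
        have h6 := hmid (w - (y + α)) (by linarith) (by linarith)
        rw [add_sub_cancel] at h6
        rw [stableMult_up (t := ((xA, y), α)) (p := (xA + α, w)) hα.le
          (by rw [vert1_mk hα.le]; exact ⟨rfl, h4⟩), h6, width_pair (by simp [ydeg])]
        simp [ydeg]

/-- The lower vertex moves up from `(xA, y)`. -/
theorem isTritangent_above (hα : 0 < α)
    (hB : active a (xA + α, y + α) = {(3, 1), (2, 2), (3, 2)}) : ∃ δ > 0, ∀ s, 0 < s → s < δ →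
    active a (xA, y + s) = {(2, 2)} ∧ active a (xA + α, y + s + α) = {(2, 2), (3, 2)} ∧
      IsTritangent a ((xA, y + s), α) := by
  obtain ⟨δ₁, h1, H1⟩ := exists_local a xA y
  obtain ⟨δ₂, h2, H2⟩ := c.exists_cross
  obtain ⟨ρ, hρ, k, hend, hmid, hup⟩ := exists_vertical_edge c.smooth hB
  have hloc : ∀ s, 0 < s → s < δ₁ → active a (xA, y + s) = {(2, 2)} := by
    intro s h0 hs
    have := (H1 0 s (by simpa using h1) (by rwa [abs_of_pos h0])).2 (2, 2)
      (by rw [c.vertex]; simp) (by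
        rw [c.vertex]
        rintro w (rfl | rfl | rfl) <;> simp [slope_mk] <;> linarith)
    rw [add_zero, c.vertex] at this
    rw [this]
    ext w
    simp only [mem_sep_iff, mem_insert_iff, mem_singleton_iff]
    constructor
    · rintro ⟨rfl | rfl | rfl, h⟩
      · rfl
      · simp [slope_mk] at h; linarith
      · simp [slope_mk] at h; linarith
    · rintro rfl; simp
  refine ⟨min (min δ₁ δ₂) ρ, by positivity, fun s h0 hs => ?_⟩
  obtain ⟨⟨hs1, hs2⟩, hs3⟩ := (lt_min_iff.1 hs).imp_left lt_min_iff.1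
  have hv0 := hloc s h0 hs1
  have eB : y + s + α = y + α + s := by ring
  have hv1 : active a (xA + α, y + s + α) = {(2, 2), (3, 2)} := by rw [eB]; exact hmid s h0 hs3
  refine ⟨hv0, hv1, ?_⟩
  obtain ⟨P, hP1, hP2, hP3, hP4⟩ := H2 0 s (by simpa using h2) (by rwa [abs_of_pos h0])
    (by rw [add_zero, hv0]; simp)
  rw [add_zero] at hP1 hP4
  have hd : curve a ∩ dwn (xA, y + s) = {(xA, y)} := by
    apply Subset.antisymm
    · rintro ⟨x', w⟩ ⟨hc, hx, hw⟩
      simp only at hx hw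
      subst hx
      rcases lt_trichotomy w y with h | rfl | h
      · have : ((x', w) : ℝ × ℝ) ∈ curve a ∩ dwn (x', y) := ⟨hc, rfl, h⟩
        rw [c.curve_inter_dwn_vertex (by decide)] at this
        exact this.elim
      · rfl
      · have := hloc (w - y) (by linarith) (by linarith)
        rw [add_sub_cancel] at this
        exact absurd hc (not_mem_curve_of_eq_singleton this)
    · rintro _ rfl
      exact ⟨c.vertex_mem_curve, rfl, by simpa using h0⟩
  have hu := hup s h0.le hs3
  have hr : curve a ∩ rgt (xA + α, y + s + α) = ∅ :=
    curve_inter_rgt_eq_empty (u := (3, 2)) (by rw [hv1]; simp) rfl (by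
        rw [hv1]; rintro w (rfl | rfl) h <;> simp at h ⊢)
  have hseg : curve a ∩ segment ℝ (xA, y + s) (xA + α, y + s + α) = {(xA + α, y + s + α)} := by
    apply Subset.antisymm
    · rintro p ⟨hc, hp⟩
      rcases segment_cases hp with rfl | rfl | hp
      · exact absurd hc (not_mem_curve_of_eq_singleton hv0)
      · rfl
      · refine absurd hc (not_mem_curve_of_eq_singleton (u := (2, 2)) ?_)
        rw [active_openSegment (u := (2, 2)) (by rw [hv0]; rfl) (by rw [hv1]; simp) hp, hv0, hv1]
        simp
    · rintro _ rfl
      exact ⟨mem_curve_of_mem (u := (2, 2)) (v := (3, 2)) (by rw [hv1]; simp) (by rw [hv1]; simp)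
        (by simp), right_mem_segment _ _ _⟩
  have memV : ∀ p, p ∈ segment ℝ (xA + α, y + α + s) (xA + α, y + α + ρ) ↔
      p.1 = xA + α ∧ y + α + s ≤ p.2 ∧ p.2 ≤ y + α + ρ := fun p =>
    mem_segment_vertical (by linarith)
  have hX : curve a ∩ curve (lineCoeff ((xA, y + s), α)) =
      {P} ∪ {(xA, y)} ∪ segment ℝ (xA + α, y + α + s) (xA + α, y + α + ρ) := by
    rw [curve_inter_line a (t := ((xA, y + s), α)) hα.le, vert0_mk, vert1_mk hα.le, hP4, hd, hr,
      hseg, union_empty, eB, hu, union_assoc ({P} ∪ {(xA, y)})]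
    congr 1
    ext ⟨z, w⟩
    rw [memV]
    simp only [mem_union, mem_ofPred_eq, mem_singleton_iff, Prod.mk.injEq]
    constructor
    · rintro (⟨h1, h2, h3⟩ | ⟨h1, h2⟩)
      · exact ⟨h1, h2.le, h3⟩
      · exact ⟨h1, h2.ge, by linarith⟩
    · rintro ⟨h1, h2, h3⟩
      rcases h2.eq_or_lt with h2 | h2
      · exact Or.inr ⟨h1, h2.symm⟩
      · exact Or.inl ⟨h1, h2, h3⟩
  refine isTritangent_of_three hX isClosed_singleton isClosed_singleton (isClosed_segment _ _)
    ?_ ?_ ?_ isConnected_singleton isConnected_singleton (isConnected_segment _ _) ?_ ?_ ?_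
  · rw [disjoint_singleton, ne_eq, Prod.ext_iff, hP2]
    rintro ⟨-, h⟩
    simp only at h; linarith
  · rw [disjoint_singleton_left, memV]
    rintro ⟨h, -⟩
    linarith
  · rw [disjoint_singleton_left, memV]
    rintro ⟨h, -⟩
    simp only at h; linarith
  · rw [componentMult, finsum_mem_singleton, stableMult_left (t := ((xA, y + s), α)) (p := P) hα.le
      ⟨hP2, hP1⟩, hP3, width_cross]
  -- Once v₀ has moved up into the chamber of (2,2), the lower leg meets Γ exactly at A, where the
  -- second exponents range from 0 to 2.
  · rw [componentMult, finsum_mem_singleton, stableMult_down (t := ((xA, y + s), α)) (p := (xA, y))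
      hα.le ⟨rfl, by simpa [vert0] using h0⟩, c.vertex, width_eq (m := 0) (M := 2)]
    · norm_num
    · rintro w (rfl | rfl | rfl) <;> simp [ydeg]
    · exact ⟨(3, 0), by simp, rfl⟩
    · exact ⟨(2, 2), by simp, rfl⟩
  · have wU : width ydeg ({(1, 0), (0, 1), (1, 1)} : Set (Exps 1)) = 1 := by
      rw [width_eq (m := 0) (M := 1)]
      · norm_num
      · rintro w (rfl | rfl | rfl) <;> simp [ydeg]
      · exact ⟨(1, 0), by simp, rfl⟩
      · exact ⟨(0, 1), by simp, rfl⟩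
    have wS : width ydeg ({(2, 2), (3, 2), (k, 3)} : Set (Exps 3)) = 1 := by
      rw [width_eq (m := 2) (M := 3)]
      · norm_num
      · rintro w (rfl | rfl | rfl) <;> simp [ydeg]
      · exact ⟨(2, 2), by simp, rfl⟩
      · exact ⟨(k, 3), by simp, rfl⟩
    rw [componentMult, finsum_mem_eq_two (x := (xA + α, y + α + s)) (y := (xA + α, y + α + ρ))
      (left_mem_segment _ _ _) (right_mem_segment _ _ _) (by simp [hs3.ne])]
    · rw [← eB, stableMult_of_horizontal_left hv1 rfl rfl,
        active_line_vert1 (t := ((xA, y + s), α)) hα.le (vert1_mk hα.le).symm hα.ne',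
        stableMult_up (t := ((xA, y + s), α)) (p := (xA + α, y + α + ρ)) hα.le
        (by rw [vert1_mk hα.le]; exact ⟨rfl, by simp only; linarith⟩), hend, wU, wS]
      norm_num
    · rintro ⟨z, w⟩ hp n1 n2
      obtain ⟨h3, h4, h5⟩ := (memV _).1 hp
      simp only at h3 h4 h5
      subst h3
      have h4' : y + α + s < w := lt_of_le_of_ne h4 fun e => n1 (by rw [e])
      have h5' : w < y + α + ρ := lt_of_le_of_ne h5 fun e => n2 (by rw [e])
      have h6 := hmid (w - (y + α)) (by linarith) (by linarith)
      rw [add_sub_cancel] at h6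
      rw [stableMult_up (t := ((xA, y + s), α)) (p := (xA + α, w)) hα.le
        (by rw [vert1_mk hα.le]; exact ⟨rfl, by simp only; linarith⟩), h6,
        width_pair (by simp [ydeg])]
      simp [ydeg]

/-- The upper vertex moves to the left from the vertex dual to `(3,1), (2,2), (2,3)`. -/
theorem isTritangent_left (hα : 0 < α)
    (hB : active a (xA + α, y + α) = {(3, 1), (2, 2), (2, 3)}) : ∃ δ > 0, ∀ s, 0 < s → s < δ →
    active a (xA - s + s ^ 2, y + s ^ 2) = {(2, 2)} ∧ active a (xA + α - s, y + α) = {(2, 2), (2, 3)} ∧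
      0 < α - s ^ 2 ∧ IsTritangent a ((xA - s + s ^ 2, y + s ^ 2), α - s ^ 2) := by
  obtain ⟨δ₁, h1, H1⟩ := exists_local a xA y
  obtain ⟨δ₂, h2, H2⟩ := c.exists_cross
  obtain ⟨δ₃, h3, H3⟩ := exists_local a (xA + α) (y + α)
  refine ⟨min (min (min δ₁ δ₂) δ₃) (min α 1), by positivity, fun s h0 hs => ?_⟩
  obtain ⟨⟨⟨hs1, hs2⟩, hs3⟩, hs4, hs5⟩ := (lt_min_iff.1 hs).imp
    (fun h => (lt_min_iff.1 h).imp_left lt_min_iff.1) lt_min_iff.1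
  have hss : s ^ 2 < s := by nlinarith
  have hs0 : 0 < s ^ 2 := by positivity
  have hl : 0 < α - s ^ 2 := by linarith
  have ex0 : xA - s + s ^ 2 = xA + (s ^ 2 - s) := by ring
  have ex1 : xA + α - s = xA + α + -s := by ring
  have habs : |s ^ 2 - s| < s := by rw [abs_lt]; constructor <;> linarith
  have hv0 : active a (xA - s + s ^ 2, y + s ^ 2) = {(2, 2)} := by
    rw [ex0, (H1 (s ^ 2 - s) (s ^ 2) (by linarith) (by rw [abs_of_pos hs0]; linarith)).2 (2, 2)
      (by rw [c.vertex]; simp) (by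
        rw [c.vertex]
        rintro w (rfl | rfl | rfl) <;> simp [slope_mk] <;> linarith), c.vertex]
    ext w
    simp only [mem_sep_iff, mem_insert_iff, mem_singleton_iff]
    constructor
    · rintro ⟨rfl | rfl | rfl, h⟩
      · rfl
      · simp [slope_mk] at h; linarith
      · simp [slope_mk] at h; linarith
    · rintro rfl; simp
  have hedge : ∀ r, 0 < r → r ≤ s → active a (xA + α + -r, y + α) = {(2, 2), (2, 3)} := by
    intro r hr hrs
    have := (H3 (-r) 0 (by rw [abs_neg, abs_of_pos hr]; linarith) (by simpa using h3)).2 (2, 2)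
      (by rw [hB]; simp) (by
        rw [hB]
        rintro w (rfl | rfl | rfl) <;> simp [slope_mk] <;> linarith)
    rw [add_zero, hB] at this
    rw [this]
    ext w
    simp only [mem_sep_iff, mem_insert_iff, mem_singleton_iff]
    constructor
    · rintro ⟨rfl | rfl | rfl, h⟩
      · simp [slope_mk] at h; linarith
      · simp
      · simp
    · rintro (rfl | rfl)
      · simp
      · simp [slope_mk]
  have hv1 : active a (xA + α - s, y + α) = {(2, 2), (2, 3)} := by
    rw [ex1]; exact hedge s h0 le_rfl
  refine ⟨hv0, hv1, hl, ?_⟩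
  obtain ⟨P, hP1, hP2, hP3, hP4⟩ := H2 (s ^ 2 - s) (s ^ 2) (by linarith)
    (by rw [abs_of_pos hs0]; linarith) (by rw [← ex0, hv0]; rfl)
  rw [← ex0] at hP1 hP4
  have ev1 : ((xA - s + s ^ 2 + (α - s ^ 2), y + s ^ 2 + (α - s ^ 2)) : ℝ × ℝ) =
      (xA + α - s, y + α) := by rw [Prod.mk.injEq]; constructor <;> ring
  -- the crossing on the lower leg
  set m : ℝ := (s - s ^ 2) / 2 with hm
  have hm0 : 0 < m := by rw [hm]; linarith
  -- The edge dual to (3,0), (2,2) leaves A in direction (-2, -1). A shift of the leg to the left by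
  -- s - s² meets it at half that depth, which is `m`.
  have hQ : active a (xA - s + s ^ 2, y - m) = {(3, 0), (2, 2)} := by
    have := (H1 (s ^ 2 - s) (-m) (by linarith) (by rw [abs_neg, abs_of_pos hm0]; linarith)).2 (2, 2)
      (by rw [c.vertex]; simp) (by
        rw [c.vertex]
        rintro w (rfl | rfl | rfl) <;> simp [slope_mk] <;> linarith)
    rw [← ex0, ← sub_eq_add_neg, c.vertex] at this
    rw [this]
    ext w
    simp only [mem_sep_iff, mem_insert_iff, mem_singleton_iff]
    constructor
    · rintro ⟨rfl | rfl | rfl, h⟩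
      · simp
      · simp
      · simp [slope_mk] at h; linarith
    · rintro (rfl | rfl)
      · simp [slope_mk]; linarith
      · simp
  have hd : curve a ∩ dwn (xA - s + s ^ 2, y + s ^ 2) = {(xA - s + s ^ 2, y - m)} :=
    curve_inter_down hQ rfl (by simp) (by rw [hv0]; rfl) (by rw [hv0]; simp) rfl
      (by simp only; linarith)
  have hr : curve a ∩ rgt (xA + α - s, y + α) =
      {p | p.2 = y + α ∧ xA + α - s < p.1 ∧ p.1 ≤ xA + α} := by
    apply Subset.antisymm
    · rintro ⟨z, w⟩ ⟨hc, hw, hz⟩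
      simp only at hw hz
      subst hw
      refine ⟨rfl, hz, ?_⟩
      by_contra hlt
      push Not at hlt
      refine absurd hc (not_mem_curve_of_eq_singleton (u := (3, 1)) ?_)
      rw [active_right (u := (3, 1)) (by rw [hB]; simp) rfl hlt, hB]
      ext w
      simp only [mem_sep_iff, mem_insert_iff, mem_singleton_iff]
      constructor
      · rintro ⟨rfl | rfl | rfl, h⟩ <;> simp at h ⊢
      · rintro rfl; simp
    · rintro ⟨z, w⟩ ⟨hw, hz, hz'⟩
      simp only at hw hz hz'
      subst hw
      refine ⟨?_, rfl, hz⟩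
      rcases hz'.eq_or_lt with rfl | hz'
      · exact mem_curve_of_mem (u := (2, 2)) (v := (2, 3)) (by rw [hB]; simp) (by rw [hB]; simp)
          (by simp)
      · have := hedge (xA + α - z) (by linarith) (by linarith)
        rw [neg_sub, add_sub_cancel] at this
        exact mem_curve_of_mem (u := (2, 2)) (v := (2, 3)) (by rw [this]; simp)
          (by rw [this]; simp) (by simp)
  have hu : curve a ∩ upw (xA + α - s, y + α) = ∅ :=
    curve_inter_upw_eq_empty (u := (2, 3)) (by rw [hv1]; simp) rfl (by
        rw [hv1]; rintro w (rfl | rfl) h <;> simp at h ⊢)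
  have hseg : curve a ∩ segment ℝ (xA - s + s ^ 2, y + s ^ 2) (xA + α - s, y + α) =
      {(xA + α - s, y + α)} := by
    apply Subset.antisymm
    · rintro p ⟨hc, hp⟩
      rcases segment_cases hp with rfl | rfl | hp
      · exact absurd hc (not_mem_curve_of_eq_singleton hv0)
      · rfl
      · refine absurd hc (not_mem_curve_of_eq_singleton (u := (2, 2)) ?_)
        rw [active_openSegment (u := (2, 2)) (by rw [hv0]; rfl) (by rw [hv1]; simp) hp, hv0, hv1]
        simp
    · rintro _ rfl
      exact ⟨mem_curve_of_mem (u := (2, 2)) (v := (2, 3)) (by rw [hv1]; simp) (by rw [hv1]; simp)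
        (by simp), right_mem_segment _ _ _⟩
  have memV : ∀ p, p ∈ segment ℝ (xA + α - s, y + α) (xA + α, y + α) ↔
      p.2 = y + α ∧ xA + α - s ≤ p.1 ∧ p.1 ≤ xA + α := fun p =>
    mem_segment_horizontal (by linarith)
  have hX : curve a ∩ curve (lineCoeff ((xA - s + s ^ 2, y + s ^ 2), α - s ^ 2)) =
      {P} ∪ {(xA - s + s ^ 2, y - m)} ∪ segment ℝ (xA + α - s, y + α) (xA + α, y + α) := by
    rw [curve_inter_line a (t := ((xA - s + s ^ 2, y + s ^ 2), α - s ^ 2)) hl.le, vert0_mk,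
      vert1_mk hl.le, ev1, hP4, hd, hr, hu, hseg, union_empty, union_assoc ({P} ∪ _)]
    congr 1
    ext ⟨z, w⟩
    rw [memV]
    simp only [mem_union, mem_ofPred_eq, mem_singleton_iff, Prod.mk.injEq]
    constructor
    · rintro (⟨h1, h2, h3⟩ | ⟨h1, h2⟩)
      · exact ⟨h1, h2.le, h3⟩
      · exact ⟨h2, h1.ge, by linarith⟩
    · rintro ⟨h1, h2, h3⟩
      rcases h2.eq_or_lt with h2 | h2
      · exact Or.inr ⟨h2.symm, h1⟩
      · exact Or.inl ⟨h1, h2, h3⟩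
  refine isTritangent_of_three hX isClosed_singleton isClosed_singleton (isClosed_segment _ _)
    ?_ ?_ ?_ isConnected_singleton isConnected_singleton (isConnected_segment _ _) ?_ ?_ ?_
  · rw [disjoint_singleton, ne_eq, Prod.ext_iff, hP2]
    rintro ⟨-, h⟩
    simp only at h; linarith
  · rw [disjoint_singleton_left, memV]
    rintro ⟨h, h', -⟩
    linarith
  · rw [disjoint_singleton_left, memV]
    rintro ⟨h, -⟩
    simp only at h; linarith
  · rw [componentMult, finsum_mem_singleton,
      stableMult_left (t := ((xA - s + s ^ 2, y + s ^ 2), α - s ^ 2)) (p := P) hl.le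
      ⟨hP2, hP1⟩, hP3, width_cross]
  · rw [componentMult, finsum_mem_singleton,
      stableMult_down (t := ((xA - s + s ^ 2, y + s ^ 2), α - s ^ 2))
      (p := (xA - s + s ^ 2, y - m)) hl.le ⟨rfl, by simp only [vert0]; linarith⟩, hQ,
      width_pair (by simp [ydeg])]
    simp [ydeg]
  · have wU : width xdeg ({(1, 0), (0, 1), (1, 1)} : Set (Exps 1)) = 1 := by
      rw [width_eq (m := 0) (M := 1)]
      · norm_num
      · rintro w (rfl | rfl | rfl) <;> simp [xdeg]
      · exact ⟨(0, 1), by simp, rfl⟩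
      · exact ⟨(1, 0), by simp, rfl⟩
    have wS : width xdeg ({(3, 1), (2, 2), (2, 3)} : Set (Exps 3)) = 1 := by
      rw [width_eq (m := 2) (M := 3)]
      · norm_num
      · rintro w (rfl | rfl | rfl) <;> simp [xdeg]
      · exact ⟨(2, 2), by simp, rfl⟩
      · exact ⟨(3, 1), by simp, rfl⟩
    rw [componentMult, finsum_mem_eq_two (x := (xA + α - s, y + α)) (y := (xA + α, y + α))
      (left_mem_segment _ _ _) (right_mem_segment _ _ _) (by simp [h0.ne'])]
    · rw [stableMult_of_vertical_left hv1 rfl rfl,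
        active_line_vert1 (t := ((xA - s + s ^ 2, y + s ^ 2), α - s ^ 2)) hl.le
          (by rw [vert1_mk hl.le, ev1]) hl.ne',
        stableMult_right (t := ((xA - s + s ^ 2, y + s ^ 2), α - s ^ 2)) (p := (xA + α, y + α)) hl.le
        (by rw [vert1_mk hl.le, ev1]; exact ⟨rfl, by simp only; linarith⟩), hB, wU, wS]
      norm_num
    · rintro ⟨z, w⟩ hp n1 n2
      obtain ⟨h3, h4, h5⟩ := (memV _).1 hp
      simp only at h3 h4 h5
      subst h3
      have h4' : xA + α - s < z := lt_of_le_of_ne h4 fun e => n1 (by rw [e])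
      have h5' : z < xA + α := lt_of_le_of_ne h5 fun e => n2 (by rw [e])
      have h6 := hedge (xA + α - z) (by linarith) (by linarith)
      rw [neg_sub, add_sub_cancel] at h6
      rw [stableMult_right (t := ((xA - s + s ^ 2, y + s ^ 2), α - s ^ 2)) (p := (z, y + α)) hl.le
        (by rw [vert1_mk hl.le, ev1]; exact ⟨rfl, h4'⟩), h6, width_pair (by simp [xdeg])]
      simp [xdeg]

end EndConfig

end Config


/-! ## Tritangents through a vertex of slope three -/

theorem curve_inter_line_neg (a : Exps 3 → ℝ) {t : Params} (h : t.2 < 0) :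
    curve a ∩ curve (lineCoeff t) = curve a ∩ lft (vert1 t) ∪ curve a ∩ dwn (vert0 t) ∪
      curve a ∩ rgt (vert0 t) ∪ curve a ∩ upw (vert1 t) ∪
        curve a ∩ segment ℝ (vert0 t) (vert1 t) := by
  rw [curve_line_neg h]
  simp only [inter_union_distrib_left]

theorem vert1_mk_neg {x y l : ℝ} (h : l < 0) : vert1 ((x, y), l) = (x + l, y - l) := by
  simp [vert1, abs_of_neg h, sub_eq_add_neg]

section Config

variable {a : Exps 3 → ℝ} {xA y xP : ℝ} {j₀ : Fin 4}

namespace EndConfig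

variable (c : EndConfig a xA y xP j₀ 3)
include c

/-- The unit square and the triangle (2,3), (3,0), (3,1) have mixed area 4, so A alone carries
multiplicity four. The right leg lies in the end and adds nothing. -/
theorem isTritangent_four_valent : IsTritangent a ((xA, y), 0) := by
  have hv1 : vert1 ((xA, y), 0) = (xA, y) := by rw [vert1_mk le_rfl, add_zero, add_zero]
  have hX : curve a ∩ curve (lineCoeff ((xA, y), 0)) =
      {(xP, y)} ∪ {p | p.2 = y ∧ xA ≤ p.1} := by
    rw [curve_inter_line a (t := ((xA, y), 0)) le_rfl, vert0_mk, hv1,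
      c.curve_inter_lft_vertex, c.curve_inter_dwn_vertex (by decide), segment_same,
      inter_eq_right.2 (singleton_subset_iff.2 c.vertex_mem_curve),
      curve_inter_upw_eq_empty (u := (2, 3)) (by rw [c.vertex]; simp) rfl (by
        rw [c.vertex]; rintro w (rfl | rfl | rfl) h <;> simp at h ⊢)]
    ext ⟨z, w⟩
    simp only [mem_union, mem_singleton_iff, mem_ofPred_eq, Prod.mk.injEq, mem_inter_iff,
      mem_empty_iff_false, or_false, rgt]
    constructor
    · rintro ((h | ⟨-, h2, h3⟩) | ⟨h2, h3⟩)
      · exact Or.inl h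
      · exact Or.inr ⟨h2, h3.le⟩
      · exact Or.inr ⟨h3, h2.ge⟩
    · rintro (h | ⟨h2, h3⟩)
      · exact Or.inl (Or.inl h)
      · rcases h3.eq_or_lt with h3 | h3
        · exact Or.inr ⟨h3.symm, h2⟩
        · exact Or.inl (Or.inr ⟨h2 ▸ c.mem_curve h3.le, h2, h3⟩)
  refine isTritangent_of_two hX isClosed_singleton (isClosed_ray_right _ _) ?_ isConnected_singleton
    (isConnected_ray_right _ _) (c.componentMult_cross le_rfl le_rfl) ?_
  · rw [disjoint_singleton_left]
    rintro ⟨-, h⟩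
    exact absurd c.lt (not_lt.2 h)
  · rw [componentMult, finsum_mem_eq_one (C := {p : ℝ × ℝ | p.2 = y ∧ xA ≤ p.1}) (x := (xA, y))
      ⟨rfl, le_rfl⟩]
    · have eS : toPlane '' ({(2, 3), (3, 0), (3, 1)} : Set (Exps 3)) =
          {((2 : ℝ), (3 : ℝ)), (2, 3), (2 + 1, 0), (2 + 1, 1)} := by
        simp only [image_insert_eq, image_singleton, toPlane]
        norm_num
      have eT : toPlane '' ({(0, 0), (1, 0), (0, 1), (1, 1)} : Set (Exps 1)) =
          {((0 : ℝ), (0 : ℝ)), (0, 1), (0 + 1, 0), (0 + 1, 1)} := by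
        simp only [image_insert_eq, image_singleton, toPlane]
        ext z; simp; tauto
      rw [stableMult_trapezoid c.vertex (active_line_vert (t := ((xA, y), 0)) le_rfl rfl rfl) eS eT
        (by norm_num) (by norm_num) (by norm_num) (by norm_num)]
      norm_num
    · rintro ⟨z, w⟩ ⟨hw, hz⟩ hne
      simp only at hw hz
      subst hw
      have hz' : xA < z := lt_of_le_of_ne hz fun e => hne (by rw [e])
      rw [stableMult_right (t := ((xA, w), 0)) (p := (z, w)) le_rfl (by rw [hv1]; exact ⟨rfl, hz'⟩),
        c.active_ray hz', width_end]

/-- The vertex splits into an edge of slope `-1`. -/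
theorem isTritangent_neg : ∃ δ > 0, ∀ s, 0 < s → s < δ →
    active a (xA - 3 * s, y - s) = {(2, 3), (3, 0)} ∧
      active a (xA - 3 * s - s ^ 2, y - s + s ^ 2) = {(2, 3)} ∧
      IsTritangent a ((xA - 3 * s, y - s), -s ^ 2) := by
  obtain ⟨δ₁, h1, H1⟩ := exists_local a xA y
  obtain ⟨δ₂, h2, H2⟩ := c.exists_cross
  -- All coordinates of the two vertices change by at most 3s + s², which is below 4s when s < 1.
  refine ⟨min (min (δ₁ / 4) (δ₂ / 4)) 1, by positivity, fun s h0 hs => ?_⟩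
  obtain ⟨⟨hs1, hs2⟩, hs3⟩ := (lt_min_iff.1 hs).imp_left lt_min_iff.1
  have hss : s ^ 2 < s := by nlinarith
  have hs0 : 0 < s ^ 2 := by positivity
  have hl : -s ^ 2 < 0 := by linarith
  have ex : xA - 3 * s = xA + -(3 * s) := by ring
  have ey : y - s = y + -s := by ring
  have ex1 : xA - 3 * s - s ^ 2 = xA + -(3 * s + s ^ 2) := by ring
  have ey1 : y - s + s ^ 2 = y + -(s - s ^ 2) := by ring
  have b1 : |-(3 * s)| < 4 * s := by rw [abs_neg, abs_of_pos (by linarith)]; linarith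
  have b2 : |-s| < 4 * s := by rw [abs_neg, abs_of_pos h0]; linarith
  have b3 : |-(3 * s + s ^ 2)| < 4 * s := by rw [abs_neg, abs_of_pos (by linarith)]; linarith
  have b4 : |-(s - s ^ 2)| < 4 * s := by rw [abs_neg, abs_of_pos (by linarith)]; linarith
  have hv0 : active a (xA - 3 * s, y - s) = {(2, 3), (3, 0)} := by
    rw [ex, ey, (H1 (-(3 * s)) (-s) (by linarith) (by linarith)).2 (2, 3)
      (by rw [c.vertex]; simp) (by
        rw [c.vertex]
        rintro w (rfl | rfl | rfl) <;> simp [slope_mk] <;> linarith), c.vertex]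
    ext w
    simp only [mem_sep_iff, mem_insert_iff, mem_singleton_iff]
    constructor
    · rintro ⟨rfl | rfl | rfl, h⟩
      · simp
      · simp
      · simp [slope_mk] at h; linarith
    · rintro (rfl | rfl)
      · simp
      · simp [slope_mk]; linarith
  have hv1 : active a (xA - 3 * s - s ^ 2, y - s + s ^ 2) = {(2, 3)} := by
    rw [ex1, ey1, (H1 (-(3 * s + s ^ 2)) (-(s - s ^ 2)) (by linarith) (by linarith)).2 (2, 3)
      (by rw [c.vertex]; simp) (by
        rw [c.vertex]
        rintro w (rfl | rfl | rfl) <;> simp [slope_mk] <;> linarith), c.vertex]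
    ext w
    simp only [mem_sep_iff, mem_insert_iff, mem_singleton_iff]
    constructor
    · rintro ⟨rfl | rfl | rfl, h⟩
      · rfl
      · simp [slope_mk] at h; linarith
      · simp [slope_mk] at h; linarith
    · rintro rfl; simp
  refine ⟨hv0, hv1, ?_⟩
  obtain ⟨P, hP1, hP2, hP3, hP4⟩ := H2 (-(3 * s + s ^ 2)) (-(s - s ^ 2)) (by linarith)
    (by linarith) (by rw [← ex1, ← ey1, hv1]; rfl)
  rw [← ex1] at hP1
  rw [← ey1] at hP2
  rw [← ex1, ← ey1] at hP4
  have ev1 : vert1 ((xA - 3 * s, y - s), -s ^ 2) = (xA - 3 * s - s ^ 2, y - s + s ^ 2) := by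
    rw [vert1_mk_neg hl, Prod.mk.injEq]
    constructor <;> ring
  have hd : curve a ∩ dwn (xA - 3 * s, y - s) = ∅ :=
    curve_inter_dwn_eq_empty (u := (3, 0)) (by rw [hv0]; simp) rfl (by
        rw [hv0]; rintro w (rfl | rfl) h <;> simp at h ⊢)
  have hr : curve a ∩ rgt (xA - 3 * s, y - s) = ∅ :=
    curve_inter_rgt_eq_empty (u := (3, 0)) (by rw [hv0]; simp) rfl (by
        rw [hv0]; rintro w (rfl | rfl) h <;> simp at h ⊢)
  have hu : curve a ∩ upw (xA - 3 * s - s ^ 2, y - s + s ^ 2) = ∅ :=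
    curve_inter_upw_eq_empty (u := (2, 3)) (by rw [hv1]; simp) rfl (by
        rw [hv1]; rintro w rfl h; rfl)
  have hseg : curve a ∩ segment ℝ (xA - 3 * s, y - s) (xA - 3 * s - s ^ 2, y - s + s ^ 2) =
      {(xA - 3 * s, y - s)} := by
    apply Subset.antisymm
    · rintro p ⟨hc, hp⟩
      rcases segment_cases hp with rfl | rfl | hp
      · rfl
      · exact absurd hc (not_mem_curve_of_eq_singleton hv1)
      · refine absurd hc (not_mem_curve_of_eq_singleton (u := (2, 3)) ?_)
        rw [active_openSegment (u := (2, 3)) (by rw [hv0]; simp) (by rw [hv1]; simp) hp, hv0, hv1]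
        simp
    · rintro _ rfl
      exact ⟨mem_curve_of_mem (u := (2, 3)) (v := (3, 0)) (by rw [hv0]; simp) (by rw [hv0]; simp)
        (by simp), left_mem_segment _ _ _⟩
  have hX : curve a ∩ curve (lineCoeff ((xA - 3 * s, y - s), -s ^ 2)) =
      {P} ∪ {(xA - 3 * s, y - s)} := by
    rw [curve_inter_line_neg a (t := ((xA - 3 * s, y - s), -s ^ 2)) hl, ev1, vert0_mk, hP4, hd, hr,
      hu, hseg]
    simp only [union_empty]
  refine isTritangent_of_two hX isClosed_singleton isClosed_singleton ?_ isConnected_singleton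
    isConnected_singleton ?_ ?_
  · rw [disjoint_singleton, ne_eq, Prod.ext_iff, hP2]
    rintro ⟨-, h⟩
    simp only at h; linarith
  · rw [componentMult, finsum_mem_singleton,
      stableMult_left_neg (t := ((xA - 3 * s, y - s), -s ^ 2)) (p := P) hl
        (by rw [ev1]; exact ⟨hP2, hP1⟩), hP3, width_cross]
  · have eS : toPlane '' ({(2, 3), (3, 0)} : Set (Exps 3)) =
        {((2 : ℝ), (3 : ℝ)), (2, 3), (2 + 1, 0), (2 + 1, 0)} := by
      simp only [image_insert_eq, image_singleton, toPlane]
      norm_num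
    have eT : toPlane '' ({(0, 0), (1, 0), (1, 1)} : Set (Exps 1)) =
        {((0 : ℝ), (0 : ℝ)), (0, 0), (0 + 1, 0), (0 + 1, 1)} := by
      simp only [image_insert_eq, image_singleton, toPlane]
      ext z; simp
    -- The segment from (2,3) to (3,0) and the triangle dual to v₀ have mixed area 4: the tangency
    -- of multiplicity four now sits at v₀.
    rw [componentMult, finsum_mem_singleton, stableMult_trapezoid hv0
      (active_line_vert0_neg (t := ((xA - 3 * s, y - s), -s ^ 2)) hl rfl) eS eT
      (by norm_num) (by norm_num) (by norm_num) (by norm_num)]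
    norm_num

end EndConfig

end Config


/-! ## Good positions and families of tritangents -/

/-- A position of a vertex that is neither cut off nor the origin of a leg with two tangencies. -/
def IsGood (U : Set (Exps 3)) : Prop :=
  (U ≠ {(0, 0)} ∧ U ≠ {(3, 3)} ∧ U ≠ {(3, 0)} ∧ U ≠ {(0, 3)}) ∧
  (¬ {(1, 0), (0, 1)} ⊆ U ∧ ¬ {(2, 3), (3, 2)} ⊆ U ∧ ¬ {(2, 0), (3, 1)} ⊆ U ∧
    ¬ {(0, 2), (1, 3)} ⊆ U) ∧
  (U.Nontrivial → (∃ u ∈ U, u.1 ≠ 0) ∧ (∃ u ∈ U, u.1 ≠ 3) ∧ (∃ u ∈ U, u.2 ≠ 0) ∧ ∃ u ∈ U, u.2 ≠ 3)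

theorem isGood_singleton {u : Exps 3}
    (h : u ≠ (0, 0) ∧ u ≠ (3, 3) ∧ u ≠ (3, 0) ∧ u ≠ (0, 3)) : IsGood {u} := by
  refine ⟨by simpa only [ne_eq, singleton_eq_singleton_iff] using h, ?_, fun h => ?_⟩
  · simp only [insert_subset_iff, singleton_subset_iff, mem_singleton_iff]
    refine ⟨?_, ?_, ?_, ?_⟩ <;> rintro ⟨h1, h2⟩ <;> exact absurd (h1.trans h2.symm) (by simp)
  · exact absurd h (Set.not_nontrivial_singleton)

theorem isGood_pair {u v : Exps 3} (huv : u ≠ v)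
    (h : ¬ {(1, 0), (0, 1)} ⊆ ({u, v} : Set (Exps 3)) ∧ ¬ {(2, 3), (3, 2)} ⊆ ({u, v} : Set (Exps 3)) ∧
      ¬ {(2, 0), (3, 1)} ⊆ ({u, v} : Set (Exps 3)) ∧ ¬ {(0, 2), (1, 3)} ⊆ ({u, v} : Set (Exps 3)))
    (h' : (u.1 ≠ 0 ∨ v.1 ≠ 0) ∧ (u.1 ≠ 3 ∨ v.1 ≠ 3) ∧ (u.2 ≠ 0 ∨ v.2 ≠ 0) ∧ (u.2 ≠ 3 ∨ v.2 ≠ 3)) :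
    IsGood {u, v} := by
  refine ⟨?_, h, fun _ => ?_⟩
  · refine ⟨?_, ?_, ?_, ?_⟩ <;>
    · intro e
      have h1 : u ∈ ({u, v} : Set (Exps 3)) := by simp
      have h2 : v ∈ ({u, v} : Set (Exps 3)) := by simp
      rw [e] at h1 h2
      exact huv (h1.trans h2.symm)
  · simpa only [mem_insert_iff, mem_singleton_iff, exists_eq_or_imp, exists_eq_left] using h'

/-- Two tritangents in the same class. -/
def Linked (a : Exps 3 → ℝ) (t t' : Params) : Prop :=
  ∃ W ⊆ tritangentSet a, IsPreconnected W ∧ t ∈ W ∧ t' ∈ W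

theorem Linked.trans {a : Exps 3 → ℝ} {t t' t'' : Params} (h : Linked a t t') (h' : Linked a t' t'') :
    Linked a t t'' := by
  obtain ⟨W, hW, c, m, m'⟩ := h
  obtain ⟨W', hW', c', n, n'⟩ := h'
  exact ⟨W ∪ W', union_subset hW hW', c.union t' m' n c', Or.inl m, Or.inr n'⟩

theorem Linked.symm {a : Exps 3 → ℝ} {t t' : Params} (h : Linked a t t') : Linked a t' t := by
  obtain ⟨W, hW, c, m, m'⟩ := h
  exact ⟨W, hW, c, m', m⟩

theorem linked_of_path {a : Exps 3 → ℝ} (f : ℝ → Params) (hf : Continuous f) {b c : ℝ} (hbc : b ≤ c)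
    (h : ∀ r, b ≤ r → r ≤ c → IsTritangent a (f r)) : Linked a (f b) (f c) := by
  refine ⟨f '' Icc b c, ?_, isPreconnected_Icc.image f hf.continuousOn,
    ⟨b, ⟨le_rfl, hbc⟩, rfl⟩, ⟨c, ⟨hbc, le_rfl⟩, rfl⟩⟩
  rintro _ ⟨r, ⟨h1, h2⟩, rfl⟩
  exact h r h1 h2

/-- A curve of tritangents in good position in the class of `t`. -/
def GoodFamily (a : Exps 3 → ℝ) (t v w : Params) : Prop :=
  ∃ p : Params, ∃ ε > 0, (∀ s : ℝ, 0 < s → s < ε → Linked a t (p + s • v + s ^ 2 • w) ∧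
      IsGood (active a (vert0 (p + s • v + s ^ 2 • w))) ∧
      IsGood (active a (vert1 (p + s • v + s ^ 2 • w)))) ∧
    ((∀ s : ℝ, 0 < s → s < ε → 0 < (p + s • v + s ^ 2 • w).2) ∨
      (∀ s : ℝ, 0 < s → s < ε → (p + s • v + s ^ 2 • w).2 < 0))

theorem GoodFamily.of_linked {a : Exps 3 → ℝ} {t t' v w : Params} (h : Linked a t t')
    (hf : GoodFamily a t' v w) : GoodFamily a t v w := by
  obtain ⟨p, ε, hε, h1, h2⟩ := hf
  exact ⟨p, ε, hε, fun s h0 hs => ⟨h.trans (h1 s h0 hs).1, (h1 s h0 hs).2⟩, h2⟩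

theorem eq_of_five_le (w : Exps 3) (h : 5 ≤ (w.1 : ℕ) + (w.2 : ℕ)) :
    w = (2, 3) ∨ w = (3, 2) ∨ w = (3, 3) := by
  revert w; decide

section Config

variable {a : Exps 3 → ℝ} {xA y xP x l : ℝ} {j₀ j₁ : Fin 4}

/-- A triangle with apex (3,1) and base in the top row has height two, hence even normalised area,
which unimodularity forbids. -/
theorem IsSmooth.row_unique (hs : IsSmooth a) {q : ℝ × ℝ} {k k' : Fin 4} (h1 : (3, 1) ∈ active a q)
    (h2 : (k, 3) ∈ active a q) (h3 : (k', 3) ∈ active a q) : k = k' := by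
  by_contra hne
  have := (hs q).2 (3, 1) h1 (k, 3) h2 (k', 3) h3 (by simp) (by simp [hne]) (by simp)
  simp only [latticeDet] at this
  have e3 : (((3 : Fin (3 + 1)) : ℕ) : ℤ) = 3 := rfl
  have e1 : (((1 : Fin (3 + 1)) : ℕ) : ℤ) = 1 := rfl
  rw [e3, e1] at this
  rcases abs_eq (zero_le_one (α := ℤ)) |>.1 this with h | h <;> omega

/-- The edge dual to two exponents of the last column is primitive. -/
theorem IsSmooth.not_mem_of_column (hs : IsSmooth a) {q : ℝ × ℝ} (h1 : (3, 1) ∈ active a q) :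
    (3, 3) ∉ active a q := by
  intro h2
  obtain ⟨r, -, h3, h4, z, hz, hz'⟩ := exists_edge_end (a := a) (p := q) (u := (3, 1)) (v := (3, 3))
    (w := (0, 0)) (d := (-1, 0)) h1 h2 (by simp [slope_mk]) (by simp [slope_mk])
  have hz1 : ((z.1 : ℕ) : ℝ) < 3 := by simpa [slope_mk] using hz'
  have hz1 : (z.1 : ℕ) < 3 := by exact_mod_cast hz1
  have := (hs _).2 (3, 1) h3 (3, 3) h4 z hz (by simp) (by rintro rfl; simp at hz1)
    (by rintro rfl; simp at hz1)
  simp only [latticeDet] at this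
  have e3 : (((3 : Fin (3 + 1)) : ℕ) : ℤ) = 3 := rfl
  have e1 : (((1 : Fin (3 + 1)) : ℕ) : ℤ) = 1 := rfl
  rw [e3, e1] at this
  rcases abs_eq (zero_le_one (α := ℤ)) |>.1 this with h | h <;> omega

/-- If the first point of the curve above `(x, y₁)` is a simple crossing, it is of width two. -/
theorem UpGood.width_eq {y₁ yq : ℝ} {u v : Exps 3} (h : UpGood a (x, y₁)) (hy : y₁ < yq)
    (hb : ∀ z, y₁ < z → z < yq → (x, z) ∉ curve a) (hq : active a (x, yq) = {u, v})
    (huv : u.2 < v.2) : (v.2 : ℕ) = u.2 + 2 := by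
  have hvr : ((u.2 : ℕ) : ℝ) < ((v.2 : ℕ) : ℝ) := by exact_mod_cast huv
  obtain ⟨δ, hδ, H⟩ := exists_local a x yq
  have habove : ∀ e, 0 < e → e < δ → active a (x, yq + e) = {v} := by
    intro e h0 he
    have := (H 0 e (by simpa using hδ) (by rwa [abs_of_pos h0])).2 v (by rw [hq]; simp) (by
      rw [hq]
      rintro w (rfl | rfl)
      · simp only [slope_mk]; nlinarith
      · rfl)
    rw [add_zero, hq] at this
    rw [this]
    ext w
    simp only [mem_sep_iff, mem_insert_iff, mem_singleton_iff, slope_mk]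
    constructor
    · rintro ⟨rfl | rfl, h⟩
      · nlinarith
      · rfl
    · rintro rfl; exact ⟨Or.inr rfl, rfl⟩
  have hqU : ((x, yq) : ℝ × ℝ) ∈ curve a ∩ upw (x, y₁) := by
    refine ⟨mem_curve_of_mem (u := u) (v := v) (by rw [hq]; simp) (by rw [hq]; simp) ?_, rfl, hy⟩
    rintro rfl; exact lt_irrefl _ huv
  have hU : curve a ∩ upw (x, y₁) = {(x, yq)} := by
    have hsub : curve a ∩ upw (x, y₁) ⊆ {p | p.2 ≤ yq} ∪ {p | yq + δ ≤ p.2} := by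
      rintro ⟨x', z⟩ ⟨hc, hx, hz⟩
      simp only at hx hz
      subst hx
      by_contra hn
      simp only [mem_union, mem_ofPred_eq, not_or, not_le] at hn
      have := habove (z - yq) (by linarith) (by linarith)
      rw [add_sub_cancel] at this
      exact not_mem_curve_of_eq_singleton this hc
    have hle : curve a ∩ upw (x, y₁) ⊆ {p | p.2 ≤ yq} := by
      rcases isPreconnected_iff_subset_of_disjoint_closed.1 h.1.isPreconnected _ _
        (isClosed_le continuous_snd continuous_const) (isClosed_le continuous_const continuous_snd)
        hsub (by
          ext p
          simp only [mem_inter_iff, mem_ofPred_eq, mem_empty_iff_false, iff_false]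
          rintro ⟨-, h1, h2⟩
          linarith) with h1 | h1
      · exact h1
      · have := h1 hqU
        simp only [mem_ofPred_eq] at this
        linarith
    apply Subset.antisymm
    · rintro ⟨x', z⟩ hp
      have h1 := hle hp
      obtain ⟨hc, hx, hz⟩ := hp
      simp only [mem_ofPred_eq] at hx hz h1
      subst hx
      rcases h1.eq_or_lt with rfl | h1
      · rfl
      · exact absurd hc (hb z hz h1)
    · rintro _ rfl; exact hqU
  have := h.2
  rw [hU, finsum_mem_singleton, hq, width_pair (by simpa [ydeg] using huv.le)] at this
  simp only [ydeg] at this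
  have h2 : ((v.2 : ℕ) : ℝ) = ((u.2 : ℕ) : ℝ) + 2 := by linarith
  exact_mod_cast h2

namespace EndConfig

variable (c : EndConfig a xA y xP j₀ j₁)
include c

/-- The monomial (3,1) minus the monomial `w` is affine, nonnegative at A and zero at `q`. The two
sides differ exactly by its change from A to `q`, so equality means a tie at A as well. This and the
next two lemmas locate the boundary of the chamber of (3,1) as seen from A. -/
theorem slope_eq {q : ℝ × ℝ} {w : Exps 3} (h1 : (3, 1) ∈ active a q) (hw : w ∈ active a q)
    (hA : w ∈ active a (xA, y)) :
    (3 - ((w.1 : ℕ) : ℝ)) * (q.1 - xA) = (((w.2 : ℕ) : ℝ) - 1) * (q.2 - y) := by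
  have e1 := term_eq_of_mem h1 hw
  have e2 := term_eq_of_mem (show (3, 1) ∈ active a (xA, y) by rw [c.vertex]; simp) hA
  simp only [term] at e1 e2
  norm_num at e1 e2
  linarith

theorem slope_lt {q : ℝ × ℝ} {w : Exps 3} (h1 : (3, 1) ∈ active a q) (hw : w ∈ active a q)
    (hA : w ∉ active a (xA, y)) :
    (3 - ((w.1 : ℕ) : ℝ)) * (q.1 - xA) < (((w.2 : ℕ) : ℝ) - 1) * (q.2 - y) := by
  have e1 := term_eq_of_mem h1 hw
  have e2 := lt_of_not_mem (show (3, 1) ∈ active a (xA, y) by rw [c.vertex]; simp) hA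
  simp only [term] at e1 e2
  norm_num at e1 e2
  linarith

theorem slope_le {q : ℝ × ℝ} {w : Exps 3} (h1 : (3, 1) ∈ active a q) (hw : w ∈ active a q) :
    (3 - ((w.1 : ℕ) : ℝ)) * (q.1 - xA) ≤ (((w.2 : ℕ) : ℝ) - 1) * (q.2 - y) := by
  by_cases hA : w ∈ active a (xA, y)
  · exact (c.slope_eq h1 hw hA).le
  · exact (c.slope_lt h1 hw hA).le

/-- Below a point of the upper boundary of the chamber of `(3, 1)`. -/
theorem active_below {yq z : ℝ} (hx : xA < x) (hq : (3, 1) ∈ active a (x, yq)) (h1 : y < z)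
    (h2 : z < yq) : active a (x, z) = {(3, 1)} :=
  c.active_edge hx hq (h1.trans h2) (mem_openSegment_vertical h1 h2)

theorem upGood_below {yq z : ℝ} {k : Fin 4} (hx : xA < x) (hq : (3, 1) ∈ active a (x, yq))
    (hk : (k, 3) ∈ active a (x, yq)) (h1 : y < z) (h2 : z < yq) : UpGood a (x, z) :=
  upGood_of_crossing (c.active_below hx hq h1 h2) h2 hq hk (by
    rintro ⟨k', z⟩ hw hw'
    simp only at hw'
    subst hw'
    rw [c.smooth.row_unique hq hk hw])

/-- If neither alternative holds, the obstacle above can only involve (3,2), because (3,3) together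
with (3,1) would be a non-primitive edge. That is a simple crossing of width one, while an `UpGood`
ray must cross with width two. -/
theorem exists_upper_boundary (hx : xA < x) {y₁ : ℝ} (h1 : active a (x, y₁) = {(3, 1)})
    (hU : UpGood a (x, y₁)) : ∃ yq, y₁ < yq ∧ (3, 1) ∈ active a (x, yq) ∧
      ((2, 3) ∈ active a (x, yq) ∨
        ∃ w ∈ active a (x, yq), w ≠ (3, 1) ∧ (w.1 : ℕ) + (w.2 : ℕ) ≤ 4) := by
  obtain ⟨r, hr, h2, -, z, hz, hz'⟩ := exists_edge_end (a := a) (p := (x, y₁)) (u := (3, 1))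
    (v := (3, 1)) (w := (3, 3)) (d := (0, 1)) (by rw [h1]; rfl) (by rw [h1]; rfl)
    (by simp [slope_mk]) (by simp [slope_mk])
  have e : ((x, y₁) : ℝ × ℝ) + r • ((0 : ℝ), (1 : ℝ)) = (x, y₁ + r) := by simp
  rw [e] at h2 hz
  have hz2 : 1 < (z.2 : ℕ) := by
    have : (1 : ℝ) < ((z.2 : ℕ) : ℝ) := by simpa [slope_mk] using hz'
    exact_mod_cast this
  have hr0 : 0 < r := by
    rcases hr.eq_or_lt with rfl | h
    · rw [add_zero, h1, mem_singleton_iff] at hz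
      rw [hz] at hz2; simp at hz2
    · exact h
  refine ⟨y₁ + r, by linarith, h2, ?_⟩
  by_contra hcon
  push Not at hcon
  obtain ⟨h23, hcon⟩ := hcon
  have hsub : active a (x, y₁ + r) = {(3, 1), (3, 2)} := by
    have key : ∀ w ∈ active a (x, y₁ + r), w = (3, 1) ∨ w = (3, 2) := by
      intro w hw
      by_cases h31 : w = (3, 1)
      · exact Or.inl h31
      have h5 := hcon w hw h31
      have h33 : w ≠ (3, 3) := by rintro rfl; exact c.smooth.not_mem_of_column h2 hw
      have h23' : w ≠ (2, 3) := by rintro rfl; exact h23 hw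
      rcases eq_of_five_le w (by omega) with h | h | h
      · exact absurd h h23'
      · exact Or.inr h
      · exact absurd h h33
    ext w
    constructor
    · exact key w
    · rintro (rfl | rfl)
      · exact h2
      · rcases key z hz with rfl | rfl
        · simp at hz2
        · exact hz
  have := hU.width_eq (by linarith) (fun w hw hw' => not_mem_curve_of_eq_singleton (u := (3, 1)) (by
    rw [active_openSegment (u := (3, 1)) (by rw [h1]; rfl) h2 (mem_openSegment_vertical hw hw'), h1]
    exact inter_eq_left.2 (singleton_subset_iff.2 h2))) hsub (by decide)
  simp at this

end EndConfig

end Config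


/-! ## Moving a tritangent into good position -/

section Config

variable {a : Exps 3 → ℝ} {xA y xP x l : ℝ} {j₀ j₁ : Fin 4}

namespace EndConfig

section Links

variable (c : EndConfig a xA y xP j₀ j₁)
include c

/-- Under the edge dual to `(3,1), (2,3)` the bounded edge may be shortened. -/
theorem linked_down {yq r₀ : ℝ} (hx : xA < x) (hl : 0 ≤ l) (ht : IsTritangent a ((x, y), l))
    (hlq : y + l ≤ yq) (hq : (3, 1) ∈ active a (x + l, yq))
    (hq' : (2, 3) ∈ active a (x + l, yq)) (h0 : 0 < r₀) (h1 : y + r₀ < yq)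
    (h2 : xA < x + l - r₀) : Linked a ((x, y), l) ((x + l - r₀, y), r₀) := by
  set f : ℝ → Params := fun r => ((x + l - r, y), r) with hf
  have hfc : Continuous f := by fun_prop
  have hfl : f l = ((x, y), l) := by simp [hf]
  have key : ∀ r, 0 < r → y + r < yq → xA < x + l - r → IsTritangent a (f r) := by
    intro r hr hry hrx
    have e : x + l - r + r = x + l := by ring
    apply c.isTritangent_of_upGood hrx hr
    · rw [e]; exact c.active_below (by linarith) hq (by linarith) hry
    · rw [e]; exact c.upGood_below (by linarith) hq hq' (by linarith) hry
  rw [← hfl]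
  change Linked a (f l) (f r₀)
  rcases le_total l r₀ with h | h
  · apply linked_of_path f hfc h
    intro r hr1 hr2
    rcases hr1.eq_or_lt with rfl | hr1
    · rw [hfl]; exact ht
    · exact key r (by linarith) (by linarith) (by linarith)
  · apply Linked.symm
    apply linked_of_path f hfc h
    intro r hr1 hr2
    rcases hr2.eq_or_lt with rfl | hr2
    · rw [hfl]; exact ht
    · exact key r (by linarith) (by linarith) (by linarith)

theorem upGood_lift {yq r : ℝ} (hx : xA < x) (hl : 0 ≤ l)
    (hU : UpGood a (x + l, y + l)) (hq : (3, 1) ∈ active a (x + l, yq)) (h : l ≤ r)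
    (hr : y + r < yq) : UpGood a (x + l, y + r) :=
  (UpGood.congr (by linarith) fun z h1 h2 => not_mem_curve_of_eq_singleton
    (c.active_below (by linarith) hq (by linarith) (by linarith))).1 hU

/-- The lower vertex moves to the left and the upper vertex up. -/
theorem linked_up {yq r₀ : ℝ} (hx : xA < x) (hl : 0 ≤ l) (ht : IsTritangent a ((x, y), l))
    (hU : UpGood a (x + l, y + l)) (hq : (3, 1) ∈ active a (x + l, yq)) (h : l ≤ r₀)
    (hr : y + r₀ ≤ yq) (hxr : xA ≤ x + l - r₀) (hT : IsTritangent a ((x + l - r₀, y), r₀)) :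
    Linked a ((x, y), l) ((x + l - r₀, y), r₀) := by
  set f : ℝ → Params := fun r => ((x + l - r, y), r) with hf
  have hfc : Continuous f := by fun_prop
  have hfl : f l = ((x, y), l) := by simp [hf]
  rw [← hfl]
  change Linked a (f l) (f r₀)
  apply linked_of_path f hfc h
  intro r hr1 hr2
  rcases hr1.eq_or_lt with rfl | hr1
  · rw [hfl]; exact ht
  rcases hr2.eq_or_lt with rfl | hr2
  · exact hT
  · have e : x + l - r + r = x + l := by ring
    apply c.isTritangent_of_upGood (by linarith) (by linarith)
    · rw [e]; exact c.active_below (by linarith) hq (by linarith) (by linarith)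
    · rw [e]; exact c.upGood_lift hx hl hU hq hr1.le (by linarith)

/-- Under the edge dual to `(3,1), (2,3)` one may move to the left. -/
theorem linked_target {yq yq' r : ℝ} (hx : xA < x) (hl : 0 ≤ l) (ht : IsTritangent a ((x, y), l))
    (hyq : y < yq) (hlq : y + l ≤ yq) (hq : (3, 1) ∈ active a (x + l, yq))
    (hq' : (2, 3) ∈ active a (x + l, yq)) (hr : 0 ≤ r) (hry : y + r ≤ yq')
    (hr1 : (3, 1) ∈ active a (xA + r, yq')) (hr2 : (2, 3) ∈ active a (xA + r, yq'))
    (hT : IsTritangent a ((xA, y), r)) : Linked a ((x, y), l) ((xA, y), r) := by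
  -- Half of the smaller of two margins: the height available below the edge of Γ, and the
  -- horizontal distance from A to v₁. With this length the bounded edge stays below the edge and v₀
  -- stays to the right of A.
  set r₀ : ℝ := min (yq - y) (x + l - xA) / 2 with hr₀
  have hm1 := min_le_left (yq - y) (x + l - xA)
  have hm2 := min_le_right (yq - y) (x + l - xA)
  have hm0 : 0 < min (yq - y) (x + l - xA) := lt_min (by linarith) (by linarith)
  have h0 : 0 < r₀ := by linarith
  have h1 : y + r₀ < yq := by linarith
  have h2 : xA < x + l - r₀ := by linarith
  refine (c.linked_down hx hl ht hlq hq hq' h0 h1 h2).trans ?_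
  -- Below a fixed edge of Γ the positions with v₀ on the end and v₁ under the edge form a convex
  -- set, so linear interpolation stays among the tritangents; the target itself may be a boundary
  -- point and is tritangent by hypothesis.
  set f : ℝ → Params := fun s =>
    (((1 - s) * (x + l - r₀) + s * xA, y), (1 - s) * r₀ + s * r) with hf
  have hfc : Continuous f := by fun_prop
  have e0 : f 0 = ((x + l - r₀, y), r₀) := by simp [hf]
  have e1 : f 1 = ((xA, y), r) := by simp [hf]
  rw [← e0, ← e1]
  apply linked_of_path f hfc zero_le_one
  intro s hs0 hs1
  rcases hs1.eq_or_lt with rfl | hs1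
  · rw [e1]; exact hT
  have ks : 0 < 1 - s := by linarith
  have hX : xA < (1 - s) * (x + l - r₀) + s * xA := by
    have := mul_pos ks (sub_pos.2 h2)
    nlinarith
  have hL : 0 < (1 - s) * r₀ + s * r := by
    have := mul_pos ks h0
    have := mul_nonneg hs0 hr
    linarith
  have hmem : ∀ u, u ∈ active a (x + l, yq) → u ∈ active a (xA + r, yq') →
      u ∈ active a ((1 - s) * (x + l - r₀) + s * xA + ((1 - s) * r₀ + s * r),
        (1 - s) * yq + s * yq') := by
    intro u m1 m2
    have e : (1 - s) * (x + l - r₀) + s * xA + ((1 - s) * r₀ + s * r) =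
      (1 - s) * (x + l) + s * (xA + r) := by ring
    rw [e]
    rcases hs0.eq_or_lt with rfl | hs0
    · simpa using m1
    · have := active_openSegment (z := ((1 - s) * (x + l) + s * (xA + r), (1 - s) * yq + s * yq'))
        m1 m2 ⟨1 - s, s, ks, hs0, by ring, rfl⟩
      rw [this]
      exact ⟨m1, m2⟩
  have hY : y + ((1 - s) * r₀ + s * r) < (1 - s) * yq + s * yq' := by
    have := mul_pos ks (sub_pos.2 h1)
    have := mul_nonneg hs0 (sub_nonneg.2 hry)
    nlinarith
  apply c.isTritangent_of_upGood hX hL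
  · exact c.active_below (by linarith) (hmem _ hq hr1) (by linarith) hY
  · exact c.upGood_below (by linarith) (hmem _ hq hr1) (hmem _ hq' hr2) (by linarith) hY

/-- The left end of the edge dual to `(3,1), (2,3)`. -/
theorem exists_left_end {yq : ℝ} (hx : xA < x) (hyq : y < yq) (hq : (3, 1) ∈ active a (x, yq))
    (hq' : (2, 3) ∈ active a (x, yq)) : j₁ = 3 ∨ ∃ m, 0 ≤ m ∧ y < yq - m ∧
      active a (x - 2 * m, yq - m) = {(3, 1), (2, 2), (2, 3)} := by
  obtain ⟨m, hm, h1, h2, z, hz, hz'⟩ := exists_edge_end (a := a) (p := (x, yq)) (u := (3, 1))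
    (v := (2, 3)) (w := (0, 0)) (d := (-2, -1)) hq hq' (by simp [slope_mk]; norm_num)
    (by simp [slope_mk]; norm_num)
  have e : ((x, yq) : ℝ × ℝ) + m • ((-2 : ℝ), (-1 : ℝ)) = (x - 2 * m, yq - m) := by
    rw [Prod.smul_mk, Prod.mk_add_mk, Prod.mk.injEq]
    constructor <;> simp only [smul_eq_mul] <;> ring
  rw [e] at h1 h2 hz
  have hz7 : 2 * (z.1 : ℕ) + (z.2 : ℕ) < 7 := by
    have : (2 : ℝ) * ((z.1 : ℕ) : ℝ) + ((z.2 : ℕ) : ℝ) < 7 := by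
      simp only [slope_mk] at hz'
      norm_num at hz'
      linarith
    exact_mod_cast this
  have hdet := (c.smooth _).2 (3, 1) h1 (2, 3) h2 z hz (by simp) (by rintro rfl; simp at hz7)
    (by rintro rfl; simp at hz7)
  -- Unimodularity leaves two possible third vertices on the left side of this edge. The exponent
  -- (3,0) is then excluded, since it ties with (3,1) only at the height of the end.
  have hz30 : z = (3, 0) ∨ z = (2, 2) := by
    clear hz hz'
    revert z; decide
  have heq := c.smooth.eq_triple h1 hz h2 (by rintro rfl; simp at hz30) (by simp)
    (by rintro rfl; simp at hz30)
  have hvert : j₁ ≠ 3 → (2, 3) ∉ active a (xA, y) := by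
    intro h
    rw [c.vertex]
    simp [h.symm]
  by_cases hj : j₁ = 3
  · exact Or.inl hj
  right
  have hlt := c.slope_lt h1 h2 (hvert hj)
  norm_num at hlt
  have t0 := term_eq_of_mem (show (3, 0) ∈ active a (xA, y) by rw [c.vertex]; simp)
    (show (3, 1) ∈ active a (xA, y) by rw [c.vertex]; simp)
  have hy : y < yq - m := by
    have t1 := h1 (3, 0)
    have t2 := h1 (2, j₁)
    have t3 := term_eq_of_mem (show (2, j₁) ∈ active a (xA, y) by rw [c.vertex]; simp)
      (show (3, 1) ∈ active a (xA, y) by rw [c.vertex]; simp)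
    simp only [term] at t0 t1 t2 t3
    norm_num at t0 t1 t2 t3
    have hge : y ≤ yq - m := by linarith
    refine lt_of_le_of_ne hge fun e => ?_
    rw [← e] at hlt t2
    linarith
  refine ⟨m, hm, hy, ?_⟩
  rcases hz30 with rfl | rfl
  · exfalso
    have t1 := term_eq_of_mem hz h1
    simp only [term] at t0 t1
    norm_num at t0 t1
    linarith
  · exact heq

end Links

end EndConfig

end Config


/-! ## Families of tritangents in good position -/

section Config

variable {a : Exps 3 → ℝ} {xA y xP x l : ℝ} {j₀ j₁ : Fin 4}

theorem fin_le_one (j : Fin 4) (h : j ≤ 1) : j = 0 ∨ j = 1 := by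
  revert j; decide

/-- A half-open arc of tritangents in good position. -/
theorem goodFamily_of_arc {p v w : Params} (h0 : IsTritangent a p)
    (h : ∃ δ > 0, ∀ s : ℝ, 0 < s → s < δ → IsTritangent a (p + s • v + s ^ 2 • w) ∧
      IsGood (active a (vert0 (p + s • v + s ^ 2 • w))) ∧
      IsGood (active a (vert1 (p + s • v + s ^ 2 • w))) ∧ 0 < (p + s • v + s ^ 2 • w).2) :
    GoodFamily a p v w := by
  obtain ⟨δ, hδ, h⟩ := h
  refine ⟨p, δ, hδ, fun s hs0 hs => ⟨?_, (h s hs0 hs).2.1, (h s hs0 hs).2.2.1⟩,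
    Or.inl fun s hs0 hs => (h s hs0 hs).2.2.2⟩
  have := linked_of_path (a := a) (fun s : ℝ => p + s • v + s ^ 2 • w) (by fun_prop) hs0.le
    (fun r hr hrs => by
      rcases hr.eq_or_lt with rfl | hr
      · simpa using h0
      · exact (h r hr (hrs.trans_lt hs)).1)
  simpa using this

namespace EndConfig

section Low

variable (c : EndConfig a xA y xP j₀ j₁)
include c

theorem exists_isTritangent_diag (hj : j₁ ≤ 1) : ∃ δ > 0, ∀ s, 0 < s → s < δ →
    IsGood (active a (xA - s, y - s)) ∧ ∀ r, 0 < r → active a (xA + r, y + r) = {(3, 1)} →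
      UpGood a (xA + r, y + r) → IsTritangent a ((xA - s, y - s), r + s) := by
  rcases fin_le_one j₁ hj with h | h
  · obtain ⟨δ, hδ, H⟩ := c.isTritangent_diag_zero h
    refine ⟨δ, hδ, fun s h0 hs => ⟨?_, (H s h0 hs).2⟩⟩
    rw [(H s h0 hs).1]
    exact isGood_singleton (by decide)
  · obtain ⟨δ, hδ, H⟩ := c.isTritangent_diag_one h
    refine ⟨δ, hδ, fun s h0 hs => ⟨?_, (H s h0 hs).2⟩⟩
    rw [(H s h0 hs).1]
    exact isGood_pair (by decide) (by simp [insert_subset_iff]) (by decide)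

/-- Only v₀ retreats, down the diagonal through A, while v₁ stays fixed. The family is straight. -/
theorem goodFamily_diag {r : ℝ} (hj : j₁ ≤ 1) (hr : 0 < r)
    (hv : active a (xA + r, y + r) = {(3, 1)}) (hU : UpGood a (xA + r, y + r)) :
    GoodFamily a ((xA, y), r) ((-1, -1), 1) 0 := by
  obtain ⟨δ, hδ, H⟩ := c.exists_isTritangent_diag hj
  refine goodFamily_of_arc (c.isTritangent_vertex hj hr hv hU) ⟨δ, hδ, fun s h0 hs => ?_⟩
  have e : (((xA, y), r) : Params) + s • (((-1, -1), 1) : Params) + s ^ 2 • (0 : Params) =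
      ((xA - s, y - s), r + s) := by
    simp [sub_eq_add_neg]
  rw [e, vert0_mk, vert1_mk (by linarith), show xA - s + (r + s) = xA + r by ring,
    show y - s + (r + s) = y + r by ring, hv]
  exact ⟨(H s h0 hs).2 r hr hv hU, (H s h0 hs).1, isGood_singleton (by decide), by
    simp only; linarith⟩

/-- If the upper leg crosses the relative interior of an edge dual to (3,1), (k,3), then v₁ is free
to move too. Lengthening the bounded edge by an additional s² bends the arc, so it detects a cell of
dimension two. -/
theorem goodFamily_diag_two {r yq : ℝ} {k : Fin 4} (hj : j₁ ≤ 1) (hr : 0 < r) (hry : y + r < yq)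
    (hq : active a (xA + r, yq) = {(3, 1), (k, 3)}) :
    GoodFamily a ((xA, y), r) ((-1, -1), 1) ((0, 0), 1) := by
  obtain ⟨δ₁, h1, H⟩ := c.exists_isTritangent_diag hj
  obtain ⟨δ₂, h2, H2⟩ := exists_local a (xA + r) yq
  have hk : (3 - ((k : ℕ) : ℝ)) ≤ 3 := by linarith [Nat.cast_nonneg (α := ℝ) (k : ℕ)]
  have hk0 : 0 ≤ (3 - ((k : ℕ) : ℝ)) := by linarith [exps_fst_le (k, 0)]
  -- The slope of the edge dual to (3,1), (k,3), along which the crossing follows the displaced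
  -- upper leg.
  set e : ℝ := (3 - ((k : ℕ) : ℝ)) / 2 with he
  have hq' : ∀ d, 0 ≤ d → d < δ₂ / 2 → active a (xA + (r + d), yq + e * d) = {(3, 1), (k, 3)} := by
    intro d h0 hd
    have hed : 0 ≤ e * d := mul_nonneg (by linarith) h0
    have hed2 : e * d ≤ 3 / 2 * d := mul_le_mul_of_nonneg_right (by linarith) h0
    rw [← add_assoc, (H2 d (e * d) (by rw [abs_of_nonneg h0]; linarith)
      (by rw [abs_of_nonneg hed]; linarith)).2 (3, 1) (by rw [hq]; simp), hq]
    · ext w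
      simp only [mem_sep_iff, mem_insert_iff, mem_singleton_iff]
      refine ⟨fun h => h.1, fun h => ⟨h, ?_⟩⟩
      rcases h with rfl | rfl
      · rfl
      · simp only [slope_mk, he]; norm_num; ring
    · rw [hq]
      rintro w (rfl | rfl)
      · rfl
      · apply le_of_eq; simp only [slope_mk, he]; norm_num; ring
  have key : ∀ d, 0 ≤ d → d < δ₂ / 2 → d < yq - (y + r) →
      active a (xA + (r + d), y + (r + d)) = {(3, 1)} ∧
        UpGood a (xA + (r + d), y + (r + d)) := by
    intro d h0 hd hd'
    have hed : 0 ≤ e * d := mul_nonneg (by linarith) h0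
    have hx : xA < xA + (r + d) := by linarith
    exact ⟨c.active_below hx (by rw [hq' d h0 hd]; simp) (by linarith) (by linarith),
      c.upGood_below hx (by rw [hq' d h0 hd]; simp) (k := k) (by rw [hq' d h0 hd]; simp)
        (by linarith) (by linarith)⟩
  obtain ⟨k1, k2⟩ := key 0 le_rfl (by linarith) (by linarith)
  rw [add_zero] at k1 k2
  refine goodFamily_of_arc (c.isTritangent_vertex hj hr k1 k2)
    ⟨min (min δ₁ (δ₂ / 2)) (min 1 (yq - (y + r))), by
      refine lt_min (lt_min h1 (by linarith)) (lt_min one_pos (by linarith)), fun s h0 hs => ?_⟩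
  obtain ⟨⟨hs1, hs2⟩, hs3, hs4⟩ := (lt_min_iff.1 hs).imp lt_min_iff.1 lt_min_iff.1
  have hss : s ^ 2 < s := by nlinarith
  have hs0 : 0 < s ^ 2 := by positivity
  obtain ⟨k3, k4⟩ := key (s ^ 2) hs0.le (by linarith) (by linarith)
  have e : (((xA, y), r) : Params) + s • (((-1, -1), 1) : Params) +
      s ^ 2 • (((0, 0), 1) : Params) = ((xA - s, y - s), r + s ^ 2 + s) := by
    simp [sub_eq_add_neg, add_right_comm]
  rw [e, vert0_mk, vert1_mk (by linarith), show xA - s + (r + s ^ 2 + s) = xA + (r + s ^ 2) by ring,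
    show y - s + (r + s ^ 2 + s) = y + (r + s ^ 2) by ring, k3]
  exact ⟨(H s h0 hs1).2 (r + s ^ 2) (by linarith) k3 k4, (H s h0 hs1).1,
    isGood_singleton (by decide), by simp only; linarith⟩

end Low

/-- The vertex v₁ slides to the left along the horizontal edge dual to (2,2), (2,3), while v₀ enters
the chamber of (2,2). Sliding and shortening are independent motions; coupling them as s and s²
gives independent directions. -/
theorem goodFamily_lower {α : ℝ} (c : EndConfig a xA y xP j₀ 2) (hα : 0 < α)
    (hB : active a (xA + α, y + α) = {(3, 1), (2, 2), (2, 3)}) :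
    GoodFamily a ((xA, y), α) ((-1, 0), 0) ((1, 1), -1) := by
  obtain ⟨δ, hδ, H⟩ := c.isTritangent_left hα hB
  refine goodFamily_of_arc (c.isTritangent_slope_lower hα hB) ⟨δ, hδ, fun s h0 hs => ?_⟩
  obtain ⟨h1, h2, h3, h4⟩ := H s h0 hs
  have e : (((xA, y), α) : Params) + s • (((-1, 0), 0) : Params) +
      s ^ 2 • (((1, 1), -1) : Params) = ((xA - s + s ^ 2, y + s ^ 2), α - s ^ 2) := by
    simp [sub_eq_add_neg]
  rw [e, vert0_mk, vert1_mk h3.le, show xA - s + s ^ 2 + (α - s ^ 2) = xA + α - s by ring,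
    show y + s ^ 2 + (α - s ^ 2) = y + α by ring, h1, h2]
  exact ⟨h4, isGood_singleton (by decide),
    isGood_pair (by decide) (by simp [insert_subset_iff]) (by decide), h3⟩

/-- The whole curve is translated upwards: v₁ follows the vertical edge dual to (2,2), (3,2) and v₀
enters the chamber of (2,2). Only one direction is obtained. -/
theorem goodFamily_upper {α : ℝ} (c : EndConfig a xA y xP j₀ 2) (hα : 0 < α)
    (hB : active a (xA + α, y + α) = {(3, 1), (2, 2), (3, 2)}) :
    GoodFamily a ((xA, y), α) ((0, 1), 0) 0 := by
  obtain ⟨δ, hδ, H⟩ := c.isTritangent_above hα hB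
  refine goodFamily_of_arc (c.isTritangent_slope_upper hα hB) ⟨δ, hδ, fun s h0 hs => ?_⟩
  obtain ⟨h1, h2, h4⟩ := H s h0 hs
  have e : (((xA, y), α) : Params) + s • (((0, 1), 0) : Params) + s ^ 2 • (0 : Params) =
      ((xA, y + s), α) := by simp
  rw [e, vert0_mk, vert1_mk hα.le, h1, h2]
  exact ⟨h4, isGood_singleton (by decide),
    isGood_pair (by decide) (by simp [insert_subset_iff]) (by decide), hα⟩

/-- The vertex v₀ slides along the edge dual to (2,3), (3,0) in direction (-3,-1), and the new edge
of slope -1 and length parameter -s² carries v₁ into the chamber of (2,3). -/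
theorem goodFamily_neg (c : EndConfig a xA y xP j₀ 3) :
    GoodFamily a ((xA, y), 0) ((-3, -1), 0) ((0, 0), -1) := by
  obtain ⟨δ, hδ, H⟩ := c.isTritangent_neg
  have e : ∀ s : ℝ, (((xA, y), 0) : Params) + s • (((-3, -1), 0) : Params) +
      s ^ 2 • (((0, 0), -1) : Params) = ((xA - 3 * s, y - s), -s ^ 2) := by
    intro s
    simp [sub_eq_add_neg, mul_comm]
  refine ⟨((xA, y), 0), δ, hδ, fun s h0 hs => ?_, Or.inr fun s h0 hs => ?_⟩
  · obtain ⟨h1, h2, h4⟩ := H s h0 hs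
    have hn : -s ^ 2 < 0 := by simpa using pow_pos h0 2
    refine ⟨?_, ?_, ?_⟩
    · have := linked_of_path (a := a) (fun s : ℝ => (((xA - 3 * s, y - s), -s ^ 2) : Params))
        (by fun_prop) h0.le (fun r hr hrs => by
          rcases hr.eq_or_lt with rfl | hr
          · simpa using c.isTritangent_four_valent
          · exact (H r hr (hrs.trans_lt hs)).2.2)
      rw [e]
      simpa using this
    · rw [e, vert0_mk, h1]
      exact isGood_pair (by decide) (by simp [insert_subset_iff]) (by decide)
    · rw [e, vert1_mk_neg hn, show xA - 3 * s + -s ^ 2 = xA - 3 * s - s ^ 2 by ring,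
        show y - s - -s ^ 2 = y - s + s ^ 2 by ring, h2]
      exact isGood_singleton (by decide)
  · rw [e]
    simpa using pow_pos h0 2

/-! ## Classification -/

variable (c : EndConfig a xA y xP j₀ j₁)
include c

/-- The exponents that meet `(3,1)` on the way up the bounded edge. -/
theorem mem_of_mem_edge {r : ℝ} (hx : xA < x) (hr : 0 < r) (h : (3, 1) ∈ active a (x + r, y + r))
    {w : Exps 3} (hw : w ∈ active a (x + r, y + r)) : w = (3, 1) ∨ w = (2, 3) ∨ w = (3, 2) := by
  by_cases h5 : 5 ≤ (w.1 : ℕ) + (w.2 : ℕ)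
  · rcases eq_of_five_le w h5 with rfl | rfl | rfl
    · simp
    · simp
    · exact absurd hw (c.smooth.not_mem_of_column h)
  left
  by_contra hne
  have hlt := c.slope_le h hw
  simp only at hlt
  have h4 : ((w.1 : ℕ) : ℝ) + ((w.2 : ℕ) : ℝ) ≤ 4 := by
    have : (w.1 : ℕ) + (w.2 : ℕ) ≤ 4 := by omega
    exact_mod_cast this
  have h3 := exps_fst_le w
  rcases h3.eq_or_lt with h3 | h3
  · have e1 : (w.1 : ℕ) = 3 := by exact_mod_cast h3
    have e2 : w.2 ≤ 1 := by
      have : (w.2 : ℕ) ≤ 1 := by omega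
      exact this
    obtain ⟨i, j⟩ := w
    obtain rfl : i = 3 := Fin.ext e1
    have hj : j = 0 := by
      rcases fin_le_one j e2 with h | h
      · exact h
      · exact absurd (by rw [h]) hne
    subst hj
    have t1 := term_eq_of_mem hw h
    have t0 := term_eq_of_mem (show (3, 0) ∈ active a (xA, y) by rw [c.vertex]; simp)
      (show (3, 1) ∈ active a (xA, y) by rw [c.vertex]; simp)
    simp only [term] at t0 t1
    norm_num at t0 t1
    linarith
  · have k1 : 0 < (3 - ((w.1 : ℕ) : ℝ)) * (x - xA) := mul_pos (by linarith) (by linarith)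
    have k2 : 0 ≤ (4 - ((w.1 : ℕ) : ℝ) - ((w.2 : ℕ) : ℝ)) * r := mul_nonneg (by linarith) hr.le
    nlinarith

/-- Either the upper vertex lies below the edge dual to `(3,1), (2,3)` or on it, or it lies in
the chamber of `(3,1)`. -/
theorem classification (hx : xA < x) (hl : 0 ≤ l) (ht : IsTritangent a ((x, y), l))
    (hc : ¬ InCornerChamber a ((x, y), l)) (ho : ¬ OnCornerEdge a ((x, y), l)) :
    ∃ yq, y < yq ∧ y + l ≤ yq ∧ (3, 1) ∈ active a (x + l, yq) ∧
      ((2, 3) ∈ active a (x + l, yq) ∨ y + l < yq ∧ UpGood a (x + l, y + l) ∧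
        ∃ w ∈ active a (x + l, yq), w ≠ (3, 1) ∧ (w.1 : ℕ) + (w.2 : ℕ) ≤ 4) := by
  rcases hl.eq_or_lt with rfl | hl
  · simp only [add_zero] at *
    have hU := c.upGood_of_isTritangent_zero hx ht
    -- For l = 0 the upper vertex is still on the end. The search for the boundary starts half-way
    -- up the gap instead, inside the chamber of (3,1).
    obtain ⟨ε, hε, hgap⟩ := c.exists_gap hx
    have h1 := (hgap (ε / 2) (by linarith) (by linarith)).2
    have hU' : UpGood a (x, y + ε / 2) := (UpGood.congr (by linarith) fun z hz hz' => by
      have := (hgap (z - y) (by linarith) (by linarith)).2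
      rw [add_sub_cancel] at this
      exact not_mem_curve_of_eq_singleton this).1 hU
    obtain ⟨yq, h2, h3, h4⟩ := c.exists_upper_boundary hx h1 hU'
    exact ⟨yq, by linarith, by linarith, h3, h4.imp_right fun h => ⟨by linarith, hU, h⟩⟩
  -- the bounded edge has positive length
  have hrest := c.rest_of_isTritangent hx hl ht
  by_cases hv : active a (x + l, y + l) = {(3, 1)}
  · have hU := c.upGood_of_isTritangent hx hl hv ht
    obtain ⟨yq, h2, h3, h4⟩ := c.exists_upper_boundary (by linarith) hv hU
    exact ⟨yq, by linarith, h2.le, h3, h4.imp_right fun h => ⟨h2, hU, h⟩⟩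
  by_cases h31 : (3, 1) ∈ active a (x + l, y + l)
  · refine ⟨y + l, by linarith, le_rfl, h31, Or.inl ?_⟩
    by_contra h23
    -- Were (2,3) not active at v₁, then v₁ would lie on the end dual to (3,1), (3,2).
    have hpair : active a (x + l, y + l) = {(3, 1), (3, 2)} := by
      have key : ∀ w ∈ active a (x + l, y + l), w = (3, 1) ∨ w = (3, 2) := by
        intro w hw
        rcases c.mem_of_mem_edge hx hl h31 hw with h | rfl | h
        · exact Or.inl h
        · exact absurd hw h23
        · exact Or.inr h
      apply Subset.antisymm
      · intro w hw; exact key w hw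
      · rintro w (rfl | rfl)
        · exact h31
        · by_contra h32
          apply hv
          ext w
          constructor
          · intro hw
            rcases key w hw with rfl | rfl
            · rfl
            · exact absurd hw h32
          · rintro rfl; exact h31
    -- In that position the upper leg starts in the chamber of (3,2). Being connected, `rest` then
    -- has no point above v₁, and it has multiplicity one, all of it at v₁: a contradiction.
    obtain ⟨δ, hδ, H⟩ := exists_local a (x + l) (y + l)
    have habove : ∀ e, 0 < e → e < δ → active a (x + l, y + l + e) = {(3, 2)} := by
      intro e h0 he
      have := (H 0 e (by simpa using hδ) (by rwa [abs_of_pos h0])).2 (3, 2) (by rw [hpair]; simp)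
        (by rw [hpair]; rintro w (rfl | rfl) <;> simp [slope_mk]; linarith)
      rw [add_zero, hpair] at this
      rw [this]
      ext w
      simp only [mem_sep_iff, mem_insert_iff, mem_singleton_iff]
      constructor
      · rintro ⟨rfl | rfl, h⟩
        · simp [slope_mk] at h; linarith
        · rfl
      · rintro rfl; simp
    have hvR : (x + l, y + l) ∈ rest a ((x, y), l) := by
      refine ⟨mem_curve_of_mem (u := (3, 1)) (v := (3, 2)) (by rw [hpair]; simp)
        (by rw [hpair]; simp) (by simp), Or.inl (Or.inl (Or.inr ?_))⟩
      rw [vert1_mk hl.le]; rfl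
    have hcases : ∀ p ∈ rest a ((x, y), l), p = (x + l, y + l) ∨ p ∈ rgt (x + l, y + l) ∨
        p ∈ upw (x + l, y + l) := by
      rintro p ⟨hc, ((hp | hp) | hp) | hp⟩
      · rw [vert0_mk, vert1_mk hl.le] at hp
        exact absurd hc (not_mem_curve_of_eq_singleton
          (c.active_edge hx h31 (by simp only; linarith) hp))
      · rw [vert1_mk hl.le] at hp; exact Or.inl hp
      · rw [vert1_mk hl.le] at hp; exact Or.inr (Or.inl hp)
      · rw [vert1_mk hl.le] at hp; exact Or.inr (Or.inr hp)
    have hsub : rest a ((x, y), l) ⊆ {p | p.2 ≤ y + l} ∪ {p | y + l + δ ≤ p.2} := by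
      rintro ⟨z, w⟩ hp
      rcases hcases _ hp with h | h | h
      · rw [h]; exact Or.inl (le_refl (y + l))
      · exact Or.inl h.1.le
      · by_contra hn
        simp only [mem_union, mem_ofPred_eq, not_or, not_le] at hn
        obtain ⟨h1, h2⟩ := h
        simp only at h1 h2
        subst h1
        have := habove (w - (y + l)) (by linarith) (by linarith)
        rw [add_sub_cancel] at this
        exact not_mem_curve_of_eq_singleton this hp.1
    have hle : rest a ((x, y), l) ⊆ {p | p.2 ≤ y + l} := by
      rcases isPreconnected_iff_subset_of_disjoint_closed.1 hrest.1.isPreconnected _ _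
        (isClosed_le continuous_snd continuous_const) (isClosed_le continuous_const continuous_snd)
        hsub (by
          ext p
          simp only [mem_inter_iff, mem_ofPred_eq, mem_empty_iff_false, iff_false]
          rintro ⟨-, h1, h2⟩
          linarith) with h1 | h1
      · exact h1
      · have := h1 hvR
        simp only [mem_ofPred_eq] at this
        linarith
    have hm := hrest.2
    rw [componentMult, finsum_mem_eq_one hvR] at hm
    · rw [stableMult_of_vertical_left hpair rfl rfl,
        active_line_vert1 (t := ((x, y), l)) hl.le (vert1_mk hl.le).symm hl.ne',
        Tritangent.width_eq (m := 0) (M := 1)] at hm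
      · norm_num at hm
      · rintro w (rfl | rfl | rfl) <;> simp [xdeg]
      · exact ⟨(0, 1), by simp, rfl⟩
      · exact ⟨(1, 0), by simp, rfl⟩
    · intro p hp hne
      rcases hcases p hp with h | h | h
      · exact absurd h hne
      · obtain ⟨z, w⟩ := p
        obtain ⟨h1, h2⟩ := h
        simp only at h1 h2
        subst h1
        rw [stableMult_right (t := ((x, y), l)) (p := (z, y + l)) hl.le
          (by rw [vert1_mk hl.le]; exact ⟨rfl, h2⟩), active_right h31 rfl h2, hpair]
        apply width_eq_zero
        · rintro u ⟨-, hu⟩ v ⟨-, hv⟩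
          simp only [xdeg, hu, hv]
        · exact ⟨(3, 1), by simp, rfl⟩
      · have h1 := hle hp
        have h2 := h.2
        simp only [mem_ofPred_eq] at h1 h2
        linarith
  -- Otherwise the bounded edge leaves the chamber of (3,1) before it ends, at height y + r, towards
  -- (2,3), (3,2) or both.
  · exfalso
    obtain ⟨r, hr0, hrl, hr31, z, hz, hz4⟩ := exists_exit (a := a) (u := (3, 1)) (p := (x, y))
      (d := (1, 1)) (s := l) (by rw [c.active_ray hx]; simp) hl (by simpa using h31)
    have e : ((x, y) : ℝ × ℝ) + r • ((1 : ℝ), (1 : ℝ)) = (x + r, y + r) := by simp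
    rw [e] at hr31 hz
    have hz31 : z ≠ (3, 1) := by rintro rfl; exact lt_irrefl _ hz4
    have hrpos : 0 < r := by
      rcases hr0.eq_or_lt with rfl | h
      · rw [add_zero, add_zero, c.active_ray hx] at hz
        rcases hz with rfl | rfl
        · simp [slope_mk] at hz4; linarith
        · exact absurd rfl hz31
      · exact h
    have hcases := fun w (hw : w ∈ active a (x + r, y + r)) => c.mem_of_mem_edge hx hrpos hr31 hw
    have hz' := (hcases z hz).resolve_left hz31
    have htd : tdeg z = 5 := by rcases hz' with rfl | rfl <;> rfl
    have hslz : ∀ d : ℝ, slope z (d, d) = 5 * d := by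
      intro d; rcases hz' with rfl | rfl <;> simp only [slope_mk] <;> norm_num <;> ring
    -- If both become active, the bounded edge runs on along the slope-one edge of Γ dual to (2,3),
    -- (3,2). Then v₁ lies either on that edge beyond its inner end or, past it, in the chamber of
    -- (3,3); both positions have been removed.
    by_cases hboth : (2, 3) ∈ active a (x + r, y + r) ∧ (3, 2) ∈ active a (x + r, y + r)
    · by_cases hon : (2, 3) ∈ active a (x + l, y + l) ∧ (3, 2) ∈ active a (x + l, y + l)
      · apply ho
        right; left
        have hslope : ∀ w ∈ active a (x + l, y + l), (5 : ℝ) ≤ slope w (1, 1) := by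
          intro w hw
          have e : ((x + l, y + l) : ℝ × ℝ) = (x + r, y + r) + (l - r) • ((1 : ℝ), (1 : ℝ)) := by
            simp
          rw [e] at hw
          have := slope_le_of_ray hboth.1 (sub_pos.2 hrl) hw
          simp only [slope_mk] at this ⊢
          norm_num at this ⊢
          linarith
        refine ⟨hl, ?_, ?_, ?_, ?_⟩
        · rw [vert1_mk hl.le]
          rintro w (rfl | rfl)
          · exact hon.1
          · exact hon.2
        · rw [vert1_mk hl.le]; intro h
          have := hslope _ h
          simp only [slope_mk] at this
          norm_num at this
        · rw [vert1_mk hl.le]; intro h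
          have := hslope _ h
          simp only [slope_mk] at this
          norm_num at this
        · rw [vert1_mk hl.le]; exact h31
      · obtain ⟨u, hu5, hu, hu'⟩ : ∃ u : Exps 3, slope u ((1 : ℝ), (1 : ℝ)) = 5 ∧
            u ∈ active a (x + r, y + r) ∧ u ∉ active a (x + l, y + l) := by
          rcases not_and_or.1 hon with h | h
          · exact ⟨(2, 3), by simp only [slope_mk]; norm_num, hboth.1, h⟩
          · exact ⟨(3, 2), by simp only [slope_mk]; norm_num, hboth.2, h⟩
        obtain ⟨m, hm0, hml, -, v, hv, hv5⟩ := exists_exit (a := a) (u := u) (p := (x + r, y + r))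
          (d := (1, 1)) (s := l - r) hu (sub_pos.2 hrl) (by simpa using hu')
        have hv6 : v = (3, 3) := by
          rw [hu5] at hv5
          simp only [slope_mk, mul_one] at hv5
          have h5 : 5 < (v.1 : ℕ) + (v.2 : ℕ) := by exact_mod_cast hv5
          rcases eq_of_five_le v h5.le with rfl | rfl | rfl
          · simp at h5
          · simp at h5
          · rfl
        subst hv6
        apply hc
        left
        refine ⟨hl, Or.inr ?_⟩
        rw [vert1_mk hl.le]
        have e : ((x + l, y + l) : ℝ × ℝ) = ((x + r, y + r) + m • ((1 : ℝ), (1 : ℝ))) +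
            (l - r - m) • ((1 : ℝ), (1 : ℝ)) := by
          simp only [Prod.smul_mk, Prod.mk_add_mk, smul_eq_mul, mul_one, Prod.mk.injEq]
          constructor <;> ring
        rw [e, Tritangent.active_ray hv (fun w => ?_) (by linarith)]
        · ext w
          simp only [mem_sep_iff, mem_singleton_iff]
          constructor
          · rintro ⟨-, h⟩
            simp only [slope_mk, mul_one] at h
            have h6 : (w.1 : ℕ) + (w.2 : ℕ) = 6 := by
              have : ((w.1 : ℕ) : ℝ) + ((w.2 : ℕ) : ℝ) = 6 := by rw [h]; norm_num
              exact_mod_cast this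
            rcases eq_of_five_le w (by omega) with rfl | rfl | rfl
            · simp at h6
            · simp at h6
            · rfl
          · rintro rfl; exact ⟨hv, rfl⟩
        · have h1 := exps_fst_le w
          have h2 := exps_snd_le w
          simp only [slope_mk]
          norm_num
          linarith
    -- If only one of them becomes active, the bounded edge crosses Γ transversely with total
    -- degrees 4 and 5. By connectedness this crossing is all of `rest`, of multiplicity one instead
    -- of two.
    · have hpair : active a (x + r, y + r) = {(3, 1), z} := by
        ext w
        simp only [mem_insert_iff, mem_singleton_iff]
        constructor
        · intro hw
          rcases hcases w hw with h | h | h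
          · exact Or.inl h
          · rcases hz' with h' | h'
            · exact Or.inr (h.trans h'.symm)
            · exact absurd ⟨h ▸ hw, h' ▸ hz⟩ hboth
          · rcases hz' with h' | h'
            · exact absurd ⟨h' ▸ hz, h ▸ hw⟩ hboth
            · exact Or.inr (h.trans h'.symm)
        · rintro (rfl | rfl)
          · exact hr31
          · exact hz
      obtain ⟨δ, hδ, H⟩ := exists_local a (x + r) (y + r)
      have hafter : ∀ e, 0 < e → e < δ → active a (x + r + e, y + r + e) = {z} := by
        intro e h0 he
        have := (H e e (by rwa [abs_of_pos h0]) (by rwa [abs_of_pos h0])).2 z hz (by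
          rw [hpair]
          rintro w (rfl | rfl)
          · rw [hslz]; simp only [slope_mk]; norm_num; linarith
          · exact le_rfl)
        rw [this, hpair]
        ext w
        simp only [mem_sep_iff, mem_insert_iff, mem_singleton_iff]
        constructor
        · rintro ⟨rfl | rfl, h⟩
          · rw [hslz] at h; simp only [slope_mk] at h; norm_num at h; linarith
          · rfl
        · rintro rfl; exact ⟨Or.inr rfl, rfl⟩
      have hdiag : ∀ p ∈ rest a ((x, y), l), p.1 < x + l → ∃ q, p = (x + q, y + q) := by
        rintro p ⟨hc, ((hp | hp) | hp) | hp⟩ hlt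
        · rw [vert0_mk, vert1_mk hl.le] at hp
          have := openSegment_subset_segment ℝ _ _ hp
          rw [mem_segment_diag_iff hl.le] at this
          obtain ⟨q, -, -, rfl⟩ := this
          exact ⟨q, rfl⟩
        · rw [vert1_mk hl.le] at hp
          rw [hp] at hlt
          exact absurd hlt (lt_irrefl _)
        · rw [vert1_mk hl.le] at hp
          exact absurd hp.2 (not_lt.2 hlt.le)
        · rw [vert1_mk hl.le] at hp
          exact absurd hp.1 hlt.ne
      have hwR : (x + r, y + r) ∈ rest a ((x, y), l) := by
        refine ⟨mem_curve_of_mem hr31 hz hz31.symm, Or.inl (Or.inl (Or.inl ?_))⟩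
        rw [vert0_mk, vert1_mk hl.le]
        exact mem_openSegment_diag hrpos hrl
      have hsub : rest a ((x, y), l) ⊆ {p | p.1 ≤ x + r} ∪ {p | x + r + min δ (l - r) ≤ p.1} := by
        intro p hp
        by_contra hn
        simp only [mem_union, mem_ofPred_eq, not_or, not_le] at hn
        have hm1 := min_le_left δ (l - r)
        have hm2 := min_le_right δ (l - r)
        obtain ⟨q, rfl⟩ := hdiag p hp (by linarith)
        simp only at hn
        have := hafter (q - r) (by linarith) (by linarith)
        rw [show x + r + (q - r) = x + q by ring, show y + r + (q - r) = y + q by ring] at this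
        exact not_mem_curve_of_eq_singleton this hp.1
      have hmpos : 0 < min δ (l - r) := lt_min hδ (sub_pos.2 hrl)
      have hle : rest a ((x, y), l) ⊆ {p | p.1 ≤ x + r} := by
        rcases isPreconnected_iff_subset_of_disjoint_closed.1 hrest.1.isPreconnected _ _
          (isClosed_le continuous_fst continuous_const)
          (isClosed_le continuous_const continuous_fst) hsub (by
            ext p
            simp only [mem_inter_iff, mem_ofPred_eq, mem_empty_iff_false, iff_false]
            rintro ⟨-, h1, h2⟩
            linarith) with h1 | h1
        · exact h1
        · have := h1 hwR
          simp only [mem_ofPred_eq] at this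
          linarith
      have hm := hrest.2
      rw [componentMult, finsum_mem_eq_one hwR] at hm
      · rw [stableMult_edge (t := ((x, y), l)) hl.le hl.ne'
          (by rw [vert0_mk, vert1_mk hl.le]; exact mem_openSegment_diag hrpos hrl), hpair,
          width_pair (by rw [htd]; simp [tdeg]), htd] at hm
        simp [tdeg] at hm
        norm_num at hm
      · intro p hp hne
        exfalso
        have h1 := hle hp
        obtain ⟨q, rfl⟩ := hdiag p hp (by simp only [mem_ofPred_eq] at h1; linarith)
        simp only [mem_ofPred_eq] at h1
        have hqr : q < r := lt_of_le_of_ne (by linarith) fun e => hne (by rw [e])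
        obtain ⟨ε, hε, hgap⟩ := c.exists_rest_gap hx hl
        have h2 := hgap _ hp
        simp only at h2
        exact not_mem_curve_of_eq_singleton (c.active_edge hx hr31 (by simp only; linarith)
          (mem_openSegment_diag (by linarith) hqr)) hp.1

end EndConfig

end Config


/-! ### Choosing a good family by the shape of Γ at A -/

section

variable {a : Exps 3 → ℝ} {xA y xP x l : ℝ} {j₀ j₁ : Fin 4}

/-- A good family at a tritangent linked to `t`; the family may be straight only if a vertex of
the curve has abscissa `x`. -/
def HasGoodFamily (a : Exps 3 → ℝ) (t : Params) (x : ℝ) : Prop :=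
  ∃ v w, GoodFamily a t v w ∧ (LinearIndependent ℝ ![v, w] ∨
    v ≠ 0 ∧ w = 0 ∧ ∃ q, (active a q).ncard = 3 ∧ q.1 = x)

theorem linearIndependent_pair_of {v w : Params} (h : ∀ α β : ℝ, α • v + β • w = 0 → α = 0 ∧ β = 0) :
    LinearIndependent ℝ ![v, w] := LinearIndependent.pair_iff.2 h

/-- Together with `slope_le` this shows that a boundary point with such a `w` ≠ (3,0) is at least as
high above the end as it is to the right of A. It thus lies on or above the diagonal through A. -/
theorem two_le_of_tdeg {w : Exps 3} (h : (w.1 : ℕ) + (w.2 : ℕ) ≤ 4) (hw : w ≠ (3, 1)) :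
    w = (3, 0) ∨ ((w.2 : ℕ) : ℝ) - 1 ≤ 3 - ((w.1 : ℕ) : ℝ) ∧ (1 : ℝ) ≤ 3 - ((w.1 : ℕ) : ℝ) := by
  have : w = (3, 0) ∨ (w.1 : ℕ) ≤ 2 := by
    revert h hw; revert w; decide
  rcases this with h3 | h3
  · exact Or.inl h3
  · right
    have h1 : ((w.1 : ℕ) : ℝ) + ((w.2 : ℕ) : ℝ) ≤ 4 := by exact_mod_cast h
    have h2 : ((w.1 : ℕ) : ℝ) ≤ 2 := by exact_mod_cast h3
    constructor <;> linarith

namespace EndConfig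

variable (c : EndConfig a xA y xP j₀ j₁)
include c

/-- For j₁ = 3 the edge dual to (3,1), (2,3) starts at A itself, so moving left under it ends at the
4-valent curve at A. -/
theorem hasGoodFamily_edge_three (hj : j₁ = 3) {yq : ℝ} (hx : xA < x) (hl : 0 ≤ l)
    (ht : IsTritangent a ((x, y), l)) (hyq : y < yq) (hlq : y + l ≤ yq)
    (hq : (3, 1) ∈ active a (x + l, yq)) (hq' : (2, 3) ∈ active a (x + l, yq)) :
    HasGoodFamily a ((x, y), l) (x + l) := by
  subst hj
  have h1 : (3, 1) ∈ active a (xA + 0, y) := by rw [add_zero, c.vertex]; simp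
  have h2 : (2, 3) ∈ active a (xA + 0, y) := by rw [add_zero, c.vertex]; simp
  have hL := c.linked_target hx hl ht hyq hlq hq hq' le_rfl (by simp) h1 h2 c.isTritangent_four_valent
  refine ⟨_, _, GoodFamily.of_linked hL c.goodFamily_neg, Or.inl ?_⟩
  refine linearIndependent_pair_of fun α β h => ?_
  simp [Prod.ext_iff] at h
  exact ⟨h.1, h.2⟩

/-- For j₁ = 2 both the left end of this edge and A have (3,1) and (2,2) active. By `slope_eq` that
left end is the point B on the diagonal through A. -/
theorem hasGoodFamily_edge_two (hj : j₁ = 2) {yq : ℝ} (hx : xA < x) (hl : 0 ≤ l)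
    (ht : IsTritangent a ((x, y), l)) (hyq : y < yq) (hlq : y + l ≤ yq)
    (hq : (3, 1) ∈ active a (x + l, yq)) (hq' : (2, 3) ∈ active a (x + l, yq)) :
    HasGoodFamily a ((x, y), l) (x + l) := by
  subst hj
  obtain h | ⟨m, hm, hym, hB⟩ := c.exists_left_end (by linarith) hyq hq hq'
  · exact absurd h (by decide)
  have h := c.slope_eq (q := (x + l - 2 * m, yq - m)) (w := (2, 2)) (by rw [hB]; simp)
    (by rw [hB]; simp) (by rw [c.vertex]; simp)
  have e2 : (((2 : Fin 4) : ℕ) : ℝ) = 2 := rfl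
  simp only [e2] at h
  obtain ⟨α, hα⟩ : ∃ α, α = yq - m - y := ⟨_, rfl⟩
  have e : (x + l - 2 * m, yq - m) = (xA + α, y + α) := by
    ext <;> simp only <;> linarith
  rw [e] at hB
  have hα0 : 0 < α := by linarith
  have hL := c.linked_target hx hl ht hyq hlq hq hq' hα0.le le_rfl (by rw [hB]; simp)
    (by rw [hB]; simp) (c.isTritangent_slope_lower hα0 hB)
  refine ⟨_, _, GoodFamily.of_linked hL (c.goodFamily_lower hα0 hB), Or.inl ?_⟩
  refine linearIndependent_pair_of fun α β h => ?_
  simp [Prod.ext_iff] at h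
  exact ⟨by linarith [h.1, h.2], h.2⟩

theorem active_vertex_le_one (hj : j₁ ≤ 1) {w : Exps 3} (h : 2 ≤ (w.2 : ℕ)) :
    w ∉ active a (xA, y) := by
  rw [c.vertex]
  clear c; revert h hj; revert w j₁; decide

omit c in
theorem linearIndependent_diag : LinearIndependent ℝ ![(((-1, -1), 1) : Params), ((0, 0), 1)] := by
  refine linearIndependent_pair_of fun α β h => ?_
  simp [Prod.ext_iff] at h
  obtain ⟨h1, h2⟩ := h
  exact ⟨h1, by linarith⟩

/-- For j₁ ≤ 1 the left end of the edge lies strictly above the diagonal through A. So there is a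
position of v₁ on this diagonal under the edge, with v₀ at A. -/
theorem hasGoodFamily_edge_one (hj : j₁ ≤ 1) {yq : ℝ} (hx : xA < x) (hl : 0 ≤ l)
    (ht : IsTritangent a ((x, y), l)) (hyq : y < yq) (hlq : y + l ≤ yq)
    (hq : (3, 1) ∈ active a (x + l, yq)) (hq' : (2, 3) ∈ active a (x + l, yq)) :
    HasGoodFamily a ((x, y), l) (x + l) := by
  obtain h | ⟨m, hm, hym, hB⟩ := c.exists_left_end (by linarith) hyq hq hq'
  · exact absurd h (by clear * - hj; revert hj; revert j₁; decide)
  have h := c.slope_lt (q := (x + l - 2 * m, yq - m)) (w := (2, 2)) (by rw [hB]; simp)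
    (by rw [hB]; simp) (c.active_vertex_le_one hj (by decide))
  have e2 : (((2 : Fin 4) : ℕ) : ℝ) = 2 := rfl
  simp only [e2] at h
  -- If the left end is directly above v₁, then Γ has a vertex of abscissa x + l and a straight
  -- family is allowed. Otherwise one moves to a point under the relative interior of the edge.
  rcases hm.eq_or_lt with hm | hm
  · subst hm
    simp only [mul_zero, sub_zero] at hB h
    obtain ⟨X, hXd⟩ : ∃ X, X = x + l - xA := ⟨_, rfl⟩
    have hr : xA + X = x + l := by rw [hXd]; ring
    have hv := c.active_below (x := x + l) (z := y + X) (by linarith) hq (by linarith)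
      (by linarith)
    have hU := c.upGood_below (x := x + l) (z := y + X) (by linarith) hq hq' (by linarith)
      (by linarith)
    rw [← hr] at hv hU
    have hL := c.linked_target hx hl ht hyq hlq hq hq' (r := X) (yq' := yq) (by linarith)
      (by linarith) (by rwa [hr]) (by rwa [hr])
      (c.isTritangent_vertex hj (by linarith) hv hU)
    refine ⟨_, _, GoodFamily.of_linked hL (c.goodFamily_diag hj (by linarith) hv hU), Or.inr
      ⟨by simp, rfl, (x + l, yq), ?_, rfl⟩⟩
    rw [hB, Set.ncard_eq_toFinset_card']; decide
  -- The abscissa `x2` is slightly larger than that of A and of the left end. It is chosen so close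
  -- to the larger of the two that the diagonal through A is still strictly below the edge there.
  · obtain ⟨x2, h1, h2, h3, h4⟩ : ∃ x2, xA < x2 ∧ x + l - 2 * m < x2 ∧ x2 < x + l ∧
        x2 - xA < yq - m + (x2 - (x + l - 2 * m)) / 2 - y := by
      obtain ⟨xo, hxo⟩ : ∃ xo, xo = max xA (x + l - 2 * m) := ⟨_, rfl⟩
      have i1 : xA ≤ xo := hxo ▸ le_max_left _ _
      have i2 : x + l - 2 * m ≤ xo := hxo ▸ le_max_right _ _
      have i3 : xo < x + l := by rw [hxo, max_lt_iff]; constructor <;> linarith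
      obtain ⟨g, hg⟩ : ∃ g, g = yq - m + (xo - (x + l - 2 * m)) / 2 - y - (xo - xA) := ⟨_, rfl⟩
      have g0 : 0 < g := by
        rcases max_choice xA (x + l - 2 * m) with e | e <;> rw [e] at hxo <;> linarith
      have m1 := min_le_left ((x + l - xo) / 2) g
      have m2 := min_le_right ((x + l - xo) / 2) g
      have m3 : 0 < min ((x + l - xo) / 2) g := lt_min (by linarith) g0
      exact ⟨xo + min ((x + l - xo) / 2) g, by linarith, by linarith, by linarith, by linarith⟩
    obtain ⟨y2, hy2⟩ : ∃ y2, y2 = yq - m + (x2 - (x + l - 2 * m)) / 2 := ⟨_, rfl⟩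
    have h22 : (2, 2) ∉ active a (x + l, yq) := by
      intro hn
      have k1 := term_eq_of_mem hn hq
      have k2 : term a (2, 2) (x + l - 2 * m, yq - m) = term a (3, 1) (x + l - 2 * m, yq - m) :=
        term_eq_of_mem (by rw [hB]; simp) (by rw [hB]; simp)
      have e3 : (((3 : Fin 4) : ℕ) : ℝ) = 3 := rfl
      have e1 : (((1 : Fin 4) : ℕ) : ℝ) = 1 := by norm_num
      simp only [term, e1, e2, e3] at k1 k2
      linarith
    have hm2 : (x2, y2) ∈ openSegment ℝ (x + l - 2 * m, yq - m) (x + l, yq) := by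
      rw [openSegment_eq_image]
      refine ⟨(x2 - (x + l - 2 * m)) / (2 * m), ⟨by apply div_pos <;> linarith, by
        rw [div_lt_one] <;> linarith⟩, ?_⟩
      simp only [Prod.smul_mk, Prod.mk_add_mk, smul_eq_mul, Prod.mk.injEq]
      constructor
      · field_simp; ring
      · rw [hy2]; field_simp; ring
    have hq2 : active a (x2, y2) = {(3, 1), (2, 3)} := by
      rw [active_openSegment (u := (3, 1)) (by rw [hB]; simp) hq hm2, hB]
      ext w
      simp only [mem_inter_iff, mem_insert_iff, mem_singleton_iff]
      constructor
      · rintro ⟨rfl | rfl | rfl, hw⟩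
        · exact Or.inl rfl
        · exact absurd hw h22
        · exact Or.inr rfl
      · rintro (rfl | rfl)
        · exact ⟨Or.inl rfl, hq⟩
        · exact ⟨Or.inr (Or.inr rfl), hq'⟩
    obtain ⟨r, hr⟩ : ∃ r, x2 = xA + r := ⟨x2 - xA, by ring⟩
    have m31 : (3, 1) ∈ active a (x2, y2) := by rw [hq2]; simp
    have m23 : (2, 3) ∈ active a (x2, y2) := by rw [hq2]; simp
    have hv := c.active_below (x := x2) (z := y + r) h1 m31 (by linarith) (by linarith)
    have hU := c.upGood_below (x := x2) (z := y + r) h1 m31 m23 (by linarith) (by linarith)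
    rw [hr] at hv hU m31 m23 hq2
    have hL := c.linked_target hx hl ht hyq hlq hq hq' (r := r) (yq' := y2) (by linarith)
      (by linarith) m31 m23 (c.isTritangent_vertex hj (by linarith) hv hU)
    exact ⟨_, _, GoodFamily.of_linked hL (c.goodFamily_diag_two hj (by linarith) (by linarith) hq2),
      Or.inl linearIndependent_diag⟩

theorem hasGoodFamily_edge {yq : ℝ} (hx : xA < x) (hl : 0 ≤ l)
    (ht : IsTritangent a ((x, y), l)) (hyq : y < yq) (hlq : y + l ≤ yq)
    (hq : (3, 1) ∈ active a (x + l, yq)) (hq' : (2, 3) ∈ active a (x + l, yq)) :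
    HasGoodFamily a ((x, y), l) (x + l) := by
  have : j₁ ≤ 1 ∨ j₁ = 2 ∨ j₁ = 3 := by clear c; revert j₁; decide
  rcases this with h | h | h
  · exact c.hasGoodFamily_edge_one h hx hl ht hyq hlq hq hq'
  · exact c.hasGoodFamily_edge_two h hx hl ht hyq hlq hq hq'
  · exact c.hasGoodFamily_edge_three h hx hl ht hyq hlq hq hq'

/-- The boundary point above v₁ lies strictly above the diagonal through A. One can therefore keep
the abscissa of v₁ and raise it while v₀ slides to A. If the boundary point is not a vertex, the
width condition puts `w` in the top row, which gives the curved family. -/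
theorem hasGoodFamily_one (hj : j₁ ≤ 1) {yq : ℝ} (hx : xA < x) (hl : 0 ≤ l)
    (ht : IsTritangent a ((x, y), l)) (hlq : y + l < yq)
    (hq : (3, 1) ∈ active a (x + l, yq)) (hU : UpGood a (x + l, y + l)) {w : Exps 3}
    (hw : w ∈ active a (x + l, yq)) (hne : w ≠ (3, 1)) (hd : (w.1 : ℕ) + (w.2 : ℕ) ≤ 4) :
    HasGoodFamily a ((x, y), l) (x + l) := by
  have hle := c.slope_le hq hw
  simp only at hle
  have hX : 0 < x + l - xA := by linarith
  have hY : 0 < yq - y := by linarith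
  have h30 : w ≠ (3, 0) := by
    rintro rfl
    have e3 : (((3 : Fin 4) : ℕ) : ℝ) = 3 := rfl
    have e0 : (((0 : Fin 4) : ℕ) : ℝ) = 0 := by norm_num
    simp only [e3, e0] at hle
    linarith
  obtain ⟨d1, d2⟩ := (two_le_of_tdeg hd hne).resolve_left h30
  have hw2 : 2 ≤ (w.2 : ℕ) := by
    by_contra hn
    have : ((w.2 : ℕ) : ℝ) ≤ 1 := by exact_mod_cast (by omega : (w.2 : ℕ) ≤ 1)
    nlinarith
  have hlt := c.slope_lt hq hw (c.active_vertex_le_one hj hw2)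
  simp only at hlt
  have hXY : x + l - xA < yq - y := by
    by_contra hn
    push Not at hn
    nlinarith
  obtain ⟨X, hXd⟩ : ∃ X, X = x + l - xA := ⟨_, rfl⟩
  rw [← hXd] at hX hXY
  have hr : xA + X = x + l := by rw [hXd]; ring
  have hr' : x + l - X = xA := by rw [hXd]; ring
  have hv := c.active_below (x := x + l) (z := y + X) (by linarith) hq (by linarith)
      (by linarith)
  have hU' := c.upGood_lift hx hl hU hq (r := X) (by linarith) (by linarith)
  have hv' := hv
  have hU'' := hU'
  rw [← hr] at hv' hU''
  have hT := c.isTritangent_vertex hj hX hv' hU''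
  have hL := c.linked_up hx hl ht hU hq (r₀ := X) (by linarith) (by linarith) (by linarith)
    (by rwa [hr'])
  rw [hr'] at hL
  by_cases h3 : (active a (x + l, yq)).ncard = 3
  · exact ⟨_, _, GoodFamily.of_linked hL (c.goodFamily_diag hj hX hv' hU''), Or.inr
      ⟨by simp, rfl, (x + l, yq), h3, rfl⟩⟩
  · have hpair : active a (x + l, yq) = {(3, 1), w} := by
      refine Subset.antisymm (fun z hz => ?_) ?_
      · by_contra hn
        simp only [mem_insert_iff, mem_singleton_iff, not_or] at hn
        apply h3
        rw [c.smooth.eq_triple hq hw hz hne.symm (Ne.symm hn.1) (Ne.symm hn.2),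
          Set.ncard_eq_three]
        exact ⟨_, _, _, hne.symm, Ne.symm hn.1, Ne.symm hn.2, rfl⟩
      · rintro z (rfl | rfl)
        exacts [hq, hw]
    have hw3 := hU'.width_eq (by linarith) (fun z h1 h2 => not_mem_curve_of_eq_singleton
      (c.active_below (by linarith) hq (by linarith) h2)) hpair (by
        rw [Fin.lt_def]; exact hw2)
    have e : w = (w.1, 3) := Prod.ext rfl (Fin.ext hw3)
    rw [e, ← hr] at hpair
    exact ⟨_, _, GoodFamily.of_linked hL (c.goodFamily_diag_two hj hX (by linarith) hpair),
      Or.inl linearIndependent_diag⟩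

omit c in
theorem tdeg_of_det {z : Exps 3} (h : |latticeDet (3, 1) (2, 2) z| = 1)
    (h4 : 4 ≤ (z.1 : ℕ) + (z.2 : ℕ)) : z = (2, 3) ∨ z = (3, 2) := by
  revert h h4; revert z; unfold latticeDet; decide

/-- For j₁ = 2 the chamber of (3,1) lies on or below the diagonal at A, whereas `w` forces the
boundary point on or above it. So the point is on the slope-one edge; as that edge alone has
vertical width one, the point must be a vertex, and unimodularity identifies its third exponent. -/
theorem hasGoodFamily_two (hj : j₁ = 2) {yq : ℝ} (hx : xA < x) (hl : 0 ≤ l)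
    (ht : IsTritangent a ((x, y), l)) (hlq : y + l < yq)
    (hq : (3, 1) ∈ active a (x + l, yq)) (hU : UpGood a (x + l, y + l)) {w : Exps 3}
    (hw : w ∈ active a (x + l, yq)) (hne : w ≠ (3, 1)) (hd : (w.1 : ℕ) + (w.2 : ℕ) ≤ 4) :
    HasGoodFamily a ((x, y), l) (x + l) := by
  subst hj
  have hle := c.slope_le hq hw
  simp only at hle
  have hX : 0 < x + l - xA := by linarith
  have hY : 0 < yq - y := by linarith
  have e3 : (((3 : Fin 4) : ℕ) : ℝ) = 3 := rfl
  have e2 : (((2 : Fin 4) : ℕ) : ℝ) = 2 := rfl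
  have e1 : (((1 : Fin 4) : ℕ) : ℝ) = 1 := by norm_num
  have e0 : (((0 : Fin 4) : ℕ) : ℝ) = 0 := by norm_num
  have h30 : w ≠ (3, 0) := by
    rintro rfl
    simp only [e3, e0] at hle
    linarith
  obtain ⟨d1, d2⟩ := (two_le_of_tdeg hd hne).resolve_left h30
  have k1 : term a (2, 2) (xA, y) = term a (3, 1) (xA, y) :=
    term_eq_of_mem (by rw [c.vertex]; simp) (by rw [c.vertex]; simp)
  have k2 := hq (2, 2)
  simp only [term, e1, e2, e3] at k1 k2
  have hXY : yq - y ≤ x + l - xA := by linarith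
  have hYX : x + l - xA ≤ yq - y := by
    by_contra hn
    push Not at hn
    nlinarith
  have h22 : (2, 2) ∈ active a (x + l, yq) := by
    refine mem_active_of_le hq ?_
    simp only [term, e1, e2, e3]
    linarith
  obtain ⟨z, hz, hz1⟩ : ∃ z ∈ active a (x + l, yq), z ≠ (3, 1) ∧ z ≠ (2, 2) := by
    by_contra hn
    push Not at hn
    have hpair : active a (x + l, yq) = {(3, 1), (2, 2)} := by
      refine Subset.antisymm (fun z hz => ?_) ?_
      · by_cases h : z = (3, 1)
        · exact Or.inl h
        · exact Or.inr (hn z hz h)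
      · rintro z (rfl | rfl)
        exacts [hq, h22]
    have := hU.width_eq hlq (fun z h1 h2 => not_mem_curve_of_eq_singleton
      (c.active_below (by linarith) hq (by linarith) h2)) hpair (by decide)
    exact absurd this (by decide)
  have hz4 : 4 ≤ (z.1 : ℕ) + (z.2 : ℕ) := by
    have hle := c.slope_le hq hz
    simp only at hle
    rw [le_antisymm hXY hYX] at hle
    have : 3 - ((z.1 : ℕ) : ℝ) ≤ ((z.2 : ℕ) : ℝ) - 1 := le_of_mul_le_mul_right hle hX
    have : (4 : ℝ) ≤ ((z.1 : ℕ) : ℝ) + ((z.2 : ℕ) : ℝ) := by linarith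
    exact_mod_cast this
  have hz' := tdeg_of_det ((c.smooth (x + l, yq)).2 _ hq _ h22 _ hz (by decide) hz1.2.symm
    hz1.1.symm) hz4
  rcases hz' with rfl | rfl
  · exact c.hasGoodFamily_edge hx hl ht (by linarith) hlq.le hq hz
  · have hB := c.smooth.eq_triple hq h22 hz (by decide) (by decide) (by decide)
    obtain ⟨α, hα⟩ : ∃ α, α = x + l - xA := ⟨_, rfl⟩
    have ex : x + l - α = xA := by linarith
    have e : (x + l, yq) = (xA + α, y + α) := by
      ext <;> simp only <;> linarith
    have hB' := hB
    rw [e] at hB'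
    have hα0 : 0 < α := by linarith
    have hL := c.linked_up hx hl ht hU hq (r₀ := α) (by linarith) (by linarith) (by linarith)
      (by rw [ex]; exact c.isTritangent_slope_upper hα0 hB')
    rw [ex] at hL
    refine ⟨_, _, GoodFamily.of_linked hL (c.goodFamily_upper hα0 hB'), Or.inr
      ⟨by simp, rfl, (x + l, yq), ?_, rfl⟩⟩
    rw [hB, Set.ncard_eq_toFinset_card']; decide

/-- For j₁ = 3 the edge dual to (2,3), (3,1) leaves A in direction (2,1), and the chamber of (3,1)
lies below its line. A boundary point would be at most half as high as it is far to the right, while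
`w` requires it to be at least as high. -/
theorem not_crossing_three (hj : j₁ = 3) {yq : ℝ} (hx : xA < x) (hy : y < yq)
    (hq : (3, 1) ∈ active a (x, yq)) {w : Exps 3}
    (hw : w ∈ active a (x, yq)) (hne : w ≠ (3, 1)) (hd : (w.1 : ℕ) + (w.2 : ℕ) ≤ 4) : False := by
  subst hj
  have hle := c.slope_le hq hw
  simp only at hle
  have hX : 0 < x - xA := by linarith
  have hY : 0 < yq - y := by linarith
  have e3 : (((3 : Fin 4) : ℕ) : ℝ) = 3 := rfl
  have e2 : (((2 : Fin 4) : ℕ) : ℝ) = 2 := rfl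
  have e1 : (((1 : Fin 4) : ℕ) : ℝ) = 1 := by norm_num
  have e0 : (((0 : Fin 4) : ℕ) : ℝ) = 0 := by norm_num
  have h30 : w ≠ (3, 0) := by
    rintro rfl
    simp only [e3, e0] at hle
    linarith
  obtain ⟨d1, d2⟩ := (two_le_of_tdeg hd hne).resolve_left h30
  have k1 : term a (2, 3) (xA, y) = term a (3, 1) (xA, y) :=
    term_eq_of_mem (by rw [c.vertex]; simp) (by rw [c.vertex]; simp)
  have k2 := hq (2, 3)
  simp only [term, e1, e2, e3] at k1 k2
  nlinarith

theorem hasGoodFamily (hx : xA < x) (hl : 0 ≤ l) (ht : IsTritangent a ((x, y), l))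
    (hc : ¬ InCornerChamber a ((x, y), l)) (ho : ¬ OnCornerEdge a ((x, y), l)) :
    HasGoodFamily a ((x, y), l) (x + l) := by
  obtain ⟨yq, hyq, hlq, hq, hq' | ⟨hlt, hU, w, hw, hne, hd⟩⟩ := c.classification hx hl ht hc ho
  · exact c.hasGoodFamily_edge hx hl ht hyq hlq hq hq'
  have : j₁ ≤ 1 ∨ j₁ = 2 ∨ j₁ = 3 := by clear c; revert j₁; decide
  rcases this with h | h | h
  · exact c.hasGoodFamily_one h hx hl ht hlt hq hU hw hne hd
  · exact c.hasGoodFamily_two h hx hl ht hlt hq hU hw hne hd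
  · exact (c.not_crossing_three h (by linarith) hyq hq hw hne hd).elim

end EndConfig

end


/-! ## Special tritangents and the crossings on a leg -/

/-- Two tangencies on different components of multiplicity two lie on `L`. -/
def SpecialOn (a : Exps 3 → ℝ) (t : Params) (L : Set (ℝ × ℝ)) : Prop :=
  IsTritangent a t ∧ ∃ C ∈ interComponents a (lineCoeff t), ∃ C' ∈ interComponents a (lineCoeff t),
    C ≠ C' ∧ ∃ P ∈ L, ∃ P' ∈ L, IsTangencyPoint a t C P ∧ IsTangencyPoint a t C' P'

section

variable {a : Exps 3 → ℝ} {x y l : ℝ}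

theorem interComponents_subset {m n : ℕ} {a : Exps m → ℝ} {b : Exps n → ℝ} {C : Set (ℝ × ℝ)}
    (hC : C ∈ interComponents a b) : C ⊆ curve a ∩ curve b := by
  obtain ⟨p, -, rfl⟩ := hC
  exact connectedComponentIn_subset _ _

theorem interComponents_preconnected {m n : ℕ} {a : Exps m → ℝ} {b : Exps n → ℝ} {C : Set (ℝ × ℝ)}
    (hC : C ∈ interComponents a b) : IsPreconnected C := by
  obtain ⟨p, -, rfl⟩ := hC
  exact isPreconnected_connectedComponentIn

theorem interComponents_eq_of_mem {m n : ℕ} {a : Exps m → ℝ} {b : Exps n → ℝ} {C C' : Set (ℝ × ℝ)}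
    (hC : C ∈ interComponents a b) (hC' : C' ∈ interComponents a b) {p : ℝ × ℝ} (h : p ∈ C)
    (h' : p ∈ C') : C = C' := by
  obtain ⟨q, -, rfl⟩ := hC
  obtain ⟨q', -, rfl⟩ := hC'
  exact (connectedComponentIn_eq h).trans (connectedComponentIn_eq h').symm

/-- For l ≥ 0, nothing but the left leg lies to the left of v₀. -/
theorem snd_eq_of_mem_line (hl : 0 ≤ l) {p : ℝ × ℝ} (hp : p ∈ curve (lineCoeff ((x, y), l)))
    (h : p.1 < x) : p.2 = y ∧ p ∈ lft (vert0 ((x, y), l)) := by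
  rcases curve_line_subset (t := ((x, y), l)) hl hp with h' | h' | h' | h' | h'
  · exact ⟨h'.1, h'⟩
  · exact absurd h'.1 h.ne
  · have := h'.2; rw [vert1_mk hl] at this; simp only at this; linarith
  · have := h'.1; rw [vert1_mk hl] at this; simp only at this; linarith
  · rw [vert0_mk, vert1_mk hl, mem_segment_diag_iff hl] at h'
    obtain ⟨r, h0, -, rfl⟩ := h'
    simp only at h; linarith

/-- The tangency is the midpoint of the divisor, so the point with smaller abscissa is on the leg;
then the other one has the same height. That other point need not be on the leg: it may be the
origin or, for l = 0, lie beyond it. -/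
theorem IsTangencyPoint.exists_pair (hl : 0 ≤ l) {C : Set (ℝ × ℝ)}
    (hC : C ∈ interComponents a (lineCoeff ((x, y), l))) {P : ℝ × ℝ}
    (h : IsTangencyPoint a ((x, y), l) C P) (hP : P.2 = y ∧ P.1 < x) :
    ∃ r s, (r, y) ∈ C ∧ (s, y) ∈ C ∧ r ≤ s ∧ r < x ∧
      ∀ p ∈ C, stableMult a (lineCoeff ((x, y), l)) p =
      ({(r, y)} : Set (ℝ × ℝ)).indicator 1 p + ({(s, y)} : Set (ℝ × ℝ)).indicator 1 p := by
  obtain ⟨A, hA, B, hB, hs, rfl⟩ := h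
  have hm : ∀ A B : ℝ × ℝ, midpoint ℝ A B = ((A.1 + B.1) / 2, (A.2 + B.2) / 2) := by
    intro A B
    rw [midpoint_eq_smul_add]
    ext <;> simp <;> ring
  rw [hm] at hP
  simp only at hP
  have key : ∀ A B : ℝ × ℝ, A ∈ C → B ∈ C → A.1 ≤ B.1 → (A.2 + B.2) / 2 = y →
      (A.1 + B.1) / 2 < x → A.1 < x ∧ A = (A.1, y) ∧ B = (B.1, y) := by
    intro A B hA hB hAB h1 h2
    have h3 : A.1 < x := by linarith
    have h4 := (snd_eq_of_mem_line hl (interComponents_subset hC hA).2 h3).1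
    exact ⟨h3, Prod.ext rfl h4, Prod.ext rfl (by simp only; linarith)⟩
  rcases le_total A.1 B.1 with h | h
  · obtain ⟨h1, h2, h3⟩ := key A B hA hB h hP.1 hP.2
    refine ⟨A.1, B.1, h2 ▸ hA, h3 ▸ hB, h, h1, ?_⟩
    rw [← h2, ← h3]; exact hs
  · obtain ⟨h1, h2, h3⟩ := key B A hB hA h (by linarith [hP.1]) (by linarith [hP.2])
    refine ⟨B.1, A.1, h2 ▸ hB, h3 ▸ hA, h, h1, ?_⟩
    rw [← h2, ← h3]
    intro p hp
    rw [hs p hp, add_comm]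

theorem mem_component_of_between (hl : 0 ≤ l) {C : Set (ℝ × ℝ)}
    (hC : C ∈ interComponents a (lineCoeff ((x, y), l))) {r s z : ℝ} (hr : (r, y) ∈ C)
    (hs : (s, y) ∈ C) (h1 : r ≤ z) (h2 : z ≤ s) (hz : z < x) : (z, y) ∈ C := by
  have hp := (interComponents_preconnected hC).image Prod.fst continuous_fst.continuousOn
  obtain ⟨p, hp, rfl⟩ := hp.Icc_subset (mem_image_of_mem _ hr) (mem_image_of_mem _ hs) ⟨h1, h2⟩
  have := (snd_eq_of_mem_line hl (interComponents_subset hC hp).2 hz).1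
  rwa [show (p.1, y) = p from Prod.ext rfl this.symm]

/-- The ranges of first exponents at successive points of a horizontal line do not overlap, so the
widths along the line add up to at most 3. -/
theorem wMax_le_wMin_of_lt {x' : ℝ} (h : x < x') :
    wMax xdeg (active a (x, y)) ≤ wMin xdeg (active a (x', y)) := by
  obtain ⟨u, hu, eu⟩ := exists_eq_wMax (f := xdeg) (active_nonempty a (x, y))
  obtain ⟨w, hw, ew⟩ := exists_eq_wMin (f := xdeg) (active_nonempty a (x', y))
  rw [← eu, ← ew]
  exact fst_le_of_right hu hw h

theorem wMax_xdeg_le (p : ℝ × ℝ) : wMax xdeg (active a p) ≤ 3 := by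
  obtain ⟨u, hu, eu⟩ := exists_eq_wMax (f := xdeg) (active_nonempty a p)
  rw [← eu]
  exact Nat.le_of_lt_succ u.1.2

theorem stableMult_eq_width (hl : 0 ≤ l) {C : Set (ℝ × ℝ)}
    (hC : C ∈ interComponents a (lineCoeff ((x, y), l))) {z : ℝ} (hz : (z, y) ∈ C) (h : z < x) :
    stableMult a (lineCoeff ((x, y), l)) (z, y) =
      (wMax xdeg (active a (z, y)) : ℝ) - wMin xdeg (active a (z, y)) :=
  stableMult_left (t := ((x, y), l)) hl (snd_eq_of_mem_line hl (interComponents_subset hC hz).2 h).2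

/-- The widths of the two crossings on a component that lies on the leg. -/
theorem width_of_pair (hl : 0 ≤ l) {C : Set (ℝ × ℝ)}
    (hC : C ∈ interComponents a (lineCoeff ((x, y), l))) {r s : ℝ} (hr : (r, y) ∈ C)
    (hs : (s, y) ∈ C) (hrs : r ≤ s) (hx : r < x)
    (h : ∀ p ∈ C, stableMult a (lineCoeff ((x, y), l)) p =
      ({(r, y)} : Set (ℝ × ℝ)).indicator 1 p + ({(s, y)} : Set (ℝ × ℝ)).indicator 1 p) :
    r = s ∧ wMax xdeg (active a (r, y)) = wMin xdeg (active a (r, y)) + 2 ∨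
      r < s ∧ wMax xdeg (active a (r, y)) = wMin xdeg (active a (r, y)) + 1 ∧
        (s < x → wMax xdeg (active a (s, y)) = wMin xdeg (active a (s, y)) + 1) := by
  have e1 := h _ hr
  rw [stableMult_eq_width hl hC hr hx] at e1
  rcases hrs.eq_or_lt with rfl | hlt
  · left
    refine ⟨rfl, ?_⟩
    simp only [indicator_of_mem (mem_singleton _), Pi.one_apply] at e1
    have : (wMax xdeg (active a (r, y)) : ℝ) = wMin xdeg (active a (r, y)) + 2 := by linarith
    exact_mod_cast this
  · right
    refine ⟨hlt, ?_, fun hsx => ?_⟩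
    · rw [indicator_of_mem (mem_singleton _), indicator_of_notMem (by simp [hlt.ne])] at e1
      have : (wMax xdeg (active a (r, y)) : ℝ) = wMin xdeg (active a (r, y)) + 1 := by
        simp only [Pi.one_apply] at e1; linarith
      exact_mod_cast this
    · have e2 := h _ hs
      rw [stableMult_eq_width hl hC hs hsx, indicator_of_notMem (by simp [hlt.ne']),
        indicator_of_mem (mem_singleton _)] at e2
      have : (wMax xdeg (active a (s, y)) : ℝ) = wMin xdeg (active a (s, y)) + 1 := by
        simp only [Pi.one_apply] at e2; linarith
      exact_mod_cast this

theorem col_of_det {j₁ j k : Fin 4} (h : |latticeDet (n := 3) (2, j₁) (3, j) (3, k)| = 1) (hjk : j < k) :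
    (k : ℕ) = j + 1 := by
  revert h hjk; revert j₁ j k; unfold latticeDet; decide

/-- The crossings on a leg that carries two tangencies. -/
theorem SpecialOn.exists_vertex (hs : IsSmooth a) (hl : 0 ≤ l)
    (h : SpecialOn a ((x, y), l) {p | p.2 = y ∧ p.1 < x}) :
    ∃ xA r s, ∃ j₁ j k : Fin 4, (k : ℕ) = j + 1 ∧ r ≤ s ∧ s < xA ∧ xA < x ∧
      active a (xA, y) = {(2, j₁), (3, j), (3, k)} ∧
      (r = s ∧ wMin xdeg (active a (r, y)) = 0 ∧ wMax xdeg (active a (r, y)) = 2 ∨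
        r < s ∧ wMax xdeg (active a (r, y)) = wMin xdeg (active a (r, y)) + 1 ∧
        ∀ z, r ≤ z → z ≤ s → (z, y) ∈ curve a) := by
  obtain ⟨ht, C, hC, C', hC', hne, P, hP, P', hP', hT, hT'⟩ := h
  obtain ⟨r, s, hr, hs', hrs, hrx, hm⟩ := hT.exists_pair hl hC hP
  obtain ⟨r', s', hr', hs'', hrs', hrx', hm'⟩ := hT'.exists_pair hl hC' hP'
  -- The decisive case: the divisor of one component reaches the origin of the leg or goes beyond
  -- it. The other component then lies entirely to its left.
  have key : ∀ (C C' : Set (ℝ × ℝ)) (r s r' s' : ℝ),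
      C ∈ interComponents a (lineCoeff ((x, y), l)) →
      C' ∈ interComponents a (lineCoeff ((x, y), l)) → C ≠ C' → (r, y) ∈ C → (s, y) ∈ C → r ≤ s → r < x →
      (∀ p ∈ C, stableMult a (lineCoeff ((x, y), l)) p =
        ({(r, y)} : Set (ℝ × ℝ)).indicator 1 p + ({(s, y)} : Set (ℝ × ℝ)).indicator 1 p) →
      (r', y) ∈ C' → (s', y) ∈ C' → r' ≤ s' → r' < x →
      (∀ p ∈ C', stableMult a (lineCoeff ((x, y), l)) p =
        ({(r', y)} : Set (ℝ × ℝ)).indicator 1 p + ({(s', y)} : Set (ℝ × ℝ)).indicator 1 p) → x ≤ s →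
      ∃ xA r s, ∃ j₁ j k : Fin 4, (k : ℕ) = j + 1 ∧ r ≤ s ∧ s < xA ∧ xA < x ∧
      active a (xA, y) = {(2, j₁), (3, j), (3, k)} ∧
      (r = s ∧ wMin xdeg (active a (r, y)) = 0 ∧ wMax xdeg (active a (r, y)) = 2 ∨
        r < s ∧ wMax xdeg (active a (r, y)) = wMin xdeg (active a (r, y)) + 1 ∧
        ∀ z, r ≤ z → z ≤ s → (z, y) ∈ curve a) := by
    clear * - hs hl
    intro C C' r s r' s' hC hC' hne hr hs' hrs hrx hm hr' hs'' hrs' hrx' hm' hxs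
    have hsr : s' < r := by
      by_contra hn
      push Not at hn
      have h1 : (max r r', y) ∈ C := mem_component_of_between hl hC hr hs' (le_max_left _ _)
        (max_le hrs (by linarith)) (max_lt hrx hrx')
      have h2 : (max r r', y) ∈ C' := mem_component_of_between hl hC' hr' hs'' (le_max_right _ _)
        (max_le hn hrs') (max_lt hrx hrx')
      exact hne (interComponents_eq_of_mem hC hC' h1 h2)
    have w1 : wMax xdeg (active a (r, y)) = wMin xdeg (active a (r, y)) + 1 := by
      rcases width_of_pair hl hC hr hs' hrs hrx hm with h | h
      · linarith [h.1]
      · exact h.2.1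
    have w2 := width_of_pair hl hC' hr' hs'' hrs' hrx' hm'
    have b1 := wMax_xdeg_le (a := a) (r, y)
    have b2 := wMax_le_wMin_of_lt (a := a) (y := y) hsr
    -- Of the three units of width the left component uses two, so the crossing at `r` goes from
    -- first exponent 2 to 3.
    have hdeg : wMin xdeg (active a (r, y)) = 2 ∧ (r' = s' ∧ wMin xdeg (active a (r', y)) = 0 ∧
        wMax xdeg (active a (r', y)) = 2 ∨ r' < s' ∧
          wMax xdeg (active a (r', y)) = wMin xdeg (active a (r', y)) + 1) := by
      rcases w2 with ⟨e, h⟩ | ⟨e, h, h'⟩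
      · subst e
        exact ⟨by omega, Or.inl ⟨rfl, by omega, by omega⟩⟩
      · have b3 := wMax_le_wMin_of_lt (a := a) (y := y) e
        have := h' (by linarith)
        exact ⟨by omega, Or.inr ⟨e, h⟩⟩
    obtain ⟨u, hu, eu⟩ := exists_eq_wMax (f := xdeg) (active_nonempty a (r, y))
    obtain ⟨w, hw, ew⟩ := exists_eq_wMin (f := xdeg) (active_nonempty a (r, y))
    have eu3 : u.1 = 3 := Fin.ext (by rw [w1, hdeg.1] at eu; exact eu)
    have ew2 : w.1 = 2 := Fin.ext (by rw [hdeg.1] at ew; exact ew)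
    -- Between `r` and the origin the leg stays on Γ. So two exponents of the last column are active
    -- there, and they are already active at `r`, which is thus a vertex.
    have hmid : ((r + x) / 2, y) ∈ curve a := (interComponents_subset hC
      (mem_component_of_between hl hC hr hs' (by linarith) (by linarith) (by linarith))).1
    have hmid' : (active a ((r + x) / 2, y)).Nontrivial := hmid
    rw [active_right hu eu3 (by linarith)] at hmid'
    obtain ⟨v, ⟨hv, ev⟩, v', ⟨hv', ev'⟩, hvv⟩ := hmid'
    have fin : ∀ v v' : Exps 3, v ∈ active a (r, y) → v' ∈ active a (r, y) → v.1 = 3 → v'.1 = 3 →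
        v.2 < v'.2 → (v'.2 : ℕ) = v.2 + 1 ∧ active a (r, y) = {(2, w.2), (3, v.2), (3, v'.2)} := by
      intro v v' hv hv' e e' hlt
      have i1 : w = (2, w.2) := Prod.ext ew2 rfl
      have i2 : v = (3, v.2) := Prod.ext e rfl
      have i3 : v' = (3, v'.2) := Prod.ext e' rfl
      have n1 : w ≠ v := fun h => by rw [h, e] at ew2; exact absurd ew2 (by decide)
      have n2 : w ≠ v' := fun h => by rw [h, e'] at ew2; exact absurd ew2 (by decide)
      have n3 : v ≠ v' := fun h => by rw [h] at hlt; exact lt_irrefl _ hlt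
      have hd := (hs (r, y)).2 _ hw _ hv _ hv' n1 n3 n2
      rw [i1, i2, i3] at hd
      refine ⟨col_of_det hd hlt, ?_⟩
      rw [← i1, ← i2, ← i3]
      exact hs.eq_triple hw hv hv' n1 n2 n3
    have hcurve : r' < s' → ∀ z, r' ≤ z → z ≤ s' → (z, y) ∈ curve a := fun _ z h1 h2 =>
      (interComponents_subset hC' (mem_component_of_between hl hC' hr' hs'' h1 h2 (by linarith))).1
    have hlast : r' = s' ∧ wMin xdeg (active a (r', y)) = 0 ∧ wMax xdeg (active a (r', y)) = 2 ∨
        r' < s' ∧ wMax xdeg (active a (r', y)) = wMin xdeg (active a (r', y)) + 1 ∧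
        ∀ z, r' ≤ z → z ≤ s' → (z, y) ∈ curve a := by
      rcases hdeg.2 with h | h
      · exact Or.inl h
      · exact Or.inr ⟨h.1, h.2, hcurve h.1⟩
    rcases lt_trichotomy v.2 v'.2 with h | h | h
    · obtain ⟨h1, h2⟩ := fin v v' hv hv' ev ev' h
      exact ⟨r, r', s', w.2, v.2, v'.2, h1, hrs', hsr, hrx, h2, hlast⟩
    · exact absurd (Prod.ext (ev.trans ev'.symm) h) hvv
    · obtain ⟨h1, h2⟩ := fin v' v hv' hv ev' ev h
      exact ⟨r, r', s', w.2, v'.2, v.2, h1, hrs', hsr, hrx, h2, hlast⟩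
  by_cases h1 : x ≤ s
  · exact key C C' r s r' s' hC hC' hne hr hs' hrs hrx hm hr' hs'' hrs' hrx' hm' h1
  by_cases h2 : x ≤ s'
  · exact key C' C r' s' r s hC' hC hne.symm hr' hs'' hrs' hrx' hm' hr hs' hrs hrx hm h2
  -- If both divisors were to the left of the origin, they would use width 4 on a single horizontal
  -- line.
  exfalso
  push Not at h1 h2
  have key2 : ∀ (C C' : Set (ℝ × ℝ)) (r s r' s' : ℝ),
      C ∈ interComponents a (lineCoeff ((x, y), l)) →
      C' ∈ interComponents a (lineCoeff ((x, y), l)) → C ≠ C' → (r, y) ∈ C → (s, y) ∈ C → r ≤ s → r < x →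
      s < x → (r', y) ∈ C' → (s', y) ∈ C' → r' ≤ s' → s' < x → r' ≤ r → s' < r := by
    clear * - hl
    intro C C' r s r' s' hC hC' hne hr hs' hrs hrx hsx hr' hs'' hrs' hrx' hle
    by_contra hn
    push Not at hn
    exact hne (interComponents_eq_of_mem hC hC' hr
      (mem_component_of_between hl hC' hr' hs'' hle hn hrx))
  have w1 := width_of_pair hl hC hr hs' hrs hrx hm
  have w2 := width_of_pair hl hC' hr' hs'' hrs' hrx' hm'
  have key3 : ∀ r s r' s' : ℝ, (r = s ∧ wMax xdeg (active a (r, y)) = wMin xdeg (active a (r, y)) + 2 ∨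
      r < s ∧ wMax xdeg (active a (r, y)) = wMin xdeg (active a (r, y)) + 1 ∧
        (s < x → wMax xdeg (active a (s, y)) = wMin xdeg (active a (s, y)) + 1)) →
      (r' = s' ∧ wMax xdeg (active a (r', y)) = wMin xdeg (active a (r', y)) + 2 ∨
      r' < s' ∧ wMax xdeg (active a (r', y)) = wMin xdeg (active a (r', y)) + 1 ∧
        (s' < x → wMax xdeg (active a (s', y)) = wMin xdeg (active a (s', y)) + 1)) →
      s < x → s' < x → s' < r → False := by
    clear * -
    intro r s r' s' w1 w2 h1 h2 hlt
    have b := wMax_le_wMin_of_lt (a := a) (y := y) hlt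
    have b1 := wMax_xdeg_le (a := a) (r, y)
    have b2 := wMax_xdeg_le (a := a) (s, y)
    rcases w1 with ⟨e, h⟩ | ⟨e, h, h'⟩ <;> rcases w2 with ⟨e', k⟩ | ⟨e', k, k'⟩
    · subst e e'; omega
    · subst e
      have b3 := wMax_le_wMin_of_lt (a := a) (y := y) e'
      have := k' h2
      omega
    · subst e'
      have b3 := wMax_le_wMin_of_lt (a := a) (y := y) e
      have := h' h1
      omega
    · have b3 := wMax_le_wMin_of_lt (a := a) (y := y) e
      have b4 := wMax_le_wMin_of_lt (a := a) (y := y) e'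
      have := h' h1
      have := k' h2
      omega
  rcases le_total r' r with h | h
  · exact key3 r s r' s' w1 w2 h1 h2
      (key2 C C' r s r' s' hC hC' hne hr hs' hrs hrx h1 hr' hs'' hrs' h2 h)
  · exact key3 r' s' r s w2 w1 h2 h1
      (key2 C' C r' s' r s hC' hC hne.symm hr' hs'' hrs' hrx' h2 hr hs' hrs h1 h)

end


/-! ### Genericity and the ends that can carry a special tritangent -/

section

variable {a : Exps 3 → ℝ} {x y l : ℝ}

open Classical in
/-- The length forms with small coefficients. -/
noncomputable def lengthForms : Finset (Exps 3 → ℤ) :=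
  (Fintype.piFinset fun _ => Finset.Icc (-11) 11).filter IsLengthForm

theorem sum_mul_form {R : Type*} [CommRing R] (f : Exps 3 → R) (u v w p q : Exps 3)
    (α β γ δ : ℤ) :
    ∑ z, f z * (((Pi.single u α + Pi.single v β + Pi.single w γ + Pi.single p δ - Pi.single q δ :
      Exps 3 → ℤ) z : ℤ) : R) = f u * α + f v * β + f w * γ + f p * δ - f q * δ := by
  have h : ∀ (u : Exps 3) (α : ℤ), ∑ z, f z * (((Pi.single u α : Exps 3 → ℤ) z : ℤ) : R) = f u * α := by
    intro u α
    rw [Finset.sum_eq_single u]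
    · simp
    · intro z _ hz; simp [Pi.single_eq_of_ne hz]
    · simp
  simp only [Pi.add_apply, Pi.sub_apply, Int.cast_add, Int.cast_sub, mul_add, mul_sub,
    Finset.sum_add_distrib, Finset.sum_sub_distrib, h]

/-- For generic edge lengths no vertex lies to the left of the vertex of an end on the line
through that end. -/
theorem AvoidsLengthForms.not_vertex_left (hg : AvoidsLengthForms lengthForms a) (hs : IsSmooth a)
    {xA : ℝ} {j₁ j k : Fin 4} (hk : (k : ℕ) = j + 1)
    (hA : active a (xA, y) = {(2, j₁), (3, j), (3, k)}) (hx : x < xA) {u v w : Exps 3}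
    (hu : u ∈ active a (x, y)) (hv : v ∈ active a (x, y)) (hw : w ∈ active a (x, y))
    (huv : u ≠ v) (hvw : v ≠ w) (huw : u ≠ w) : False := by
  have hdet := (hs (x, y)).2 u hu v hv w hw huv hvw huw
  -- Left of A no exponent of the last column is active. So (3,j) and (3,k) differ from u, v, w,
  -- which makes the form below nonzero.
  have hle : ∀ z ∈ active a (x, y), (z.1 : ℕ) ≤ 2 := fun z hz =>
    fst_le_of_right hz (show ((2, j₁) : Exps 3) ∈ active a (xA, y) by rw [hA]; simp) hx
  have hu2 := hle u hu
  have hv2 := hle v hv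
  have hw2 := hle w hw
  obtain ⟨D, hD⟩ : ∃ D, D = -latticeDet u v w := ⟨_, rfl⟩
  have hD' : D = 1 ∨ D = -1 := by
    rw [← abs_neg, ← hD] at hdet
    exact (abs_eq zero_le_one).1 hdet
  have hne : ∀ z ∈ active a (x, y), ∀ i : Fin 4, ((3, i) : Exps 3) ≠ z := by
    rintro z hz i rfl
    exact absurd (show 3 ≤ 2 from hle _ hz) (by decide)
  have hjk : ((3, j) : Exps 3) ≠ (3, k) := by
    intro h
    have : j = k := congrArg Prod.snd h
    rw [this] at hk; omega
  -- By Cramer's rule the height of the vertex dual to u, v, w is an integral form in the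
  -- coefficients, divided by the determinant ±1. The height of the end is a(3,j) - a(3,k). Up to
  -- sign `c` is the difference of the two heights.
  let c : Exps 3 → ℤ := Pi.single u (((v.1 : ℕ) : ℤ) - ((w.1 : ℕ) : ℤ)) +
    Pi.single v (((w.1 : ℕ) : ℤ) - ((u.1 : ℕ) : ℤ)) +
    Pi.single w (((u.1 : ℕ) : ℤ) - ((v.1 : ℕ) : ℤ)) + Pi.single (3, j) D - Pi.single (3, k) D
  have hc3 : c (3, j) = D := by
    simp only [c, Pi.add_apply, Pi.sub_apply, Pi.single_eq_same, Pi.single_eq_of_ne (hne u hu j),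
      Pi.single_eq_of_ne (hne v hv j), Pi.single_eq_of_ne (hne w hw j), Pi.single_eq_of_ne hjk]
    ring
  have e3 : ((3 : Fin 4) : ℕ) = 3 := rfl
  have hform : IsLengthForm c := by
    refine ⟨fun h => ?_, ?_, ?_, ?_⟩
    · rw [h, Pi.zero_apply] at hc3
      omega
    · have := sum_mul_form (R := ℤ) (fun _ => 1) u v w (3, j) (3, k)
        (((v.1 : ℕ) : ℤ) - ((w.1 : ℕ) : ℤ)) (((w.1 : ℕ) : ℤ) - ((u.1 : ℕ) : ℤ))
        (((u.1 : ℕ) : ℤ) - ((v.1 : ℕ) : ℤ)) D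
      simp only [one_mul, Int.cast_id] at this
      exact this.trans (by ring)
    · have := sum_mul_form (R := ℤ) (fun z => ((z.1 : ℕ) : ℤ)) u v w (3, j) (3, k)
        (((v.1 : ℕ) : ℤ) - ((w.1 : ℕ) : ℤ)) (((w.1 : ℕ) : ℤ) - ((u.1 : ℕ) : ℤ))
        (((u.1 : ℕ) : ℤ) - ((v.1 : ℕ) : ℤ)) D
      simp only [Int.cast_id] at this
      exact this.trans (by ring)
    · have := sum_mul_form (R := ℤ) (fun z => ((z.2 : ℕ) : ℤ)) u v w (3, j) (3, k)
        (((v.1 : ℕ) : ℤ) - ((w.1 : ℕ) : ℤ)) (((w.1 : ℕ) : ℤ) - ((u.1 : ℕ) : ℤ))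
        (((u.1 : ℕ) : ℤ) - ((v.1 : ℕ) : ℤ)) D
      simp only [Int.cast_id] at this
      refine this.trans ?_
      rw [hk, hD]
      unfold latticeDet
      push_cast
      ring
  have hmem : c ∈ lengthForms := by
    simp only [lengthForms, Finset.mem_filter, Fintype.mem_piFinset, Finset.mem_Icc]
    refine ⟨fun z => ?_, hform⟩
    -- The bound 11 in `lengthForms` is 3 + 3 + 3 + 1 + 1: it allows for coincidences among the five
    -- exponents.
    have hsing : ∀ (p : Exps 3) (m : ℤ) (b : ℤ), 0 ≤ b → -b ≤ m → m ≤ b →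
        -b ≤ (Pi.single p m : Exps 3 → ℤ) z ∧ (Pi.single p m : Exps 3 → ℤ) z ≤ b := by
      intro p m b hb h1 h2
      rw [Pi.single_apply]
      split_ifs
      · exact ⟨h1, h2⟩
      · exact ⟨by omega, hb⟩
    have s1 := hsing u (((v.1 : ℕ) : ℤ) - ((w.1 : ℕ) : ℤ)) 3 (by omega) (by omega) (by omega)
    have s2 := hsing v (((w.1 : ℕ) : ℤ) - ((u.1 : ℕ) : ℤ)) 3 (by omega) (by omega) (by omega)
    have s3 := hsing w (((u.1 : ℕ) : ℤ) - ((v.1 : ℕ) : ℤ)) 3 (by omega) (by omega) (by omega)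
    have s4 := hsing (3, j) D 1 (by omega) (by omega) (by omega)
    have s5 := hsing (3, k) D 1 (by omega) (by omega) (by omega)
    simp only [c, Pi.add_apply, Pi.sub_apply]
    constructor <;> linarith [s1.1, s1.2, s2.1, s2.2, s3.1, s3.2, s4.1, s4.2, s5.1, s5.2]
  apply hg c hmem
  have hsum := sum_mul_form (R := ℝ) a u v w (3, j) (3, k)
    (((v.1 : ℕ) : ℤ) - ((w.1 : ℕ) : ℤ)) (((w.1 : ℕ) : ℤ) - ((u.1 : ℕ) : ℤ))
    (((u.1 : ℕ) : ℤ) - ((v.1 : ℕ) : ℤ)) D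
  simp only [mul_comm (a _)] at hsum
  refine hsum.trans ?_
  have q1 := term_eq_of_mem hu hw
  have q2 := term_eq_of_mem hv hw
  have q3 := term_eq_of_mem (show ((3, j) : Exps 3) ∈ active a (xA, y) by rw [hA]; simp)
    (show ((3, k) : Exps 3) ∈ active a (xA, y) by rw [hA]; simp)
  have hkr : ((k : ℕ) : ℝ) = ((j : ℕ) : ℝ) + 1 := by exact_mod_cast hk
  simp only [term, hkr] at q1 q2 q3
  have hDr : (D : ℝ) = -((((v.1 : ℕ) : ℝ) - ((u.1 : ℕ) : ℝ)) * (((w.2 : ℕ) : ℝ) - ((u.2 : ℕ) : ℝ)) -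
    (((v.2 : ℕ) : ℝ) - ((u.2 : ℕ) : ℝ)) * (((w.1 : ℕ) : ℝ) - ((u.1 : ℕ) : ℝ))) := by
    rw [hD]; unfold latticeDet; push_cast; ring
  have q3' : a (3, j) = a (3, k) + y := by linarith
  push_cast
  rw [q3', hDr]
  linear_combination (((v.1 : ℕ) : ℝ) - ((w.1 : ℕ) : ℝ)) * q1 + (((w.1 : ℕ) : ℝ) - ((u.1 : ℕ) : ℝ)) * q2

/-- No tritangent has its lower vertex on the middle one of the three ends. -/
theorem not_isTritangent_middle (hs : IsSmooth a) (hl : 0 ≤ l)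
    (h : active a (x, y) = {(3, 1), (3, 2)}) : ¬ IsTritangent a ((x, y), l) := by
  intro ht
  have e3 : (((3 : Fin 4) : ℕ) : ℝ) = 3 := rfl
  have e2 : (((2 : Fin 4) : ℕ) : ℝ) = 2 := rfl
  have e1 : (((1 : Fin 4) : ℕ) : ℝ) = 1 := by norm_num
  have e0 : (((0 : Fin 4) : ℕ) : ℝ) = 0 := by norm_num
  obtain ⟨s, hs0, hns⟩ : ∃ s : ℝ, 0 < s ∧ (3, 1) ∉ active a ((x, y) + s • ((0, -1) : ℝ × ℝ)) := by
    refine ⟨|a (3, 1) - a (3, 0) + y| + 1, by positivity, fun hn => ?_⟩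
    have := hn (3, 0)
    simp only [term, Prod.smul_mk, Prod.mk_add_mk, smul_eq_mul, e3, e1, e0] at this
    have := le_abs_self (a (3, 1) - a (3, 0) + y)
    linarith
  obtain ⟨r, hr0, -, hr, w, hw, hsl⟩ := exists_exit (u := (3, 1)) (by rw [h]; simp) hs0 hns
  have eq : (x, y) + r • ((0, -1) : ℝ × ℝ) = (x, y - r) := by
    ext <;> simp; ring
  rw [eq] at hr hw
  have hw0 : (w.2 : ℕ) = 0 := by
    simp only [slope, e3, e1, e0] at hsl
    have : ((w.2 : ℕ) : ℝ) < 1 := by linarith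
    have : (w.2 : ℕ) < 1 := by exact_mod_cast this
    omega
  have hw0' : w.2 = 0 := Fin.ext hw0
  have hr0 : 0 < r := by
    refine hr0.lt_of_ne fun e => ?_
    rw [← e, sub_zero, h] at hw
    rcases hw with rfl | rfl
    · exact absurd hw0 (by decide)
    · exact absurd hw0 (by decide)
  have hgap : ∀ z, y - r < z → z < y → active a (x, z) = {(3, 1)} := by
    intro z h1 h2
    rw [active_openSegment hr (show (3, 1) ∈ active a (x, y) by rw [h]; simp)
      (mem_openSegment_vertical h1 h2), h]
    ext w'
    simp only [mem_inter_iff, mem_insert_iff, mem_singleton_iff]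
    constructor
    · rintro ⟨h1, rfl | rfl⟩
      · rfl
      · exact absurd (snd_le_of_up h1 (show ((3, 1) : Exps 3) ∈ active a (x, y) by rw [h]; simp)
          (by linarith)) (by decide)
    · rintro rfl; exact ⟨hr, Or.inl rfl⟩
  have hdwn : ∀ z, z < y → (x, z) ∈ dwn (vert0 ((x, y), l)) := fun z hz => ⟨rfl, hz⟩
  have hq : (x, y - r) ∈ curve a ∩ curve (lineCoeff ((x, y), l)) := by
    refine ⟨mem_curve_of_mem hr hw (by rintro rfl; exact absurd hw0 (by decide)), ?_⟩
    rw [curve_line (t := ((x, y), l)) hl]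
    exact Or.inl (Or.inl (Or.inl (Or.inr (hdwn _ (by linarith)))))
  have hdown : ∀ p ∈ curve (lineCoeff ((x, y), l)), p.2 < y → p.1 = x := by
    intro p hp hy
    rcases curve_line_subset (t := ((x, y), l)) hl hp with h' | h' | h' | h' | h'
    · exact absurd h'.1 hy.ne
    · exact h'.1
    · have := h'.1; rw [vert1_mk hl] at this; simp only at this; linarith
    · have := h'.2; rw [vert1_mk hl] at this; simp only at this; linarith
    · rw [vert0_mk, vert1_mk hl, mem_segment_diag_iff hl] at h'
      obtain ⟨r, h0, -, rfl⟩ := h'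
      simp only at hy; linarith
  -- The component of the point where the lower leg leaves the chamber of (3,1). The chamber
  -- separates it from v₀, and the second exponents drop only from 1 to 0, so its multiplicity is
  -- one.
  obtain ⟨K, hK⟩ : ∃ K, K = connectedComponentIn (curve a ∩ curve (lineCoeff ((x, y), l))) (x, y - r) :=
    ⟨_, rfl⟩
  have hKm : K ∈ interComponents a (lineCoeff ((x, y), l)) := ⟨_, hq, hK⟩
  have hqK : (x, y - r) ∈ K := hK ▸ mem_connectedComponentIn hq
  have hKsub : ∀ p ∈ K, p.1 = x ∧ p.2 ≤ y - r := by
    intro p hp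
    have hpX := interComponents_subset hKm hp
    have hp2 : p.2 < y := by
      by_contra hn
      push Not at hn
      have him := (interComponents_preconnected hKm).image Prod.snd continuous_snd.continuousOn
      obtain ⟨p', hp', e⟩ := him.Icc_subset (mem_image_of_mem _ hqK) (mem_image_of_mem _ hp)
        (show y - r / 2 ∈ Icc (y - r) p.2 from ⟨by linarith, by linarith⟩)
      have hp'X := interComponents_subset hKm hp'
      have e1 := hdown p' hp'X.2 (by linarith)
      have : p' = (x, y - r / 2) := Prod.ext e1 e
      rw [this] at hp'X
      exact not_mem_curve_of_eq_singleton (hgap _ (by linarith) (by linarith)) hp'X.1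
    have e1 := hdown p hpX.2 hp2
    refine ⟨e1, ?_⟩
    by_contra hn
    push Not at hn
    have : p = (x, p.2) := Prod.ext e1 rfl
    rw [this] at hpX
    exact not_mem_curve_of_eq_singleton (hgap _ hn hp2) hpX.1
  have hmult : componentMult a (lineCoeff ((x, y), l)) K = 1 := by
    unfold componentMult
    rw [finsum_mem_eq_one (C := K) hqK]
    · rw [stableMult_down (t := ((x, y), l)) hl (hdwn _ (by linarith)),
        width_eq (m := 0) (M := 1)]
      · norm_num
      · intro u hu
        refine ⟨Nat.zero_le _, ?_⟩
        exact snd_le_of_up hu (show ((3, 1) : Exps 3) ∈ active a (x, y) by rw [h]; simp) (by linarith)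
      · exact ⟨w, hw, hw0⟩
      · exact ⟨_, hr, rfl⟩
    · intro p hp hne
      obtain ⟨p1, p2⟩ := p
      obtain ⟨e1, e2⟩ := hKsub _ hp
      simp only at e1 e2
      subst e1
      have hlt : p2 < y - r := lt_of_le_of_ne e2 fun e => hne (by rw [e])
      rw [stableMult_down (t := ((p1, y), l)) hl (hdwn _ (by linarith))]
      refine width_eq_zero ?_ (active_nonempty _ _)
      rw [active_down hw hw0' hlt]
      rintro u ⟨-, hu⟩ v ⟨-, hv⟩
      simp only [ydeg, hu, hv]
  rcases ht.componentMult_mem hKm with h | h | h <;> rw [hmult] at h <;> norm_num at h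

/-- One of the vertices lies on an end of the curve. -/
def OnEnd (a : Exps 3 → ℝ) (t : Params) : Prop :=
  ∃ p, (p = vert0 t ∨ p = vert1 t) ∧ (active a p).Nontrivial ∧
    ((∀ u ∈ active a p, u.1 = 0) ∨ (∀ u ∈ active a p, u.1 = 3) ∨ (∀ u ∈ active a p, u.2 = 0) ∨
      ∀ u ∈ active a p, u.2 = 3)

theorem SpecialOn.exists_end (hs : IsSmooth a) (hl : 0 ≤ l)
    (h : SpecialOn a ((x, y), l) {p | p.2 = y ∧ p.1 < x}) :
    ∃ j k : Fin 4, (k : ℕ) = j + 1 ∧ active a (x, y) = {(3, j), (3, k)} := by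
  obtain ⟨xA, r, s, j₁, j, k, hjk, -, -, hx, hA, -⟩ := h.exists_vertex hs hl
  refine ⟨j, k, hjk, ?_⟩
  rw [active_right (u := (3, j)) (by rw [hA]; simp) rfl hx, hA]
  ext w
  simp only [mem_ofPred_eq, mem_insert_iff, mem_singleton_iff]
  constructor
  · rintro ⟨rfl | rfl | rfl, h⟩
    · exact absurd (show (2 : Fin 4) = 3 from h) (by decide)
    · exact Or.inl rfl
    · exact Or.inr rfl
  · rintro (rfl | rfl)
    · exact ⟨Or.inr (Or.inl rfl), rfl⟩
    · exact ⟨Or.inr (Or.inr rfl), rfl⟩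

theorem SpecialOn.onEnd_left (hs : IsSmooth a) (hl : 0 ≤ l)
    (h : SpecialOn a ((x, y), l) {p | p.2 = y ∧ p.1 < x}) : OnEnd a ((x, y), l) := by
  obtain ⟨j, k, hjk, e⟩ := h.exists_end hs hl
  refine ⟨(x, y), Or.inl rfl, ?_, Or.inr (Or.inl ?_)⟩
  · rw [e]
    refine ⟨_, Or.inl rfl, _, Or.inr rfl, fun h => ?_⟩
    have : j = k := congrArg Prod.snd h
    rw [this] at hjk; omega
  · rw [e]; rintro u (rfl | rfl) <;> rfl

/-- There are three ends on the right side of Γ. At the lowest one genericity reduces the second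
tangency to a simple crossing; the middle one carries no tritangent; the top one is left over and is
treated by cutting off or by reflection. -/
theorem SpecialOn.exists_endConfig (hs : IsSmooth a) (hg : AvoidsLengthForms lengthForms a)
    (hl : 0 ≤ l) (h : SpecialOn a ((x, y), l) {p | p.2 = y ∧ p.1 < x}) :
    (∃ xA xP, ∃ j₀ j₁ : Fin 4, EndConfig a xA y xP j₀ j₁ ∧ xA < x) ∨
      active a (x, y) = {(3, 2), (3, 3)} := by
  obtain ⟨j', k', hjk', e⟩ := h.exists_end hs hl
  obtain ⟨xA, r, s, j₁, j, k, hjk, hrs, hsA, hx, hA, hP⟩ := h.exists_vertex hs hl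
  have hjj : j = j' ∧ k = k' := by
    have m1 : (3, j) ∈ active a (x, y) := by
      rw [active_right (u := (3, j)) (by rw [hA]; simp) rfl hx, hA]; simp
    have m2 : (3, k) ∈ active a (x, y) := by
      rw [active_right (u := (3, j)) (by rw [hA]; simp) rfl hx, hA]; simp
    rw [e] at m1 m2
    simp only [mem_insert_iff, mem_singleton_iff, Prod.mk.injEq, true_and] at m1 m2
    clear * - m1 m2 hjk hjk'
    rcases m1 with rfl | rfl <;> rcases m2 with rfl | rfl <;> constructor <;>
      first | rfl | (exfalso; omega)
  obtain ⟨rfl, rfl⟩ := hjj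
  have hcases : ∀ j k : Fin 4, (k : ℕ) = j + 1 → (j = 0 ∧ k = 1) ∨ (j = 1 ∧ k = 2) ∨ (j = 2 ∧ k = 3) := by
    decide
  rcases hcases j k hjk with ⟨rfl, rfl⟩ | ⟨rfl, rfl⟩ | ⟨rfl, rfl⟩
  · left
    have hr : r < xA := by linarith
    have hno : ∀ u v w : Exps 3, u ∈ active a (r, y) → v ∈ active a (r, y) → w ∈ active a (r, y) →
        u ≠ v → v ≠ w → u ≠ w → False := fun u v w hu hv hw =>
      hg.not_vertex_left hs hjk hA hr hu hv hw
    obtain ⟨u, hu, eu⟩ := exists_eq_wMin (f := xdeg) (active_nonempty a (r, y))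
    obtain ⟨v, hv, ev⟩ := exists_eq_wMax (f := xdeg) (active_nonempty a (r, y))
    rcases hP with ⟨rfl, h0, h2⟩ | ⟨hlt, h1, hc⟩
    · have hu0 : u.1 = 0 := Fin.ext (by rw [h0] at eu; exact eu)
      have hv2 : v.1 = 2 := Fin.ext (by rw [h2] at ev; exact ev)
      have huv : u ≠ v := by rintro rfl; rw [hu0] at hv2; exact absurd hv2 (by decide)
      have hpair : active a (r, y) = {u, v} := by
        refine Subset.antisymm (fun z hz => ?_) ?_
        · by_contra hn
          simp only [mem_insert_iff, mem_singleton_iff, not_or] at hn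
          exact hno u v z hu hv hz huv (Ne.symm hn.2) (Ne.symm hn.1)
        · rintro z (rfl | rfl)
          exacts [hu, hv]
      -- Monomials with the same first exponent keep their difference along a horizontal line. Hence
      -- the exponent in column 2 at the crossing is the same (2,j₁) as at A.
      have m := mem_active_of_fst_eq hv (show ((2, j₁) : Exps 3) ∈ active a (xA, y) by
        rw [hA]; simp) hv2
      rw [hpair] at m
      have hv' : v = (2, j₁) := by
        rcases m with m | m
        · rw [← m] at hu0; exact absurd (show (2 : Fin 4) = 0 from hu0) (by decide)
        · exact m.symm
      refine ⟨xA, r, u.2, j₁, ⟨hs, hsA, ?_, hA⟩, hx⟩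
      rw [hpair, hv', show u = (0, u.2) from Prod.ext hu0 rfl]
    -- A tangency along a segment would start at a vertex. Just right of `r` two active exponents
    -- remain, and the leftmost exponent active at `r` is not among them, so three are active at
    -- `r`.
    · exfalso
      obtain ⟨δ, hδ, hloc⟩ := exists_local a r y
      obtain ⟨d, hd0, hd1, hd2⟩ : ∃ d, 0 < d ∧ d < δ ∧ r + d < s := by
        have h1 := min_le_left (δ / 2) ((s - r) / 2)
        have h2 := min_le_right (δ / 2) ((s - r) / 2)
        have h3 : 0 < min (δ / 2) ((s - r) / 2) := lt_min (by linarith) (by linarith)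
        exact ⟨_, h3, by linarith, by linarith⟩
      have hsub := (hloc d 0 (by rw [abs_of_pos hd0]; exact hd1) (by simpa using hδ)).1
      rw [add_zero] at hsub
      obtain ⟨z, hz, z', hz', hzz⟩ : (active a (r + d, y)).Nontrivial :=
        hc (r + d) (by linarith) (by linarith)
      have hle : ∀ z ∈ active a (r + d, y), z ≠ u := by
        rintro z hz rfl
        have := fst_le_of_right hv hz (by linarith)
        have h4 : (v.1 : ℕ) ≤ z.1 := this
        simp only [xdeg] at eu ev
        omega
      exact hno u z z' hu (hsub hz) (hsub hz') (hle z hz).symm hzz (hle z' hz').symm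
  · exact absurd h.1 (not_isTritangent_middle hs hl e)
  · exact Or.inr e

end


section

variable {a : Exps 3 → ℝ} {x y l : ℝ}

/-! ## Parabolas of tritangents -/

/-- The point with parameter `s` of a parabola that starts at `t`. -/
def arc (t v w : Params) (s : ℝ) : Params := t + s • v + s ^ 2 • w

theorem arc_zero (t v w : Params) : arc t v w 0 = t := by simp [arc]

theorem arc_zero_zero (t : Params) (s : ℝ) : arc t 0 0 s = t := by simp [arc]

/-- A parabola of tritangents inside the relative interior of a bounded cell. -/
def IsCellArc (a : Exps 3 → ℝ) (t v w : Params) (ε : ℝ) : Prop :=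
  ∀ s, 0 ≤ s → s < ε → IsTritangent a (arc t v w s) ∧
    active a (vert0 (arc t v w s)) = active a (vert0 t) ∧
    active a (vert1 (arc t v w s)) = active a (vert1 t) ∧
    ¬ InCornerChamber a (arc t v w s) ∧ ¬ OnCornerEdge a (arc t v w s)

/-- The slope of the bounded edge does not change along the parabola. -/
def HasConstSign (t v w : Params) (ε : ℝ) : Prop :=
  (∀ s, 0 ≤ s → s < ε → 0 < (arc t v w s).2) ∨ (∀ s, 0 ≤ s → s < ε → (arc t v w s).2 < 0) ∨
    v = 0 ∧ w = 0

/-- Some point of the parabola is linked to a good family of suitable dimension. -/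
def HasNearbyFamily (a : Exps 3 → ℝ) (t v w : Params) (ε : ℝ) : Prop :=
  ∃ s, 0 ≤ s ∧ s < ε ∧ ∃ v' w', GoodFamily a (arc t v w s) v' w' ∧
    (LinearIndependent ℝ ![v', w'] ∨ v' ≠ 0 ∧ w' = 0 ∧ ¬ LinearIndependent ℝ ![v, w])

/-- The conclusion reached at a special tritangent of a generic curve. -/
def IsMovable (a : Exps 3 → ℝ) (t : Params) : Prop :=
  ∀ v w ε, 0 < ε → IsCellArc a t v w ε → HasConstSign t v w ε → HasNearbyFamily a t v w ε

/-- The three exponents active at a vertex determine it, by two linear equations of determinant ±1,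
and there are finitely many sets of exponents. -/
theorem finite_vertices (hs : IsSmooth a) : {q | (active a q).ncard = 3}.Finite := by
  refine Set.Finite.of_finite_image (f := active a) (Set.toFinite _) ?_
  intro q hq q' hq' h
  have hq : (active a q).ncard = 3 := hq
  obtain ⟨u, v, w, huv, huw, hvw, e⟩ := Set.ncard_eq_three.1 hq
  have hu : u ∈ active a q := by rw [e]; simp
  have hv : v ∈ active a q := by rw [e]; simp
  have hw : w ∈ active a q := by rw [e]; simp
  have hdet := (hs q).2 u hu v hv w hw huv hvw huw
  have q1 := term_eq_of_mem hu hv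
  have q2 := term_eq_of_mem hu hw
  rw [h] at hu hv hw
  have q3 := term_eq_of_mem hu hv
  have q4 := term_eq_of_mem hu hw
  have hd : latticeDet u v w ≠ 0 := by rintro h; rw [h] at hdet; exact absurd hdet (by decide)
  have hd' : (latticeDet u v w : ℝ) ≠ 0 := by exact_mod_cast hd
  simp only [term] at q1 q2 q3 q4
  unfold latticeDet at hd'
  push_cast at hd'
  refine Prod.ext (sub_eq_zero.1 ((mul_eq_zero.1 ?_).resolve_left hd'))
    (sub_eq_zero.1 ((mul_eq_zero.1 ?_).resolve_left hd'))
  · linear_combination (((v.2 : ℕ) : ℝ) - ((u.2 : ℕ) : ℝ)) * (q2 - q4) -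
      (((w.2 : ℕ) : ℝ) - ((u.2 : ℕ) : ℝ)) * (q1 - q3)
  · linear_combination (((w.1 : ℕ) : ℝ) - ((u.1 : ℕ) : ℝ)) * (q1 - q3) -
      (((v.1 : ℕ) : ℝ) - ((u.1 : ℕ) : ℝ)) * (q2 - q4)

theorem finite_quadratic_roots {p q r : ℝ} (h : ¬ (q = 0 ∧ r = 0)) :
    {s : ℝ | p + s * q + s ^ 2 * r = 0}.Finite := by
  let P : Polynomial ℝ := Polynomial.C p + Polynomial.C q * Polynomial.X +
    Polynomial.C r * Polynomial.X ^ 2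
  have hP : P ≠ 0 := by
    intro h0
    apply h
    have h1 := congrArg (fun P => Polynomial.coeff P 1) h0
    have h2 := congrArg (fun P => Polynomial.coeff P 2) h0
    simp [P, Polynomial.coeff_X, Polynomial.coeff_C, Polynomial.coeff_X_pow] at h1 h2
    exact ⟨h1, h2⟩
  refine (Polynomial.finite_setOfPred_isRoot hP).subset fun s hs => ?_
  have hs : p + s * q + s ^ 2 * r = 0 := hs
  simp only [mem_ofPred_eq, Polynomial.IsRoot, P, Polynomial.eval_add, Polynomial.eval_mul, Polynomial.eval_C,
    Polynomial.eval_X, Polynomial.eval_pow]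
  linarith

theorem exists_avoiding {p q r ε : ℝ} (h : ¬ (q = 0 ∧ r = 0)) (hε : 0 < ε) {F : Set ℝ}
    (hF : F.Finite) : ∃ s, 0 < s ∧ s < ε ∧ p + s * q + s ^ 2 * r ∉ F := by
  have hfin : (⋃ f ∈ F, {s : ℝ | (p - f) + s * q + s ^ 2 * r = 0}).Finite :=
    hF.biUnion fun f _ => finite_quadratic_roots h
  obtain ⟨s, hs, hn⟩ := (Set.Ioo_infinite hε).exists_notMem_finite hfin
  refine ⟨s, hs.1, hs.2, fun hm => hn ?_⟩
  refine mem_biUnion hm ?_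
  show _ = _
  ring

theorem coeff_eq_zero_of_quadratic {q r ε : ℝ} (hε : 0 < ε)
    (h : ∀ s, 0 ≤ s → s < ε → s * q + s ^ 2 * r = 0) : q = 0 ∧ r = 0 := by
  have h1 := h (ε / 2) (by linarith) (by linarith)
  have h2 := h (ε / 4) (by linarith) (by linarith)
  have h3 : ε / 2 ≠ 0 := by positivity
  have h4 : ε / 4 ≠ 0 := by positivity
  have e1 : q + ε / 2 * r = 0 := mul_left_cancel₀ h3 (by linear_combination h1)
  have e2 : q + ε / 4 * r = 0 := mul_left_cancel₀ h4 (by linear_combination h2)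
  have e3 : r = 0 := mul_left_cancel₀ h4 (by linear_combination e1 - e2)
  rw [e3] at e1
  exact ⟨by linarith, e3⟩

/-- Along an arc inside the cell v₀ stays on the same end, so each member yields a good family. That
family is straight only at abscissas of vertices of Γ, and on an arc with independent directions
these can be avoided. -/
theorem EndConfig.isMovable {xA xP : ℝ} {j₀ j₁ : Fin 4} (c : EndConfig a xA y xP j₀ j₁)
    (hx : xA < x) (hl : 0 ≤ l) : IsMovable a ((x, y), l) := by
  intro v w ε hε hf hs
  have hv0 : active a (x, y) = {(3, 0), (3, 1)} := c.active_ray hx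
  have key : ∀ s, 0 ≤ s → s < ε → (arc ((x, y), l) v w s).1.2 = y ∧
      HasGoodFamily a (arc ((x, y), l) v w s)
        ((arc ((x, y), l) v w s).1.1 + (arc ((x, y), l) v w s).2) := by
    intro s h0 h1
    obtain ⟨ht, ha, -, hc, ho⟩ := hf s h0 h1
    have hl' : 0 ≤ (arc ((x, y), l) v w s).2 := by
      rcases hs with h | h | ⟨rfl, rfl⟩
      · exact (h s h0 h1).le
      · have := h 0 le_rfl hε
        rw [arc_zero] at this
        exact absurd hl (not_le.2 this)
      · rw [arc_zero_zero]; exact hl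
    generalize arc ((x, y), l) v w s = T at ht ha hc ho hl' ⊢
    obtain ⟨⟨x', y'⟩, l'⟩ := T
    simp only [vert0_mk] at ha hl' ⊢
    rw [hv0] at ha
    have e3 : (((3 : Fin 4) : ℕ) : ℝ) = 3 := rfl
    have e1 : (((1 : Fin 4) : ℕ) : ℝ) = 1 := by norm_num
    have e0 : (((0 : Fin 4) : ℕ) : ℝ) = 0 := by norm_num
    have k1 : term a (3, 0) (x', y') = term a (3, 1) (x', y') :=
      term_eq_of_mem (by rw [ha]; simp) (by rw [ha]; simp)
    have k2 : term a (3, 0) (x, y) = term a (3, 1) (x, y) :=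
      term_eq_of_mem (by rw [hv0]; simp) (by rw [hv0]; simp)
    simp only [term, e3, e1, e0] at k1 k2
    have hy : y' = y := by linarith
    subst hy
    refine ⟨rfl, ?_⟩
    have hx' : xA < x' := by
      rcases lt_trichotomy x' xA with h | h | h
      · exact absurd (fst_le_of_right (show ((3, 0) : Exps 3) ∈ active a (x', y') by rw [ha]; simp)
          (show ((2, j₁) : Exps 3) ∈ active a (xA, y') by rw [c.vertex]; simp) h)
          (show ¬ (3 : Fin 4) ≤ 2 by decide)
      · have : ((2, j₁) : Exps 3) ∈ active a (xA, y') := by rw [c.vertex]; simp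
        rw [← h, ha] at this
        rcases this with h | h
        · exact absurd (show (2 : Fin 4) = 3 from congrArg Prod.fst h) (by decide)
        · exact absurd (show (2 : Fin 4) = 3 from congrArg Prod.fst h) (by decide)
      · exact h
    exact c.hasGoodFamily hx' hl' ht hc ho
  by_cases hvw : LinearIndependent ℝ ![v, w]
  · have hy : v.1.2 = 0 ∧ w.1.2 = 0 := coeff_eq_zero_of_quadratic hε fun s h0 h1 => by
      have := (key s h0 h1).1
      simp only [arc, Prod.fst_add, Prod.snd_add, Prod.smul_fst, Prod.smul_snd, smul_eq_mul] at this
      linarith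
    -- The ordinate of v₀ is fixed on the end. If the abscissa of v₁ were constant as well, `v` and
    -- `w` would be multiples of one vector.
    have hne : ¬ (v.1.1 + v.2 = 0 ∧ w.1.1 + w.2 = 0) := by
      rintro ⟨h1, h2⟩
      rw [LinearIndependent.pair_iff] at hvw
      by_cases hw : w.2 = 0
      · have := hvw 0 1 (by
          ext <;> simp
          · linarith
          · exact hy.2
          · exact hw)
        exact one_ne_zero this.2
      · refine hw (hvw w.2 (-v.2) ?_).1
        ext <;> simp
        · rw [show v.1.1 = -v.2 by linarith, show w.1.1 = -w.2 by linarith]; ring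
        · rw [hy.1, hy.2]; ring
        · ring
    obtain ⟨s, h0, h1, hF⟩ := exists_avoiding (p := x + l) hne hε
      ((finite_vertices c.smooth).image Prod.fst)
    refine ⟨s, h0.le, h1, ?_⟩
    obtain ⟨v', w', hg, h | ⟨-, -, q, hq, e⟩⟩ := (key s h0.le h1).2
    · exact ⟨v', w', hg, Or.inl h⟩
    · refine absurd ⟨q, hq, ?_⟩ hF
      rw [e]
      simp only [arc, Prod.fst_add, Prod.snd_add, Prod.smul_fst, Prod.smul_snd, smul_eq_mul]
      ring
  · obtain ⟨v', w', hg, h | ⟨h, h', -⟩⟩ := (key 0 le_rfl hε).2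
    · exact ⟨0, le_rfl, hε, v', w', hg, Or.inl h⟩
    · exact ⟨0, le_rfl, hε, v', w', hg, Or.inr ⟨h, h', hvw⟩⟩

theorem isMovable_of_inCornerChamber {t : Params} (h : InCornerChamber a t) : IsMovable a t := by
  intro v w ε hε hf
  have := (hf 0 le_rfl hε).2.2.2.1
  rw [arc_zero] at this
  exact absurd h this

theorem inCornerChamber_of_top_end (hl : 0 < l) (h : active a (x, y) = {(3, 2), (3, 3)}) :
    InCornerChamber a ((x, y), l) := by
  refine Or.inl ⟨hl, Or.inr ?_⟩
  rw [vert1_mk hl.le]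
  have e : (x + l, y + l) = (x, y) + l • ((1, 1) : ℝ × ℝ) := by ext <;> simp
  have e3 : (((3 : Fin 4) : ℕ) : ℝ) = 3 := rfl
  rw [e, Tritangent.active_ray (u := (3, 3)) (by rw [h]; simp) (fun w => by
    have h1 := exps_fst_le w
    have h2 := exps_snd_le w
    simp only [slope_mk, e3]; linarith) hl, h]
  ext w
  simp only [mem_ofPred_eq, mem_insert_iff, mem_singleton_iff]
  constructor
  · rintro ⟨rfl | rfl, h⟩
    · have e2 : (((2 : Fin 4) : ℕ) : ℝ) = 2 := rfl
      simp only [slope_mk, e3, e2] at h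
      norm_num at h
    · rfl
  · rintro rfl; exact ⟨Or.inr rfl, rfl⟩

end


/-! ## Symmetries -/

/-- The exponents lie on one side of the Newton square. -/
def OnSide (U : Set (Exps 3)) : Prop :=
  (∀ u ∈ U, u.1 = 0) ∨ (∀ u ∈ U, u.1 = 3) ∨ (∀ u ∈ U, u.2 = 0) ∨ ∀ u ∈ U, u.2 = 3

/-- An involutive symmetry of the Newton square together with its action on the plane and on
the parameters of (1,1)-curves. -/
structure Symmetry where
  e : (n : ℕ) → Exps n → Exps n
  f : (ℝ × ℝ) →ₗ[ℝ] (ℝ × ℝ)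
  c : ℕ → ℝ × ℝ
  g : Params → Params
  preserving : MeasurePreserving f volume volume
  embedding : MeasurableEmbedding f
  f_f : ∀ p, f (f p) = p
  inner_f : ∀ p q, (f p).1 * (f q).1 + (f p).2 * (f q).2 = p.1 * q.1 + p.2 * q.2
  e_e : ∀ n u, e n (e n u) = u
  toPlane_e : ∀ n u, toPlane (e n u) = f (toPlane u) + c n
  g_g : ∀ t, g (g t) = t
  continuous_g : Continuous g
  linear : ∀ t : Params, ∃ L : Params ≃ₗ[ℝ] Params, ∀ t' : Params, (0 ≤ t.2 ↔ 0 ≤ t'.2) → g t' = L t'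
  vert : ∀ t : Params, (∀ t' : Params, (0 ≤ t.2 ↔ 0 ≤ t'.2) →
      vert0 (g t') = f (vert0 t') ∧ vert1 (g t') = f (vert1 t')) ∨
    ∀ t' : Params, (0 ≤ t.2 ↔ 0 ≤ t'.2) →
      vert0 (g t') = f (vert1 t') ∧ vert1 (g t') = f (vert0 t')
  sign : (∀ t : Params, (0 < t.2 → 0 < (g t).2) ∧ (t.2 < 0 → (g t).2 < 0)) ∨
    ∀ t : Params, (0 < t.2 → (g t).2 < 0) ∧ (t.2 < 0 → 0 < (g t).2)
  line : ∀ t, ∃ k, ∀ u, lineCoeff (g t) u = lineCoeff t (e 1 u) + k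
  side : ∀ U, OnSide U → OnSide (e 3 '' U)
  good : ∀ U, IsGood U → IsGood (e 3 '' U)
  chamber : ∀ a a' t, (∀ p, active a' (f p) = e 3 '' active a p) → InCornerChamber a t →
    InCornerChamber a' (g t)
  edge : ∀ a a' t, (∀ p, active a' (f p) = e 3 '' active a p) → OnCornerEdge a t →
    OnCornerEdge a' (g t)

namespace Symmetry

variable (S : Symmetry) {m n : ℕ} {a : Exps 3 → ℝ} {t : Params}

theorem e_injective (n : ℕ) : Function.Injective (S.e n) :=
  (show Function.Involutive (S.e n) from S.e_e n).injective

theorem f_injective : Function.Injective S.f :=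
  (show Function.Involutive S.f from S.f_f).injective

theorem comp_comp (a : Exps n → ℝ) : (a ∘ S.e n) ∘ S.e n = a := by
  funext u; simp [S.e_e]

/-- Since `f` is orthogonal and `e` acts on exponents as `f` followed by a translation, the
transformed monomial differs from the original by a quantity independent of `u`. So the maximisers
correspond. -/
theorem term_eq {a a' : Exps n → ℝ} {k : ℝ} (h : ∀ u, a' u = a (S.e n u) + k) (u : Exps n)
    (p : ℝ × ℝ) : term a' (S.e n u) (S.f p) =
      term a u p + ((S.c n).1 * (S.f p).1 + (S.c n).2 * (S.f p).2 + k) := by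
  have h1 := S.inner_f (toPlane u) p
  have h2 := S.toPlane_e n u
  have h3 : (toPlane (S.e n u)).1 = (S.f (toPlane u)).1 + (S.c n).1 := by rw [h2]; rfl
  have h4 : (toPlane (S.e n u)).2 = (S.f (toPlane u)).2 + (S.c n).2 := by rw [h2]; rfl
  have h5 : (toPlane u).1 = ((u.1 : ℕ) : ℝ) := rfl
  have h6 : (toPlane u).2 = ((u.2 : ℕ) : ℝ) := rfl
  have h7 : (toPlane (S.e n u)).1 = (((S.e n u).1 : ℕ) : ℝ) := rfl
  have h8 : (toPlane (S.e n u)).2 = (((S.e n u).2 : ℕ) : ℝ) := rfl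
  rw [h5, h6] at h1
  unfold term
  rw [← h7, ← h8, h3, h4, h, S.e_e]
  linear_combination h1

theorem active_eq {a a' : Exps n → ℝ} {k : ℝ} (h : ∀ u, a' u = a (S.e n u) + k) (p : ℝ × ℝ) :
    active a' (S.f p) = S.e n '' active a p := by
  ext u
  constructor
  · intro hu
    refine ⟨S.e n u, fun w => ?_, S.e_e n u⟩
    have := hu (S.e n w)
    have e1 := S.term_eq h w p
    have e2 := S.term_eq h (S.e n u) p
    rw [S.e_e] at e2
    linarith
  · rintro ⟨u, hu, rfl⟩ w
    have := hu (S.e n w)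
    have e1 := S.term_eq h (S.e n w) p
    have e2 := S.term_eq h u p
    rw [S.e_e] at e1
    linarith

theorem active_comp (a : Exps n → ℝ) (p : ℝ × ℝ) :
    active (a ∘ S.e n) (S.f p) = S.e n '' active a p :=
  S.active_eq (k := 0) (fun u => by simp) p

theorem active_line (t : Params) (p : ℝ × ℝ) :
    active (lineCoeff (S.g t)) (S.f p) = S.e 1 '' active (lineCoeff t) p := by
  obtain ⟨k, hk⟩ := S.line t
  exact S.active_eq hk p

theorem mem_curve_iff {a a' : Exps n → ℝ} {p : ℝ × ℝ} (h : active a' (S.f p) = S.e n '' active a p) :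
    S.f p ∈ curve a' ↔ p ∈ curve a := by
  show (active a' (S.f p)).Nontrivial ↔ (active a p).Nontrivial
  rw [h]
  exact Set.image_nontrivial (S.e_injective n)

theorem inter_eq (a : Exps 3 → ℝ) (t : Params) :
    curve (a ∘ S.e 3) ∩ curve (lineCoeff (S.g t)) = S.f '' (curve a ∩ curve (lineCoeff t)) := by
  ext p
  constructor
  · rintro ⟨h1, h2⟩
    refine ⟨S.f p, ⟨?_, ?_⟩, S.f_f p⟩
    · rw [← S.mem_curve_iff (S.active_comp a _), S.f_f]; exact h1
    · rw [← S.mem_curve_iff (S.active_line t _), S.f_f]; exact h2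
  · rintro ⟨p, ⟨h1, h2⟩, rfl⟩
    exact ⟨(S.mem_curve_iff (S.active_comp a _)).2 h1, (S.mem_curve_iff (S.active_line t _)).2 h2⟩

theorem dualCell_eq {a a' : Exps n → ℝ} {p : ℝ × ℝ} (h : active a' (S.f p) = S.e n '' active a p) :
    dualCell a' (S.f p) = (fun q => S.f q + S.c n) '' dualCell a p := by
  unfold dualCell
  rw [h, image_convexHull_affine, image_image, image_image]
  simp only [S.toPlane_e]

theorem stableMult_eq (a : Exps 3 → ℝ) (t : Params) (p : ℝ × ℝ) :
    stableMult (a ∘ S.e 3) (lineCoeff (S.g t)) (S.f p) = stableMult a (lineCoeff t) p := by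
  unfold stableMult
  rw [S.dualCell_eq (S.active_comp a p), S.dualCell_eq (S.active_line t p),
    mixedArea_image S.f S.preserving S.embedding]

/-- The action on the plane as a homeomorphism. -/
noncomputable def homeo : (ℝ × ℝ) ≃ₜ (ℝ × ℝ) where
  toFun := S.f
  invFun := S.f
  left_inv := S.f_f
  right_inv := S.f_f
  continuous_toFun := S.f.continuous_of_finiteDimensional
  continuous_invFun := S.f.continuous_of_finiteDimensional

theorem image_mem_interComponents {C : Set (ℝ × ℝ)} (h : C ∈ interComponents a (lineCoeff t)) :
    S.f '' C ∈ interComponents (a ∘ S.e 3) (lineCoeff (S.g t)) := by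
  obtain ⟨p, hp, rfl⟩ := h
  refine ⟨S.f p, by rw [S.inter_eq]; exact mem_image_of_mem _ hp, ?_⟩
  rw [S.inter_eq]
  exact S.homeo.image_connectedComponentIn hp

theorem interComponents_eq (a : Exps 3 → ℝ) (t : Params) :
    interComponents (a ∘ S.e 3) (lineCoeff (S.g t)) =
      (fun C => S.f '' C) '' interComponents a (lineCoeff t) := by
  ext C
  constructor
  · intro h
    refine ⟨S.f '' C, ?_, ?_⟩
    · have := S.image_mem_interComponents h
      rwa [S.comp_comp, S.g_g] at this
    · simp only [image_image, S.f_f, image_id']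
  · rintro ⟨C, h, rfl⟩
    exact S.image_mem_interComponents h

theorem componentMult_eq (a : Exps 3 → ℝ) (t : Params) (C : Set (ℝ × ℝ)) :
    componentMult (a ∘ S.e 3) (lineCoeff (S.g t)) (S.f '' C) = componentMult a (lineCoeff t) C := by
  unfold componentMult
  rw [finsum_mem_image S.f_injective.injOn]
  simp only [S.stableMult_eq]

theorem isTritangent (h : IsTritangent a t) : IsTritangent (a ∘ S.e 3) (S.g t) := by
  have hinj : Function.Injective fun C : Set (ℝ × ℝ) => S.f '' C := S.f_injective.image_injective
  unfold IsTritangent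
  rw [S.interComponents_eq]
  rcases h with ⟨h1, h2⟩ | ⟨C, C', hne, h1, h2, h3⟩ | ⟨C, h1, h2⟩
  · left
    refine ⟨by rw [ncard_image_of_injective _ hinj, h1], ?_⟩
    rintro _ ⟨C, hC, rfl⟩
    rw [S.componentMult_eq]; exact h2 C hC
  · right; left
    refine ⟨S.f '' C, S.f '' C', hinj.ne hne, ?_, ?_, ?_⟩
    · rw [h1, image_pair]
    · rw [S.componentMult_eq, h2]
    · rw [S.componentMult_eq, h3]
  · right; right
    refine ⟨S.f '' C, ?_, ?_⟩
    · rw [h1, image_singleton]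
    · rw [S.componentMult_eq, h2]

theorem isTangencyPoint {C : Set (ℝ × ℝ)} {P : ℝ × ℝ} (h : IsTangencyPoint a t C P) :
    IsTangencyPoint (a ∘ S.e 3) (S.g t) (S.f '' C) (S.f P) := by
  obtain ⟨A, hA, B, hB, hm, rfl⟩ := h
  refine ⟨S.f A, mem_image_of_mem _ hA, S.f B, mem_image_of_mem _ hB, ?_, ?_⟩
  · rintro _ ⟨p, hp, rfl⟩
    rw [S.stableMult_eq, hm p hp]
    simp only [indicator_apply, mem_singleton_iff, S.f_injective.eq_iff, Pi.one_apply]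
  · exact S.f.toAffineMap.map_midpoint A B

theorem specialOn {L L' : Set (ℝ × ℝ)} (h : SpecialOn a t L) (hL : ∀ p ∈ L, S.f p ∈ L') :
    SpecialOn (a ∘ S.e 3) (S.g t) L' := by
  obtain ⟨ht, C, hC, C', hC', hne, P, hP, P', hP', hT, hT'⟩ := h
  exact ⟨S.isTritangent ht, _, S.image_mem_interComponents hC, _, S.image_mem_interComponents hC',
    S.f_injective.image_injective.ne hne, _, hL P hP, _, hL P' hP', S.isTangencyPoint hT,
    S.isTangencyPoint hT'⟩

theorem toPlane_sub (n : ℕ) (u v : Exps n) :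
    toPlane (S.e n u) - toPlane (S.e n v) = S.f (toPlane u - toPlane v) := by
  rw [S.toPlane_e, S.toPlane_e, map_sub]; abel

/-- The square of the determinant is the Gram determinant, which only involves inner products. -/
theorem abs_latticeDet (n : ℕ) (u v w : Exps n) :
    |latticeDet (S.e n u) (S.e n v) (S.e n w)| = |latticeDet u v w| := by
  have cast : ∀ u v w : Exps n, (latticeDet u v w : ℝ) =
      (toPlane v - toPlane u).1 * (toPlane w - toPlane u).2 -
        (toPlane v - toPlane u).2 * (toPlane w - toPlane u).1 := by
    intro u v w; unfold latticeDet toPlane; push_cast; simp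
  have hsq : ((latticeDet (S.e n u) (S.e n v) (S.e n w) : ℤ) : ℝ) ^ 2 =
      ((latticeDet u v w : ℤ) : ℝ) ^ 2 := by
    rw [cast, cast, S.toPlane_sub, S.toPlane_sub]
    have h1 := S.inner_f (toPlane v - toPlane u) (toPlane v - toPlane u)
    have h2 := S.inner_f (toPlane v - toPlane u) (toPlane w - toPlane u)
    have h3 := S.inner_f (toPlane w - toPlane u) (toPlane w - toPlane u)
    generalize S.f (toPlane v - toPlane u) = p at *
    generalize S.f (toPlane w - toPlane u) = q at *
    generalize toPlane v - toPlane u = p' at *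
    generalize toPlane w - toPlane u = q' at *
    have : (p.1 * q.2 - p.2 * q.1) ^ 2 =
      (p.1 * p.1 + p.2 * p.2) * (q.1 * q.1 + q.2 * q.2) - (p.1 * q.1 + p.2 * q.2) ^ 2 := by ring
    rw [this, h1, h2, h3]; ring
  exact (sq_eq_sq_iff_abs_eq_abs _ _).1 (by exact_mod_cast hsq)

theorem isSmooth (h : IsSmooth a) : IsSmooth (a ∘ S.e 3) := by
  intro p
  have e : active (a ∘ S.e 3) p = S.e 3 '' active a (S.f p) := by
    rw [← S.active_comp, S.f_f]
  rw [e]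
  refine ⟨by rw [ncard_image_of_injective _ (S.e_injective 3)]; exact (h _).1, ?_⟩
  rintro _ ⟨u, hu, rfl⟩ _ ⟨v, hv, rfl⟩ _ ⟨w, hw, rfl⟩ huv hvw huw
  rw [S.abs_latticeDet]
  exact (h _).2 u hu v hv w hw (fun h => huv (by rw [h])) (fun h => hvw (by rw [h]))
    fun h => huw (by rw [h])

/-- The permutation of the exponents. -/
def perm (n : ℕ) : Equiv.Perm (Exps n) := ⟨S.e n, S.e n, S.e_e n, S.e_e n⟩

/-- The two moment conditions are the vector equation Σ c(u) u = 0. An affine change of exponents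
transforms it by the linear part plus a translation times Σ c(u), which vanishes. -/
theorem isLengthForm {c : Exps 3 → ℤ} (h : IsLengthForm c) : IsLengthForm (c ∘ S.e 3) := by
  have key : ∀ c : Exps 3 → ℤ, (∑ u, ((u.1 : ℕ) : ℤ) * c u = 0 ∧ ∑ u, ((u.2 : ℕ) : ℤ) * c u = 0) ↔
      ∑ u, (c u : ℝ) • toPlane u = 0 := by
    intro c
    rw [Prod.ext_iff, Prod.fst_sum, Prod.snd_sum]
    simp only [Prod.smul_fst, Prod.smul_snd, toPlane, smul_eq_mul, Prod.fst_zero, Prod.snd_zero]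
    constructor
    · rintro ⟨h1, h2⟩
      constructor
      · exact_mod_cast (by simpa only [mul_comm] using h1 :
          ∑ u : Exps 3, c u * ((u.1 : ℕ) : ℤ) = 0)
      · exact_mod_cast (by simpa only [mul_comm] using h2 :
          ∑ u : Exps 3, c u * ((u.2 : ℕ) : ℤ) = 0)
    · rintro ⟨h1, h2⟩
      constructor
      · have : ∑ u : Exps 3, c u * ((u.1 : ℕ) : ℤ) = 0 := by exact_mod_cast h1
        simpa only [mul_comm] using this
      · have : ∑ u : Exps 3, c u * ((u.2 : ℕ) : ℤ) = 0 := by exact_mod_cast h2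
        simpa only [mul_comm] using this
  obtain ⟨h0, h1, h2⟩ := h
  rw [key] at h2
  refine ⟨fun h => h0 ?_, ?_, ?_⟩
  · funext u
    have := congrFun h (S.e 3 u)
    simpa [S.e_e] using this
  · exact (Equiv.sum_comp (S.perm 3) c).trans h1
  · rw [key]
    have e1 : ∑ u, ((c ∘ S.e 3) u : ℝ) • toPlane u = ∑ u, (c u : ℝ) • toPlane (S.e 3 u) := by
      rw [← Equiv.sum_comp (S.perm 3)]
      refine Finset.sum_congr rfl fun u _ => ?_
      show ((c (S.e 3 (S.e 3 u)) : ℤ) : ℝ) • toPlane (S.e 3 u) = _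
      rw [S.e_e]
    rw [e1]
    simp only [S.toPlane_e, smul_add, Finset.sum_add_distrib, ← map_smul, ← map_sum]
    rw [h2, map_zero, zero_add, ← Finset.sum_smul]
    have : ∑ u, (c u : ℝ) = 0 := by exact_mod_cast h1
    rw [this, zero_smul]

/-- The set `lengthForms` bounds all coefficients alike, so it is stable under permutations of the
exponents that preserve length forms. This is why it consists of all small forms. -/
theorem avoidsLengthForms (h : AvoidsLengthForms lengthForms a) :
    AvoidsLengthForms lengthForms (a ∘ S.e 3) := by
  intro c hc
  have hc' : c ∘ S.e 3 ∈ lengthForms := by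
    simp only [lengthForms, Finset.mem_filter, Fintype.mem_piFinset] at hc ⊢
    exact ⟨fun u => hc.1 _, S.isLengthForm hc.2⟩
  have := h _ hc'
  rw [← Equiv.sum_comp (S.perm 3)] at this
  intro h0
  apply this
  rw [← h0]
  refine Finset.sum_congr rfl fun u _ => ?_
  show ((c (S.e 3 (S.e 3 u)) : ℤ) : ℝ) * a (S.e 3 u) = c u * a (S.e 3 u)
  rw [S.e_e]

theorem vert_cases (t : Params) : (vert0 (S.g t) = S.f (vert0 t) ∧ vert1 (S.g t) = S.f (vert1 t)) ∨
    (vert0 (S.g t) = S.f (vert1 t) ∧ vert1 (S.g t) = S.f (vert0 t)) :=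
  (S.vert t).imp (fun h => h t Iff.rfl) fun h => h t Iff.rfl

theorem onEnd (h : OnEnd a t) : OnEnd (a ∘ S.e 3) (S.g t) := by
  obtain ⟨p, hp, h1, h2⟩ := h
  refine ⟨S.f p, ?_, (S.mem_curve_iff (S.active_comp a p)).2 h1, ?_⟩
  · rcases S.vert_cases t with ⟨e0, e1⟩ | ⟨e0, e1⟩ <;> rw [e0, e1] <;>
      rcases hp with rfl | rfl <;> simp
  · rw [S.active_comp]; exact S.side _ h2

theorem linked {t' : Params} (h : Linked a t t') : Linked (a ∘ S.e 3) (S.g t) (S.g t') := by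
  obtain ⟨W, hW, hc, h1, h2⟩ := h
  refine ⟨S.g '' W, ?_, hc.image _ S.continuous_g.continuousOn, mem_image_of_mem _ h1,
    mem_image_of_mem _ h2⟩
  rintro _ ⟨t, ht, rfl⟩
  exact S.isTritangent (hW ht)

/-- The action on parameters is only piecewise linear, with break at l = 0. A good family stays
strictly on one side, where one linear isomorphism maps the arc to an arc; the midpoint ε/2 only
serves to select the side. -/
theorem goodFamily {v w : Params} (h : GoodFamily a t v w) :
    ∃ L : Params ≃ₗ[ℝ] Params, GoodFamily (a ∘ S.e 3) (S.g t) (L v) (L w) := by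
  obtain ⟨p, ε, hε, hf, hs⟩ := h
  obtain ⟨L, hL⟩ := S.linear (p + (ε / 2) • v + (ε / 2) ^ 2 • w)
  have hsame : ∀ s, 0 < s → s < ε → (0 ≤ (p + (ε / 2) • v + (ε / 2) ^ 2 • w).2 ↔
      0 ≤ (p + s • v + s ^ 2 • w).2) := by
    intro s h0 h1
    rcases hs with h | h
    · exact ⟨fun _ => (h s h0 h1).le, fun _ => (h _ (by linarith) (by linarith)).le⟩
    · exact ⟨fun k => absurd k (not_le.2 (h _ (by linarith) (by linarith))),
        fun k => absurd k (not_le.2 (h s h0 h1))⟩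
  have hg : ∀ s, 0 < s → s < ε → L p + s • L v + s ^ 2 • L w = S.g (p + s • v + s ^ 2 • w) := by
    intro s h0 h1
    rw [hL _ (hsame s h0 h1)]; simp
  refine ⟨L, L p, ε, hε, fun s h0 h1 => ?_, ?_⟩
  · rw [hg s h0 h1]
    obtain ⟨k1, k2, k3⟩ := hf s h0 h1
    refine ⟨S.linked k1, ?_⟩
    rcases S.vert_cases (p + s • v + s ^ 2 • w) with ⟨e0, e1⟩ | ⟨e0, e1⟩ <;>
      rw [e0, e1, S.active_comp, S.active_comp]
    · exact ⟨S.good _ k2, S.good _ k3⟩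
    · exact ⟨S.good _ k3, S.good _ k2⟩
  · rcases hs with h | h <;> rcases S.sign with h' | h'
    · exact Or.inl fun s h0 h1 => by rw [hg s h0 h1]; exact (h' _).1 (h s h0 h1)
    · exact Or.inr fun s h0 h1 => by rw [hg s h0 h1]; exact (h' _).1 (h s h0 h1)
    · exact Or.inr fun s h0 h1 => by rw [hg s h0 h1]; exact (h' _).2 (h s h0 h1)
    · exact Or.inl fun s h0 h1 => by rw [hg s h0 h1]; exact (h' _).2 (h s h0 h1)

theorem linearIndependent_map {v w : Params} (L : Params ≃ₗ[ℝ] Params)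
    (h : LinearIndependent ℝ ![v, w]) : LinearIndependent ℝ ![L v, L w] := by
  rw [LinearIndependent.pair_iff] at h ⊢
  intro α β e
  refine h α β (L.injective ?_)
  rw [map_add, map_smul, map_smul, e, map_zero]

/-- The arc is carried to the other curve, moved there, and the good family is carried back by the
same involution. Linear isomorphisms preserve independence of the directions, in both uses. -/
theorem isMovable (h : IsMovable (a ∘ S.e 3) (S.g t)) : IsMovable a t := by
  intro v w ε hε hf hs
  have hsame : ∀ s, 0 ≤ s → s < ε → (0 ≤ t.2 ↔ 0 ≤ (arc t v w s).2) := by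
    intro s h0 h1
    rcases hs with h | h | ⟨rfl, rfl⟩
    · have h2 := h 0 le_rfl hε
      rw [arc_zero] at h2
      exact ⟨fun _ => (h s h0 h1).le, fun _ => h2.le⟩
    · have h2 := h 0 le_rfl hε
      rw [arc_zero] at h2
      exact ⟨fun k => absurd k (not_le.2 h2), fun k => absurd k (not_le.2 (h s h0 h1))⟩
    · rw [arc_zero_zero]
  obtain ⟨L, hL⟩ := S.linear t
  have hg : ∀ s, 0 ≤ s → s < ε → arc (S.g t) (L v) (L w) s = S.g (arc t v w s) := by
    intro s h0 h1
    rw [hL _ (hsame s h0 h1), hL t Iff.rfl]; simp [arc]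
  obtain ⟨s, h0, h1, v', w', hgood, hli⟩ := h (L v) (L w) ε hε (fun s h0 h1 => by
    rw [hg s h0 h1]
    obtain ⟨k1, k2, k3, k4, k5⟩ := hf s h0 h1
    refine ⟨S.isTritangent k1, ?_, ?_, fun k => k4 ?_, fun k => k5 ?_⟩
    · rcases S.vert t with h | h
      · rw [(h _ (hsame s h0 h1)).1, (h t Iff.rfl).1, S.active_comp, S.active_comp, k2]
      · rw [(h _ (hsame s h0 h1)).1, (h t Iff.rfl).1, S.active_comp, S.active_comp, k3]
    · rcases S.vert t with h | h
      · rw [(h _ (hsame s h0 h1)).2, (h t Iff.rfl).2, S.active_comp, S.active_comp, k3]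
      · rw [(h _ (hsame s h0 h1)).2, (h t Iff.rfl).2, S.active_comp, S.active_comp, k2]
    · have := S.chamber _ _ _ (S.active_comp _) k
      rwa [S.comp_comp, S.g_g] at this
    · have := S.edge _ _ _ (S.active_comp _) k
      rwa [S.comp_comp, S.g_g] at this) (by
    rcases hs with h | h | ⟨h, h'⟩
    · rcases S.sign with h' | h'
      · exact Or.inl fun s h0 h1 => by rw [hg s h0 h1]; exact (h' _).1 (h s h0 h1)
      · exact Or.inr (Or.inl fun s h0 h1 => by rw [hg s h0 h1]; exact (h' _).1 (h s h0 h1))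
    · rcases S.sign with h' | h'
      · exact Or.inr (Or.inl fun s h0 h1 => by rw [hg s h0 h1]; exact (h' _).2 (h s h0 h1))
      · exact Or.inl fun s h0 h1 => by rw [hg s h0 h1]; exact (h' _).2 (h s h0 h1)
    · exact Or.inr (Or.inr ⟨by rw [h, map_zero], by rw [h', map_zero]⟩))
  rw [hg s h0 h1] at hgood
  obtain ⟨L', hgood'⟩ := S.goodFamily hgood
  rw [S.comp_comp, S.g_g] at hgood'
  refine ⟨s, h0, h1, _, _, hgood', ?_⟩
  rcases hli with h | ⟨h2, h3, h4⟩
  · exact Or.inl (linearIndependent_map L' h)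
  · refine Or.inr ⟨?_, by rw [h3, map_zero], fun h => h4 (linearIndependent_map L h)⟩
    exact fun h => h2 (L'.injective (by rw [h, map_zero]))

end Symmetry


/-! ### The two reflections of the Newton square -/

section Instances

theorem mem_image_of_involutive {α : Type*} {e : α → α} (h : ∀ u, e (e u) = u) {U : Set α} {u : α} :
    u ∈ e '' U ↔ e u ∈ U :=
  ⟨by rintro ⟨v, hv, rfl⟩; rwa [h], fun hu => ⟨e u, hu, h u⟩⟩

theorem image_eq_singleton_of_involutive {α : Type*} {e : α → α} (h : ∀ u, e (e u) = u) {U : Set α}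
    {u : α} : e '' U = {u} ↔ U = {e u} := by
  constructor
  · intro hU
    ext v
    rw [← h v, ← mem_image_of_involutive h, hU, h]
    simp only [mem_singleton_iff]
    exact ⟨fun e => by rw [← e, h], fun e => by rw [e, h]⟩
  · rintro rfl
    rw [image_singleton, h]

/-- The exchange of the coordinates. -/
def swapExp (n : ℕ) (u : Exps n) : Exps n := (u.2, u.1)

/-- The reflection of the first coordinate. -/
def reflExp (n : ℕ) (u : Exps n) : Exps n := (u.1.rev, u.2)

theorem swapExp_swapExp (n : ℕ) (u : Exps n) : swapExp n (swapExp n u) = u := rfl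

theorem reflExp_reflExp (n : ℕ) (u : Exps n) : reflExp n (reflExp n u) = u := by
  simp [reflExp]

/-- The action of the exchange of coordinates on parameters. -/
def swapParam (t : Params) : Params := ((t.1.2 - min t.2 0, t.1.1 + min t.2 0), t.2)

/-- The action of the reflection in the vertical axis on parameters. -/
def reflParam (t : Params) : Params := ((-t.1.1, t.1.2), -t.2)

theorem swapParam_of_nonneg {t : Params} (h : 0 ≤ t.2) : swapParam t = ((t.1.2, t.1.1), t.2) := by
  simp [swapParam, min_eq_right h]

theorem swapParam_of_neg {t : Params} (h : t.2 < 0) :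
    swapParam t = ((t.1.2 - t.2, t.1.1 + t.2), t.2) := by
  simp [swapParam, min_eq_left h.le]

/-- The exchange of coordinates on the members with nonnegative edge. -/
def swapLinear : Params ≃ₗ[ℝ] Params where
  toFun t := ((t.1.2, t.1.1), t.2)
  invFun t := ((t.1.2, t.1.1), t.2)
  map_add' _ _ := rfl
  map_smul' _ _ := rfl
  left_inv _ := rfl
  right_inv _ := rfl

/-- The exchange of coordinates on the members with negative edge. -/
def swapLinearNeg : Params ≃ₗ[ℝ] Params where
  toFun t := ((t.1.2 - t.2, t.1.1 + t.2), t.2)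
  invFun t := ((t.1.2 - t.2, t.1.1 + t.2), t.2)
  map_add' s t := by ext <;> simp <;> ring
  map_smul' c t := by ext <;> simp <;> ring
  left_inv t := by ext <;> simp
  right_inv t := by ext <;> simp

/-- The reflection in the vertical axis on parameters. -/
def reflLinear : Params ≃ₗ[ℝ] Params where
  toFun t := ((-t.1.1, t.1.2), -t.2)
  invFun t := ((-t.1.1, t.1.2), -t.2)
  map_add' s t := by ext <;> simp <;> ring
  map_smul' c t := by ext <;> simp
  left_inv t := by ext <;> simp
  right_inv t := by ext <;> simp

theorem exps_one_forall {P : Exps 1 → Prop} (h : P (0, 0) ∧ P (0, 1) ∧ P (1, 0) ∧ P (1, 1)) :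
    ∀ u, P u := by
  intro u
  rcases exps_one_cases u with rfl | rfl | rfl | rfl
  exacts [h.1, h.2.1, h.2.2.1, h.2.2.2]

theorem swapExp_side {U : Set (Exps 3)} (h : OnSide U) : OnSide (swapExp 3 '' U) := by
  simp only [OnSide, forall_mem_image, swapExp] at h ⊢
  tauto

theorem reflExp_side {U : Set (Exps 3)} (h : OnSide U) : OnSide (reflExp 3 '' U) := by
  simp only [OnSide, forall_mem_image, reflExp] at h ⊢
  have h1 : ∀ i : Fin 4, i.rev = 0 ↔ i = 3 := by decide
  have h2 : ∀ i : Fin 4, i.rev = 3 ↔ i = 0 := by decide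
  simp only [h1, h2]
  tauto

theorem swapExp_good {U : Set (Exps 3)} (h : IsGood U) : IsGood (swapExp 3 '' U) := by
  unfold IsGood at h ⊢
  simp only [exists_mem_image]
  simp only [ne_eq, image_eq_singleton_of_involutive (swapExp_swapExp 3), insert_subset_iff,
    singleton_subset_iff, mem_image_of_involutive (swapExp_swapExp 3),
    Set.image_nontrivial (show Function.Involutive (swapExp 3) from swapExp_swapExp 3).injective]
    at h ⊢
  obtain ⟨⟨h1, h2, h3, h4⟩, ⟨h5, h6, h7, h8⟩, h9⟩ := h
  exact ⟨⟨h1, h2, h4, h3⟩, ⟨fun k => h5 k.symm, fun k => h6 k.symm, h8, h7⟩,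
    fun k => ⟨(h9 k).2.2.1, (h9 k).2.2.2, (h9 k).1, (h9 k).2.1⟩⟩

theorem rev_eq_zero_iff : ∀ i : Fin 4, i.rev = 0 ↔ i = 3 := by decide

theorem rev_eq_three_iff : ∀ i : Fin 4, i.rev = 3 ↔ i = 0 := by decide

theorem reflExp_good {U : Set (Exps 3)} (h : IsGood U) : IsGood (reflExp 3 '' U) := by
  unfold IsGood at h ⊢
  simp only [exists_mem_image]
  simp only [ne_eq, image_eq_singleton_of_involutive (reflExp_reflExp 3), insert_subset_iff,
    singleton_subset_iff, mem_image_of_involutive (reflExp_reflExp 3),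
    Set.image_nontrivial (show Function.Involutive (reflExp 3) from reflExp_reflExp 3).injective]
    at h ⊢
  obtain ⟨⟨h1, h2, h3, h4⟩, ⟨h5, h6, h7, h8⟩, h9⟩ := h
  refine ⟨⟨h3, h4, h1, h2⟩, ⟨fun k => h7 k, fun k => h8 k.symm, fun k => h5 k, fun k => h6 k.symm⟩,
    fun k => ⟨?_, ?_, (h9 k).2.2.1, (h9 k).2.2.2⟩⟩
  · obtain ⟨u, hu, h⟩ := (h9 k).2.1
    exact ⟨u, hu, fun e => h ((rev_eq_zero_iff _).1 e)⟩
  · obtain ⟨u, hu, h⟩ := (h9 k).1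
    exact ⟨u, hu, fun e => h ((rev_eq_three_iff _).1 e)⟩

theorem vert_reflParam (t : Params) : vert0 (reflParam t) = reflMap (vert0 t) ∧
    vert1 (reflParam t) = reflMap (vert1 t) := by
  constructor
  · rfl
  · simp [vert1, reflParam]; ring

theorem vert_swapParam_of_nonneg {t : Params} (h : 0 ≤ t.2) :
    vert0 (swapParam t) = swapMap (vert0 t) ∧ vert1 (swapParam t) = swapMap (vert1 t) := by
  rw [swapParam_of_nonneg h]
  simp [vert0, vert1, abs_of_nonneg h]

/-- Reflection in the diagonal turns an edge of slope -1 upside down, so the lower and the upper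
vertex are exchanged. This is the reason for the case distinction in `swapParam`. -/
theorem vert_swapParam_of_neg {t : Params} (h : t.2 < 0) :
    vert0 (swapParam t) = swapMap (vert1 t) ∧ vert1 (swapParam t) = swapMap (vert0 t) := by
  rw [swapParam_of_neg h]
  simp [vert0, vert1, abs_of_neg h, ← sub_eq_add_neg]

theorem swap_chamber {a a' : Exps 3 → ℝ} {t : Params}
    (ha : ∀ p, active a' (swapMap p) = swapExp 3 '' active a p) (h : InCornerChamber a t) :
    InCornerChamber a' (swapParam t) := by
  rcases h with ⟨h, h'⟩ | ⟨h, h'⟩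
  · obtain ⟨e0, e1⟩ := vert_swapParam_of_nonneg h.le
    refine Or.inl ⟨h, ?_⟩
    rw [e0, e1, ha, ha]
    simp only [image_eq_singleton_of_involutive (swapExp_swapExp 3)]
    exact h'
  · obtain ⟨e0, e1⟩ := vert_swapParam_of_neg h
    refine Or.inr ⟨h, ?_⟩
    rw [e0, e1, ha, ha]
    simp only [image_eq_singleton_of_involutive (swapExp_swapExp 3)]
    exact h'.symm

theorem refl_chamber {a a' : Exps 3 → ℝ} {t : Params}
    (ha : ∀ p, active a' (reflMap p) = reflExp 3 '' active a p) (h : InCornerChamber a t) :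
    InCornerChamber a' (reflParam t) := by
  obtain ⟨e0, e1⟩ := vert_reflParam t
  rcases h with ⟨h, h'⟩ | ⟨h, h'⟩
  · refine Or.inr ⟨neg_neg_of_pos h, ?_⟩
    rw [e0, e1, ha, ha]
    simp only [image_eq_singleton_of_involutive (reflExp_reflExp 3)]
    exact h'
  · refine Or.inl ⟨neg_pos_of_neg h, ?_⟩
    rw [e0, e1, ha, ha]
    simp only [image_eq_singleton_of_involutive (reflExp_reflExp 3)]
    exact h'

theorem swap_edge {a a' : Exps 3 → ℝ} {t : Params}
    (ha : ∀ p, active a' (swapMap p) = swapExp 3 '' active a p) (h : OnCornerEdge a t) :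
    OnCornerEdge a' (swapParam t) := by
  unfold OnCornerEdge at h ⊢
  simp only [insert_subset_iff, singleton_subset_iff] at h ⊢
  have ht : (swapParam t).2 = t.2 := rfl
  rcases lt_trichotomy t.2 0 with hl | hl | hl
  · obtain ⟨e0, e1⟩ := vert_swapParam_of_neg hl
    rw [e0, e1, ha, ha, ht]
    simp only [mem_image_of_involutive (swapExp_swapExp 3)]
    rcases h with ⟨h, -⟩ | ⟨h, -⟩ | ⟨-, ⟨h1, h2⟩, h3, h4, h5⟩ | ⟨-, ⟨h1, h2⟩, h3, h4, h5⟩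
    · exact absurd h hl.not_gt
    · exact absurd h hl.not_gt
    · exact Or.inr (Or.inr (Or.inr ⟨hl, ⟨h1, h2⟩, h3, h4, h5⟩))
    · exact Or.inr (Or.inr (Or.inl ⟨hl, ⟨h1, h2⟩, h3, h4, h5⟩))
  · rw [hl] at h; simp at h
  · obtain ⟨e0, e1⟩ := vert_swapParam_of_nonneg hl.le
    rw [e0, e1, ha, ha, ht]
    simp only [mem_image_of_involutive (swapExp_swapExp 3)]
    rcases h with ⟨-, ⟨h1, h2⟩, h3, h4, h5⟩ | ⟨-, ⟨h1, h2⟩, h3, h4, h5⟩ | ⟨h, -⟩ | ⟨h, -⟩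
    · exact Or.inl ⟨hl, ⟨h2, h1⟩, h5, h4, h3⟩
    · exact Or.inr (Or.inl ⟨hl, ⟨h2, h1⟩, h5, h4, h3⟩)
    · exact absurd h hl.not_gt
    · exact absurd h hl.not_gt

theorem refl_edge {a a' : Exps 3 → ℝ} {t : Params}
    (ha : ∀ p, active a' (reflMap p) = reflExp 3 '' active a p) (h : OnCornerEdge a t) :
    OnCornerEdge a' (reflParam t) := by
  unfold OnCornerEdge at h ⊢
  simp only [insert_subset_iff, singleton_subset_iff] at h ⊢
  obtain ⟨e0, e1⟩ := vert_reflParam t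
  rw [e0, e1, ha, ha]
  simp only [mem_image_of_involutive (reflExp_reflExp 3)]
  have hn : (reflParam t).2 = -t.2 := rfl
  rw [hn, Left.neg_pos_iff, Left.neg_neg_iff]
  rcases h with ⟨h, ⟨h1, h2⟩, h3, h4, h5⟩ | ⟨h, ⟨h1, h2⟩, h3, h4, h5⟩ | ⟨h, ⟨h1, h2⟩, h3, h4, h5⟩ |
    ⟨h, ⟨h1, h2⟩, h3, h4, h5⟩
  · exact Or.inr (Or.inr (Or.inl ⟨h, ⟨h1, h2⟩, h5, h4, h3⟩))
  · exact Or.inr (Or.inr (Or.inr ⟨h, ⟨h2, h1⟩, h5, h4, h3⟩))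
  · exact Or.inl ⟨h, ⟨h1, h2⟩, h5, h4, h3⟩
  · exact Or.inr (Or.inl ⟨h, ⟨h2, h1⟩, h5, h4, h3⟩)

/-- The exchange of the coordinates as a symmetry. -/
def swapSymmetry : Symmetry where
  e := swapExp
  f := swapMap
  c _ := 0
  g := swapParam
  preserving := measurePreserving_swapMap
  embedding := measurableEmbedding_swapMap
  f_f _ := rfl
  inner_f p q := by simp; ring
  e_e _ _ := rfl
  toPlane_e n u := by simp [toPlane, swapExp]
  g_g t := by simp [swapParam]
  continuous_g := by unfold swapParam; fun_prop
  linear t := by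
    by_cases h : 0 ≤ t.2
    · exact ⟨swapLinear, fun t' h' => swapParam_of_nonneg (h'.1 h)⟩
    · exact ⟨swapLinearNeg, fun t' h' => swapParam_of_neg (not_le.1 fun k => h (h'.2 k))⟩
  vert t := by
    by_cases h : 0 ≤ t.2
    · exact Or.inl fun t' h' => vert_swapParam_of_nonneg (h'.1 h)
    · exact Or.inr fun t' h' => vert_swapParam_of_neg (not_le.1 fun k => h (h'.2 k))
  sign := Or.inl fun t => ⟨id, id⟩
  line t := ⟨0, exps_one_forall (by
    rcases le_or_gt 0 t.2 with h | h
    · rw [swapParam_of_nonneg h]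
      simp [lineCoeff, swapExp, min_eq_right h]; ring
    · rw [swapParam_of_neg h]
      simp [lineCoeff, swapExp, min_eq_left h.le, max_eq_right h.le]
      constructor <;> ring)⟩
  side _ := swapExp_side
  good _ := swapExp_good
  chamber _ _ _ := swap_chamber
  edge _ _ _ := swap_edge

/-- The reflection in the vertical axis as a symmetry. -/
def reflSymmetry : Symmetry where
  e := reflExp
  f := reflMap
  c n := (n, 0)
  g := reflParam
  preserving := measurePreserving_reflMap
  embedding := measurableEmbedding_reflMap
  f_f p := by simp
  inner_f p q := by simp
  e_e := reflExp_reflExp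
  toPlane_e n u := by
    have h : (u.1 : ℕ) + 1 ≤ n + 1 := u.1.2
    simp only [toPlane, reflExp, Fin.val_rev, Nat.cast_sub h, reflMap_apply, Prod.mk_add_mk, add_zero]
    push_cast
    rw [show ((n : ℝ) + 1 - (((u.1 : ℕ) : ℝ) + 1)) = -((u.1 : ℕ) : ℝ) + n by ring]
  g_g t := by simp [reflParam]
  continuous_g := by unfold reflParam; fun_prop
  linear _ := ⟨reflLinear, fun _ _ => rfl⟩
  vert _ := Or.inl fun t' _ => vert_reflParam t'
  sign := Or.inr fun t => ⟨neg_neg_of_pos, neg_pos_of_neg⟩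
  -- The coefficient of (0,0) is normalised to zero. After the reflection this position receives the
  -- coefficient -t.1.1, which the shift compensates.
  line t := ⟨t.1.1, exps_one_forall (by
    have h1 : min (-t.2) 0 = -max t.2 0 := by rw [← neg_zero, min_neg_neg, neg_zero]
    have h2 : max (-t.2) 0 = -min t.2 0 := by rw [← neg_zero, max_neg_neg, neg_zero]
    have r0 : Fin.rev (0 : Fin 2) = 1 := rfl
    have r1 : Fin.rev (1 : Fin 2) = 0 := rfl
    simp [lineCoeff, reflExp, reflParam, h1, h2, r0, r1]
    constructor <;> ring)⟩
  side _ := reflExp_side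
  good _ := reflExp_good
  chamber _ _ _ := refl_chamber
  edge _ _ _ := refl_edge

end Instances


/-! ### Reduction to a special left leg -/

section

/-- A property that is stable under the symmetries holds at all special tritangents if it holds
at those that are special on the left leg, with nonnegative bounded edge. -/
theorem IsSpecial.induction {Q : (Exps 3 → ℝ) → Prop} {R : (Exps 3 → ℝ) → Params → Prop}
    (hQ : ∀ (S : Symmetry) (a : Exps 3 → ℝ), Q a → Q (a ∘ S.e 3))
    (hR : ∀ (S : Symmetry) (a : Exps 3 → ℝ) (t : Params), R (a ∘ S.e 3) (S.g t) → R a t)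
    (base : ∀ (a : Exps 3 → ℝ) (t : Params), Q a → 0 ≤ t.2 → SpecialOn a t (lft (vert0 t)) → R a t)
    {a : Exps 3 → ℝ} {t : Params} (ha : Q a) (h : IsSpecial a t) : R a t := by
  -- Each remaining leg, with its sign of l, is carried by one reflection to a case already settled.
  -- Several cases include l = 0 on both sides, because negation exchanges the two sides.
  have right0 : ∀ (a : Exps 3 → ℝ) (t : Params), Q a → t.2 ≤ 0 → SpecialOn a t (rgt (vert0 t)) →
      R a t := by
    intro a t ha hl h
    refine hR reflSymmetry a t (base _ _ (hQ _ _ ha) (neg_nonneg.2 hl) (reflSymmetry.specialOn h ?_))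
    rintro p ⟨h1, h2⟩
    exact ⟨h1, neg_lt_neg h2⟩
  have down : ∀ (a : Exps 3 → ℝ) (t : Params), Q a → 0 ≤ t.2 → SpecialOn a t (dwn (vert0 t)) →
      R a t := by
    intro a t ha hl h
    refine hR swapSymmetry a t (base _ _ (hQ _ _ ha) hl (swapSymmetry.specialOn h ?_))
    rintro p ⟨h1, h2⟩
    show _ ∈ lft (vert0 (swapParam t))
    rw [(vert_swapParam_of_nonneg hl).1]
    exact ⟨h1, h2⟩
  have down' : ∀ (a : Exps 3 → ℝ) (t : Params), Q a → t.2 ≤ 0 → SpecialOn a t (dwn (vert0 t)) →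
      R a t := by
    intro a t ha hl h
    refine hR reflSymmetry a t (down _ _ (hQ _ _ ha) (neg_nonneg.2 hl) (reflSymmetry.specialOn h ?_))
    rintro p ⟨h1, h2⟩
    exact ⟨congrArg Neg.neg h1, h2⟩
  have left1 : ∀ (a : Exps 3 → ℝ) (t : Params), Q a → t.2 < 0 → SpecialOn a t (lft (vert1 t)) →
      R a t := by
    intro a t ha hl h
    refine hR swapSymmetry a t (down' _ _ (hQ _ _ ha) hl.le (swapSymmetry.specialOn h ?_))
    rintro p ⟨h1, h2⟩
    show _ ∈ dwn (vert0 (swapParam t))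
    rw [(vert_swapParam_of_neg hl).1]
    exact ⟨h1, h2⟩
  have right1 : ∀ (a : Exps 3 → ℝ) (t : Params), Q a → 0 ≤ t.2 → SpecialOn a t (rgt (vert1 t)) →
      R a t := by
    intro a t ha hl h
    rcases hl.eq_or_lt with h0 | h0
    · refine right0 a t ha h0.ge ?_
      have : vert1 t = vert0 t := by simp [vert1, vert0, ← h0]
      rwa [this] at h
    · refine hR reflSymmetry a t (left1 _ _ (hQ _ _ ha) (neg_neg_of_pos h0)
        (reflSymmetry.specialOn h ?_))
      rintro p ⟨h1, h2⟩
      show _ ∈ lft (vert1 (reflParam t))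
      rw [(vert_reflParam t).2]
      exact ⟨h1, neg_lt_neg h2⟩
  have up : ∀ (a : Exps 3 → ℝ) (t : Params), Q a → 0 ≤ t.2 → SpecialOn a t (upw (vert1 t)) →
      R a t := by
    intro a t ha hl h
    refine hR swapSymmetry a t (right1 _ _ (hQ _ _ ha) hl (swapSymmetry.specialOn h ?_))
    rintro p ⟨h1, h2⟩
    show _ ∈ rgt (vert1 (swapParam t))
    rw [(vert_swapParam_of_nonneg hl).2]
    exact ⟨h1, h2⟩
  have up' : ∀ (a : Exps 3 → ℝ) (t : Params), Q a → t.2 < 0 → SpecialOn a t (upw (vert1 t)) →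
      R a t := by
    intro a t ha hl h
    refine hR reflSymmetry a t (up _ _ (hQ _ _ ha) (neg_pos_of_neg hl).le
      (reflSymmetry.specialOn h ?_))
    rintro p ⟨h1, h2⟩
    show _ ∈ upw (vert1 (reflParam t))
    rw [(vert_reflParam t).2]
    exact ⟨congrArg Neg.neg h1, h2⟩
  obtain ⟨ht, L, hL, hsp⟩ := h
  have hs : SpecialOn a t L := ⟨ht, hsp⟩
  clear ht hsp
  unfold legInteriors at hL
  rcases le_or_gt 0 t.2 with hl | hl
  · rw [leftVert, rightVert, if_pos hl, if_pos hl] at hL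
    rcases hL with rfl | rfl | rfl | rfl
    exacts [base a t ha hl hs, right1 a t ha hl hs, down a t ha hl hs, up a t ha hl hs]
  · rw [leftVert, rightVert, if_neg hl.not_ge, if_neg hl.not_ge] at hL
    rcases hL with rfl | rfl | rfl | rfl
    exacts [left1 a t ha hl hs, right0 a t ha hl.le hs, down' a t ha hl.le hs, up' a t ha hl hs]

variable {a : Exps 3 → ℝ} {t : Params}

theorem IsSpecial.onEnd (hs : IsSmooth a) (h : IsSpecial a t) : OnEnd a t := by
  refine IsSpecial.induction (Q := IsSmooth) (R := OnEnd) (fun S a => S.isSmooth)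
    (fun S a t h => ?_) (fun a t ha hl h => ?_) hs h
  · have := S.onEnd h
    rwa [S.comp_comp, S.g_g] at this
  · obtain ⟨⟨x, y⟩, l⟩ := t
    exact h.onEnd_left ha hl

theorem IsSpecial.isMovable (hs : IsSmooth a) (hg : AvoidsLengthForms lengthForms a)
    (h : IsSpecial a t) : IsMovable a t := by
  refine IsSpecial.induction (Q := fun a => IsSmooth a ∧ AvoidsLengthForms lengthForms a)
    (R := IsMovable) (fun S a h => ⟨S.isSmooth h.1, S.avoidsLengthForms h.2⟩)
    (fun S a t h => S.isMovable h) (fun a t ha hl h => ?_) ⟨hs, hg⟩ h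
  obtain ⟨⟨x, y⟩, l⟩ := t
  rcases h.exists_endConfig ha.1 ha.2 hl with ⟨xA, xP, j₀, j₁, c, hx⟩ | htop
  · exact c.isMovable hx hl
  rcases (show 0 ≤ l from hl).eq_or_lt with rfl | hl'
  swap
  · exact isMovable_of_inCornerChamber (inCornerChamber_of_top_end hl' htop)
  have mem_tr : ∀ (S : Symmetry) (a : Exps 3 → ℝ), IsSmooth a ∧ AvoidsLengthForms lengthForms a →
      IsSmooth (a ∘ S.e 3) ∧ AvoidsLengthForms lengthForms (a ∘ S.e 3) :=
    fun S a h => ⟨S.isSmooth h.1, S.avoidsLengthForms h.2⟩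
  -- For l = 0 the top end is treated by the reflection y ↦ -y, a product of three generators. It
  -- carries the end dual to (3,2), (3,3) to the one dual to (3,0), (3,1) and preserves left legs.
  refine swapSymmetry.isMovable (reflSymmetry.isMovable (swapSymmetry.isMovable ?_))
  have h1 := swapSymmetry.specialOn (reflSymmetry.specialOn (swapSymmetry.specialOn h
    (L' := dwn (y, x)) ?_) (L' := dwn (-y, x)) ?_) (L' := lft (x, -y)) ?_
  · have e : swapSymmetry.g (reflSymmetry.g (swapSymmetry.g ((x, y), 0))) = ((x, -y), 0) := by
      simp [swapSymmetry, reflSymmetry, swapParam, reflParam]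
    have ha3 := mem_tr swapSymmetry _ (mem_tr reflSymmetry _ (mem_tr swapSymmetry _ ha))
    have hact : active (((a ∘ swapSymmetry.e 3) ∘ reflSymmetry.e 3) ∘ swapSymmetry.e 3) (x, -y) =
        {(3, 1), (3, 0)} := by
      have k1 := swapSymmetry.active_comp a (x, y)
      have k2 := reflSymmetry.active_comp (a ∘ swapSymmetry.e 3) (y, x)
      have k3 := swapSymmetry.active_comp ((a ∘ swapSymmetry.e 3) ∘ reflSymmetry.e 3) (-y, x)
      refine k3.trans ?_
      rw [show ((-y, x) : ℝ × ℝ) = reflSymmetry.f (y, x) from rfl, k2,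
        show ((y, x) : ℝ × ℝ) = swapSymmetry.f (x, y) from rfl, k1, htop]
      simp only [image_pair]
      rfl
    rw [e] at h1 ⊢
    rcases h1.exists_endConfig ha3.1 ha3.2 le_rfl with ⟨xA, xP, j₀, j₁, c, hx⟩ | htop'
    · exact c.isMovable hx le_rfl
    · exfalso
      rw [hact] at htop'
      have : ((3, 1) : Exps 3) ∈ ({(3, 2), (3, 3)} : Set (Exps 3)) := by rw [← htop']; simp
      revert this
      simp
  · rintro p ⟨h1, h2⟩; exact ⟨h1, h2⟩
  · rintro p ⟨h1, h2⟩; exact ⟨congrArg Neg.neg h1, h2⟩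
  · rintro p ⟨h1, h2⟩; exact ⟨h1, h2⟩

end


/-! ## Polyhedral complexes of tritangents -/

section Polyhedra

/-- The points of a polyhedron lie in the relative interiors of its faces. -/
theorem IsPolyhedron.exists_face {P : Set Params} (hP : IsPolyhedron P) {x : Params} (hx : x ∈ P) :
    ∃ F : Set Params, IsExposed ℝ P F ∧ x ∈ F ∧ F ⊆ P ∧ (F = P → x ∈ intrinsicInterior ℝ P) := by
  classical
  obtain ⟨s, rfl⟩ := hP
  have hx' : ∀ h ∈ s, h.1 x ≤ h.2 := hx
  refine ⟨{y | y ∈ {x : Params | ∀ h ∈ s, h.1 x ≤ h.2} ∧ ∀ h ∈ s, h.1 x = h.2 → h.1 y = h.2}, ?_,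
    ⟨hx, fun h _ e => e⟩, fun y hy => hy.1, fun hF => ?_⟩
  · intro _
    -- On the polyhedron the sum of the constraints tight at `x` is maximal exactly where all of
    -- them are tight, so this single functional exposes the face.
    refine ⟨∑ h ∈ s.filter (fun h => h.1 x = h.2), h.1, ?_⟩
    ext y
    simp only [mem_ofPred_eq, FunLike.coe_sum, Finset.sum_apply]
    refine and_congr_right fun hy => ⟨fun h z hz => Finset.sum_le_sum fun k hk => ?_, fun h => ?_⟩
    · rw [Finset.mem_filter] at hk
      rw [h k hk.1 hk.2]; exact hz k hk.1
    · have h1 := h x hx'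
      have h2 : ∀ k ∈ s.filter (fun h => h.1 x = h.2), k.1 y ≤ k.1 x := by
        intro k hk
        rw [Finset.mem_filter] at hk
        rw [hk.2]; exact hy k hk.1
      have h3 := (Finset.sum_eq_sum_iff_of_le h2).1 (le_antisymm (Finset.sum_le_sum h2) h1)
      intro k hk e
      rw [h3 k (Finset.mem_filter.2 ⟨hk, e⟩), e]
  -- If the face is everything, the tight constraints are equations on the affine hull and the
  -- others hold strictly near `x`; so a neighbourhood of `x` in the affine hull lies in the
  -- polyhedron.
  · have heq : ∀ h ∈ s, h.1 x = h.2 → ∀ y ∈ affineSpan ℝ {x : Params | ∀ h ∈ s, h.1 x ≤ h.2},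
        h.1 y = h.2 := by
      intro h hs e y hy
      have hle : affineSpan ℝ {x : Params | ∀ h ∈ s, h.1 x ≤ h.2} ≤
          AffineSubspace.comap h.1.toLinearMap.toAffineMap (affineSpan ℝ {h.2}) := by
        rw [affineSpan_le]
        intro z hz
        rw [← hF] at hz
        show h.1 z ∈ affineSpan ℝ {h.2}
        rw [AffineSubspace.mem_affineSpan_singleton]
        exact hz.2 h hs e
      have := hle hy
      exact (AffineSubspace.mem_affineSpan_singleton ℝ ℝ).1 this
    refine ⟨⟨x, subset_affineSpan ℝ _ hx⟩, ?_, rfl⟩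
    rw [mem_interior_iff_mem_nhds]
    have hopen : ∀ h ∈ s, h.1 x ≠ h.2 → ∀ᶠ y : affineSpan ℝ {x : Params | ∀ h ∈ s, h.1 x ≤ h.2} in
        nhds ⟨x, subset_affineSpan ℝ _ hx⟩, h.1 y < h.2 := by
      intro h hs e
      have hc : Continuous fun y : affineSpan ℝ {x : Params | ∀ h ∈ s, h.1 x ≤ h.2} => h.1 y :=
        h.1.continuous.comp continuous_subtype_val
      exact hc.continuousAt.eventually_lt continuousAt_const (lt_of_le_of_ne (hx' h hs) e)
    have hall : ∀ᶠ y : affineSpan ℝ {x : Params | ∀ h ∈ s, h.1 x ≤ h.2} in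
        nhds ⟨x, subset_affineSpan ℝ _ hx⟩, ∀ h ∈ s, h.1 x ≠ h.2 → h.1 y < h.2 := by
      rw [Filter.eventually_all_finset]
      intro h hs
      by_cases e : h.1 x = h.2
      · exact Filter.Eventually.of_forall fun y hn => absurd e hn
      · filter_upwards [hopen h hs e] with y hy _ using hy
    filter_upwards [hall] with y hy
    intro h hs
    by_cases e : h.1 x = h.2
    · exact (heq h hs e y y.2).le
    · exact (hy h hs e).le

/-- A minimal cell containing `x` has `x` in its relative interior, since otherwise a smaller face,
again a cell, would contain it. -/
theorem PolyComplex.exists_mem_intrinsicInterior (K : PolyComplex) {x : Params}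
    (hx : x ∈ K.support) : ∃ P ∈ K.cells, x ∈ intrinsicInterior ℝ P := by
  obtain ⟨P, ⟨hP, hxP⟩, hmin⟩ := (K.finite.subset (sep_subset K.cells fun P => x ∈ P)).exists_minimal
    (by obtain ⟨P, hP, hxP⟩ := hx; exact ⟨P, hP, hxP⟩)
  obtain ⟨F, hF, hxF, hFP, h⟩ := (K.polyhedron P hP).exists_face hxP
  exact ⟨P, hP, h (hFP.antisymm (hmin ⟨K.face_mem P hP F ⟨x, hxF⟩ hF, hxF⟩ hFP))⟩

/-- A parabola with directions in the direction of `P` starts in the relative interior. -/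
theorem exists_arc_subset {P : Set Params} {t v w : Params} (ht : t ∈ intrinsicInterior ℝ P)
    (hv : v ∈ vectorSpan ℝ P) (hw : w ∈ vectorSpan ℝ P) :
    ∃ ε > 0, ∀ s, 0 ≤ s → s < ε → arc t v w s ∈ intrinsicInterior ℝ P := by
  obtain ⟨⟨t, htm⟩, ht, rfl⟩ := ht
  have hmem : ∀ s : ℝ, arc t v w s ∈ affineSpan ℝ P := by
    intro s
    have h1 : s • v + s ^ 2 • w ∈ (affineSpan ℝ P).direction := by
      rw [direction_affineSpan]
      exact Submodule.add_mem _ (Submodule.smul_mem _ _ hv) (Submodule.smul_mem _ _ hw)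
    have h2 := AffineSubspace.vadd_mem_of_mem_direction h1 htm
    have e : arc t v w s = (s • v + s ^ 2 • w) +ᵥ t := by
      simp only [arc, vadd_eq_add]; abel
    rw [e]; exact h2
  let γ : ℝ → affineSpan ℝ P := fun s => ⟨arc t v w s, hmem s⟩
  have hγ : Continuous γ := by
    refine Continuous.subtype_mk ?_ _
    unfold arc
    fun_prop
  have h0 : γ 0 = ⟨t, htm⟩ := Subtype.ext (arc_zero t v w)
  have hn : γ ⁻¹' interior ((↑) ⁻¹' P : Set (affineSpan ℝ P)) ∈ nhds (0 : ℝ) := by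
    refine hγ.continuousAt.preimage_mem_nhds (isOpen_interior.mem_nhds ?_)
    rw [h0]; exact ht
  obtain ⟨ε, hε, hb⟩ := Metric.mem_nhds_iff.1 hn
  refine ⟨ε, hε, fun s hs0 hs1 => ⟨γ s, hb ?_, rfl⟩⟩
  rw [Metric.mem_ball, Real.dist_eq, sub_zero, abs_of_nonneg hs0]
  exact hs1

theorem two_le_finrank {V : Submodule ℝ Params} {v w : Params} (hv : v ∈ V) (hw : w ∈ V)
    (h : LinearIndependent ℝ ![v, w]) : 2 ≤ Module.finrank ℝ V := by
  have h1 := finrank_span_eq_card h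
  have h2 : Submodule.span ℝ (Set.range ![v, w]) ≤ V := by
    rw [Submodule.span_le]
    rintro _ ⟨i, rfl⟩
    fin_cases i
    exacts [hv, hw]
  have := Submodule.finrank_mono h2
  rw [h1] at this
  simpa using this

theorem exists_linearIndependent {V : Submodule ℝ Params} (h : 2 ≤ Module.finrank ℝ V) :
    ∃ v ∈ V, ∃ w ∈ V, LinearIndependent ℝ ![v, w] := by
  obtain ⟨f, hf⟩ := exists_linearIndependent_of_le_finrank h
  refine ⟨f 0, (f 0).2, f 1, (f 1).2, ?_⟩
  rw [LinearIndependent.pair_iff]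
  intro α β e
  have hf' : LinearIndependent ℝ ![f 0, f 1] := by
    convert hf using 1
    funext i; fin_cases i <;> rfl
  exact LinearIndependent.pair_iff.1 hf' α β (Subtype.ext e)

theorem one_le_finrank_vectorSpan {Q : Set Params} {t v w : Params} {s s' : ℝ} (hs : s ≠ s')
    (h : arc t v w s ∈ Q) (h' : arc t v w s' ∈ Q) (hv : v ≠ 0) (hw : w = 0) :
    1 ≤ Module.finrank ℝ (vectorSpan ℝ Q) := by
  have h1 := vsub_mem_vectorSpan ℝ h h'
  have e : arc t v w s -ᵥ arc t v w s' = (s - s') • v := by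
    simp only [arc, hw, smul_zero, add_zero, vsub_eq_sub, sub_smul]; abel
  rw [e] at h1
  have h2 : v ∈ vectorSpan ℝ Q := (Submodule.smul_mem_iff _ (sub_ne_zero.2 hs)).1 h1
  rw [Nat.one_le_iff_ne_zero, Ne, Submodule.finrank_eq_zero]
  intro h0
  rw [h0, Submodule.mem_bot] at h2
  exact hv h2

/-- A chord of the parabola has direction v + (s + s') w. Two chords from one point have different
sums s + s', so together they span both `v` and `w`. -/
theorem two_le_finrank_vectorSpan {Q : Set Params} {t v w : Params} {s₁ s₂ s₃ : ℝ} (h12 : s₁ ≠ s₂)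
    (h13 : s₁ ≠ s₃) (h23 : s₂ ≠ s₃) (h1 : arc t v w s₁ ∈ Q) (h2 : arc t v w s₂ ∈ Q)
    (h3 : arc t v w s₃ ∈ Q) (h : LinearIndependent ℝ ![v, w]) :
    2 ≤ Module.finrank ℝ (vectorSpan ℝ Q) := by
  have key : ∀ s s', s ≠ s' → arc t v w s ∈ Q → arc t v w s' ∈ Q →
      v + (s + s') • w ∈ vectorSpan ℝ Q := by
    intro s s' hs h h'
    have h1 := vsub_mem_vectorSpan ℝ h h'
    have e : arc t v w s -ᵥ arc t v w s' = (s - s') • (v + (s + s') • w) := by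
      simp only [arc, vsub_eq_sub]; module
    rw [e] at h1
    exact (Submodule.smul_mem_iff _ (sub_ne_zero.2 hs)).1 h1
  have k2 := key s₁ s₂ h12 h1 h2
  have k3 := key s₁ s₃ h13 h1 h3
  have hw : w ∈ vectorSpan ℝ Q := by
    have := Submodule.sub_mem _ k2 k3
    have e : v + (s₁ + s₂) • w - (v + (s₁ + s₃) • w) = (s₂ - s₃) • w := by module
    rw [e] at this
    exact (Submodule.smul_mem_iff _ (sub_ne_zero.2 h23)).1 this
  have hv : v ∈ vectorSpan ℝ Q := by
    have := Submodule.sub_mem _ k2 (Submodule.smul_mem _ (s₁ + s₂) hw)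
    rwa [add_sub_cancel_right] at this
  exact two_le_finrank hv hw h

end Polyhedra

/-! ### Dimensions of the cells of a tritangent class -/

section Cells

variable {a : Exps 3 → ℝ} {Ω : Set Params} {K : PolyComplex}

theorem IsTritangentClass.mem_of_linked (hΩ : IsTritangentClass a Ω) {t t' : Params} (ht : t ∈ Ω)
    (h : Linked a t t') : t' ∈ Ω := by
  obtain ⟨t₀, -, rfl⟩ := hΩ
  obtain ⟨W, hW, hc, h1, h2⟩ := h
  rw [connectedComponentIn_eq ht]
  exact hc.subset_connectedComponentIn h1 hW h2

theorem IsTritangentClass.isTritangent (hΩ : IsTritangentClass a Ω) {t : Params} (ht : t ∈ Ω) :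
    IsTritangent a t := by
  obtain ⟨t₀, -, rfl⟩ := hΩ
  have h : t ∈ tritangentSet a := connectedComponentIn_subset _ _ ht
  exact h

theorem mem_of_mem_cell (hK : IsCompatibleStructure a Ω K) {P : Set Params} (hP : P ∈ K.cells)
    {t : Params} (ht : t ∈ intrinsicInterior ℝ P) : t ∈ Ω := by
  rw [← hK.1]
  exact ⟨P, hP, intrinsicInterior_subset ht⟩

theorem OnEnd.not_isGood {t : Params} (h : OnEnd a t) (h0 : IsGood (active a (vert0 t)))
    (h1 : IsGood (active a (vert1 t))) : False := by
  obtain ⟨p, hp, hn, hside⟩ := h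
  have hg : IsGood (active a p) := by
    rcases hp with rfl | rfl
    exacts [h0, h1]
  obtain ⟨⟨u1, m1, e1⟩, ⟨u2, m2, e2⟩, ⟨u3, m3, e3⟩, u4, m4, e4⟩ := hg.2.2 hn
  rcases hside with h | h | h | h
  exacts [e1 (h _ m1), e2 (h _ m2), e3 (h _ m3), e4 (h _ m4)]

/-- A cell with a good member belongs to the non-special bounded complex. -/
theorem mem_nonSpecialBoundedCells (hs : IsSmooth a) (hK : IsCompatibleStructure a Ω K)
    {Q : Set Params} (hQ : Q ∈ K.cells) {q : Params} (hq : q ∈ intrinsicInterior ℝ Q)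
    (h0 : IsGood (active a (vert0 q))) (h1 : IsGood (active a (vert1 q))) :
    Q ∈ nonSpecialBoundedCells a K := by
  have key : ∀ t ∈ intrinsicInterior ℝ Q, IsGood (active a (vert0 t)) ∧
      IsGood (active a (vert1 t)) := by
    intro t ht
    obtain ⟨e0, e1⟩ := hK.2 Q hQ t ht q hq
    rw [e0, e1]; exact ⟨h0, h1⟩
  refine ⟨⟨hQ, ?_⟩, ?_⟩
  · rintro ⟨t, ht, h | h⟩
    · obtain ⟨g0, g1⟩ := key t ht
      rcases h with ⟨-, h | h⟩ | ⟨-, h | h⟩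
      exacts [g0.1.1 h, g1.1.2.1 h, g0.1.2.2.1 h, g1.1.2.2.2 h]
    · obtain ⟨g0, g1⟩ := key t ht
      rcases h with ⟨-, h, -⟩ | ⟨-, h, -⟩ | ⟨-, h, -⟩ | ⟨-, h, -⟩
      exacts [g0.2.1.1 h, g1.2.1.2.1 h, g0.2.1.2.2.1 h, g1.2.1.2.2.2 h]
  · rintro ⟨t, ht, h⟩
    obtain ⟨g0, g1⟩ := key t ht
    exact (h.onEnd hs).not_isGood g0 g1

/-- The arc has infinitely many points and the complex finitely many cells. So one relative interior
contains three points of the arc, enough for the dimension bound, and goodness at one of them makes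
the cell bounded and non-special. -/
theorem GoodFamily.exists_cell (hs : IsSmooth a) (hΩ : IsTritangentClass a Ω)
    (hK : IsCompatibleStructure a Ω K) {t v w : Params} (ht : t ∈ Ω) (h : GoodFamily a t v w) :
    ∃ Q ∈ nonSpecialBoundedCells a K, (v ≠ 0 → w = 0 → 1 ≤ Module.finrank ℝ (vectorSpan ℝ Q)) ∧
      (LinearIndependent ℝ ![v, w] → 2 ≤ Module.finrank ℝ (vectorSpan ℝ Q)) := by
  obtain ⟨p, ε, hε, hf, -⟩ := h
  obtain ⟨Q, hQ, hinf⟩ : ∃ Q ∈ K.cells,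
      {s | s ∈ Ioo 0 ε ∧ arc p v w s ∈ intrinsicInterior ℝ Q}.Infinite := by
    by_contra hn
    push Not at hn
    refine Set.Ioo_infinite hε ((K.finite.biUnion hn).subset fun s hs' => ?_)
    have hm := hΩ.mem_of_linked ht (hf s hs'.1 hs'.2).1
    rw [← hK.1] at hm
    obtain ⟨Q, hQ, hq⟩ := K.exists_mem_intrinsicInterior hm
    exact mem_biUnion hQ ⟨hs', hq⟩
  obtain ⟨F, hF, hcard⟩ := hinf.exists_subset_card_eq 3
  obtain ⟨s₁, s₂, s₃, h12, h13, h23, rfl⟩ := Finset.card_eq_three.1 hcard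
  have m1 := hF (show s₁ ∈ _ by simp)
  have m2 := hF (show s₂ ∈ _ by simp)
  have m3 := hF (show s₃ ∈ _ by simp)
  refine ⟨Q, mem_nonSpecialBoundedCells hs hK hQ m1.2 (hf _ m1.1.1 m1.1.2).2.1
    (hf _ m1.1.1 m1.1.2).2.2, fun hv hw => ?_, fun hvw => ?_⟩
  · exact one_le_finrank_vectorSpan h12 (intrinsicInterior_subset m1.2)
      (intrinsicInterior_subset m2.2) hv hw
  · exact two_le_finrank_vectorSpan h12 h13 h23 (intrinsicInterior_subset m1.2)
      (intrinsicInterior_subset m2.2) (intrinsicInterior_subset m3.2) hvw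

/-- Full-dimensional cells contain no special tritangents. -/
theorem not_isSpecial_of_finrank (hs : IsSmooth a) (hK : IsCompatibleStructure a Ω K)
    {P : Set Params} (hP : P ∈ K.cells) (hd : 3 ≤ Module.finrank ℝ (vectorSpan ℝ P)) {t : Params}
    (ht : t ∈ intrinsicInterior ℝ P) : ¬ IsSpecial a t := by
  intro hsp
  have h3 : Module.finrank ℝ Params = 3 := by simp
  have htop : vectorSpan ℝ P = ⊤ := Submodule.eq_top_of_finrank_eq
    (le_antisymm (Submodule.finrank_le _) (h3.trans_le hd))
  obtain ⟨p, hp, ⟨u, hu, u', hu', hne⟩, -⟩ := hsp.onEnd hs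
  -- In a full-dimensional cell the vertex on the end could be moved slightly in every direction
  -- with the same active exponents. Two exponents tied at all these points would have equal slopes
  -- in every direction and coincide.
  have key : ∀ d : ℝ × ℝ, ∃ s : ℝ, 0 < s ∧ active a (p + s • d) = active a p := by
    intro d
    obtain ⟨ε, hε, h⟩ := exists_arc_subset (v := ((d, 0) : Params)) (w := 0) ht (by rw [htop]; trivial)
      (by rw [htop]; trivial)
    obtain ⟨e0, e1⟩ := hK.2 P hP _ (h (ε / 2) (by linarith) (by linarith)) t ht
    refine ⟨ε / 2, by linarith, ?_⟩
    rcases hp with rfl | rfl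
    · rw [← e0]; congr 1; simp [arc, vert0]
    · rw [← e1]; congr 1
      ext <;> simp [arc, vert1] <;> ring
  have hslope : ∀ d : ℝ × ℝ, slope u d = slope u' d := by
    intro d
    obtain ⟨s, h0, e⟩ := key d
    have k1 := term_eq_of_mem hu hu'
    rw [← e] at hu hu'
    have k2 := term_eq_of_mem hu hu'
    rw [term_add_smul, term_add_smul, k1] at k2
    exact mul_left_cancel₀ h0.ne' (add_left_cancel k2)
  have e1 := hslope (1, 0)
  have e2 := hslope (0, 1)
  rw [slope_mk, slope_mk] at e1 e2
  simp only [mul_one, mul_zero, add_zero, zero_add, Nat.cast_inj] at e1 e2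
  exact hne (Prod.ext (Fin.ext e1) (Fin.ext e2))

theorem coordinate_eq_of_onSide {p q : ℝ × ℝ} (hn : (active a p).Nontrivial)
    (hside : OnSide (active a p)) :
    (active a q = active a p → q.1 = p.1) ∨ (active a q = active a p → q.2 = p.2) := by
  obtain ⟨u, hu, u', hu', hne⟩ := hn
  have k1 := term_eq_of_mem hu hu'
  have fst : u.1 = u'.1 → active a q = active a p → q.2 = p.2 := by
    intro h e
    rw [← e] at hu hu'
    have k2 := term_eq_of_mem hu hu'
    simp only [term, h] at k1 k2
    have h2 : ((u.2 : ℕ) : ℝ) ≠ ((u'.2 : ℕ) : ℝ) := fun h2 =>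
      hne (Prod.ext h (Fin.ext (by exact_mod_cast h2)))
    exact mul_left_cancel₀ (sub_ne_zero.2 h2) (by linear_combination k2 - k1)
  have snd : u.2 = u'.2 → active a q = active a p → q.1 = p.1 := by
    intro h e
    rw [← e] at hu hu'
    have k2 := term_eq_of_mem hu hu'
    simp only [term, h] at k1 k2
    have h2 : ((u.1 : ℕ) : ℝ) ≠ ((u'.1 : ℕ) : ℝ) := fun h2 =>
      hne (Prod.ext (Fin.ext (by exact_mod_cast h2)) h)
    exact mul_left_cancel₀ (sub_ne_zero.2 h2) (by linear_combination k2 - k1)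
  rcases hside with h | h | h | h
  · exact Or.inr (fst ((h _ hu).trans (h _ hu').symm))
  · exact Or.inr (fst ((h _ hu).trans (h _ hu').symm))
  · exact Or.inl (snd ((h _ hu).trans (h _ hu').symm))
  · exact Or.inl (snd ((h _ hu).trans (h _ hu').symm))

theorem not_linearIndependent_of_eq {u v w : Params} {α β : ℝ} (hv : v = α • u) (hw : w = β • u) :
    ¬ LinearIndependent ℝ ![v, w] := by
  intro h
  rw [LinearIndependent.pair_iff] at h
  have h1 := h β (-α) (by rw [hv, hw]; module)
  have h2 : α = 0 := neg_eq_zero.1 h1.2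
  have h3 := h 1 0 (by rw [hv, h2]; simp)
  exact one_ne_zero h3.1

/-- Along a cell of dimension two with a special member the bounded edge does not degenerate. -/
theorem edge_ne_zero (hs : IsSmooth a) {t v w : Params} {ε : ℝ} (hε : 0 < ε) (hsp : IsSpecial a t)
    (hvw : LinearIndependent ℝ ![v, w])
    (h : ∀ s, 0 ≤ s → s < ε → active a (vert0 (arc t v w s)) = active a (vert0 t) ∧
      active a (vert1 (arc t v w s)) = active a (vert1 t)) : t.2 ≠ 0 := by
  intro h0
  have hv : vert1 t = vert0 t := by simp [vert1, vert0, h0]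
  obtain ⟨p, hp, hn, hside⟩ := hsp.onEnd hs
  have hp : p = vert0 t := by rcases hp with rfl | rfl <;> simp [hv]
  subst hp
  obtain ⟨u, hu, u', hu', hne⟩ := id hn
  have hcoord : (∀ q, active a q = active a (vert0 t) → q.1 = (vert0 t).1) ∨
      ∀ q, active a q = active a (vert0 t) → q.2 = (vert0 t).2 := by
    by_contra hc
    push Not at hc
    obtain ⟨⟨q, hq, hq'⟩, r, hr, hr'⟩ := hc
    have hq2 : q.2 = (vert0 t).2 :=
      (coordinate_eq_of_onSide (q := q) hn hside).elim (fun h => absurd (h hq) hq') fun h => h hq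
    have hr1 : r.1 = (vert0 t).1 :=
      (coordinate_eq_of_onSide (q := r) hn hside).elim (fun h => h hr) fun h => absurd (h hr) hr'
    have k1 := term_eq_of_mem hu hu'
    rw [← hq] at hu hu'
    have k2 := term_eq_of_mem hu hu'
    rw [hq, ← hr] at hu hu'
    have k3 := term_eq_of_mem hu hu'
    simp only [term, hq2, hr1] at k1 k2 k3
    have e1 : ((u.1 : ℕ) : ℝ) = ((u'.1 : ℕ) : ℝ) :=
      mul_right_cancel₀ (sub_ne_zero.2 hq') (by linear_combination k2 - k1)
    have e2 : ((u.2 : ℕ) : ℝ) = ((u'.2 : ℕ) : ℝ) :=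
      mul_right_cancel₀ (sub_ne_zero.2 hr') (by linear_combination k3 - k1)
    exact hne (Prod.ext (Fin.ext (by exact_mod_cast e1)) (Fin.ext (by exact_mod_cast e2)))
  -- Both vertices stay on the same end, which has one constant coordinate. As v₁ - v₀ = (l, |l|),
  -- this forces l = 0 along the arc, and only one coordinate of v₀ is left to vary.
  rcases hcoord with hc | hc
  · have hl : ∀ s, 0 ≤ s → s < ε → (arc t v w s).1.1 = t.1.1 ∧ (arc t v w s).2 = 0 := by
      intro s h1 h2
      obtain ⟨e0, e1⟩ := h s h1 h2
      rw [hv] at e1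
      have k0 := hc _ e0
      have k1 := hc _ e1
      simp only [vert0, vert1] at k0 k1
      exact ⟨k0, by linarith⟩
    have hx := coeff_eq_zero_of_quadratic (q := v.1.1) (r := w.1.1) hε fun s h1 h2 => by
      have := (hl s h1 h2).1
      simp only [arc, Prod.fst_add, Prod.smul_fst, smul_eq_mul] at this
      linarith
    have hz := coeff_eq_zero_of_quadratic (q := v.2) (r := w.2) hε fun s h1 h2 => by
      have := (hl s h1 h2).2
      simp only [arc, Prod.snd_add, Prod.smul_snd, smul_eq_mul, h0] at this
      linarith
    refine not_linearIndependent_of_eq (u := ((0, 1), 0)) (α := v.1.2) (β := w.1.2) ?_ ?_ hvw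
    · ext <;> simp [hx.1, hz.1]
    · ext <;> simp [hx.2, hz.2]
  · have hl : ∀ s, 0 ≤ s → s < ε → (arc t v w s).1.2 = t.1.2 ∧ (arc t v w s).2 = 0 := by
      intro s h1 h2
      obtain ⟨e0, e1⟩ := h s h1 h2
      rw [hv] at e1
      have k0 := hc _ e0
      have k1 := hc _ e1
      simp only [vert0, vert1] at k0 k1
      exact ⟨k0, abs_eq_zero.1 (by linarith)⟩
    have hx := coeff_eq_zero_of_quadratic (q := v.1.2) (r := w.1.2) hε fun s h1 h2 => by
      have := (hl s h1 h2).1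
      simp only [arc, Prod.fst_add, Prod.snd_add, Prod.smul_fst, Prod.smul_snd, smul_eq_mul] at this
      linarith
    have hz := coeff_eq_zero_of_quadratic (q := v.2) (r := w.2) hε fun s h1 h2 => by
      have := (hl s h1 h2).2
      simp only [arc, Prod.snd_add, Prod.smul_snd, smul_eq_mul, h0] at this
      linarith
    refine not_linearIndependent_of_eq (u := ((1, 0), 0)) (α := v.1.1) (β := w.1.1) ?_ ?_ hvw
    · ext <;> simp [hx.1, hz.1]
    · ext <;> simp [hx.2, hz.2]

theorem exists_hasConstSign {t : Params} (v w : Params) (h : t.2 ≠ 0) :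
    ∃ ε > 0, HasConstSign t v w ε := by
  have hc : Continuous fun s => (arc t v w s).2 := by unfold arc; fun_prop
  have h0 : (arc t v w 0).2 = t.2 := by rw [arc_zero]
  rcases h.lt_or_gt with hl | hl
  · have : ∀ᶠ s in nhds (0 : ℝ), (arc t v w s).2 < 0 :=
      hc.continuousAt.eventually_lt continuousAt_const (by rw [h0]; exact hl)
    obtain ⟨ε, hε, hb⟩ := Metric.eventually_nhds_iff.1 this
    exact ⟨ε, hε, Or.inr (Or.inl fun s h1 h2 => hb (by
      rw [Real.dist_eq, sub_zero, abs_of_nonneg h1]; exact h2))⟩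
  · have : ∀ᶠ s in nhds (0 : ℝ), 0 < (arc t v w s).2 :=
      continuousAt_const.eventually_lt hc.continuousAt (by rw [h0]; exact hl)
    obtain ⟨ε, hε, hb⟩ := Metric.eventually_nhds_iff.1 this
    exact ⟨ε, hε, Or.inl fun s h1 h2 => hb (by
      rw [Real.dist_eq, sub_zero, abs_of_nonneg h1]; exact h2)⟩

theorem HasConstSign.mono {t v w : Params} {ε ε' : ℝ} (h : HasConstSign t v w ε) (hle : ε' ≤ ε) :
    HasConstSign t v w ε' := by
  rcases h with h | h | h
  · exact Or.inl fun s h1 h2 => h s h1 (h2.trans_le hle)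
  · exact Or.inr (Or.inl fun s h1 h2 => h s h1 (h2.trans_le hle))
  · exact Or.inr (Or.inr h)

/-- For a generic curve every cell of the bounded complex is dominated by a cell of the
non-special bounded complex. -/
theorem exists_nonSpecial_cell (hs : IsSmooth a) (hg : AvoidsLengthForms lengthForms a)
    (hΩ : IsTritangentClass a Ω) (hK : IsCompatibleStructure a Ω K) {P : Set Params}
    (hP : P ∈ boundedCells a K) : ∃ Q ∈ nonSpecialBoundedCells a K,
      Module.finrank ℝ (vectorSpan ℝ P) ≤ Module.finrank ℝ (vectorSpan ℝ Q) := by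
  by_cases hns : P ∈ nonSpecialBoundedCells a K
  · exact ⟨P, hns, le_rfl⟩
  obtain ⟨t, ht, hsp⟩ : ∃ t ∈ intrinsicInterior ℝ P, IsSpecial a t := by
    by_contra h
    exact hns ⟨hP, h⟩
  have hd : Module.finrank ℝ (vectorSpan ℝ P) < 3 := by
    by_contra hn
    exact not_isSpecial_of_finrank hs hK hP.1 (not_lt.1 hn) ht hsp
  have hcell : ∀ (v w : Params) (ε : ℝ), (∀ s, 0 ≤ s → s < ε → arc t v w s ∈ intrinsicInterior ℝ P) →
      IsCellArc a t v w ε := by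
    intro v w ε h s h0 h1
    have hm := h s h0 h1
    obtain ⟨e0, e1⟩ := hK.2 P hP.1 _ hm t ht
    exact ⟨hΩ.isTritangent (mem_of_mem_cell hK hP.1 hm), e0, e1, fun k => hP.2 ⟨_, hm, Or.inl k⟩,
      fun k => hP.2 ⟨_, hm, Or.inr k⟩⟩
  by_cases h2 : 2 ≤ Module.finrank ℝ (vectorSpan ℝ P)
  -- In dimension two a curved arc inside the cell leaves room to avoid the exceptional positions;
  -- its independent directions rule out the straight alternative.
  · obtain ⟨v, hv, w, hw, hvw⟩ := exists_linearIndependent h2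
    obtain ⟨ε, hε, harc⟩ := exists_arc_subset ht hv hw
    have hne := edge_ne_zero hs hε hsp hvw fun s h0 h1 => hK.2 P hP.1 _ (harc s h0 h1) t ht
    obtain ⟨ε', hε', hsign⟩ := exists_hasConstSign v w hne
    have hsub : ∀ s, 0 ≤ s → s < min ε ε' → arc t v w s ∈ intrinsicInterior ℝ P :=
      fun s h0 h1 => harc s h0 (h1.trans_le (min_le_left _ _))
    obtain ⟨s, h0, h1, v', w', hgood, h | ⟨-, -, h⟩⟩ := hsp.isMovable hs hg v w (min ε ε')
      (lt_min hε hε') (hcell _ _ _ hsub) (hsign.mono (min_le_right _ _))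
    · obtain ⟨Q, hQ, -, hdim⟩ := hgood.exists_cell hs hΩ hK (mem_of_mem_cell hK hP.1 (hsub s h0 h1))
      exact ⟨Q, hQ, (Nat.lt_succ_iff.1 hd).trans (hdim h)⟩
    · exact absurd hvw h
  -- In dimension at most one the constant arc is enough, as a straight good family already gives
  -- dimension one.
  · obtain ⟨s, h0, h1, v', w', hgood, hor⟩ := hsp.isMovable hs hg 0 0 1 one_pos
      (hcell 0 0 1 fun s _ _ => by rw [arc_zero_zero]; exact ht) (Or.inr (Or.inr ⟨rfl, rfl⟩))
    rw [arc_zero_zero] at hgood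
    obtain ⟨Q, hQ, hdim1, hdim2⟩ := hgood.exists_cell hs hΩ hK (mem_of_mem_cell hK hP.1 ht)
    refine ⟨Q, hQ, ?_⟩
    rcases hor with h | ⟨h, h', -⟩
    · have := hdim2 h; omega
    · have := hdim1 h h'; omega

theorem complexDim_mono {S T : Set (Set Params)} (h : ∀ P ∈ S, ∃ Q ∈ T,
    Module.finrank ℝ (vectorSpan ℝ P) ≤ Module.finrank ℝ (vectorSpan ℝ Q)) :
    complexDim S ≤ complexDim T := by
  refine iSup₂_le fun P hP => ?_
  obtain ⟨Q, hQ, hle⟩ := h P hP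
  refine le_trans ?_ (le_iSup₂ (f := fun (P : Set Params) (_ : P ∈ T) =>
    ((Module.finrank ℝ (vectorSpan ℝ P) : ℕ∞) : WithBot ℕ∞)) Q hQ)
  exact_mod_cast hle

theorem complexDim_nonSpecial_le (a : Exps 3 → ℝ) (K : PolyComplex) :
    complexDim (nonSpecialBoundedCells a K) ≤ complexDim (boundedCells a K) :=
  complexDim_mono fun P hP => ⟨P, hP.1, le_rfl⟩

theorem complexDim_le {S : Set (Set Params)} {d : ℕ}
    (h : ∀ P ∈ S, Module.finrank ℝ (vectorSpan ℝ P) ≤ d) :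
    complexDim S ≤ ((d : ℕ∞) : WithBot ℕ∞) := by
  refine iSup₂_le fun P hP => ?_
  exact_mod_cast h P hP

theorem le_complexDim {S : Set (Set Params)} {P : Set Params} (hP : P ∈ S) :
    ((Module.finrank ℝ (vectorSpan ℝ P) : ℕ∞) : WithBot ℕ∞) ≤ complexDim S :=
  le_iSup₂ (f := fun (P : Set Params) (_ : P ∈ S) =>
    ((Module.finrank ℝ (vectorSpan ℝ P) : ℕ∞) : WithBot ℕ∞)) P hP

theorem finrank_vectorSpan_le (P : Set Params) : Module.finrank ℝ (vectorSpan ℝ P) ≤ 3 := by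
  have h3 : Module.finrank ℝ Params = 3 := by simp
  exact (Submodule.finrank_le _).trans h3.le

/-- Without genericity, the dimensions agree if that of the non-special complex is at least two. -/
theorem complexDim_eq_of_two_or_three (hs : IsSmooth a) (hK : IsCompatibleStructure a Ω K)
    (h : complexDim (nonSpecialBoundedCells a K) = 2 ∨ complexDim (nonSpecialBoundedCells a K) = 3) :
    complexDim (nonSpecialBoundedCells a K) = complexDim (boundedCells a K) := by
  refine le_antisymm (complexDim_nonSpecial_le a K) ?_
  rcases h with h | h
  · rw [h]
    refine complexDim_le (d := 2) fun P hP => ?_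
    by_contra hn
    push Not at hn
    -- A bounded cell of dimension three is automatically non-special, which would contradict
    -- dimension two of the non-special complex.
    have hmem : P ∈ nonSpecialBoundedCells a K := ⟨hP, fun ⟨t, ht, hsp⟩ =>
      not_isSpecial_of_finrank hs hK hP.1 hn ht hsp⟩
    have := le_complexDim hmem
    rw [h] at this
    have h2 : ((Module.finrank ℝ (vectorSpan ℝ P) : ℕ∞) : WithBot ℕ∞) ≤ ((2 : ℕ) : ℕ∞) := this
    have h2 : Module.finrank ℝ (vectorSpan ℝ P) ≤ 2 := by exact_mod_cast h2
    omega
  · rw [h]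
    exact complexDim_le (d := 3) fun P _ => finrank_vectorSpan_le P

end Cells

end Tritangent

theorem mainTheorem6 :
    (∃ H : Finset (Tritangent.Exps 3 → ℤ), (∀ c ∈ H, Tritangent.IsLengthForm c) ∧
      ∀ a : Tritangent.Exps 3 → ℝ, Tritangent.IsSmooth a → Tritangent.AvoidsLengthForms H a →
        ∀ Ω : Set Tritangent.Params, Tritangent.IsTritangentClass a Ω →
          ∀ K : Tritangent.PolyComplex, Tritangent.IsCompatibleStructure a Ω K →
            Tritangent.complexDim (Tritangent.nonSpecialBoundedCells a K) =
              Tritangent.complexDim (Tritangent.boundedCells a K)) ∧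
    (∀ a : Tritangent.Exps 3 → ℝ, Tritangent.IsSmooth a →
      ∀ Ω : Set Tritangent.Params, Tritangent.IsTritangentClass a Ω →
        ∀ K : Tritangent.PolyComplex, Tritangent.IsCompatibleStructure a Ω K →
          (Tritangent.complexDim (Tritangent.nonSpecialBoundedCells a K) = 2 ∨
            Tritangent.complexDim (Tritangent.nonSpecialBoundedCells a K) = 3) →
          Tritangent.complexDim (Tritangent.nonSpecialBoundedCells a K) =
            Tritangent.complexDim (Tritangent.boundedCells a K)) := by
  refine ⟨⟨Tritangent.lengthForms, fun c hc => ?_, fun a hs hg Ω hΩ K hK => ?_⟩,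
    fun a hs Ω _ K hK h => Tritangent.complexDim_eq_of_two_or_three hs hK h⟩
  · classical
    unfold Tritangent.lengthForms at hc
    exact (Finset.mem_filter.1 hc).2
  · exact le_antisymm (Tritangent.complexDim_nonSpecial_le a K) (Tritangent.complexDim_mono
      fun P hP => Tritangent.exists_nonSpecial_cell hs hg hΩ hK hP)
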